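/- Let $\Bbbk=\mathbb R$ or $\mathbb C$ and let $(V,\omega,Q)$ be a dg symplectic vector space: $V$ is $\mathbb Z$-graded and finite-dimensional in every degree, $\omega$ is a nondegenerate graded-antisymmetric form of degree $-1$, $Q$ is a differential of degree $1$, and $\omega(Q\otimes 1+1\otimes Q)=0$. Let $V=H\oplus B\oplus C$ be a (graded) Hodge decomposition: $B=\operatorname{im}Q$, $\ker Q=H\oplus B$, $C$ is a complement of $\ker Q$, $H\perp_\omega(B\oplus C)$, and $\omega|_B=0=\omega|_C$. Let $e_i$ be a homogeneous basis adapted to the decomposition, $\omega_{ij}=\omega(e_i,e_j)$, $(\omega^{ij})$ the inverse matrix ($\sum_j\omega_{ij}\omega^{jk}=\delta_i^k$), $\phi^i$ the dual basis (with $|\phi^i|=-|e_i|$), consisting of the variables $\alpha$ on $H$, $\beta$ on $B$, $\gamma$ on $C$, and write $Q(c_i)=Q_i^kb_k$. A monomial $\hbar^g\phi^{i_1}\cdots\phi^{i_n}$ has polynomial degree $n$, genus $g\in\mathbb Z$ and weight $2g+n$. Put $\mathcal F(V)=\prod_{g,n\ge0}\hbar^g(V^*)^{\odot n}$ and $\mathcal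 F_{\ge m}(V)=\prod_{w\ge m}\bigoplus_{2g+n=w}\hbar^g(V^*)^{\odot n}$, $\mathcal F_+(V)=\mathcal F_{\ge1}(V)$ (negative $g$ allowed in the last two), and $$\Delta F=\tfrac12\sum_{i,j}(-1)^{|\phi^i|}\omega^{ij}\frac{\partial_L^2F}{\partial\phi^i\partial\phi^j},\qquad \{F,G\}=\sum_{i,j}\frac{\partial_RF}{\partial\phi^i}\,\omega^{ij}\,\frac{\partial_LG}{\partial\phi^j},\qquad T_S=\hbar\Delta+\{S,-\}.$$ Write $\Delta',\{\,,\}'$ for the same operations on $H$ and $T'_W=\hbar\Delta'+\{W,-\}'$. A quantum $L_\infty$ algebra on $V$ is a degree-$0$ element $S\in\mathcal F(V)$, at least quadratic in genus $0$ and at least linear in genus $1$, with $2\hbar\Delta S+\{S,S\}=0$. Let $S=S_{\rm free}+S_{\rm int}$ be a quantum $L_\infty$ algebra on $V$ with $S_{\rm free}=\frac12\sum_{i,j}(-1)^{|e_i|}\omega(e_i,Qe_j)\,\phi^i\phi^j$ and $S_{\rm int}$ of weight at least $3$. Let $I$ and $P$ be the pullbacks of functions along the projection $p:V\to H$ and the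 inclusion $H\to V$, let $K=\frac1{\#_{\beta+\gamma}}\beta^k(Q^{-1})^i_k\frac{\partial_L}{\partial\gamma^i}$ (zero on monomials without $\beta,\gamma$; $\#_{\beta+\gamma}$ is the number of variables $\beta,\gamma$), and $$Q_1=\{S_{\rm free},-\}+\hbar\Delta,\qquad K_1=\sum_{n\ge0}K(\hbar\Delta K)^n,\qquad P_1=\sum_{n\ge0}P(\hbar\Delta K)^n .$$ Define $W=\hbar\log P_1(e^{S_{\rm int}/\hbar})$ and $F=K_1(e^{S_{\rm int}/\hbar})$. Then: 1. $W/\hbar\in\mathcal F_+(H)$, $e^{W/\hbar}=P_1(e^{S_{\rm int}/\hbar})$, $F\in\mathcal F_+(V)$ has degree $-1$, and $$e^{I(W)/\hbar}-e^{S_{\rm int}/\hbar}=Q_1K_1(e^{S_{\rm int}/\hbar})=Q_1F .$$ Moreover $P_1(F)=0$ and $K_1(F)=0$, and $F$ is the only element of $\mathcal F_+(V)$ with these three properties. 2. Define $A(t)=\hbar\log\big((1-t)e^{I(W)/\hbar}+t\,e^{S_{\rm int}/\hbar}\big)$, so that $e^{A(t)/\hbar}=(1-t)e^{I(W)/\hbar}+te^{S_{\rm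 int}/\hbar}$, and $B(t)=\hbar e^{-A(t)/\hbar}F$. Then $e^{(A(t)+B(t)dt)/\hbar}$ is a homotopy from $A(0)=I(W)$ to $A(1)=S_{\rm int}$: $A/\hbar$ and $B/\hbar$ lie in $\mathcal F_+(V)\otimes\Omega([0,1])$ (in each weight finitely many monomials, with coefficients smooth in $t$), $A(t)$ has degree $0$, $B(t)$ has degree $-1$, and $$(\{S_{\rm free},-\}+\hbar\Delta+d_{\rm dR})\,e^{(A(t)+B(t)dt)/\hbar}=0\quad\text{on }[0,1].$$ 3. $I(W)$ has no quadratic terms of genus $0$. The vector field $X(t)=-\hbar\{e^{-A(t)/\hbar}K_1(e^{S_{\rm int}/\hbar}),-\}$ has a flow $\Phi_t$, $0\le t\le1$, smooth in $t$ (that is, $\Phi_0=1$ and $\frac{d}{dt}\Phi_t^*=\Phi_t^*X(t)$ on $\mathcal F_{\ge m}(V)$ for all $m$), consisting of formal maps of the form $1+(\text{terms of positive weight})$. The map $\Phi=\Phi_1:V\to V$ is a symplectic diffeomorphism (it preserves the bracket and has an inverse $\Phi^{-1}$ of the same form) and $$e^{(S_{\rm free}+I(W))/\hbar}\,d^{1/2}V=\Phi^*\big(e^{(S_{\rm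 free}+S_{\rm int})/\hbar}\,d^{1/2}V\big),$$ where $\Phi^*(G\,d^{1/2}V)=\Phi^*(G)\operatorname{Ber}(\partial\Phi)^{1/2}d^{1/2}V$ and $\log\operatorname{Ber}(\partial\Phi)=\operatorname{str}\log(\partial\Phi)$. 4. Call a formal map $\Psi:(U,\omega_U,S_U)\to(U',\omega_{U'},S_{U'})$ (with degree-preserving components $\Psi^*\phi^i\in\mathcal F_+(U)$) between quantum $L_\infty$ algebras a quantum $L_\infty$-morphism if it is Poisson, $\{\Psi^*f,\Psi^*g\}_U=\Psi^*\{f,g\}_{U'}$, and $\Psi^*\circ T_{S_{U'}}=T_{S_U}\circ\Psi^*$, both on $\mathcal F_{\ge m}(U')$ for all $m$ (in particular on $\mathcal F(U')$). Then $W$ is a quantum $L_\infty$ algebra on $H$ (in particular $W\in\mathcal F(H)$), $S_{\rm free}+I(W)$ is one on $V$, and the following are quantum $L_\infty$-morphisms: $$\Phi:(V,\omega,S_{\rm free}+I(W))\to(V,\omega,S_{\rm free}+S_{\rm int}),\qquad p:(V,\omega,S_{\rm free}+I(W))\to(H,\omega|_H,W),$$ $$p\circ\Phi^{-1}:(V,\omega,S_{\rm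 free}+S_{\rm int})\to(H,\omega|_H,W).$$ -/

import Mathlib

noncomputable section

namespace BV

/-! ### Graded linear algebra -/

section Linear

variable {𝕜 : Type*} [RCLike 𝕜] {V : Type*} [AddCommGroup V] [Module 𝕜 V]

/-- A `ℤ`-graded vector space which is finite-dimensional in every degree. -/
structure IsGraded (𝒱 : ℤ → Submodule 𝕜 V) : Prop where
  internal : DirectSum.IsInternal 𝒱
  finite : ∀ n, FiniteDimensional 𝕜 (𝒱 n)

/-- An odd symplectic form of degree `-1`: a nondegenerate, graded antisymmetric bilinear form,
nonzero only on arguments of total degree `1`. -/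
structure IsOddSymplectic (𝒱 : ℤ → Submodule 𝕜 V) (ω : V →ₗ[𝕜] V →ₗ[𝕜] 𝕜) : Prop where
  degree : ∀ m n, m + n ≠ 1 → ∀ v ∈ 𝒱 m, ∀ w ∈ 𝒱 n, ω v w = 0
  antisymm : ∀ m n, ∀ v ∈ 𝒱 m, ∀ w ∈ 𝒱 n, ω v w = -((-1 : 𝕜) ^ (m * n) * ω w v)
  nondegenerate : ∀ v, (∀ w, ω v w = 0) → v = 0

/-- A dg symplectic vector space: `Q` is a differential of degree `1` with
`ω (Q ⊗ 1 + 1 ⊗ Q) = 0`. -/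
structure IsDGSymplectic (𝒱 : ℤ → Submodule 𝕜 V) (ω : V →ₗ[𝕜] V →ₗ[𝕜] 𝕜)
    (Q : V →ₗ[𝕜] V) : Prop where
  graded : IsGraded 𝒱
  symplectic : IsOddSymplectic 𝒱 ω
  degree : ∀ n, ∀ v ∈ 𝒱 n, Q v ∈ 𝒱 (n + 1)
  square : ∀ v, Q (Q v) = 0
  compatible : ∀ n, ∀ v ∈ 𝒱 n, ∀ w, ω (Q v) w + (-1 : 𝕜) ^ n * ω v (Q w) = 0

/-- A Hodge decomposition `V = H ⊕ B ⊕ C`: `B = im Q`, `H` is a complement of `B` in `ker Q`,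
`C` is a complement of `ker Q`, the subspaces `H` and `B ⊕ C` are symplectically orthogonal, and
`B` and `C` are Lagrangian in `B ⊕ C`. (That all three are graded subspaces is expressed through
an adapted homogeneous basis, see `IsAdaptedBasis`.) -/
structure IsHodgeDecomposition (ω : V →ₗ[𝕜] V →ₗ[𝕜] 𝕜) (Q : V →ₗ[𝕜] V)
    (H B C : Submodule 𝕜 V) : Prop where
  boundaries : B = LinearMap.range Q
  cycles : H ⊔ B = LinearMap.ker Q
  disjoint : H ⊓ B = ⊥
  complement : IsCompl (LinearMap.ker Q) C
  orthogonal : ∀ x ∈ H, ∀ y ∈ B ⊔ C, ω x y = 0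
  lagrangianB : ∀ x ∈ B, ∀ y ∈ B, ω x y = 0
  lagrangianC : ∀ x ∈ C, ∀ y ∈ C, ω x y = 0

/-- A homogeneous basis of `V` composed of bases of `H`, `B` and `C`; `d i` is the degree of
the basis vector `e i`. -/
structure IsAdaptedBasis {ι : Type*} (𝒱 : ℤ → Submodule 𝕜 V) (H B C : Submodule 𝕜 V)
    (e : Module.Basis ι 𝕜 V) (d : ι → ℤ) : Prop where
  homogeneous : ∀ i, e i ∈ 𝒱 (d i)
  adapted : ∀ i, e i ∈ H ∨ e i ∈ B ∨ e i ∈ C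

open Classical in
/-- The homotopy `k : V → V` of the Hodge decomposition: it is `-(Q|_C)⁻¹` on `B` and zero on
`H` and on `C`. (A basis vector in `H` or `C` is never of the form `Q c`.) -/
def homotopy {ι : Type*} (Q : V →ₗ[𝕜] V) (C : Submodule 𝕜 V) (e : Module.Basis ι 𝕜 V) :
    V →ₗ[𝕜] V :=
  e.constr 𝕜 fun j => if h : ∃ c ∈ C, Q c = e j then -h.choose else 0

end Linear

/-! ### Formal functions in coordinates

A homogeneous basis `e i` (`i : ι`) of a graded vector space has a dual basis `φ i`; the degree of
`φ i` is `-(d i)`. For a multi-index `I : ι →₀ ℕ` the monomial `φ^I` is the product of the powers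
`(φ i) ^ (I i)` in increasing order of `i`; it is zero if `I i ≥ 2` for some odd `i`.
A formal series `∑ F(I,g) φ^I ħ^g`, `g ∈ ℤ`, is recorded by its coefficients. -/

/-- Coefficients `F I g` of the monomials `φ^I ħ^g`. -/
abbrev Coef (ι 𝕜 : Type*) := (ι →₀ ℕ) → ℤ → 𝕜

section Functions

variable {ι : Type*} [LinearOrder ι] {𝕜 : Type*} [RCLike 𝕜] (d : ι → ℤ)

/-- The multi-indices of nonzero monomials. -/
def Admissible (I : ι →₀ ℕ) : Prop := ∀ i, Odd (d i) → I i ≤ 1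

/-- The weight `2g + n` of a monomial of polynomial degree `n` and genus `g`. -/
def weight (I : ι →₀ ℕ) (g : ℤ) : ℤ := 2 * g + (I.degree : ℤ)

/-- The degree of the monomial `φ^I`. -/
def monDegree (I : ι →₀ ℕ) : ℤ := I.sum fun i a => -(d i) * (a : ℤ)

/-- The space `𝓕(V) = ∏_{g ≥ 0, n ≥ 0} (V*)^{⊙ n} ħ^g` of formal functions. -/
structure IsFun (F : Coef ι 𝕜) : Prop where
  admissible : ∀ I g, F I g ≠ 0 → Admissible d I
  finite : ∀ (n : ℕ) (g : ℤ), {I : ι →₀ ℕ | I.degree = n ∧ F I g ≠ 0}.Finite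
  genus : ∀ I g, F I g ≠ 0 → 0 ≤ g

/-- The space `∏_{w ≥ m} ⨁_{2g+n = w} (V*)^{⊙ n} ħ^g` of formal functions, possibly with negative
powers of `ħ`, of weight at least `m`. Every element of `𝓕(V)` has this property for `m = 0`. -/
structure IsFunWeight (m : ℤ) (F : Coef ι 𝕜) : Prop where
  admissible : ∀ I g, F I g ≠ 0 → Admissible d I
  weight_ge : ∀ I g, F I g ≠ 0 → m ≤ weight I g
  finite : ∀ w : ℤ, {p : (ι →₀ ℕ) × ℤ | weight p.1 p.2 = w ∧ F p.1 p.2 ≠ 0}.Finite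

/-- The space `𝓕₊(V)` of formal functions of positive weight. -/
def IsFunPos (F : Coef ι 𝕜) : Prop := IsFunWeight d 1 F

/-- `F` is homogeneous of degree `n`. -/
def HasDegree (n : ℤ) (F : Coef ι 𝕜) : Prop := ∀ I g, F I g ≠ 0 → monDegree d I = n

/-- Multiplication by `ħ ^ m`. -/
def hbar (m : ℤ) (F : Coef ι 𝕜) : Coef ι 𝕜 := fun I g => F I (g - m)

open Classical in
/-- The function `1`. -/
def one : Coef ι 𝕜 := fun I g => if I = 0 ∧ g = 0 then 1 else 0

open Classical in
/-- The coordinate function `φ i`. -/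
def coord (i : ι) : Coef ι 𝕜 := fun I g => if I = Finsupp.single i 1 ∧ g = 0 then 1 else 0

/-- The Koszul sign in `φ^J φ^K = ± φ^(J+K)`. -/
def koszul (J K : ι →₀ ℕ) : 𝕜 :=
  (-1) ^ (J.sum fun i a => K.sum fun j b => if j < i then d i * d j * a * b else (0 : ℤ))

open Classical in
/-- The graded commutative product. -/
def mul (F G : Coef ι 𝕜) : Coef ι 𝕜 := fun I g =>
  if Admissible d I then
    ∑ p ∈ Finset.HasAntidiagonal.antidiagonal I, ∑ᶠ h : ℤ, koszul d p.1 p.2 * F p.1 h * G p.2 (g - h)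
  else 0

/-- Powers. -/
def pow (F : Coef ι 𝕜) : ℕ → Coef ι 𝕜
  | 0 => one
  | n + 1 => mul d F (pow F n)

/-- The exponential series `e^F`. -/
def expo (F : Coef ι 𝕜) : Coef ι 𝕜 := fun I g =>
  ∑ᶠ n : ℕ, ((n.factorial : ℕ) : 𝕜)⁻¹ * pow d F n I g

/-- The logarithm series `log F = ∑_{n ≥ 1} (-1)^(n+1) (F - 1)^n / n`. -/
def logar (F : Coef ι 𝕜) : Coef ι 𝕜 := fun I g =>
  ∑ᶠ n : ℕ, (-1) ^ n * ((n : 𝕜) + 1)⁻¹ * pow d (F - one) (n + 1) I g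

/-- The left partial derivative `∂_L / ∂φ^i`. -/
def leftDeriv (i : ι) (F : Coef ι 𝕜) : Coef ι 𝕜 := fun I g =>
  ((I i : 𝕜) + 1) * koszul d (Finsupp.single i 1) I * F (I + Finsupp.single i 1) g

/-- The right partial derivative `∂_R / ∂φ^i`. -/
def rightDeriv (i : ι) (F : Coef ι 𝕜) : Coef ι 𝕜 := fun I g =>
  ((I i : 𝕜) + 1) * koszul d I (Finsupp.single i 1) * F (I + Finsupp.single i 1) g

open Classical in
/-- The inverse matrix `ω^{ij}` of `ω_{ij}`: the `k`-th column is the finitely supported vector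
with `∑_j ω_{ij} ω^{jk} = δ_i^k`. -/
def inverse (ω : ι → ι → 𝕜) (j k : ι) : 𝕜 :=
  if h : ∃ v : ι →₀ 𝕜, ∀ i, (v.sum fun j a => ω i j * a) = if i = k then 1 else 0
  then h.choose j else 0

/-- The BV Laplacian `Δ F = ½ ∑ (-1)^|φ^i| ω^{ij} ∂_i ∂_j F`; the argument `ω` is the matrix
`ω_{ij}`. -/
def laplacian (ω : ι → ι → 𝕜) (F : Coef ι 𝕜) : Coef ι 𝕜 := fun I g =>
  (1 / 2) * ∑ᶠ p : ι × ι,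
    (-1) ^ (d p.1) * inverse ω p.1 p.2 * leftDeriv d p.1 (leftDeriv d p.2 F) I g

/-- The BV bracket `{F, G} = ∑ (∂_R F / ∂φ^i) ω^{ij} (∂_L G / ∂φ^j)`. -/
def bracket (ω : ι → ι → 𝕜) (F G : Coef ι 𝕜) : Coef ι 𝕜 := fun I g =>
  ∑ᶠ p : ι × ι, inverse ω p.1 p.2 * mul d (rightDeriv d p.1 F) (leftDeriv d p.2 G) I g

/-- The twisted Laplacian `T_S F = ħ Δ F + {S, F}`. -/
def twisted (ω : ι → ι → 𝕜) (S F : Coef ι 𝕜) : Coef ι 𝕜 :=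
  hbar 1 (laplacian d ω F) + bracket d ω S F

/-- A quantum `L_∞` algebra: a degree zero `S ∈ 𝓕(V)`, at least quadratic in genus `0` and
at least linear in genus `1`, solving the quantum master equation `2 ħ Δ S + {S, S} = 0`. -/
structure IsQuantumLInfty (ω : ι → ι → 𝕜) (S : Coef ι 𝕜) : Prop where
  isFun : IsFun d S
  degree : HasDegree d 0 S
  genus_zero : ∀ I, S I 0 ≠ 0 → 2 ≤ I.degree
  genus_one : ∀ I, S I 1 ≠ 0 → 1 ≤ I.degree
  master : (2 : 𝕜) • hbar 1 (laplacian d ω S) + bracket d ω S S = 0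

/-- The free action `½ ∑ (-1)^|e_i| ω(e_i, Q e_j) φ^i φ^j`. -/
def freeAction {V : Type*} [AddCommGroup V] [Module 𝕜 V] (ω : V →ₗ[𝕜] V →ₗ[𝕜] 𝕜)
    (Q : V →ₗ[𝕜] V) (e : Module.Basis ι 𝕜 V) : Coef ι 𝕜 := fun I g =>
  (1 / 2) * ∑ᶠ p : ι × ι,
    (-1) ^ (d p.1) * ω (e p.1) (Q (e p.2)) * mul d (coord p.1) (coord p.2) I g

/-! ### The deformation retract and its perturbation by `ħ Δ`

`h i` says that `e i` lies in `H`, so `{i // h i}` indexes the basis of `H`; `κ i j` is the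
coefficient of `e i` in `k (e j)`. -/

/-- `P : 𝓕(V) → 𝓕(H)`, the restriction along the inclusion `H → V`. -/
def proj (h : ι → Prop) (F : Coef ι 𝕜) : Coef {i // h i} 𝕜 := fun I g =>
  F (I.embDomain (Function.Embedding.subtype h)) g

open Classical in
/-- `I : 𝓕(H) → 𝓕(V)`, the pullback along the projection `p : V → H`. -/
def incl (h : ι → Prop) (F : Coef {i // h i} 𝕜) : Coef ι 𝕜 := fun I g =>
  if ∀ i ∈ I.support, h i then F (I.subtypeDomain h) g else 0

open Classical in
/-- The number of variables `β` and `γ` in the monomial `φ^I`. -/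
def countNonH (h : ι → Prop) (I : ι →₀ ℕ) : ℕ := I.sum fun i a => if h i then 0 else a

/-- The homotopy `K = (1 / #_{β+γ}) β^k (Q⁻¹)^i_k ∂/∂γ^i`, zero on monomials without
`β` and `γ`. The coefficients are `(Q⁻¹)^i_k = -κ i k`. -/
def contraction (h : ι → Prop) (κ : ι → ι → 𝕜) (F : Coef ι 𝕜) : Coef ι 𝕜 := fun I g =>
  (countNonH h I : 𝕜)⁻¹ *
    ∑ᶠ p : ι × ι, -κ p.1 p.2 * mul d (coord p.2) (leftDeriv d p.1 F) I g

/-- `(ħ Δ K)^n F`. -/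
def iterLapContraction (ω : ι → ι → 𝕜) (h : ι → Prop) (κ : ι → ι → 𝕜) (n : ℕ)
    (F : Coef ι 𝕜) : Coef ι 𝕜 :=
  (fun G => hbar 1 (laplacian d ω (contraction d h κ G)))^[n] F

/-- The perturbed homotopy `K₁ = ∑_n K (ħ Δ K)^n`. -/
def pertContraction (ω : ι → ι → 𝕜) (h : ι → Prop) (κ : ι → ι → 𝕜) (F : Coef ι 𝕜) :
    Coef ι 𝕜 := fun I g =>
  ∑ᶠ n : ℕ, contraction d h κ (iterLapContraction d ω h κ n F) I g

/-- The perturbed projection `P₁ = ∑_n P (ħ Δ K)^n`. -/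
def pertProj (ω : ι → ι → 𝕜) (h : ι → Prop) (κ : ι → ι → 𝕜) (F : Coef ι 𝕜) :
    Coef {i // h i} 𝕜 := fun I g =>
  ∑ᶠ n : ℕ, proj h (iterLapContraction d ω h κ n F) I g

/-! ### Homotopies of solutions of the quantum master equation -/

/-- `f(t) ∈ 𝓕₊(V) ⊗ C^∞([0,1])`: in every weight finitely many monomials, with smooth
coefficients. -/
structure IsFunPosFamily (f : ℝ → Coef ι 𝕜) : Prop where
  pos : ∀ t ∈ Set.Icc (0 : ℝ) 1, IsFunPos d (f t)
  finite : ∀ w : ℤ,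
    {p : (ι →₀ ℕ) × ℤ | weight p.1 p.2 = w ∧ ∃ t ∈ Set.Icc (0 : ℝ) 1, f t p.1 p.2 ≠ 0}.Finite
  smooth : ∀ I g, ContDiffOn ℝ ((⊤ : ℕ∞) : WithTop ℕ∞) (fun t => f t I g) (Set.Icc 0 1)

/-- `F ↦ (-1)^|F| F`. -/
def parity (F : Coef ι 𝕜) : Coef ι 𝕜 := fun I g => (-1) ^ (monDegree d I) * F I g

/-- The form `a.1(t) + a.2(t) dt` with coefficients in functions. -/
abbrev Form (ι 𝕜 : Type*) := (ℝ → Coef ι 𝕜) × (ℝ → Coef ι 𝕜)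

/-- The product of forms, with `dt F = (-1)^|F| F dt`. -/
def formMul (a b : Form ι 𝕜) : Form ι 𝕜 :=
  (fun t => mul d (a.1 t) (b.1 t),
   fun t => mul d (a.1 t) (b.2 t) + mul d (a.2 t) (parity d (b.1 t)))

/-- Powers of a form. -/
def formPow (a : Form ι 𝕜) : ℕ → Form ι 𝕜
  | 0 => (fun _ => one, 0)
  | n + 1 => formMul d a (formPow a n)

/-- The exponential of a form. -/
def formExp (a : Form ι 𝕜) : Form ι 𝕜 :=
  (fun t I g => ∑ᶠ n : ℕ, ((n.factorial : ℕ) : 𝕜)⁻¹ * (formPow d a n).1 t I g,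
   fun t I g => ∑ᶠ n : ℕ, ((n.factorial : ℕ) : 𝕜)⁻¹ * (formPow d a n).2 t I g)

/-- The form `a` on `[0,1]` is closed under `{S_free, -} + ħ Δ + d_dR`, where
`d_dR F = (-1)^|F| (∂_t F) dt`. -/
def IsClosedForm (ω : ι → ι → 𝕜) (Sfree : Coef ι 𝕜) (a : Form ι 𝕜) : Prop :=
  ∀ t ∈ Set.Icc (0 : ℝ) 1,
    twisted d ω Sfree (a.1 t) = 0 ∧
    ∀ I g, HasDerivWithinAt (fun s => parity d (a.1 s) I g)
      (-(twisted d ω Sfree (a.2 t) I g)) (Set.Icc 0 1) t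

/-- `e^{(A(t) + B(t) dt)/ħ}` is a homotopy between `S₀ = A(0)` and `S₁ = A(1)`. -/
structure IsHomotopy (ω : ι → ι → 𝕜) (Sfree : Coef ι 𝕜) (A B : ℝ → Coef ι 𝕜)
    (S₀ S₁ : Coef ι 𝕜) : Prop where
  familyA : IsFunPosFamily d fun t => hbar (-1) (A t)
  familyB : IsFunPosFamily d fun t => hbar (-1) (B t)
  degreeA : ∀ t ∈ Set.Icc (0 : ℝ) 1, HasDegree d 0 (A t)
  degreeB : ∀ t ∈ Set.Icc (0 : ℝ) 1, HasDegree d (-1) (B t)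
  closed : IsClosedForm d ω Sfree
    (formExp d (fun t => hbar (-1) (A t), fun t => hbar (-1) (B t)))
  start : A 0 = S₀
  finish : A 1 = S₁

/-! ### Formal maps and quantum `L_∞`-morphisms -/

section Maps

variable {ι' : Type*} [LinearOrder ι'] (d' : ι' → ℤ)

/-- A formal map `U → V` given by its components `Φ i = Φ^*(φ i)`; here `d` are the degrees of
the basis of `U` and `d'` those of `V`. -/
structure IsFormalMap (Φ : ι' → Coef ι 𝕜) : Prop where
  pos : ∀ i, IsFunPos d (Φ i)
  degree : ∀ i, HasDegree d (-(d' i)) (Φ i)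

/-- `Φ^*(φ^J)`, the product of the powers `(Φ i)^(J i)` in increasing order. -/
def monPullback (Φ : ι' → Coef ι 𝕜) (J : ι' →₀ ℕ) : Coef ι 𝕜 :=
  ((J.support.sort (· ≤ ·)).map fun i => pow d (Φ i) (J i)).foldr (mul d) one

/-- The pullback `Φ^* F = ∑ F(J,h) ħ^h Φ^*(φ^J)`. -/
def pullback (Φ : ι' → Coef ι 𝕜) (F : Coef ι' 𝕜) : Coef ι 𝕜 := fun I g =>
  ∑ᶠ p : (ι' →₀ ℕ) × ℤ, F p.1 p.2 * monPullback d Φ p.1 I (g - p.2)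

/-- The map `Φ` is Poisson. -/
def IsPoisson (ω : ι → ι → 𝕜) (ω' : ι' → ι' → 𝕜) (Φ : ι' → Coef ι 𝕜) : Prop :=
  ∀ (m n : ℤ) (F G : Coef ι' 𝕜), IsFunWeight d' m F → IsFunWeight d' n G →
    bracket d ω (pullback d Φ F) (pullback d Φ G) = pullback d Φ (bracket d' ω' F G)

/-- `Φ : (U, ω, S) → (V, ω', S')` is a quantum `L_∞`-morphism: a Poisson map with
`Φ^* ∘ T_{S'} = T_S ∘ Φ^*`. -/
structure IsQuantumMorphism (ω : ι → ι → 𝕜) (S : Coef ι 𝕜) (ω' : ι' → ι' → 𝕜)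
    (S' : Coef ι' 𝕜) (Φ : ι' → Coef ι 𝕜) : Prop where
  source : IsQuantumLInfty d ω S
  target : IsQuantumLInfty d' ω' S'
  formalMap : IsFormalMap d d' Φ
  poisson : IsPoisson d d' ω ω' Φ
  intertwines : ∀ (m : ℤ) (F : Coef ι' 𝕜), IsFunWeight d' m F →
    pullback d Φ (twisted d' ω' S' F) = twisted d ω S (pullback d Φ F)

/-- The linear projection `p : V → H` as a formal map. -/
def projMap (h : ι → Prop) : {i // h i} → Coef ι 𝕜 := fun i => coord i.1

/-- The composition `Ψ ∘ Φ` of formal maps `Φ : U → V` and `Ψ : V → W`. -/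
def comp {ι'' : Type*} (Ψ : ι'' → Coef ι' 𝕜) (Φ : ι' → Coef ι 𝕜) : ι'' → Coef ι 𝕜 :=
  fun i => pullback d Φ (Ψ i)

end Maps

/-- A formal map `V → V` of the form `1 + (terms of positive weight)`: the displacement
`Φ i - φ i` has weight at least `2`, with finitely many terms in each weight for all `i` together
(a condition which is automatic if `V` is finite-dimensional). -/
structure IsNearIdentity (Φ : ι → Coef ι 𝕜) : Prop where
  formalMap : IsFormalMap d d Φ
  displacement : ∀ i, IsFunWeight d 2 (Φ i - coord i)
  finite : ∀ w : ℤ, {i | ∃ I g, weight I g = w ∧ (Φ i - coord i : Coef ι 𝕜) I g ≠ 0}.Finite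

/-- The matrix `∂Φ - 1`, with entries `∂_L (Φ i - φ i) / ∂φ^j`. -/
def jacobianSubOne (Φ : ι → Coef ι 𝕜) (j i : ι) : Coef ι 𝕜 := leftDeriv d j (Φ i - coord i)

open Classical in
/-- Powers of a matrix of functions. -/
def matPow (N : ι → ι → Coef ι 𝕜) : ℕ → ι → ι → Coef ι 𝕜
  | 0 => fun j i => if j = i then one else 0
  | n + 1 => fun j i I g => ∑ᶠ k : ι, mul d (N j k) (matPow N n k i) I g

/-- `log Ber(∂Φ)` for `Φ` of the form `1 + (terms of positive weight)`: the supertrace of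
`log(∂Φ) = ∑_{n ≥ 1} (-1)^(n+1) (∂Φ - 1)^n / n`. -/
def logBer (Φ : ι → Coef ι 𝕜) : Coef ι 𝕜 := fun I g =>
  ∑ᶠ n : ℕ, (-1) ^ n * ((n : 𝕜) + 1)⁻¹ *
    ∑ᶠ i : ι, (-1) ^ (d i) * matPow d (jacobianSubOne d Φ) (n + 1) i i I g

/-- The pullback of semidensities, `Φ^*(F d^{1/2}V) = Φ^*(F) Ber(∂Φ)^{1/2} d^{1/2}V`. -/
def semiPullback (Φ : ι → Coef ι 𝕜) (F : Coef ι 𝕜) : Coef ι 𝕜 :=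
  mul d (pullback d Φ F) (expo d ((1 / 2 : 𝕜) • logBer d Φ))

/-- `Φ_t` (`0 ≤ t ≤ 1`) is the flow of the time-dependent vector field `X(t)`, acting on functions:
`Φ_0 = 1` and `d/dt Φ_t^* = Φ_t^* X(t)`. -/
structure IsFlow (X : ℝ → Coef ι 𝕜 → Coef ι 𝕜) (Φ : ℝ → ι → Coef ι 𝕜) : Prop where
  start : Φ 0 = coord
  nearIdentity : ∀ t ∈ Set.Icc (0 : ℝ) 1, IsNearIdentity d (Φ t)
  smooth : ∀ i I g, ContDiffOn ℝ ((⊤ : ℕ∞) : WithTop ℕ∞) (fun t => Φ t i I g) (Set.Icc 0 1)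
  deriv : ∀ t ∈ Set.Icc (0 : ℝ) 1, ∀ (m : ℤ) (F : Coef ι 𝕜), IsFunWeight d m F → ∀ I g,
    HasDerivWithinAt (fun s => pullback d (Φ s) F I g) (pullback d (Φ t) (X t F) I g)
      (Set.Icc 0 1) t

end Functions

end BV

end

open BV

set_option linter.unusedSectionVars false
set_option linter.unusedSimpArgs false
set_option linter.flexible false

noncomputable section

namespace BVCalc

open Finsupp (single linearCombination mem_support_iff linearCombination_apply single_apply degree_single)
open Finset (sum_congr sum_eq_zero mem_filter sum_add_distrib sum_sub_distrib)
open Finset.HasAntidiagonal (antidiagonal mem_antidiagonal)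
open Set (mem_ofPred_eq)
open Function (iterate_succ_apply')
open AddMonoidHom (comp_apply)
/-! ### Signs -/

section Signs

variable {L : Type*} [CommRing L]

/-- The sign `(-1)^n` in a commutative ring. -/
def sg (L : Type*) [CommRing L] (n : ℤ) : L := ((Int.negOnePow n : ℤˣ) : ℤ)

lemma sg_add (m n : ℤ) : sg L (m + n) = sg L m * sg L n := by
  simp [sg, Int.negOnePow_add]

@[simp] lemma sg_zero : sg L 0 = 1 := by simp [sg]

lemma sg_even {n : ℤ} (h : Even n) : sg L n = 1 := by simp [sg, Int.negOnePow_even n h]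

lemma sg_odd {n : ℤ} (h : Odd n) : sg L n = -1 := by simp [sg, Int.negOnePow_odd n h]

@[simp] lemma sg_one : sg L 1 = -1 := sg_odd odd_one

lemma sg_mul_self (n : ℤ) : sg L n * sg L n = 1 := by
  rw [← sg_add, sg_even (Even.add_self n)]

lemma sg_congr {m n : ℤ} (h : Even (m - n)) : sg L m = sg L n := by
  have : m = (m - n) + n := by ring
  rw [this, sg_add, sg_even h, one_mul]

lemma sg_neg (n : ℤ) : sg L (-n) = sg L n := sg_congr ⟨-n, by ring⟩

lemma zpow_eq_sg {𝕜 : Type*} [Field 𝕜] (n : ℤ) : (-1 : 𝕜) ^ n = sg 𝕜 n := by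
  rcases Int.even_or_odd n with h | h
  · rw [sg_even h, h.neg_one_zpow]
  · rw [sg_odd h, h.neg_one_zpow]

end Signs

section Exponents

variable {ι : Type*} [LinearOrder ι] (d : ι → ℤ)

/-- The exponent of the Koszul sign. -/
def kz (J K : ι →₀ ℕ) : ℤ :=
  J.sum fun i a => K.sum fun j b => if j < i then d i * d j * a * b else (0 : ℤ)

lemma kz_add_left (J J' K : ι →₀ ℕ) : kz d (J + J') K = kz d J K + kz d J' K := by
  unfold kz
  rw [Finsupp.sum_add_index']
  · intro i; simp
  · intro i a b
    rw [← Finsupp.sum_add]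
    refine Finsupp.sum_congr fun j _ => ?_
    split_ifs
    · push_cast; ring
    · simp

lemma kz_add_right (J K K' : ι →₀ ℕ) : kz d J (K + K') = kz d J K + kz d J K' := by
  unfold kz
  rw [← Finsupp.sum_add]
  refine Finsupp.sum_congr fun i _ => ?_
  rw [Finsupp.sum_add_index']
  · intro i; simp
  · intro i a b
    split_ifs
    · push_cast; ring
    · simp

@[simp] lemma kz_zero_left (K : ι →₀ ℕ) : kz d 0 K = 0 := by simp [kz]

@[simp] lemma kz_zero_right (K : ι →₀ ℕ) : kz d K 0 = 0 := by simp [kz]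

lemma kz_single (i j : ι) (a b : ℕ) :
    kz d (single i a) (single j b) = if j < i then d i * d j * a * b else 0 := by
  unfold kz
  rw [Finsupp.sum_single_index, Finsupp.sum_single_index] <;> simp

lemma md_add (J K : ι →₀ ℕ) : monDegree d (J + K) = monDegree d J + monDegree d K := by
  unfold monDegree
  rw [Finsupp.sum_add_index']
  · simp
  · intros; push_cast; ring

@[simp] lemma md_zero : monDegree d 0 = 0 := by simp [monDegree]

lemma md_single (i : ι) (a : ℕ) : monDegree d (single i a) = -(d i) * a := by
  unfold monDegree; rw [Finsupp.sum_single_index]; simp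

/-- `∑ (d i)² J i K i`. -/
def dg (J K : ι →₀ ℕ) : ℤ := J.sum fun i a => d i * d i * a * K i

lemma dg_add_left (J J' K : ι →₀ ℕ) : dg d (J + J') K = dg d J K + dg d J' K := by
  unfold dg
  rw [Finsupp.sum_add_index']
  · simp
  · intros; push_cast; ring

lemma dg_add_right (J K K' : ι →₀ ℕ) : dg d J (K + K') = dg d J K + dg d J K' := by
  unfold dg
  rw [← Finsupp.sum_add]
  refine Finsupp.sum_congr fun i _ => ?_
  rw [Finsupp.add_apply]; push_cast; ring

lemma dg_single_right (i : ι) (K : ι →₀ ℕ) : dg d K (single i 1) = d i * d i * K i := by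
  classical
  unfold dg
  by_cases h : i ∈ K.support
  · rw [Finsupp.sum, Finset.sum_eq_single i]
    · simp
    · intro b _ hb; simp [single_apply, hb.symm]
    · simp [h]
  · rw [Finsupp.sum, sum_eq_zero]
    · simp only [mem_support_iff, not_not] at h; simp [h]
    · intro b hb
      have : i ≠ b := fun e => h (e ▸ hb)
      simp [single_apply, this]

lemma kz_comm (J K : ι →₀ ℕ) : kz d J K + kz d K J + dg d J K = monDegree d J * monDegree d K := by
  induction J using Finsupp.induction_linear with
  | zero => simp [dg]
  | add f g hf hg =>
    rw [kz_add_left, kz_add_right, dg_add_left, md_add, add_mul, ← hf, ← hg]; ring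
  | single i a =>
    induction K using Finsupp.induction_linear with
    | zero => simp [dg]
    | add f g hf hg =>
      rw [kz_add_left, kz_add_right, dg_add_right, md_add, mul_add, ← hf, ← hg]; ring
    | single j b =>
      rw [kz_single, kz_single, md_single, md_single]
      have : dg d (single i a) (single j b) =
          if i = j then d i * d i * a * b else 0 := by
        unfold dg
        rw [Finsupp.sum_single_index (by simp), single_apply]
        by_cases h : i = j
        · subst h; simp
        · rw [if_neg (fun e => h e.symm), if_neg h]; simp
      rw [this]
      rcases lt_trichotomy i j with h | h | h
      · simp [h, h.not_gt, h.ne]; ring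
      · subst h; simp; ring
      · simp [h, h.not_gt, h.ne']; ring

lemma adm_of_le {d : ι → ℤ} {I J : ι →₀ ℕ} (h : Admissible d J) (hIJ : I ≤ J) :
    Admissible d I := fun i hi => (hIJ i).trans (h i hi)

lemma adm_left {d : ι → ℤ} {I J : ι →₀ ℕ} (h : Admissible d (I + J)) : Admissible d I :=
  adm_of_le h (by simp)

lemma adm_right {d : ι → ℤ} {I J : ι →₀ ℕ} (h : Admissible d (I + J)) : Admissible d J :=
  adm_of_le h (by simp)

lemma admissible_zero : Admissible d (0 : ι →₀ ℕ) := fun i _ => by simp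

lemma admissible_single (i : ι) : Admissible d (single i 1) := fun j _ => by
  classical
  rw [single_apply]; split_ifs <;> simp

lemma dg_even {J K : ι →₀ ℕ} (h : Admissible d (J + K)) : Even (dg d J K) := by
  unfold dg
  refine Finset.even_sum _ fun i _ => ?_
  rcases Int.even_or_odd (d i) with hi | hi
  · exact ((hi.mul_right _).mul_right _).mul_right _
  · have h1 := h i hi
    simp only [Finsupp.add_apply] at h1
    have : J i = 0 ∨ K i = 0 := by omega
    rcases this with h0 | h0 <;> simp [h0]

variable {L : Type*} [CommRing L]

lemma sg_kz_comm {J K : ι →₀ ℕ} (h : Admissible d (J + K)) :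
    sg L (kz d J K) = sg L (monDegree d J * monDegree d K) * sg L (kz d K J) := by
  rw [← sg_add, ← kz_comm]
  apply sg_congr
  have := dg_even d h
  have e : kz d J K - (kz d J K + kz d K J + dg d J K + kz d K J) =
    -(dg d J K) + -(kz d K J + kz d K J) := by ring
  rw [e]
  exact (this.neg).add (Even.neg (Even.add_self _))

end Exponents

/-! ### Products of series of graded commuting variables -/

section Raw

variable {ι : Type*} [LinearOrder ι] (d : ι → ℤ) {L : Type*} [CommRing L]

open Classical in
/-- The graded commutative product of formal series with coefficients in `L`. -/
def rmul (F G : (ι →₀ ℕ) → L) : (ι →₀ ℕ) → L := fun I =>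
  if Admissible d I then
    ∑ p ∈ antidiagonal I, sg L (kz d p.1 p.2) * (F p.1 * G p.2)
  else 0

open Classical in
lemma rmul_assoc (F G H : (ι →₀ ℕ) → L) : rmul d (rmul d F G) H = rmul d F (rmul d G H) := by
  ext I
  unfold rmul
  split_ifs with hI
  swap; · rfl
  have h1 : ∀ p ∈ antidiagonal I, Admissible d p.1 ∧ Admissible d p.2 := by
    intro p hp
    rw [mem_antidiagonal] at hp
    rw [← hp] at hI
    exact ⟨adm_left hI, adm_right hI⟩
  have hl : ∀ p ∈ antidiagonal I,
      sg L (kz d p.1 p.2) * ((if Admissible d p.1 then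
        ∑ q ∈ antidiagonal p.1, sg L (kz d q.1 q.2) * (F q.1 * G q.2)
        else 0) * H p.2) =
      sg L (kz d p.1 p.2) * ((∑ q ∈ antidiagonal p.1,
        sg L (kz d q.1 q.2) * (F q.1 * G q.2)) * H p.2) :=
    fun p hp => by rw [if_pos (h1 p hp).1]
  have hr : ∀ p ∈ antidiagonal I,
      sg L (kz d p.1 p.2) * (F p.1 * (if Admissible d p.2 then
        ∑ q ∈ antidiagonal p.2, sg L (kz d q.1 q.2) * (G q.1 * H q.2)
        else 0)) =
      sg L (kz d p.1 p.2) * (F p.1 * ∑ q ∈ antidiagonal p.2,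
        sg L (kz d q.1 q.2) * (G q.1 * H q.2)) :=
    fun p hp => by rw [if_pos (h1 p hp).2]
  rw [sum_congr rfl hl, sum_congr rfl hr]
  simp only [Finset.sum_mul, Finset.mul_sum, Finset.sum_sigma']
  apply Finset.sum_nbij' (fun ⟨⟨_i, j⟩, ⟨k, l⟩⟩ ↦ ⟨(k, l + j), (l, j)⟩)
    (fun ⟨⟨i, _j⟩, ⟨k, l⟩⟩ ↦ ⟨(i + k, l), (i, k)⟩)
  · rintro ⟨⟨a, b⟩, ⟨k, l⟩⟩ h
    simp only [Finset.mem_sigma, mem_antidiagonal] at h ⊢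
    simp [← h.1, ← h.2, add_assoc]
  · rintro ⟨⟨a, b⟩, ⟨k, l⟩⟩ h
    simp only [Finset.mem_sigma, mem_antidiagonal] at h ⊢
    simp [← h.1, ← h.2, add_assoc]
  · rintro ⟨⟨a, b⟩, ⟨k, l⟩⟩ h
    simp only [Finset.mem_sigma, mem_antidiagonal] at h ⊢
    simp [← h.2]
  · rintro ⟨⟨a, b⟩, ⟨k, l⟩⟩ h
    simp only [Finset.mem_sigma, mem_antidiagonal] at h ⊢
    simp [← h.2]
  · rintro ⟨⟨a, b⟩, ⟨k, l⟩⟩ h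
    simp only [Finset.mem_sigma, mem_antidiagonal] at h ⊢
    obtain ⟨h, rfl⟩ := h
    have : sg L (kz d (k + l) b) * sg L (kz d k l) = sg L (kz d k (l + b)) * sg L (kz d l b) := by
      rw [← sg_add, ← sg_add, kz_add_left, kz_add_right]; congr 1; ring
    linear_combination (F k * G l * H b) * this

lemma rmul_add (F G H : (ι →₀ ℕ) → L) : rmul d F (G + H) = rmul d F G + rmul d F H := by
  ext I
  unfold rmul
  simp only [Pi.add_apply]
  split_ifs
  · rw [← sum_add_distrib]
    exact sum_congr rfl fun p _ => by ring
  · simp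

lemma add_rmul (F G H : (ι →₀ ℕ) → L) : rmul d (F + G) H = rmul d F H + rmul d G H := by
  ext I
  unfold rmul
  simp only [Pi.add_apply]
  split_ifs
  · rw [← sum_add_distrib]
    exact sum_congr rfl fun p _ => by ring
  · simp

open Classical in
/-- The constant series. -/
def rconst (l : L) : (ι →₀ ℕ) → L := fun I => if I = 0 then l else 0

lemma rconst_rmul (l : L) (F : (ι →₀ ℕ) → L) (hF : ∀ I, ¬ Admissible d I → F I = 0) :
    rmul d (rconst l) F = fun I => l * F I := by
  ext I
  unfold rmul rconst
  split_ifs with hI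
  · rw [Finset.sum_eq_single (0, I)]
    · simp
    · rintro ⟨a, b⟩ h hne
      rw [mem_antidiagonal] at h
      rw [if_neg]
      · simp
      · rintro rfl; apply hne; simp at h; simp [h]
    · simp
  · rw [hF I hI, mul_zero]

/-- The sign operator `F ↦ (-1)^(n |F|) F`. -/
def rsig (n : ℤ) (F : (ι →₀ ℕ) → L) : (ι →₀ ℕ) → L := fun I => sg L (n * monDegree d I) * F I

lemma rsig_rmul (n : ℤ) (F G : (ι →₀ ℕ) → L) :
    rsig d n (rmul d F G) = rmul d (rsig d n F) (rsig d n G) := by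
  ext I
  unfold rsig rmul
  split_ifs
  · rw [Finset.mul_sum]
    refine sum_congr rfl fun p hp => ?_
    rw [mem_antidiagonal] at hp
    rw [← hp, md_add, mul_add, sg_add]; ring
  · simp

lemma sum_antidiagonal_prodComm (I : ι →₀ ℕ) (f : (ι →₀ ℕ) × (ι →₀ ℕ) → L) :
    ∑ p ∈ antidiagonal I, f p =
      ∑ p ∈ antidiagonal I, f p.swap := by
  refine Finset.sum_equiv (Equiv.prodComm _ _) (fun p => ?_) (fun p _ => by simp)
  simp [add_comm]

/-- Elements of parity `n` commute up to sign. -/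
lemma rmul_comm_of_parity (n : ℤ) (F G : (ι →₀ ℕ) → L)
    (hF : ∀ I, F I ≠ 0 → Even (monDegree d I - n)) :
    rmul d F G = rmul d (rsig d n G) F := by
  ext I
  unfold rsig rmul
  split_ifs with hI
  swap; · rfl
  rw [sum_antidiagonal_prodComm I (fun p => sg L (kz d p.1 p.2) *
    ((fun I => sg L (n * monDegree d I) * G I) p.1 * F p.2))]
  refine sum_congr rfl fun p hp => ?_
  rw [mem_antidiagonal] at hp
  by_cases h0 : F p.1 = 0
  · simp [h0]
  · rw [← hp] at hI
    have h1 := hF _ h0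
    rw [sg_kz_comm d hI]
    have : sg L (monDegree d p.1 * monDegree d p.2) = sg L (n * monDegree d p.2) := by
      apply sg_congr; rw [← sub_mul]; exact h1.mul_right _
    rw [this]
    simp only [Prod.fst_swap, Prod.snd_swap]
    ring

/-- The left partial derivative. -/
def rder (i : ι) (F : (ι →₀ ℕ) → L) : (ι →₀ ℕ) → L := fun I =>
  ((I i : L) + 1) * sg L (kz d (single i 1) I) * F (I + single i 1)

lemma sum_antidiagonal_shift_left (i : ι) (I : ι →₀ ℕ) (f : (ι →₀ ℕ) → (ι →₀ ℕ) → L)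
    (hf : ∀ J K, J i = 0 → f J K = 0) :
    ∑ p ∈ antidiagonal I, f (p.1 + single i 1) p.2 =
      ∑ p ∈ antidiagonal (I + single i 1), f p.1 p.2 := by
  classical
  rw [← Finset.sum_filter_add_sum_filter_not
    (antidiagonal (I + single i 1)) (fun p : (ι →₀ ℕ) × (ι →₀ ℕ) => p.1 i = 0)]
  rw [sum_eq_zero (s := Finset.filter (fun p : (ι →₀ ℕ) × (ι →₀ ℕ) => p.1 i = 0) _), zero_add]
  · refine Finset.sum_nbij' (fun p => (p.1 + single i 1, p.2))
      (fun p => (p.1 - single i 1, p.2)) ?_ ?_ ?_ ?_ ?_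
    · rintro ⟨a, b⟩ h
      simp only [mem_filter, mem_antidiagonal] at h ⊢
      refine ⟨by rw [← h]; abel, by simp⟩
    · rintro ⟨a, b⟩ h
      simp only [mem_filter, mem_antidiagonal] at h ⊢
      have h1 : single i 1 ≤ a := by
        rw [Finsupp.single_le_iff]; omega
      apply add_right_cancel (b := single i 1)
      rw [← h.1, add_right_comm, tsub_add_cancel_of_le h1]
    · rintro ⟨a, b⟩ h; simp
    · rintro ⟨a, b⟩ h
      simp only [mem_filter, mem_antidiagonal] at h ⊢
      have h1 : single i 1 ≤ a := by
        rw [Finsupp.single_le_iff]; omega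
      simp [tsub_add_cancel_of_le h1]
    · rintro ⟨a, b⟩ h; simp
  · intro p hp
    exact hf _ _ (Finset.mem_filter.mp hp).2

lemma sum_antidiagonal_shift_right (i : ι) (I : ι →₀ ℕ) (f : (ι →₀ ℕ) → (ι →₀ ℕ) → L)
    (hf : ∀ J K, K i = 0 → f J K = 0) :
    ∑ p ∈ antidiagonal I, f p.1 (p.2 + single i 1) =
      ∑ p ∈ antidiagonal (I + single i 1), f p.1 p.2 := by
  have := sum_antidiagonal_shift_left i I (fun J K => f K J) (fun J K h => hf K J h)
  rw [sum_antidiagonal_prodComm, sum_antidiagonal_prodComm (I + _)]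
  simpa using this

lemma rder_rmul (i : ι) (F G : (ι →₀ ℕ) → L) (hF : ∀ I, ¬ Admissible d I → F I = 0)
    (hG : ∀ I, ¬ Admissible d I → G I = 0) :
    rder d i (rmul d F G) = rmul d (rder d i F) G + rmul d (rsig d (d i) F) (rder d i G) := by
  ext I
  rw [Pi.add_apply]
  by_cases hI : Admissible d I
  swap
  · have h1 : ¬ Admissible d (I + single i 1) := fun h => hI (adm_left h)
    simp [rder, rmul, hI, h1]
  have e1 : rmul d (rder d i F) G I =
      ∑ p ∈ antidiagonal (I + single i 1),
        sg L (kz d (p.1 - single i 1) p.2) * (p.1 i : L) *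
          sg L (kz d (single i 1) (p.1 - single i 1)) * (F p.1 * G p.2) := by
    rw [← sum_antidiagonal_shift_left i I (fun J K =>
        sg L (kz d (J - single i 1) K) * (J i : L) *
          sg L (kz d (single i 1) (J - single i 1)) * (F J * G K))]
    · unfold rmul rder
      rw [if_pos hI]
      refine sum_congr rfl fun p _ => ?_
      simp; ring
    · intro J K h; simp [h]
  have e2 : rmul d (rsig d (d i) F) (rder d i G) I =
      ∑ p ∈ antidiagonal (I + single i 1),
        sg L (kz d p.1 (p.2 - single i 1)) * (p.2 i : L) * sg L (d i * monDegree d p.1) *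
          sg L (kz d (single i 1) (p.2 - single i 1)) * (F p.1 * G p.2) := by
    rw [← sum_antidiagonal_shift_right i I (fun J K =>
        sg L (kz d J (K - single i 1)) * (K i : L) * sg L (d i * monDegree d J) *
          sg L (kz d (single i 1) (K - single i 1)) * (F J * G K))]
    · unfold rmul rder rsig
      rw [if_pos hI]
      refine sum_congr rfl fun p _ => ?_
      simp; ring
    · intro J K h; simp [h]
  rw [e1, e2, ← sum_add_distrib]
  have key : ∀ p : (ι →₀ ℕ) × (ι →₀ ℕ), p ∈ antidiagonal (I + single i 1) →
      p.1 i ≠ 0 → kz d (single i 1) I + kz d p.1 p.2 =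
        kz d (p.1 - single i 1) p.2 +
          kz d (single i 1) (p.1 - single i 1) +
          2 * kz d (single i 1) p.2 := by
    rintro ⟨J, K⟩ hp h0
    rw [mem_antidiagonal] at hp
    simp only at hp h0 ⊢
    have h1 : single i 1 ≤ J := by rw [Finsupp.single_le_iff]; omega
    obtain ⟨J', rfl⟩ : ∃ J', J = J' + single i 1 := ⟨_, (tsub_add_cancel_of_le h1).symm⟩
    have hI' : I = J' + K := by
      apply add_right_cancel (b := single i 1); rw [← hp]; abel
    rw [hI', add_tsub_cancel_right, kz_add_left, kz_add_right]; ring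
  have key2 : ∀ p : (ι →₀ ℕ) × (ι →₀ ℕ), p ∈ antidiagonal (I + single i 1) →
      p.2 i ≠ 0 → kz d (single i 1) I + kz d p.1 p.2 =
        kz d p.1 (p.2 - single i 1) +
          kz d (single i 1) (p.2 - single i 1) +
          -(d i * monDegree d p.1) - d i * d i * p.1 i := by
    rintro ⟨J, K⟩ hp h0
    rw [mem_antidiagonal] at hp
    simp only at hp h0 ⊢
    have h1 : single i 1 ≤ K := by rw [Finsupp.single_le_iff]; omega
    obtain ⟨K', rfl⟩ : ∃ J', K = J' + single i 1 := ⟨_, (tsub_add_cancel_of_le h1).symm⟩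
    have hI' : I = J + K' := by
      apply add_right_cancel (b := single i 1); rw [← hp]; abel
    have := kz_comm d J (single i 1)
    rw [dg_single_right, md_single] at this
    rw [hI', add_tsub_cancel_right, kz_add_right, kz_add_right]
    push_cast at this
    linear_combination this
  by_cases hIi : Admissible d (I + single i 1)
  · unfold rder rmul
    rw [if_pos hIi, Finset.mul_sum]
    refine sum_congr rfl fun p hp => ?_
    have hk1 := key p hp
    have hk2 := key2 p hp
    rw [mem_antidiagonal] at hp
    have hc : ((I i : L) + 1) = p.1 i + p.2 i := by
      have := congrArg (fun f => f i) hp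
      simp at this
      rw [← Nat.cast_add, this]; push_cast; rfl
    rw [hc]
    have a1 : (p.1 i : L) * (sg L (kz d (single i 1) I) * sg L (kz d p.1 p.2)) =
        (p.1 i : L) * (sg L (kz d (p.1 - single i 1) p.2) *
          sg L (kz d (single i 1) (p.1 - single i 1))) := by
      by_cases h0 : p.1 i = 0
      · simp [h0]
      · rw [← sg_add, ← sg_add, hk1 h0]
        congr 1
        apply sg_congr; exact ⟨kz d (single i 1) p.2, by ring⟩
    have a2 : (p.2 i : L) * (sg L (kz d (single i 1) I) * sg L (kz d p.1 p.2)) =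
        (p.2 i : L) * (sg L (kz d p.1 (p.2 - single i 1)) *
          sg L (kz d (single i 1) (p.2 - single i 1)) *
          sg L (d i * monDegree d p.1)) := by
      by_cases h0 : p.2 i = 0
      · simp [h0]
      · rw [← sg_add, ← sg_add, ← sg_add, hk2 h0]
        congr 1
        apply sg_congr
        have e : Even (d i * d i * (p.1 i : ℤ)) := by
          rcases Int.even_or_odd (d i) with hi | hi
          · rw [mul_assoc]; exact hi.mul_right _
          · have h1 := hIi i hi
            rw [← hp] at h1
            simp only [Finsupp.add_apply] at h1
            have : p.1 i = 0 := by omega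
            simp [this]
        obtain ⟨r, hr⟩ := e
        refine ⟨-(d i * monDegree d p.1) - r, ?_⟩
        linear_combination -hr
    linear_combination (F p.1 * G p.2) * a1 + (F p.1 * G p.2) * a2
  · have h0 : rder d i (rmul d F G) I = 0 := by simp [rder, rmul, hIi]
    rw [h0, eq_comm]
    obtain ⟨hodd, hIi1⟩ : Odd (d i) ∧ I i = 1 := by
      simp only [Admissible, not_forall] at hIi
      obtain ⟨j, hj, hj2⟩ := hIi
      have := hI j hj
      simp only [Finsupp.add_apply, single_apply] at hj2
      split_ifs at hj2 with hij
      · subst hij; exact ⟨hj, by omega⟩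
      · omega
    apply sum_eq_zero
    intro p hp
    have hk1 := key p hp
    have hk2 := key2 p hp
    rw [mem_antidiagonal] at hp
    have hc : p.1 i + p.2 i = 2 := by
      have := congrArg (fun f => f i) hp
      simp [hIi1] at this
      omega
    by_cases h2 : 2 ≤ p.1 i
    · rw [hF p.1 (fun h => by have := h i hodd; omega)]; ring
    by_cases h2' : 2 ≤ p.2 i
    · rw [hG p.2 (fun h => by have := h i hodd; omega)]; ring
    have h11 : p.1 i = 1 := by omega
    have h21 : p.2 i = 1 := by omega
    have hk1 := hk1 (by omega)
    have hk2 := hk2 (by omega)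
    have : sg L (kz d (p.1 - single i 1) p.2) *
          sg L (kz d (single i 1) (p.1 - single i 1)) =
        - (sg L (kz d p.1 (p.2 - single i 1)) * sg L (d i * monDegree d p.1) *
          sg L (kz d (single i 1) (p.2 - single i 1))) := by
      rw [← sg_add, ← sg_add, ← sg_add, ← neg_one_mul, ← sg_one, ← sg_add]
      apply sg_congr
      have ho : Odd (d i * d i) := hodd.mul hodd
      rw [h11] at hk2
      obtain ⟨r, hr⟩ := ho
      refine ⟨- kz d (single i 1) p.2 - d i * monDegree d p.1 - r - 1, ?_⟩
      push_cast at hk2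
      linear_combination hk1.symm.trans hk2 + -hr
    rw [h11, h21]
    linear_combination (F p.1 * G p.2) * this

lemma rder_rder (i j : ι) (F : (ι →₀ ℕ) → L) (hF : ∀ I, ¬ Admissible d I → F I = 0) :
    rder d i (rder d j F) = fun I => sg L (d i * d j) * rder d j (rder d i F) I := by
  classical
  ext I
  unfold rder
  rw [add_right_comm I (single j 1), kz_add_right, kz_add_right, sg_add, sg_add,
    kz_single, kz_single]
  rcases lt_trichotomy i j with h | h | h
  · simp [h, h.not_gt, h.ne, h.ne', mul_comm (d j)]
    try ring
  · subst h
    simp only [lt_irrefl, if_false, sg_zero]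
    rcases Int.even_or_odd (d i) with hi | hi
    · rw [sg_even (hi.mul_right _)]; ring
    · rw [hF]
      · ring
      · intro h; have := h i hi; simp at this
  · simp [h, h.not_gt, h.ne, h.ne', mul_comm (d j)]
    linear_combination (-(((I i : L) + 1) * sg L (kz d (single i 1) I) *
      (((I j : L) + 1) * sg L (kz d (single j 1) I) *
        F (I + single i 1 + single j 1)))) * sg_mul_self (L := L) (d i * d j)

end Raw

/-! ### The ring of locally finite series -/

/-- Exponents of monomials `φ^I ħ^g`. -/
abbrev Mon (ι : Type*) := (ι →₀ ℕ) × ℤ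

/-- The level `(2c+1) n + (2c+2) g` of a monomial; for `c = 0` this is the weight. -/
def lv {ι : Type*} (c : ℕ) (p : Mon ι) : ℤ := (2 * c + 1) * (p.1.degree : ℤ) + (2 * c + 2) * p.2

lemma lv_add {ι : Type*} (c : ℕ) (p q : Mon ι) : lv c (p + q) = lv c p + lv c q := by
  simp [lv]; ring

/-- Formal series in the variables `φ` and `ħ, ħ⁻¹` with finitely many monomials of bounded
level. -/
@[ext] structure SF {ι : Type*} (d : ι → ℤ) (R : Type*) [CommRing R] (c : ℕ) where
  coef : (ι →₀ ℕ) → ℤ → R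
  adm : ∀ I g, coef I g ≠ 0 → Admissible d I
  lf : ∀ v : ℤ, {p : Mon ι | lv c p ≤ v ∧ coef p.1 p.2 ≠ 0}.Finite

namespace SF

section Basic

variable {ι : Type*} {d : ι → ℤ} {R : Type*} [CommRing R] {c : ℕ}

lemma exists_lower (F : SF d R c) : ∃ m : ℤ, ∀ p : Mon ι, F.coef p.1 p.2 ≠ 0 → m ≤ lv c p := by
  classical
  obtain ⟨b, hb⟩ := ((F.lf 0).image (lv c)).bddBelow
  refine ⟨min b 0, fun p hp => ?_⟩
  by_cases h : lv c p ≤ 0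
  · exact (min_le_left _ _).trans (hb ⟨p, ⟨h, hp⟩, rfl⟩)
  · exact (min_le_right _ _).trans (le_of_lt (not_le.mp h))

lemma bddBelow (F : SF d R c) (I : ι →₀ ℕ) : BddBelow (Function.support (F.coef I)) := by
  obtain ⟨m, hm⟩ := F.exists_lower
  refine ⟨min 0 (m - (2 * c + 1) * I.degree), fun g hg => ?_⟩
  have := hm (I, g) hg
  simp only [lv] at this
  by_cases h : 0 ≤ g
  · exact (min_le_left _ _).trans h
  · refine (min_le_right _ _).trans ?_
    have : (c : ℤ) * g ≤ 0 := mul_nonpos_of_nonneg_of_nonpos (by positivity) (by omega)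
    nlinarith

/-- The coefficients as Laurent series in `ħ`. -/
def toL (F : SF d R c) : (ι →₀ ℕ) → HahnSeries ℤ R := fun I =>
  HahnSeries.ofSuppBddBelow (F.coef I) (F.bddBelow I)

@[simp] lemma toL_coeff (F : SF d R c) (I : ι →₀ ℕ) (g : ℤ) : (F.toL I).coeff g = F.coef I g := by
  simp [toL]

lemma toL_adm (F : SF d R c) (I : ι →₀ ℕ) (h : ¬ Admissible d I) : F.toL I = 0 := by
  ext g
  rw [toL_coeff, HahnSeries.coeff_zero]
  by_contra h'
  exact h (F.adm I g h')

lemma toL_injective : Function.Injective (toL : SF d R c → _) := by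
  intro F G h
  ext I g
  rw [← toL_coeff, h, toL_coeff]

instance : Zero (SF d R c) := ⟨⟨fun _ _ => 0, by simp, by simp⟩⟩

instance : Add (SF d R c) := ⟨fun F G => ⟨fun I g => F.coef I g + G.coef I g, fun I g h => by
    by_cases h1 : F.coef I g = 0
    · by_cases h2 : G.coef I g = 0
      · simp [h1, h2] at h
      · exact G.adm I g h2
    · exact F.adm I g h1, fun v => ((F.lf v).union (G.lf v)).subset fun p hp => by
    by_cases h1 : F.coef p.1 p.2 = 0
    · by_cases h2 : G.coef p.1 p.2 = 0
      · simp [h1, h2] at hp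
      · exact Or.inr ⟨hp.1, h2⟩
    · exact Or.inl ⟨hp.1, h1⟩⟩⟩

instance : Neg (SF d R c) := ⟨fun F => ⟨fun I g => -F.coef I g, fun I g h => F.adm I g (by simpa using h),
  fun v => (F.lf v).subset fun p hp => ⟨hp.1, by simpa using hp.2⟩⟩⟩

instance : Sub (SF d R c) := ⟨fun F G => ⟨fun I g => F.coef I g - G.coef I g, fun I g h => by
    rw [sub_eq_add_neg] at h; exact (F + -G).adm I g h, fun v => ((F + -G).lf v).subset fun p hp =>
      ⟨hp.1, by have := hp.2; rwa [sub_eq_add_neg] at this⟩⟩⟩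

instance {S : Type*} [Monoid S] [DistribMulAction S R] : SMul S (SF d R c) := ⟨fun r F =>
  ⟨fun I g => r • F.coef I g, fun I g h => F.adm I g (by rintro h'; simp [h'] at h),
    fun v => (F.lf v).subset fun p hp => ⟨hp.1, by
      have := hp.2; rintro h'; simp [h'] at this⟩⟩⟩

@[simp] lemma coef_zero (I : ι →₀ ℕ) (g : ℤ) : (0 : SF d R c).coef I g = 0 := rfl
@[simp] lemma coef_add (F G : SF d R c) (I : ι →₀ ℕ) (g : ℤ) :
    (F + G).coef I g = F.coef I g + G.coef I g := rfl
@[simp] lemma coef_neg (F : SF d R c) (I : ι →₀ ℕ) (g : ℤ) : (-F).coef I g = -F.coef I g := rfl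
@[simp] lemma coef_sub (F G : SF d R c) (I : ι →₀ ℕ) (g : ℤ) :
    (F - G).coef I g = F.coef I g - G.coef I g := rfl
@[simp] lemma coef_smul {S : Type*} [Monoid S] [DistribMulAction S R] (r : S) (F : SF d R c)
    (I : ι →₀ ℕ) (g : ℤ) : (r • F).coef I g = r • F.coef I g := rfl

lemma coef_injective : Function.Injective (coef : SF d R c → _) := fun _ _ h => SF.ext h

instance : AddCommGroup (SF d R c) :=
  Function.Injective.addCommGroup (fun F => F.coef) coef_injective rfl (fun _ _ => rfl)
    (fun _ => rfl) (fun _ _ => rfl) (fun _ _ => rfl) (fun _ _ => rfl)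

/-- The coefficient of a monomial. -/
def coefHom (I : ι →₀ ℕ) (g : ℤ) : SF d R c →+ R where
  toFun F := F.coef I g
  map_zero' := rfl
  map_add' _ _ := rfl

lemma coef_sum {κ : Type*} (s : Finset κ) (y : κ → SF d R c) (I : ι →₀ ℕ) (g : ℤ) :
    (∑ i ∈ s, y i).coef I g = ∑ i ∈ s, (y i).coef I g :=
  map_sum (coefHom I g) y s

instance {S : Type*} [Semiring S] [Module S R] : Module S (SF d R c) :=
  Function.Injective.module S ⟨⟨fun F : SF d R c => F.coef, rfl⟩, fun _ _ => rfl⟩ coef_injective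
    (fun _ _ => rfl)

/-- Series supported in a set of monomials. -/
def Supp (d : ι → ℤ) (R : Type*) [CommRing R] (c : ℕ) (S : Set (Mon ι)) :
    AddSubgroup (SF d R c) where
  carrier := {F | ∀ p : Mon ι, F.coef p.1 p.2 ≠ 0 → p ∈ S}
  zero_mem' := by simp
  add_mem' := by
    intro F G hF hG p hp
    by_cases h1 : F.coef p.1 p.2 = 0
    · exact hG p (by simpa [h1] using hp)
    · exact hF p h1
  neg_mem' := by intro F hF p hp; exact hF p (by simpa using hp)

lemma mem_supp {S : Set (Mon ι)} {F : SF d R c} :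
    F ∈ Supp d R c S ↔ ∀ p : Mon ι, F.coef p.1 p.2 ≠ 0 → p ∈ S := Iff.rfl

lemma supp_smul {K : Type*} [Monoid K] [DistribMulAction K R] {S : Set (Mon ι)} {F : SF d R c}
    (r : K) (h : F ∈ Supp d R c S) : r • F ∈ Supp d R c S := fun p hp => h p (by
  rintro h'; simp [h'] at hp)

lemma supp_mono {S T : Set (Mon ι)} (h : S ⊆ T) : Supp d R c S ≤ Supp d R c T :=
  fun _ hF p hp => h (hF p hp)

/-- Series of level at least `v`. -/
def Fil (d : ι → ℤ) (R : Type*) [CommRing R] (c : ℕ) (v : ℤ) : AddSubgroup (SF d R c) :=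
  Supp d R c {p | v ≤ lv c p}

lemma mem_fil {v : ℤ} {F : SF d R c} :
    F ∈ Fil d R c v ↔ ∀ p : Mon ι, F.coef p.1 p.2 ≠ 0 → v ≤ lv c p := Iff.rfl

lemma mem_fil' {v : ℤ} {F : SF d R c} :
    F ∈ Fil d R c v ↔ ∀ p : Mon ι, lv c p < v → F.coef p.1 p.2 = 0 := by
  rw [mem_fil]
  exact forall_congr' fun p => ⟨fun h hp => by_contra fun h' => absurd (h h') (not_le.mpr hp),
    fun h h' => not_lt.mp fun h'' => h' (h h'')⟩

lemma fil_anti {v w : ℤ} (h : v ≤ w) : Fil d R c w ≤ Fil d R c v :=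
  supp_mono fun _ hp => h.trans hp

lemma exists_mem_fil (F : SF d R c) : ∃ m, F ∈ Fil d R c m := F.exists_lower

lemma eq_zero_of_forall_fil {F : SF d R c} (h : ∀ v, F ∈ Fil d R c v) : F = 0 := by
  ext I g
  by_contra h'
  have := h (lv c (I, g) + 1) (I, g) h'
  simp at this

lemma fil_induction {F : SF d R c} {m : ℤ} (h0 : F ∈ Fil d R c m)
    (hs : ∀ v, F ∈ Fil d R c v → F ∈ Fil d R c (v + 1)) : F = 0 := by
  have : ∀ n : ℕ, F ∈ Fil d R c (m + n) := by
    intro n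
    induction n with
    | zero => simpa using h0
    | succ n ih => have := hs _ ih; push_cast; rwa [← add_assoc]
  exact eq_zero_of_forall_fil fun v => fil_anti (by omega) (this (v - m).toNat)

open Classical in
/-- The monomial `r φ^I ħ^g` (zero if `I` is not admissible). -/
def mono (d : ι → ℤ) (c : ℕ) (r : R) (p : Mon ι) : SF d R c where
  coef := fun I g => if (I, g) = p ∧ Admissible d I then r else 0
  adm := fun I g h => by by_contra h'; simp [h'] at h
  lf := fun v => (Set.finite_singleton p).subset fun q hq => by
    by_contra h'
    have := hq.2
    rw [if_neg] at this
    · exact this rfl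
    · rintro ⟨h, -⟩; exact h' h

open Classical in
lemma coef_mono (r : R) (p : Mon ι) (I : ι →₀ ℕ) (g : ℤ) :
    (mono d c r p).coef I g = if (I, g) = p ∧ Admissible d I then r else 0 := rfl

lemma mono_mem {S : Set (Mon ι)} {r : R} {p : Mon ι} (h : p ∈ S) : mono d c r p ∈ Supp d R c S := by
  classical
  intro q hq
  rw [coef_mono] at hq
  by_contra h'
  rw [if_neg] at hq
  · exact hq rfl
  · rintro ⟨e, -⟩; apply h'; rw [show q = p from e]; exact h

instance : One (SF d R c) := ⟨mono d c 1 0⟩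

lemma one_def : (1 : SF d R c) = mono d c 1 0 := rfl

end Basic

section Ring

variable {ι : Type*} [LinearOrder ι] {d : ι → ℤ} {R : Type*} [CommRing R] {c : ℕ}

lemma exists_of_rmul_ne {F G : SF d R c} {I : ι →₀ ℕ} {g : ℤ}
    (h : (rmul d F.toL G.toL I).coeff g ≠ 0) :
    ∃ p q : Mon ι, p + q = (I, g) ∧ F.coef p.1 p.2 ≠ 0 ∧ G.coef q.1 q.2 ≠ 0 := by
  unfold rmul at h
  split_ifs at h with hI
  · have hs : (∑ p ∈ antidiagonal I,
        (sg (HahnSeries ℤ R) (kz d p.1 p.2) * (F.toL p.1 * G.toL p.2))).coeff g =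
        ∑ p ∈ antidiagonal I,
        (sg (HahnSeries ℤ R) (kz d p.1 p.2) * (F.toL p.1 * G.toL p.2)).coeff g :=
      map_sum (HahnSeries.coeff.addMonoidHom g) _ _
    rw [hs] at h
    obtain ⟨p, hp, hp'⟩ := Finset.exists_ne_zero_of_sum_ne_zero h
    rw [mem_antidiagonal] at hp
    have h2 : (F.toL p.1 * G.toL p.2).coeff g ≠ 0 := by
      intro h0
      rcases Int.even_or_odd (kz d p.1 p.2) with he | ho
      · rw [sg_even he, one_mul] at hp'; exact hp' h0
      · rw [sg_odd ho, neg_one_mul, HahnSeries.coeff_neg, h0, neg_zero] at hp'; exact hp' rfl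
    obtain ⟨a, ha, b, hb, hab⟩ := HahnSeries.support_mul_subset h2
    refine ⟨(p.1, a), (p.2, b), ?_, ?_, ?_⟩
    · simp [hp]; exact hab
    · simpa using ha
    · simpa using hb
  · simp at h

instance : Mul (SF d R c) := ⟨fun F G =>
  { coef := fun I g => (rmul d F.toL G.toL I).coeff g
    adm := fun I g h => by by_contra h'; simp [rmul, h'] at h
    lf := fun v => by
      obtain ⟨m, hm⟩ := F.exists_lower
      obtain ⟨n, hn⟩ := G.exists_lower
      refine ((F.lf (v - n)).image2 (fun p q => p + q) (G.lf (v - m))).subset ?_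
      rintro ⟨I, g⟩ ⟨h1, h2⟩
      obtain ⟨p, q, hpq, hp, hq⟩ := exists_of_rmul_ne h2
      have h3 := lv_add c p q
      rw [hpq] at h3
      replace h1 : lv c (I, g) ≤ v := h1
      refine ⟨p, ⟨?_, hp⟩, q, ⟨?_, hq⟩, hpq⟩
      · have := hn q hq
        change lv c p ≤ v - n
        linarith
      · have := hm p hp
        change lv c q ≤ v - m
        linarith }⟩

lemma exists_of_mul_ne {F G : SF d R c} {I : ι →₀ ℕ} {g : ℤ} (h : (F * G).coef I g ≠ 0) :
    ∃ p q : Mon ι, p + q = (I, g) ∧ F.coef p.1 p.2 ≠ 0 ∧ G.coef q.1 q.2 ≠ 0 :=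
  exists_of_rmul_ne h

lemma toL_mul (F G : SF d R c) : (F * G).toL = rmul d F.toL G.toL := by
  ext I g; rw [toL_coeff]; rfl

lemma toL_add (F G : SF d R c) : (F + G).toL = F.toL + G.toL := by
  ext I g; simp

lemma toL_one : (1 : SF d R c).toL = rconst 1 := by
  classical
  ext I g
  rw [toL_coeff, one_def, coef_mono]
  unfold rconst
  by_cases h : I = 0
  · subst h
    simp [admissible_zero, HahnSeries.coeff_one]
  · simp [h]

lemma toL_zero : (0 : SF d R c).toL = 0 := by
  ext I g; simp

instance : Ring (SF d R c) where
  zero_mul F := toL_injective (by rw [toL_mul, toL_zero]; ext I g; simp [rmul])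
  mul_zero F := toL_injective (by rw [toL_mul, toL_zero]; ext I g; simp [rmul])
  left_distrib F G H := toL_injective (by simp only [toL_mul, toL_add, rmul_add])
  right_distrib F G H := toL_injective (by simp only [toL_mul, toL_add, add_rmul])
  mul_assoc F G H := toL_injective (by simp only [toL_mul, rmul_assoc])
  one_mul F := toL_injective (by
    rw [toL_mul, toL_one, rconst_rmul _ _ _ F.toL_adm]; simp)
  mul_one F := toL_injective (by
    have h1 := rmul_comm_of_parity d 0 (rconst (1 : HahnSeries ℤ R)) F.toL (fun I hI => by
      have : I = 0 := by by_contra h; simp [rconst, h] at hI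
      simp [this])
    have h2 : rsig d 0 F.toL = F.toL := by ext I; simp [rsig]
    rw [h2] at h1
    rw [toL_mul, toL_one, ← h1, rconst_rmul _ _ _ F.toL_adm]; simp)
  neg_add_cancel := neg_add_cancel
  zsmul := fun n F => n • F
  nsmul := fun n F => n • F
  zsmul_zero' := SubNegMonoid.zsmul_zero'
  zsmul_succ' := SubNegMonoid.zsmul_succ'
  zsmul_neg' := SubNegMonoid.zsmul_neg'
  nsmul_zero := AddMonoid.nsmul_zero
  nsmul_succ := AddMonoid.nsmul_succ
  sub_eq_add_neg := sub_eq_add_neg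

end Ring

section Algebra

variable {ι : Type*} [LinearOrder ι] {d : ι → ℤ} {R : Type*} [CommRing R] {c : ℕ}

lemma sg_mul_coeff (n : ℤ) (x : HahnSeries ℤ R) (g : ℤ) :
    (sg (HahnSeries ℤ R) n * x).coeff g = sg R n * x.coeff g := by
  rcases Int.even_or_odd n with h | h
  · simp [sg_even h]
  · simp [sg_odd h]

lemma coeff_mul_finsum (x y : HahnSeries ℤ R) (g : ℤ) :
    (x * y).coeff g = ∑ᶠ h : ℤ, x.coeff h * y.coeff (g - h) := by
  rw [HahnSeries.coeff_mul]
  have hs : (Function.support fun h : ℤ => x.coeff h * y.coeff (g - h)) ⊆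
      ((Finset.antidiagonal x.isPWO_support y.isPWO_support g).image Prod.fst : Set ℤ) := by
    intro h hh
    simp only [Function.mem_support] at hh
    simp only [Finset.coe_image, Set.mem_image, Finset.mem_coe, Finset.mem_antidiagonal]
    exact ⟨(h, g - h),
      ⟨left_ne_zero_of_mul hh, right_ne_zero_of_mul hh, add_sub_cancel h g⟩, rfl⟩
  rw [finsum_eq_sum_of_support_subset _ hs, Finset.sum_image]
  · refine sum_congr rfl fun p hp => ?_
    rw [Finset.mem_antidiagonal] at hp
    rw [← hp.2.2]; simp
  · rintro ⟨a, b⟩ ha ⟨a', b'⟩ hb h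
    simp only [Finset.coe_image, Finset.mem_coe, Finset.mem_antidiagonal] at ha hb h
    ext
    · exact h
    · have := ha.2.2; have := hb.2.2; simp only at *; omega

lemma finite_mul_support (F G : SF d R c) (I J : ι →₀ ℕ) (g : ℤ) :
    (Function.support fun h : ℤ => F.coef I h * G.coef J (g - h)).Finite := by
  obtain ⟨a, ha⟩ := F.bddBelow I
  obtain ⟨b, hb⟩ := G.bddBelow J
  refine (Set.finite_Icc a (g - b)).subset fun h hh => ?_
  simp only [Function.mem_support] at hh
  have h1 := ha (show h ∈ Function.support (F.coef I) from left_ne_zero_of_mul hh)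
  have h2 := hb (show g - h ∈ Function.support (G.coef J) from right_ne_zero_of_mul hh)
  exact ⟨h1, by omega⟩

open Classical in
lemma coef_mul (F G : SF d R c) (I : ι →₀ ℕ) (g : ℤ) :
    (F * G).coef I g = if Admissible d I then
      ∑ p ∈ antidiagonal I,
        sg R (kz d p.1 p.2) * ∑ᶠ h : ℤ, F.coef p.1 h * G.coef p.2 (g - h) else 0 := by
  change (rmul d F.toL G.toL I).coeff g = _
  unfold rmul
  split_ifs with hI
  · have hs : (∑ p ∈ antidiagonal I,
        (sg (HahnSeries ℤ R) (kz d p.1 p.2) * (F.toL p.1 * G.toL p.2))).coeff g =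
        ∑ p ∈ antidiagonal I,
        (sg (HahnSeries ℤ R) (kz d p.1 p.2) * (F.toL p.1 * G.toL p.2)).coeff g :=
      map_sum (HahnSeries.coeff.addMonoidHom g) _ _
    rw [hs]
    refine sum_congr rfl fun p _ => ?_
    rw [sg_mul_coeff, coeff_mul_finsum]
    simp
  · simp

instance {K : Type*} [CommSemiring K] [Algebra K R] : Algebra K (SF d R c) :=
  Algebra.ofModule
    (fun r F G => by
      classical
      ext I g
      rw [coef_smul, coef_mul, coef_mul]
      split_ifs
      · rw [Finset.smul_sum]
        refine sum_congr rfl fun p _ => ?_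
        rw [← mul_smul_comm]
        congr 1
        refine Eq.trans ?_ ((DistribSMul.toAddMonoidHom R r).map_finsum
          (finite_mul_support F G p.1 p.2 g)).symm
        simp only [coef_smul, smul_mul_assoc, DistribSMul.toAddMonoidHom_apply]
      · simp)
    (fun r F G => by
      classical
      ext I g
      rw [coef_smul, coef_mul, coef_mul]
      split_ifs
      · rw [Finset.smul_sum]
        refine sum_congr rfl fun p _ => ?_
        rw [← mul_smul_comm]
        congr 1
        refine Eq.trans ?_ ((DistribSMul.toAddMonoidHom R r).map_finsum
          (finite_mul_support F G p.1 p.2 g)).symm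
        simp only [coef_smul, mul_smul_comm, DistribSMul.toAddMonoidHom_apply]
      · simp)

lemma mul_mem_supp {S T U : Set (Mon ι)} (h : ∀ p ∈ S, ∀ q ∈ T, p + q ∈ U) {F G : SF d R c}
    (hF : F ∈ Supp d R c S) (hG : G ∈ Supp d R c T) : F * G ∈ Supp d R c U := by
  rintro ⟨I, g⟩ hp
  obtain ⟨p, q, hpq, h1, h2⟩ := exists_of_mul_ne hp
  rw [← hpq]
  exact h p (hF p h1) q (hG q h2)

lemma mul_mem_fil {v w : ℤ} {F G : SF d R c} (hF : F ∈ Fil d R c v) (hG : G ∈ Fil d R c w) :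
    F * G ∈ Fil d R c (v + w) :=
  mul_mem_supp (fun p hp q hq => by
    simp only [mem_ofPred_eq, lv_add] at *; omega) hF hG

lemma one_mem_supp {S : Set (Mon ι)} (h : (0 : Mon ι) ∈ S) : (1 : SF d R c) ∈ Supp d R c S :=
  mono_mem h

lemma pow_mem_supp {S : Set (Mon ι)} (h0 : (0 : Mon ι) ∈ S) (h : ∀ p ∈ S, ∀ q ∈ S, p + q ∈ S)
    {F : SF d R c} (hF : F ∈ Supp d R c S) (n : ℕ) : F ^ n ∈ Supp d R c S := by
  induction n with
  | zero => rw [pow_zero]; exact one_mem_supp h0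
  | succ n ih => rw [pow_succ]; exact mul_mem_supp h ih hF

lemma pow_mem_fil {v : ℤ} {F : SF d R c} (hF : F ∈ Fil d R c v) (n : ℕ) :
    F ^ n ∈ Fil d R c (n * v) := by
  induction n with
  | zero => simp only [pow_zero]; exact one_mem_supp (by simp [lv])
  | succ n ih =>
    rw [pow_succ]
    convert mul_mem_fil ih hF using 1
    push_cast; ring

/-! ### Monomials -/

lemma mono_mul_coef (r : R) (m : ℤ) (F : SF d R c) (I : ι →₀ ℕ) (g : ℤ) :
    (mono d c r (0, m) * F).coef I g = r * F.coef I (g - m) := by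
  classical
  change (rmul d (mono d c r (0, m)).toL F.toL I).coeff g = _
  have : (mono d c r (0, m)).toL = rconst (HahnSeries.single m r) := by
    ext J h
    rw [toL_coeff, coef_mono]
    unfold rconst
    by_cases hJ : J = 0
    · subst hJ
      simp [admissible_zero, HahnSeries.coeff_single, Pi.single_apply]
    · simp [hJ]
  rw [this, rconst_rmul _ _ _ F.toL_adm]
  have e : g = (g - m) + m := by ring
  rw [e, HahnSeries.coeff_single_mul_add, toL_coeff]; simp

/-- The element `ħ^m`. -/
def hb (d : ι → ℤ) (R : Type*) [CommRing R] (c : ℕ) (m : ℤ) : SF d R c := mono d c 1 (0, m)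

@[simp] lemma coef_hb_mul (m : ℤ) (F : SF d R c) (I : ι →₀ ℕ) (g : ℤ) :
    (hb d R c m * F).coef I g = F.coef I (g - m) := by
  rw [hb, mono_mul_coef, one_mul]

lemma hb_mul_hb (m n : ℤ) : hb d R c m * hb d R c n = hb d R c (m + n) := by
  classical
  ext I g
  rw [coef_hb_mul, hb, hb, coef_mono, coef_mono]
  have : (I, g - m) = ((0, n) : Mon ι) ↔ (I, g) = (0, m + n) := by
    simp only [Prod.mk.injEq]
    constructor <;> rintro ⟨h, h'⟩ <;> exact ⟨h, by omega⟩
  simp only [this]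
  split_ifs <;> rfl

@[simp] lemma hb_zero : hb d R c 0 = 1 := rfl

lemma hb_mul_hb_neg (m : ℤ) (F : SF d R c) : hb d R c m * (hb d R c (-m) * F) = F := by
  rw [← mul_assoc, hb_mul_hb]; simp

lemma hb_neg_mul_hb (m : ℤ) (F : SF d R c) : hb d R c (-m) * (hb d R c m * F) = F := by
  rw [← mul_assoc, hb_mul_hb]; simp

/-! ### Parity -/

/-- The sign operator `F ↦ (-1)^(n |F|) F`. -/
def sig (d : ι → ℤ) (R : Type*) [CommRing R] (c : ℕ) (n : ℤ) : SF d R c →+* SF d R c where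
  toFun F :=
    { coef := fun I g => sg R (n * monDegree d I) * F.coef I g
      adm := fun I g h => F.adm I g (right_ne_zero_of_mul h)
      lf := fun v => (F.lf v).subset fun p hp => ⟨hp.1, right_ne_zero_of_mul hp.2⟩ }
  map_zero' := by ext; simp
  map_add' F G := by ext I g; simp [mul_add]
  map_one' := by
    classical
    ext I g
    simp only [one_def, coef_mono]
    split_ifs with h
    · obtain ⟨h, -⟩ := h
      simp only [Prod.mk_eq_zero] at h
      simp [h.1]
    · simp
  map_mul' F G := toL_injective (by
    have key : ∀ H : SF d R c, toL (SF.mk (fun I g => sg R (n * monDegree d I) * H.coef I g)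
        (fun I g h => H.adm I g (right_ne_zero_of_mul h))
        (fun v => (H.lf v).subset fun p hp => ⟨hp.1, right_ne_zero_of_mul hp.2⟩) : SF d R c) =
        rsig d n H.toL := by
      intro H
      ext I g
      rw [toL_coeff]
      unfold rsig
      rw [sg_mul_coeff, toL_coeff]
    rw [toL_mul, key, key, key, toL_mul, rsig_rmul])

@[simp] lemma coef_sig (n : ℤ) (F : SF d R c) (I : ι →₀ ℕ) (g : ℤ) :
    (sig d R c n F).coef I g = sg R (n * monDegree d I) * F.coef I g := rfl

lemma toL_sig (n : ℤ) (F : SF d R c) : (sig d R c n F).toL = rsig d n F.toL := by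
  ext I g
  rw [toL_coeff]
  unfold rsig
  rw [sg_mul_coeff, toL_coeff, coef_sig]

lemma sig_sig (m n : ℤ) (F : SF d R c) : sig d R c m (sig d R c n F) = sig d R c (m + n) F := by
  ext I g
  simp only [coef_sig, add_mul, sg_add]; ring

lemma sig_congr {m n : ℤ} (h : Even (m - n)) : sig d R c m = sig d R c n := by
  ext F I g
  simp only [coef_sig]
  rw [sg_congr (m := m * _) (n := n * monDegree d I)]
  rw [← sub_mul]; exact h.mul_right _

lemma sig_even {n : ℤ} (h : Even n) (F : SF d R c) : sig d R c n F = F := by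
  rw [sig_congr (n := 0) (by simpa using h)]
  ext I g; simp

/-- Series all of whose monomials have degree of the parity of `n`. -/
def Par (d : ι → ℤ) (R : Type*) [CommRing R] (c : ℕ) (n : ℤ) : AddSubgroup (SF d R c) :=
  Supp d R c {p | Even (monDegree d p.1 - n)}

lemma mul_comm_of_par {n : ℤ} {F : SF d R c} (hF : F ∈ Par d R c n) (G : SF d R c) :
    F * G = sig d R c n G * F := toL_injective (by
  rw [toL_mul, toL_mul, toL_sig, rmul_comm_of_parity d n]
  intro I hI
  by_contra h
  apply hI
  ext g
  rw [toL_coeff]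
  by_contra h'
  exact h (hF (I, g) h'))

lemma sig_of_par {n : ℤ} {F : SF d R c} (hF : F ∈ Par d R c n) (m : ℤ) :
    sig d R c m F = sg R (m * n) • F := by
  ext I g
  rw [coef_sig, coef_smul, smul_eq_mul]
  by_cases h : F.coef I g = 0
  · simp [h]
  · rw [sg_congr (m := m * monDegree d I) (n := m * n)]
    rw [← mul_sub]; exact (hF (I, g) h).mul_left _

lemma par_congr {m n : ℤ} (h : Even (m - n)) : Par d R c m = Par d R c n := by
  have : ∀ m n : ℤ, Even (m - n) → Par d R c m ≤ Par d R c n := fun m n h =>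
    supp_mono fun p hp => by
      have e : monDegree d p.1 - n = (monDegree d p.1 - m) + (m - n) := by ring
      rw [mem_ofPred_eq, e]; exact hp.add h
  exact le_antisymm (this m n h) (this n m (by rw [← neg_sub]; exact h.neg))

lemma sig_even_par {F : SF d R c} (hF : F ∈ Par d R c 0) (m : ℤ) : sig d R c m F = F := by
  rw [sig_of_par hF]; simp

lemma sig_odd_par {F : SF d R c} (hF : F ∈ Par d R c 1) : sig d R c 1 F = -F := by
  rw [sig_of_par hF]; simp

lemma mul_par {m n : ℤ} {F G : SF d R c} (hF : F ∈ Par d R c m) (hG : G ∈ Par d R c n) :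
    F * G ∈ Par d R c (m + n) :=
  mul_mem_supp (fun p hp q hq => by
    simp only [mem_ofPred_eq, Prod.fst_add, md_add] at *
    have := hp.add hq
    rwa [show monDegree d p.1 - m + (monDegree d q.1 - n) =
      monDegree d p.1 + monDegree d q.1 - (m + n) by ring] at this) hF hG

lemma central_of_even {F : SF d R c} (hF : F ∈ Par d R c 0) (G : SF d R c) : F * G = G * F := by
  rw [mul_comm_of_par hF, sig_even (by simp)]

lemma hb_par (m : ℤ) : hb d R c m ∈ Par d R c 0 := mono_mem (by simp)

lemma hb_comm (m : ℤ) (F : SF d R c) : hb d R c m * F = F * hb d R c m :=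
  central_of_even (hb_par m) F

/-! ### Derivatives -/

/-- The left partial derivative. -/
def der (d : ι → ℤ) (R : Type*) [CommRing R] (c : ℕ) (i : ι) : SF d R c →+ SF d R c where
  toFun F :=
    { coef := fun I g => ((I i : R) + 1) * sg R (kz d (single i 1) I) *
        F.coef (I + single i 1) g
      adm := fun I g h => adm_left (F.adm _ g (right_ne_zero_of_mul h))
      lf := fun v => by
        refine ((F.lf (v + (2 * c + 1))).preimage (f := fun p => p + (single i 1, 0))
          (add_left_injective _).injOn).subset fun p hp => ⟨?_, ?_⟩
        · have := hp.1
          simp only [lv, Prod.fst_add, Prod.snd_add, map_add, degree_single] at *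
          push_cast
          linarith
        · have := right_ne_zero_of_mul hp.2
          simpa using this }
  map_zero' := by ext; simp
  map_add' F G := by ext I g; simp [mul_add]

lemma coef_der (i : ι) (F : SF d R c) (I : ι →₀ ℕ) (g : ℤ) :
    (der d R c i F).coef I g = ((I i : R) + 1) * sg R (kz d (single i 1) I) *
        F.coef (I + single i 1) g := rfl

lemma toL_der (i : ι) (F : SF d R c) : (der d R c i F).toL = rder d i F.toL := by
  ext I g
  rw [toL_coeff]
  unfold rder
  have e : ((I i : HahnSeries ℤ R) + 1) * sg (HahnSeries ℤ R) (kz d (single i 1) I) =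
    sg (HahnSeries ℤ R) (kz d (single i 1) I) * ((I i : HahnSeries ℤ R) + 1) :=
      mul_comm _ _
  have e2 : ((I i : HahnSeries ℤ R) + 1) = HahnSeries.C ((I i : R) + 1) := by
    rw [map_add, map_natCast, map_one]
  rw [e, mul_assoc, sg_mul_coeff, e2, HahnSeries.C_mul_eq_smul, HahnSeries.coeff_smul, toL_coeff,
    coef_der, smul_eq_mul]
  ring

lemma der_mul (i : ι) (F G : SF d R c) :
    der d R c i (F * G) = der d R c i F * G + sig d R c (d i) F * der d R c i G :=
  toL_injective (by
    rw [toL_der, toL_mul, rder_rmul _ _ _ _ F.toL_adm G.toL_adm, toL_add, toL_mul, toL_mul,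
      toL_der, toL_der, toL_sig])

lemma der_der (i j : ι) (F : SF d R c) :
    der d R c i (der d R c j F) = sg R (d i * d j) • der d R c j (der d R c i F) :=
  toL_injective (by
    ext I g
    rw [toL_der, toL_der, rder_rder _ _ _ _ F.toL_adm]
    rw [sg_mul_coeff, ← toL_der, ← toL_der, toL_coeff, toL_coeff, coef_smul, smul_eq_mul])

lemma der_smul {K : Type*} [CommSemiring K] [Algebra K R] (i : ι) (r : K) (F : SF d R c) :
    der d R c i (r • F) = r • der d R c i F := by
  ext I g
  rw [coef_der, coef_smul, coef_smul, coef_der, mul_smul_comm]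

lemma sig_smul {K : Type*} [CommSemiring K] [Algebra K R] (n : ℤ) (r : K) (F : SF d R c) :
    sig d R c n (r • F) = r • sig d R c n F := by
  ext I g
  rw [coef_sig, coef_smul, coef_smul, coef_sig, mul_smul_comm]

lemma der_sig (i : ι) (n : ℤ) (F : SF d R c) :
    der d R c i (sig d R c n F) = sg R (n * d i) • sig d R c n (der d R c i F) := by
  ext I g
  simp only [coef_der, coef_sig, coef_smul, smul_eq_mul, md_add, md_single]
  have : sg R (n * (monDegree d I + -d i * (1 : ℕ))) = sg R (n * d i) * sg R (n * monDegree d I) := by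
    rw [← sg_add]; apply sg_congr; exact ⟨-(n * d i), by push_cast; ring⟩
  rw [this]; ring

lemma der_mem_supp {i : ι} {S T : Set (Mon ι)}
    (h : ∀ p : Mon ι, p + (single i 1, 0) ∈ S → p ∈ T) {F : SF d R c}
    (hF : F ∈ Supp d R c S) : der d R c i F ∈ Supp d R c T := fun p hp => by
  apply h
  apply hF
  rw [coef_der] at hp
  have := right_ne_zero_of_mul hp
  simpa using this

lemma der_mem_fil {i : ι} {v : ℤ} {F : SF d R c} (hF : F ∈ Fil d R c v) :
    der d R c i F ∈ Fil d R c (v - (2 * c + 1)) :=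
  der_mem_supp (fun p hp => by
    simp only [mem_ofPred_eq, lv, Prod.fst_add, Prod.snd_add, map_add,
      degree_single] at *
    push_cast at hp
    linarith) hF

lemma der_par {i : ι} {n : ℤ} {F : SF d R c} (hF : F ∈ Par d R c n) :
    der d R c i F ∈ Par d R c (n + d i) :=
  der_mem_supp (fun p hp => by
    simp only [mem_ofPred_eq, Prod.fst_add, md_add, md_single] at *
    convert hp using 1; push_cast; ring) hF

lemma sig_mem_supp {n : ℤ} {S : Set (Mon ι)} {F : SF d R c} (hF : F ∈ Supp d R c S) :
    sig d R c n F ∈ Supp d R c S := fun p hp => hF p (right_ne_zero_of_mul hp)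

/-- The coordinate function. -/
def phi (d : ι → ℤ) (R : Type*) [CommRing R] (c : ℕ) (i : ι) : SF d R c :=
  mono d c 1 (single i 1, 0)

/-- `φ^I` as a monomial. -/
lemma der_phi [DecidableEq ι] (i j : ι) : der d R c i (phi d R c j) = if i = j then 1 else 0 := by
  classical
  ext I g
  rw [coef_der, phi, coef_mono]
  split_ifs with h1 h2 h2
  · subst h2
    obtain ⟨h1, -⟩ := h1
    simp only [Prod.mk.injEq, add_eq_right] at h1
    obtain ⟨rfl, rfl⟩ := h1
    rw [one_def, coef_mono, if_pos ⟨rfl, admissible_zero _⟩]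
    simp
  · exfalso
    obtain ⟨h1, -⟩ := h1
    simp only [Prod.mk.injEq] at h1
    have := congrArg (fun f => f i) h1.1
    simp [single_apply, Ne.symm h2] at this
  · subst h2
    rw [one_def, coef_mono, if_neg]
    · simp
    · rintro ⟨h, -⟩
      simp only [Prod.mk_eq_zero] at h
      apply h1
      simp [h.1, h.2, admissible_single]
  · simp

lemma der_hb (i : ι) (m : ℤ) : der d R c i (hb d R c m) = 0 := by
  classical
  ext I g
  rw [coef_der, hb, coef_mono, if_neg]
  · simp
  · rintro ⟨h, -⟩
    simp only [Prod.mk.injEq] at h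
    have := congrArg (fun f => f i) h.1
    simp at this

lemma der_hb_mul (i : ι) (m : ℤ) (F : SF d R c) :
    der d R c i (hb d R c m * F) = hb d R c m * der d R c i F := by
  rw [der_mul, der_hb, sig_even_par (hb_par m)]; simp

lemma der_one (i : ι) : der d R c i 1 = 0 := by rw [← hb_zero, der_hb]

end Algebra

section Sums

variable {ι : Type*} {d : ι → ℤ} {R : Type*} [CommRing R] {c : ℕ} {κ κ' : Type*}
variable {ι' : Type*} {d' : ι' → ℤ} {R' : Type*} [CommRing R'] {c' : ℕ}

/-- `z` is the sum of the family `y` in the topology of the level filtration. -/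
def IsSum (y : κ → SF d R c) (z : SF d R c) : Prop :=
  ∀ v, ∃ s₀ : Finset κ, ∀ s, s₀ ⊆ s → z - ∑ i ∈ s, y i ∈ Fil d R c v

/-- All but finitely many members of the family have large level. -/
def Summ (y : κ → SF d R c) : Prop := ∀ v, {i | y i ∉ Fil d R c v}.Finite

/-- Continuity with respect to the level filtrations. -/
def Cont (L : SF d R c →+ SF d' R' c') : Prop :=
  ∀ v, ∃ w, ∀ F ∈ Fil d R c w, L F ∈ Fil d' R' c' v

lemma IsSum.unique {y : κ → SF d R c} {z z' : SF d R c} (h : IsSum y z) (h' : IsSum y z') :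
    z = z' := by
  classical
  rw [← sub_eq_zero]
  refine eq_zero_of_forall_fil fun v => ?_
  obtain ⟨s, hs⟩ := h v
  obtain ⟨s', hs'⟩ := h' v
  have := sub_mem (hs (s ∪ s') Finset.subset_union_left) (hs' (s ∪ s') Finset.subset_union_right)
  simpa using this

lemma IsSum.add {y y' : κ → SF d R c} {z z' : SF d R c} (h : IsSum y z) (h' : IsSum y' z') :
    IsSum (fun i => y i + y' i) (z + z') := by
  classical
  intro v
  obtain ⟨s, hs⟩ := h v
  obtain ⟨s', hs'⟩ := h' v
  refine ⟨s ∪ s', fun t ht => ?_⟩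
  have := add_mem (hs t (Finset.subset_union_left.trans ht))
    (hs' t (Finset.subset_union_right.trans ht))
  rw [sum_add_distrib, add_sub_add_comm]
  exact this

lemma IsSum.map {y : κ → SF d R c} {z : SF d R c} (h : IsSum y z) {L : SF d R c →+ SF d' R' c'}
    (hL : Cont L) : IsSum (fun i => L (y i)) (L z) := by
  intro v
  obtain ⟨w, hw⟩ := hL v
  obtain ⟨s, hs⟩ := h w
  refine ⟨s, fun t ht => ?_⟩
  rw [← map_sum, ← map_sub]
  exact hw _ (hs t ht)

lemma cont_neg : Cont (-AddMonoidHom.id (SF d R c)) := fun v => ⟨v, fun _ hF => neg_mem hF⟩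

lemma IsSum.neg {y : κ → SF d R c} {z : SF d R c} (h : IsSum y z) :
    IsSum (fun i => - y i) (-z) := h.map (L := -AddMonoidHom.id _) cont_neg

lemma IsSum.sub {y y' : κ → SF d R c} {z z' : SF d R c} (h : IsSum y z) (h' : IsSum y' z') :
    IsSum (fun i => y i - y' i) (z - z') := by
  simpa [sub_eq_add_neg] using h.add h'.neg

lemma IsSum.congr {y y' : κ → SF d R c} {z : SF d R c} (h : IsSum y z) (h' : ∀ i, y' i = y i) :
    IsSum y' z := by
  rwa [show y' = y from funext h']

lemma coef_eq_of_sub_mem {F G : SF d R c} {I : ι →₀ ℕ} {g : ℤ}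
    (h : F - G ∈ Fil d R c (lv c (I, g) + 1)) : F.coef I g = G.coef I g := by
  have := mem_fil'.mp h (I, g) (by simp)
  simpa [sub_eq_zero] using this

lemma IsSum.mem_supp {y : κ → SF d R c} {z : SF d R c} (h : IsSum y z) {S : Set (Mon ι)}
    (hy : ∀ i, y i ∈ Supp d R c S) : z ∈ Supp d R c S := by
  rintro ⟨I, g⟩ hp
  obtain ⟨s, hs⟩ := h (lv c (I, g) + 1)
  have e := coef_eq_of_sub_mem (hs s le_rfl)
  simp only at hp
  rw [e] at hp
  exact sum_mem (fun i _ => hy i) (I, g) hp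

lemma IsSum.summ {y : κ → SF d R c} {z : SF d R c} (h : IsSum y z) : Summ y := by
  classical
  intro v
  obtain ⟨s, hs⟩ := h v
  refine s.finite_toSet.subset fun i hi => ?_
  by_contra his
  apply hi
  have := sub_mem (hs s le_rfl) (hs (insert i s) (Finset.subset_insert i s))
  rw [Finset.sum_insert (by simpa using his)] at this
  simpa using this

lemma exists_of_finsum_ne {M : Type*} [AddCommMonoid M] {f : κ → M} (h : ∑ᶠ i, f i ≠ 0) :
    ∃ i, f i ≠ 0 := by
  by_contra h'
  push Not at h'
  exact h (by simp [h'])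

open Classical in
/-- The sum of a family (zero if it does not converge). -/
def fsum (y : κ → SF d R c) : SF d R c :=
  if h : Summ y then
    { coef := fun I g => ∑ᶠ i, (y i).coef I g
      adm := fun I g hp => by
        obtain ⟨i, hi⟩ := exists_of_finsum_ne hp
        exact (y i).adm I g hi
      lf := fun v => by
        refine ((h (v + 1)).biUnion fun i _ => (y i).lf v).subset ?_
        rintro ⟨I, g⟩ ⟨h1, h2⟩
        obtain ⟨i, hi⟩ := exists_of_finsum_ne h2
        refine Set.mem_biUnion (x := i) ?_ ⟨h1, hi⟩
        intro h'
        have := h' (I, g) hi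
        simp only [mem_ofPred_eq] at this h1
        omega }
  else 0

lemma Summ.coef_fsum {y : κ → SF d R c} (h : Summ y) (I : ι →₀ ℕ) (g : ℤ) :
    (fsum y).coef I g = ∑ᶠ i, (y i).coef I g := by
  rw [fsum, dif_pos h]

lemma Summ.isSum {y : κ → SF d R c} (h : Summ y) : IsSum y (fsum y) := by
  classical
  intro v
  refine ⟨(h v).toFinset, fun s hs => ?_⟩
  rw [mem_fil']
  rintro ⟨I, g⟩ hp
  rw [coef_sub, coef_sum, h.coef_fsum, finsum_eq_sum_of_support_subset, sub_self]
  intro i hi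
  apply hs
  rw [Set.Finite.mem_toFinset]
  intro h'
  exact hi (mem_fil'.mp h' (I, g) hp)

lemma IsSum.eq_fsum {y : κ → SF d R c} {z : SF d R c} (h : IsSum y z) : z = fsum y :=
  h.unique h.summ.isSum

lemma IsSum.coef {y : κ → SF d R c} {z : SF d R c} (h : IsSum y z) (I : ι →₀ ℕ) (g : ℤ) :
    z.coef I g = ∑ᶠ i, (y i).coef I g := by
  rw [h.eq_fsum, h.summ.coef_fsum]

lemma isSum_zero : IsSum (fun _ : κ => (0 : SF d R c)) 0 := fun v => ⟨∅, fun s _ => by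
  simp [zero_mem]⟩

lemma IsSum.of_injective {y : κ → SF d R c} {z : SF d R c} {e : κ' → κ} (he : Function.Injective e)
    (h0 : ∀ i, i ∉ Set.range e → y i = 0) (h : IsSum (fun j => y (e j)) z) : IsSum y z := by
  classical
  intro v
  obtain ⟨s, hs⟩ := h v
  refine ⟨s.map ⟨e, he⟩, fun t ht => ?_⟩
  have h1 := hs (t.preimage e he.injOn) (fun j hj => by
    rw [Finset.mem_preimage]; exact ht (Finset.mem_map_of_mem _ hj))
  have h2 : ∑ j ∈ t.preimage e he.injOn, y (e j) = ∑ i ∈ t, y i :=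
    Finset.sum_preimage e t he.injOn y fun i _ hi => h0 i hi
  rwa [h2] at h1

lemma IsSum.equiv {y : κ → SF d R c} {z : SF d R c} (e : κ' ≃ κ) (h : IsSum y z) :
    IsSum (fun j => y (e j)) z :=
  IsSum.of_injective (y := fun j => y (e j)) (e := e.symm) e.symm.injective
    (fun i hi => absurd (e.symm.surjective i) hi) (by simpa using h)

lemma isSum_finset (s : Finset κ) (y : κ → SF d R c) (h : ∀ i ∉ s, y i = 0) :
    IsSum y (∑ i ∈ s, y i) := fun v => ⟨s, fun t ht => by
  rw [Finset.sum_subset ht (fun i _ hi => h i hi), sub_self]; exact zero_mem _⟩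

lemma IsSum.succ {y : ℕ → SF d R c} {z : SF d R c} (h : IsSum y z) :
    IsSum (fun n => y (n + 1)) (z - y 0) := by
  classical
  intro v
  obtain ⟨s, hs⟩ := h v
  refine ⟨s.preimage Nat.succ Nat.succ_injective.injOn, fun t ht => ?_⟩
  have h1 := hs (insert 0 (t.map ⟨Nat.succ, Nat.succ_injective⟩)) (fun n hn => by
    rcases n with _ | n
    · simp
    · refine Finset.mem_insert_of_mem (Finset.mem_map_of_mem _ (ht ?_))
      rw [Finset.mem_preimage]; exact hn)
  rw [Finset.sum_insert (by simp), Finset.sum_map] at h1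
  rw [sub_sub]; exact h1

lemma IsSum.of_succ {y : ℕ → SF d R c} {z : SF d R c} (h : IsSum (fun n => y (n + 1)) z) :
    IsSum y (y 0 + z) := by
  have h1 : IsSum (fun n => if n = 0 then 0 else y n) z :=
    IsSum.of_injective (e := Nat.succ) Nat.succ_injective (fun i hi => by
      rcases i with _ | i
      · simp
      · exact absurd ⟨i, rfl⟩ hi) (by simpa using h)
  have h2 : IsSum (fun n => if n = 0 then y 0 else 0) (y 0) := by
    have := isSum_finset {0} (fun n => if n = 0 then y 0 else 0) (fun i hi => by
      simp at hi; simp [hi])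
    simpa using this
  refine (h2.add h1).congr fun n => ?_
  rcases n with _ | n <;> simp

/-- Two continuous maps which agree on monomials agree. -/
lemma isSum_monomials (F : SF d R c) :
    IsSum (fun p : Mon ι => mono d c (F.coef p.1 p.2) p) F := by
  classical
  have hs : Summ (fun p : Mon ι => mono d c (F.coef p.1 p.2) p) := fun v =>
    (F.lf v).subset fun p hp => by
      by_contra h'
      apply hp
      by_cases h0 : F.coef p.1 p.2 = 0
      · change mono d c (F.coef p.1 p.2) p ∈ _
        rw [h0]
        have : mono d c (0 : R) p = 0 := by ext; simp [coef_mono]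
        rw [this]; exact zero_mem _
      · have : ¬ lv c p ≤ v := fun h'' => h' ⟨h'', h0⟩
        exact mono_mem (le_of_lt (not_le.mp this))
  have e : F = fsum (fun p : Mon ι => mono d c (F.coef p.1 p.2) p) := by
    ext I g
    rw [hs.coef_fsum, finsum_eq_single _ (I, g)]
    · rw [coef_mono]
      by_cases h0 : F.coef I g = 0
      · simp [h0]
      · rw [if_pos ⟨rfl, F.adm I g h0⟩]
    · intro p hp
      rw [coef_mono, if_neg]
      rintro ⟨h, -⟩; exact hp h.symm
  nth_rewrite 2 [e]
  exact hs.isSum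

lemma ext_of_mono {L M : SF d R c →+ SF d' R' c'} (hL : Cont L) (hM : Cont M)
    (h : ∀ r p, L (mono d c r p) = M (mono d c r p)) : L = M := by
  ext1 F
  have h1 := (isSum_monomials F).map hL
  have h2 := (isSum_monomials F).map hM
  exact h1.unique (h2.congr fun p => h _ _)

lemma Cont.comp {ι'' : Type*} {d'' : ι'' → ℤ} {R'' : Type*} [CommRing R''] {c'' : ℕ}
    {M : SF d' R' c' →+ SF d'' R'' c''} {L : SF d R c →+ SF d' R' c'} (hM : Cont M) (hL : Cont L) :
    Cont (M.comp L) := fun v => by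
  obtain ⟨w, hw⟩ := hM v
  obtain ⟨u, hu⟩ := hL w
  exact ⟨u, fun F hF => hw _ (hu F hF)⟩

lemma Cont.add {L M : SF d R c →+ SF d' R' c'} (hL : Cont L) (hM : Cont M) : Cont (L + M) :=
  fun v => by
    obtain ⟨w, hw⟩ := hL v
    obtain ⟨u, hu⟩ := hM v
    exact ⟨max w u, fun F hF => add_mem (hw _ (fil_anti (le_max_left _ _) hF))
      (hu _ (fil_anti (le_max_right _ _) hF))⟩

lemma Cont.neg {L : SF d R c →+ SF d' R' c'} (hL : Cont L) : Cont (-L) :=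
  fun v => by
    obtain ⟨w, hw⟩ := hL v
    exact ⟨w, fun F hF => neg_mem (hw _ hF)⟩

lemma cont_of_shift {L : SF d R c →+ SF d' R' c'} (s : ℤ)
    (h : ∀ v, ∀ F ∈ Fil d R c v, L F ∈ Fil d' R' c' (v + s)) : Cont L :=
  fun v => ⟨v - s, fun F hF => by simpa using h _ F hF⟩

lemma summ_nat {y : ℕ → SF d R c} (h : ∀ v, ∃ N, ∀ n ≥ N, y n ∈ Fil d R c v) : Summ y := fun v => by
  obtain ⟨N, hN⟩ := h v
  exact (Set.finite_lt_nat N).subset fun n hn => by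
    by_contra h'
    exact hn (hN n (not_lt.mp h'))

end Sums

section Maps

variable {ι : Type*} {d : ι → ℤ} {R : Type*} [CommRing R] {c : ℕ}
variable {R' : Type*} [CommRing R']

/-- The action of an additive map on coefficients. -/
def mapC (f : R →+ R') : SF d R c →+ SF d R' c where
  toFun F :=
    { coef := fun I g => f (F.coef I g)
      adm := fun I g h => F.adm I g (by rintro h'; simp [h'] at h)
      lf := fun v => (F.lf v).subset fun p hp => ⟨hp.1, by
        have := hp.2; rintro h'; simp [h'] at this⟩ }
  map_zero' := by ext; simp
  map_add' F G := by ext; simp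

@[simp] lemma coef_mapC (f : R →+ R') (F : SF d R c) (I : ι →₀ ℕ) (g : ℤ) :
    (mapC f F).coef I g = f (F.coef I g) := rfl

lemma mapC_mem_supp (f : R →+ R') {S : Set (Mon ι)} {F : SF d R c} (h : F ∈ Supp d R c S) :
    mapC f F ∈ Supp d R' c S := fun p hp => h p (by
      rintro h'; simp [h'] at hp)

lemma cont_mapC (f : R →+ R') : Cont (mapC f : SF d R c →+ SF d R' c) :=
  fun v => ⟨v, fun _ hF => mapC_mem_supp f hF⟩

end Maps

section Maps2

variable {ι : Type*} [LinearOrder ι] {d : ι → ℤ} {R : Type*} [CommRing R] {c : ℕ}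
variable {R' : Type*} [CommRing R']

lemma map_sg_mul (f : R →+ R') (n : ℤ) (x : R) : f (sg R n * x) = sg R' n * f x := by
  rcases Int.even_or_odd n with h | h
  · simp [sg_even h]
  · simp [sg_odd h]

lemma mapC_coef_mul (f : R →+ R') (F G : SF d R c) (I : ι →₀ ℕ) (g : ℤ) [Decidable (Admissible d I)] :
    (mapC f (F * G)).coef I g = if Admissible d I then
      ∑ p ∈ antidiagonal I,
        sg R' (kz d p.1 p.2) * ∑ᶠ h : ℤ, f (F.coef p.1 h * G.coef p.2 (g - h)) else 0 := by
  rw [coef_mapC, coef_mul]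
  split_ifs
  · rw [map_sum]
    refine sum_congr rfl fun p _ => ?_
    rw [map_sg_mul, f.map_finsum (finite_mul_support F G p.1 p.2 g)]
  · simp

/-- The action of a ring homomorphism on coefficients. -/
def mapR (f : R →+* R') : SF d R c →+* SF d R' c :=
  { mapC f.toAddMonoidHom with
    map_one' := by
      classical
      ext I g
      change f (coef 1 I g) = _
      rw [one_def, one_def, coef_mono, coef_mono]
      split_ifs <;> simp
    map_mul' := fun F G => by
      classical
      ext I g
      change (mapC f.toAddMonoidHom (F * G)).coef I g = _
      rw [mapC_coef_mul, coef_mul]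
      split_ifs
      · refine sum_congr rfl fun p _ => ?_
        congr 1
        exact finsum_congr fun h => map_mul f _ _
      · rfl }

@[simp] lemma coef_mapR (f : R →+* R') (F : SF d R c) (I : ι →₀ ℕ) (g : ℤ) :
    (mapR f F).coef I g = f (F.coef I g) := rfl

lemma mapR_mem_supp (f : R →+* R') {S : Set (Mon ι)} {F : SF d R c} (h : F ∈ Supp d R c S) :
    mapR f F ∈ Supp d R' c S := mapC_mem_supp f.toAddMonoidHom h

lemma cont_mapR (f : R →+* R') : Cont (mapR f : SF d R c →+* SF d R' c).toAddMonoidHom :=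
  cont_mapC f.toAddMonoidHom

lemma mapC_leibniz (f : R →+ R) (hf : ∀ x y, f (x * y) = f x * y + x * f y) (F G : SF d R c) :
    mapC f (F * G) = mapC f F * G + F * mapC f G := by
  classical
  ext I g
  rw [mapC_coef_mul, coef_add, coef_mul, coef_mul]
  split_ifs
  · rw [← sum_add_distrib]
    refine sum_congr rfl fun p _ => ?_
    rw [← mul_add, ← finsum_add_distrib]
    · congr 1
      exact finsum_congr fun h => hf _ _
    · exact finite_mul_support (mapC f F) G p.1 p.2 g
    · exact finite_mul_support F (mapC f G) p.1 p.2 g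
  · simp

lemma mapC_der (f : R →+ R') (i : ι) (F : SF d R c) :
    mapC f (der d R c i F) = der d R' c i (mapC f F) := by
  ext I g
  rw [coef_mapC, coef_der, coef_der, coef_mapC]
  have : ((I i : R) + 1) * sg R (kz d (single i 1) I) * F.coef (I + single i 1) g =
      sg R (kz d (single i 1) I) * ((I i + 1) • F.coef (I + single i 1) g) := by
    rw [nsmul_eq_mul]; push_cast; ring
  rw [this, map_sg_mul, map_nsmul, nsmul_eq_mul]; push_cast; ring

lemma mapC_sig (f : R →+ R') (n : ℤ) (F : SF d R c) :
    mapC f (sig d R c n F) = sig d R' c n (mapC f F) := by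
  ext I g
  simp [map_sg_mul]

lemma cont_mul_left (G : SF d R c) : Cont (AddMonoidHom.mulLeft G) := by
  obtain ⟨m, hm⟩ := G.exists_mem_fil
  exact cont_of_shift m fun v F hF => by rw [add_comm]; exact mul_mem_fil hm hF

lemma cont_mul_right (G : SF d R c) : Cont (AddMonoidHom.mulRight G) := by
  obtain ⟨m, hm⟩ := G.exists_mem_fil
  exact cont_of_shift m fun v F hF => mul_mem_fil hF hm

lemma IsSum.mul_left {κ : Type*} {y : κ → SF d R c} {z : SF d R c} (h : IsSum y z) (G : SF d R c) :
    IsSum (fun i => G * y i) (G * z) := h.map (cont_mul_left G)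

lemma IsSum.mul_right {κ : Type*} {y : κ → SF d R c} {z : SF d R c} (h : IsSum y z)
    (G : SF d R c) : IsSum (fun i => y i * G) (z * G) := h.map (cont_mul_right G)

lemma cont_der (i : ι) : Cont (der d R c i) :=
  cont_of_shift (-(2 * c + 1)) fun v F hF => by
    rw [← sub_eq_add_neg]; exact der_mem_fil hF

lemma cont_sig (n : ℤ) : Cont (sig d R c n).toAddMonoidHom :=
  cont_of_shift 0 fun v F hF => by rw [add_zero]; exact sig_mem_supp hF

lemma IsSum.smul {K κ : Type*} [Semiring K] [Module K R] {y : κ → SF d R c}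
    {z : SF d R c} (h : IsSum y z) (r : K) : IsSum (fun i => r • y i) (r • z) := by
  intro v
  obtain ⟨s, hs⟩ := h v
  refine ⟨s, fun t ht => ?_⟩
  rw [← Finset.smul_sum, ← smul_sub]
  exact supp_smul r (hs t ht)

end Maps2

/-! ### Exponential and logarithm -/

section Exp

variable {ι : Type*} [LinearOrder ι] {d : ι → ℤ} {R : Type*} [CommRing R] [Algebra ℚ R] {c : ℕ}

/-- The exponential series. -/
def ex (F : SF d R c) : SF d R c := fsum fun n : ℕ => ((n.factorial : ℕ) : ℚ)⁻¹ • F ^ n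

/-- The logarithm series. -/
def lg (F : SF d R c) : SF d R c :=
  fsum fun n : ℕ => ((-1) ^ n * ((n : ℚ) + 1)⁻¹) • (F - 1) ^ (n + 1)

lemma isSum_ex {F : SF d R c} (hF : F ∈ Fil d R c 1) :
    IsSum (fun n : ℕ => ((n.factorial : ℕ) : ℚ)⁻¹ • F ^ n) (ex F) :=
  (summ_nat fun v => ⟨v.toNat, fun n hn => supp_smul _
    (fil_anti (by omega) (pow_mem_fil hF n))⟩).isSum

lemma isSum_lg {F : SF d R c} (hF : F - 1 ∈ Fil d R c 1) :
    IsSum (fun n : ℕ => ((-1) ^ n * ((n : ℚ) + 1)⁻¹) • (F - 1) ^ (n + 1)) (lg F) :=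
  (summ_nat fun v => ⟨v.toNat, fun n hn => supp_smul _
    (fil_anti (by push_cast; omega) (pow_mem_fil hF (n + 1)))⟩).isSum

lemma ex_mem_supp {F : SF d R c} (hF : F ∈ Fil d R c 1) {S : Set (Mon ι)} (h0 : (0 : Mon ι) ∈ S)
    (h : ∀ p ∈ S, ∀ q ∈ S, p + q ∈ S) (hS : F ∈ Supp d R c S) : ex F ∈ Supp d R c S :=
  (isSum_ex hF).mem_supp fun n => supp_smul _ (pow_mem_supp h0 h hS n)

lemma lg_mem_supp {F : SF d R c} (hF : F - 1 ∈ Fil d R c 1) {S : Set (Mon ι)}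
    (h : ∀ p ∈ S, ∀ q ∈ S, p + q ∈ S) (hS : F - 1 ∈ Supp d R c S) : lg F ∈ Supp d R c S :=
  (isSum_lg hF).mem_supp fun n => supp_smul _ (by
    induction n with
    | zero => simpa using hS
    | succ n ih => rw [pow_succ]; exact mul_mem_supp h ih hS)

lemma lg_mem_fil {F : SF d R c} (hF : F - 1 ∈ Fil d R c 1) : lg F ∈ Fil d R c 1 :=
  lg_mem_supp hF (fun p hp q hq => by
    simp only [mem_ofPred_eq, lv_add] at *; omega) hF

lemma ex_sub_one_mem {F : SF d R c} {v : ℤ} (hv : 1 ≤ v) (hF : F ∈ Fil d R c v) :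
    ex F - 1 ∈ Fil d R c v := by
  have h := (isSum_ex (fil_anti hv hF)).succ
  simp only [Nat.factorial_zero, Nat.cast_one, inv_one, pow_zero, one_smul] at h
  refine h.mem_supp fun n => supp_smul _ (fil_anti ?_ (pow_mem_fil hF (n + 1)))
  push_cast
  nlinarith [Int.natCast_nonneg n]

lemma ex_even {F : SF d R c} (hF : F ∈ Fil d R c 1) (h : F ∈ Par d R c 0) : ex F ∈ Par d R c 0 :=
  ex_mem_supp hF (by simp) (fun p hp q hq => by
    simp only [mem_ofPred_eq, Prod.fst_add, md_add, sub_zero] at *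
    exact hp.add hq) h

lemma one_par : (1 : SF d R c) ∈ Par d R c 0 := one_mem_supp (by simp)

lemma lg_even {F : SF d R c} (hF : F - 1 ∈ Fil d R c 1) (h : F ∈ Par d R c 0) :
    lg F ∈ Par d R c 0 :=
  lg_mem_supp hF (fun p hp q hq => by
    simp only [mem_ofPred_eq, Prod.fst_add, md_add, sub_zero] at *
    exact hp.add hq) (sub_mem h one_par)

@[simp] lemma ex_zero : ex (0 : SF d R c) = 1 := by
  refine (isSum_ex (zero_mem _)).unique ?_
  have := isSum_finset {0} (fun n : ℕ => ((n.factorial : ℕ) : ℚ)⁻¹ • (0 : SF d R c) ^ n)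
    (fun n hn => by simp at hn; simp [hn])
  simpa using this

@[simp] lemma lg_one : lg (1 : SF d R c) = 0 := by
  refine (isSum_lg (by simp [zero_mem])).unique ?_
  refine isSum_zero.congr fun n => by simp

lemma ex_map {ι' : Type*} [LinearOrder ι'] {d' : ι' → ℤ} {R' : Type*} [CommRing R'] [Algebra ℚ R']
    {c' : ℕ} (f : SF d R c →+* SF d' R' c') (hf : Cont f.toAddMonoidHom) {F : SF d R c}
    (hF : F ∈ Fil d R c 1) (hF' : f F ∈ Fil d' R' c' 1) : f (ex F) = ex (f F) :=
  ((isSum_ex hF).map hf).unique ((isSum_ex hF').congr fun n => by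
    change f _ = _
    rw [map_rat_smul, map_pow])

lemma lg_map {ι' : Type*} [LinearOrder ι'] {d' : ι' → ℤ} {R' : Type*} [CommRing R'] [Algebra ℚ R']
    {c' : ℕ} (f : SF d R c →+* SF d' R' c') (hf : Cont f.toAddMonoidHom) {F : SF d R c}
    (hF : F - 1 ∈ Fil d R c 1) (hF' : f F - 1 ∈ Fil d' R' c' 1) : f (lg F) = lg (f F) :=
  ((isSum_lg hF).map hf).unique ((isSum_lg hF').congr fun n => by
    change f _ = _
    rw [map_rat_smul, map_pow, map_sub, map_one])

/-- The derivative of a power of a central element. -/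
lemma deriv_pow_central {δ : SF d R c →+ SF d R c} {a : SF d R c}
    (h : ∀ G, δ (a * G) = δ a * G + a * δ G) (ha : ∀ G, a * G = G * a) (h1 : δ 1 = 0) (n : ℕ) :
    δ (a ^ (n + 1)) = ((n : ℚ) + 1) • (a ^ n * δ a) := by
  induction n with
  | zero => simp
  | succ n ih =>
    rw [pow_succ', h, ih, mul_smul_comm, ← mul_assoc, ← pow_succ']
    have : δ a * a ^ (n + 1) = a ^ (n + 1) * δ a :=
      (Commute.pow_right (show Commute (δ a) a from (ha _).symm) _).eq
    rw [this]; push_cast; module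

lemma deriv_ex {δ : SF d R c →+ SF d R c} (hδ : Cont δ) {a : SF d R c}
    (h : ∀ G, δ (a * G) = δ a * G + a * δ G) (ha : ∀ G, a * G = G * a) (h1 : δ 1 = 0)
    (ha1 : a ∈ Fil d R c 1) : δ (ex a) = ex a * δ a := by
  have hs := (isSum_ex ha1).map hδ
  have hs' := hs.succ
  simp only [pow_zero, map_rat_smul, h1, smul_zero, sub_zero] at hs'
  refine hs'.unique (((isSum_ex ha1).mul_right (δ a)).congr fun n => ?_)
  rw [deriv_pow_central h ha h1, smul_smul, smul_mul_assoc]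
  congr 1
  have : ((n : ℚ) + 1) ≠ 0 := by positivity
  rw [Nat.factorial_succ]; push_cast; field_simp

lemma deriv_lg {δ : SF d R c →+ SF d R c} (hδ : Cont δ) {F : SF d R c}
    (h : ∀ G, δ (F * G) = δ F * G + F * δ G) (ha : ∀ G, F * G = G * F) (h1 : δ 1 = 0)
    (hF1 : F - 1 ∈ Fil d R c 1) : F * δ (lg F) = δ F := by
  have hx : ∀ G, δ ((F - 1) * G) = δ (F - 1) * G + (F - 1) * δ G := fun G => by
    rw [sub_mul, map_sub, h, map_sub, h1]; noncomm_ring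
  have hxc : ∀ G, (F - 1) * G = G * (F - 1) := fun G => by rw [sub_mul, mul_sub, ha]; simp
  have hδF : δ (F - 1) = δ F := by rw [map_sub, h1, sub_zero]
  have hs := (isSum_lg hF1).map hδ
  have hs : IsSum (fun n : ℕ => ((-1 : ℚ) ^ n) • ((F - 1) ^ n * δ F)) (δ (lg F)) :=
    hs.congr fun n => by
      rw [map_rat_smul, deriv_pow_central hx hxc h1, smul_smul, hδF]
      congr 1
      have : ((n : ℚ) + 1) ≠ 0 := by positivity
      field_simp
  have h2 := hs.mul_left (F - 1)
  have h3 := hs.succ.neg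
  have h4 := h2.unique (h3.congr fun n => by
    rw [mul_smul_comm, ← mul_assoc, ← pow_succ', pow_succ (-1 : ℚ)]; module)
  simp only [pow_zero, one_smul, one_mul] at h4
  rw [sub_mul, one_mul] at h4
  have : F * δ (lg F) = (F * δ (lg F) - δ (lg F)) + δ (lg F) := by abel
  rw [this, h4]; abel

end Exp

/-! ### Polynomial dependence on a parameter -/

section Time

open Polynomial

variable {ι : Type*} [LinearOrder ι] {d : ι → ℤ} {A : Type*} [CommRing A] {c : ℕ}

/-- The derivative with respect to the parameter. -/
def dt : SF d A[X] c →+ SF d A[X] c := mapC (Polynomial.derivative (R := A)).toAddMonoidHom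

/-- Evaluation of the parameter. -/
def ev (x : A) : SF d A[X] c →+* SF d A c := mapR (Polynomial.evalRingHom x)

/-- Constant families. -/
def cst : SF d A c →+* SF d A[X] c := mapR Polynomial.C

lemma coef_dt (F : SF d A[X] c) (I : ι →₀ ℕ) (g : ℤ) :
    (dt F).coef I g = derivative (F.coef I g) := rfl

lemma coef_ev (x : A) (F : SF d A[X] c) (I : ι →₀ ℕ) (g : ℤ) :
    (ev x F).coef I g = (F.coef I g).eval x := rfl

lemma coef_cst (F : SF d A c) (I : ι →₀ ℕ) (g : ℤ) : (cst F).coef I g = C (F.coef I g) := rfl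

lemma dt_mul (F G : SF d A[X] c) : dt (F * G) = dt F * G + F * dt G :=
  mapC_leibniz _ (fun x y => Polynomial.derivative_mul) F G

@[simp] lemma dt_cst (F : SF d A c) : dt (cst F) = 0 := by
  ext I g; simp [coef_dt, coef_cst]

@[simp] lemma dt_one : dt (1 : SF d A[X] c) = 0 := by rw [← map_one cst, dt_cst]

@[simp] lemma ev_cst (x : A) (F : SF d A c) : ev x (cst F) = F := by
  ext I g; simp [coef_ev, coef_cst]

lemma dt_X_smul (F : SF d A[X] c) : dt ((X : A[X]) • F) = F + (X : A[X]) • dt F := by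
  ext I g; simp [coef_dt]

lemma ev_X_smul (x : A) (F : SF d A[X] c) : ev x ((X : A[X]) • F) = x • ev x F := by
  ext I g; simp [coef_ev]

lemma cont_dt : Cont (dt : SF d A[X] c →+ SF d A[X] c) := cont_mapC _

lemma cont_ev (x : A) : Cont (ev x : SF d A[X] c →+* SF d A c).toAddMonoidHom := cont_mapR _

lemma dt_mem_supp {S : Set (Mon ι)} {F : SF d A[X] c} (h : F ∈ Supp d A[X] c S) :
    dt F ∈ Supp d A[X] c S := mapC_mem_supp _ h

lemma ev_mem_supp (x : A) {S : Set (Mon ι)} {F : SF d A[X] c} (h : F ∈ Supp d A[X] c S) :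
    ev x F ∈ Supp d A c S := mapR_mem_supp _ h

lemma cst_mem_supp {S : Set (Mon ι)} {F : SF d A c} (h : F ∈ Supp d A c S) :
    cst F ∈ Supp d A[X] c S := mapR_mem_supp _ h

variable [Algebra ℚ A]

lemma nat_mul_eq_zero {n : ℕ} (hn : n ≠ 0) {a : A} (h : a * (n : A) = 0) : a = 0 := by
  have h1 : (n : ℚ) • a = 0 := by rw [Algebra.smul_def]; simpa [mul_comm] using h
  have h2 : (n : ℚ) ≠ 0 := by exact_mod_cast hn
  rw [← inv_smul_smul₀ h2 a, h1, smul_zero]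

lemma eq_zero_of_dt_iterate {F : SF d A[X] c} (h : ∀ k, ev 0 (dt^[k] F) = 0) : F = 0 := by
  ext I g m
  have h1 : ∀ k, (dt^[k] F).coef I g = derivative^[k] (F.coef I g) := by
    intro k
    induction k with
    | zero => rfl
    | succ k ih => rw [iterate_succ_apply', iterate_succ_apply', coef_dt, ih]
  have h2 := congrArg (fun G => G.coef I g) (h m)
  simp only [coef_ev, h1, coef_zero, ← Polynomial.coeff_zero_eq_eval_zero,
    Polynomial.coeff_iterate_derivative, zero_add, Nat.descFactorial_self, nsmul_eq_mul] at h2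
  rw [mul_comm] at h2
  rw [nat_mul_eq_zero (Nat.factorial_ne_zero m) h2]; simp

lemma eq_of_dt {F G : SF d A[X] c} (h : dt F = dt G) (h0 : ev 0 F = ev 0 G) : F = G := by
  rw [← sub_eq_zero]
  refine eq_zero_of_dt_iterate fun k => ?_
  rcases k with _ | k
  · simp [h0]
  · rw [Function.iterate_succ_apply, map_sub, h, sub_self]
    have : dt^[k] (0 : SF d A[X] c) = 0 := by
      induction k with
      | zero => rfl
      | succ k ih => rw [iterate_succ_apply', ih, map_zero]
    rw [this, map_zero]

lemma ev_ex (x : A) {F : SF d A[X] c} (h : F ∈ Fil d A[X] c 1) : ev x (ex F) = ex (ev x F) :=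
  ex_map _ (cont_ev x) h (ev_mem_supp x h)

lemma ev_lg (x : A) {F : SF d A[X] c} (h : F - 1 ∈ Fil d A[X] c 1) : ev x (lg F) = lg (ev x F) :=
  lg_map _ (cont_ev x) h (by rw [← map_one (ev x), ← map_sub]; exact ev_mem_supp x h)

lemma dt_ex {a : SF d A[X] c} (h : a ∈ Fil d A[X] c 1) (he : a ∈ Par d A[X] c 0) :
    dt (ex a) = ex a * dt a :=
  deriv_ex cont_dt (fun G => dt_mul a G) (central_of_even he) dt_one h

lemma dt_lg {F : SF d A[X] c} (h : F - 1 ∈ Fil d A[X] c 1) (he : F ∈ Par d A[X] c 0) :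
    F * dt (lg F) = dt F :=
  deriv_lg cont_dt (fun G => dt_mul F G) (central_of_even he) dt_one h

lemma ex_mul_ex_mul_ex {a b : SF d A c} (ha : a ∈ Fil d A c 1) (hb : b ∈ Fil d A c 1)
    (ha0 : a ∈ Par d A c 0) (hb0 : b ∈ Par d A c 0) : ex a * ex b * ex (-(a + b)) = 1 := by
  set a' : SF d A[X] c := (X : A[X]) • cst a with ha'
  set b' : SF d A[X] c := (X : A[X]) • cst b with hb'
  have fa : a' ∈ Fil d A[X] c 1 := supp_smul _ (cst_mem_supp ha)
  have fb : b' ∈ Fil d A[X] c 1 := supp_smul _ (cst_mem_supp hb)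
  have pa : a' ∈ Par d A[X] c 0 := supp_smul _ (cst_mem_supp ha0)
  have pb : b' ∈ Par d A[X] c 0 := supp_smul _ (cst_mem_supp hb0)
  have fc : -(a' + b') ∈ Fil d A[X] c 1 := neg_mem (add_mem fa fb)
  have pc : -(a' + b') ∈ Par d A[X] c 0 := neg_mem (add_mem pa pb)
  have da : dt a' = cst a := by rw [ha', dt_X_smul, dt_cst, smul_zero, add_zero]
  have db : dt b' = cst b := by rw [hb', dt_X_smul, dt_cst, smul_zero, add_zero]
  have key : ex a' * ex b' * ex (-(a' + b')) = 1 := by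
    apply eq_of_dt
    · rw [dt_one, dt_mul, dt_mul, dt_ex fa pa, dt_ex fb pb, dt_ex fc pc, map_neg, map_add, da, db]
      have c1 : cst a * ex b' = ex b' * cst a := (central_of_even (ex_even fb pb) _).symm
      have c2 : (cst a + cst b) * ex (-(a' + b')) = ex (-(a' + b')) * (cst a + cst b) :=
        (central_of_even (ex_even fc pc) _).symm
      have : (ex a' * cst a * ex b' + ex a' * (ex b' * cst b)) * ex (-(a' + b')) =
          ex a' * ex b' * ex (-(a' + b')) * (cst a + cst b) := by
        rw [mul_assoc (ex a') (cst a), c1, mul_assoc _ (ex (-(a' + b'))) _, ← c2]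
        noncomm_ring
      rw [this]; noncomm_ring
    · rw [map_mul, map_mul, map_one, ev_ex _ fa, ev_ex _ fb, ev_ex _ fc, map_neg, map_add, ha', hb',
        ev_X_smul, ev_X_smul]
      simp
  have := congrArg (ev 1) key
  rw [map_mul, map_mul, map_one, ev_ex _ fa, ev_ex _ fb, ev_ex _ fc, map_neg, map_add, ha', hb',
        ev_X_smul, ev_X_smul] at this
  simpa using this

lemma ex_mul_ex_neg {a : SF d A c} (ha : a ∈ Fil d A c 1) (ha0 : a ∈ Par d A c 0) :
    ex a * ex (-a) = 1 := by
  have := ex_mul_ex_mul_ex ha (zero_mem _) ha0 (zero_mem _)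
  simpa using this

lemma ex_neg_mul_ex {a : SF d A c} (ha : a ∈ Fil d A c 1) (ha0 : a ∈ Par d A c 0) :
    ex (-a) * ex a = 1 := by
  rw [← central_of_even (ex_even ha ha0), ex_mul_ex_neg ha ha0]

lemma ex_add {a b : SF d A c} (ha : a ∈ Fil d A c 1) (hb : b ∈ Fil d A c 1)
    (ha0 : a ∈ Par d A c 0) (hb0 : b ∈ Par d A c 0) : ex (a + b) = ex a * ex b := by
  have := ex_mul_ex_mul_ex ha hb ha0 hb0
  have h2 := ex_neg_mul_ex (add_mem ha hb) (add_mem ha0 hb0)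
  calc ex (a + b) = ex a * ex b * ex (-(a + b)) * ex (a + b) := by rw [this, one_mul]
    _ = _ := by rw [mul_assoc, h2, mul_one]

lemma ex_lg {F : SF d A c} (h : F - 1 ∈ Fil d A c 1) (he : F ∈ Par d A c 0) : ex (lg F) = F := by
  set u : SF d A[X] c := 1 + (X : A[X]) • cst (F - 1) with hu
  have hu1 : u - 1 ∈ Fil d A[X] c 1 := by
    rw [hu, add_sub_cancel_left]; exact supp_smul _ (cst_mem_supp h)
  have hue : u ∈ Par d A[X] c 0 :=
    add_mem one_par (supp_smul _ (cst_mem_supp (sub_mem he one_par)))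
  have fl := lg_mem_fil hu1
  have pl := lg_even hu1 hue
  have key : u * ex (-lg u) = 1 := by
    apply eq_of_dt
    · rw [dt_one, dt_mul, dt_ex (neg_mem fl) (neg_mem pl), ← dt_lg hu1 hue, map_neg,
        mul_assoc, ← central_of_even (ex_even (neg_mem fl) (neg_mem pl)) (dt (lg u))]
      noncomm_ring
    · rw [map_mul, ev_ex _ (neg_mem fl), map_neg, ev_lg _ hu1, hu, map_add, ev_X_smul]
      simp
  have h2 : u = ex (lg u) := by
    calc u = u * (ex (-lg u) * ex (lg u)) := by rw [ex_neg_mul_ex fl pl, mul_one]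
      _ = _ := by rw [← mul_assoc, key, one_mul]
  have := congrArg (ev 1) h2
  rw [ev_ex _ fl, ev_lg _ hu1, hu, map_add, ev_X_smul] at this
  simpa using this.symm

lemma lg_ex {a : SF d A c} (ha : a ∈ Fil d A c 1) (ha0 : a ∈ Par d A c 0) : lg (ex a) = a := by
  set a' : SF d A[X] c := (X : A[X]) • cst a with ha'
  have fa : a' ∈ Fil d A[X] c 1 := supp_smul _ (cst_mem_supp ha)
  have pa : a' ∈ Par d A[X] c 0 := supp_smul _ (cst_mem_supp ha0)
  have fe := ex_sub_one_mem le_rfl fa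
  have key : lg (ex a') = a' := by
    apply eq_of_dt
    · have := dt_lg fe (ex_even fa pa)
      rw [dt_ex fa pa] at this
      have h2 := congrArg (fun G => ex (-a') * G) this
      simpa [← mul_assoc, ex_neg_mul_ex fa pa] using h2
    · rw [ev_lg _ fe, ev_ex _ fa, ha', ev_X_smul]; simp
  have := congrArg (ev 1) key
  rw [ev_lg _ fe, ev_ex _ fa, ha', ev_X_smul] at this
  simpa using this

end Time

/-! ### The BV Laplacian and the bracket -/

section BVop

variable {ι : Type*} [LinearOrder ι] {d : ι → ℤ} {K : Type*} [Field K]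
  {R : Type*} [CommRing R] [Algebra K R] {c : ℕ}

/-- The properties of the inverse matrix of an odd symplectic form of degree `-1`. -/
structure IsOddPoisson (d : ι → ℤ) (π : ι → ι → K) : Prop where
  degree : ∀ i j, π i j ≠ 0 → d i + d j = 1
  antisymm : ∀ i j, π i j = -π j i

lemma finite_vars (F : SF d R c) (v : ℤ) : {i | der d R c i F ∉ Fil d R c v}.Finite := by
  refine ((F.lf (v + (2 * c + 1))).biUnion fun q _ => q.1.support.finite_toSet).subset ?_
  intro i hi
  simp only [mem_ofPred_eq, mem_fil, not_forall, not_le] at hi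
  obtain ⟨p, hp, hlt⟩ := hi
  rw [coef_der] at hp
  refine Set.mem_biUnion (x := p + (single i 1, 0)) ⟨?_, ?_⟩ ?_
  · rw [lv_add]
    have : lv c ((single i 1, 0) : Mon ι) = 2 * c + 1 := by simp [lv]
    rw [this]; linarith
  · have := right_ne_zero_of_mul hp
    simpa using this
  · simp

lemma der_notMem {i : ι} {F : SF d R c} {v : ℤ} (h : der d R c i F ∉ Fil d R c v) :
    F ∉ Fil d R c (v + (2 * c + 1)) := fun h' => h (by
  have := der_mem_fil (i := i) h'; simpa using this)

lemma sg_smul_mem_iff {n : ℤ} {F : SF d R c} {S : Set (Mon ι)} :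
    sg R n • F ∈ Supp d R c S ↔ F ∈ Supp d R c S := by
  rcases Int.even_or_odd n with h | h
  · rw [sg_even h, one_smul]
  · rw [sg_odd h, neg_one_smul, neg_mem_iff]

lemma sg_smul (n : ℤ) (F : SF d R c) : sg R n • F = sg K n • F := by
  rcases Int.even_or_odd n with h | h
  · rw [sg_even h, sg_even h, one_smul, one_smul]
  · rw [sg_odd h, sg_odd h, neg_one_smul, neg_one_smul]

lemma summ_der_der (w : ι → ι → K) (F : SF d R c) :
    Summ (fun p : ι × ι => w p.1 p.2 • der d R c p.1 (der d R c p.2 F)) := fun v => by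
  refine ((finite_vars F (v + (2 * c + 1))).prod (finite_vars F (v + (2 * c + 1)))).subset ?_
  rintro ⟨i, j⟩ h
  have h1 : der d R c i (der d R c j F) ∉ Fil d R c v := fun h' => h (supp_smul _ h')
  refine ⟨?_, der_notMem h1⟩
  rw [der_der] at h1
  exact der_notMem (i := j) (fun h' => h1 (sg_smul_mem_iff.mpr h'))

/-- The coefficient of `∂_i ∂_j` in the Laplacian. -/
def lw (d : ι → ℤ) (π : ι → ι → K) (i j : ι) : K := 1 / 2 * (sg K (d i) * π i j)

/-- The BV Laplacian. -/
def lap (d : ι → ℤ) (R : Type*) [CommRing R] [Algebra K R] (c : ℕ) (π : ι → ι → K) :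
    SF d R c →+ SF d R c where
  toFun F := fsum fun p : ι × ι => lw d π p.1 p.2 • der d R c p.1 (der d R c p.2 F)
  map_zero' := ((summ_der_der (lw d π) (0 : SF d R c)).isSum.unique
    (isSum_zero.congr fun p => by simp))
  map_add' F G := (summ_der_der (lw d π) (F + G)).isSum.unique
    (((summ_der_der (lw d π) F).isSum.add (summ_der_der (lw d π) G).isSum).congr
      fun p => by simp)

lemma isSum_lap (π : ι → ι → K) (F : SF d R c) :
    IsSum (fun p : ι × ι => lw d π p.1 p.2 • der d R c p.1 (der d R c p.2 F)) (lap d R c π F) :=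
  (summ_der_der (lw d π) F).isSum

/-- The right partial derivative. -/
def rdv (d : ι → ℤ) (R : Type*) [CommRing R] (c : ℕ) (i : ι) : SF d R c →+ SF d R c where
  toFun F := sg R (d i) • der d R c i (sig d R c (d i) F)
  map_zero' := by simp
  map_add' F G := by simp

lemma rdv_apply (i : ι) (F : SF d R c) :
    rdv d R c i F = sg R (d i) • der d R c i (sig d R c (d i) F) := rfl

lemma rdv_eq (i : ι) (F : SF d R c) : rdv d R c i F = sig d R c (d i) (der d R c i F) := by
  rw [rdv_apply, der_sig, smul_smul, ← sg_add, sg_even, one_smul]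
  rcases Int.even_or_odd (d i) with h | h
  · exact h.add (h.mul_left _)
  · exact h.add_odd (h.mul h)

lemma rdv_mem_supp {i : ι} {S T : Set (Mon ι)}
    (h : ∀ p : Mon ι, p + (single i 1, 0) ∈ S → p ∈ T) {F : SF d R c}
    (hF : F ∈ Supp d R c S) : rdv d R c i F ∈ Supp d R c T := by
  rw [rdv_eq]; exact sig_mem_supp (der_mem_supp h hF)

lemma summ_bracket (π : ι → ι → K) (F G : SF d R c) :
    Summ (fun p : ι × ι => π p.1 p.2 • (rdv d R c p.1 F * der d R c p.2 G)) := fun v => by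
  obtain ⟨m, hm⟩ := F.exists_mem_fil
  obtain ⟨n, hn⟩ := G.exists_mem_fil
  refine ((finite_vars F (v - (n - (2 * c + 1)))).prod
    (finite_vars G (v - (m - (2 * c + 1))))).subset ?_
  rintro ⟨i, j⟩ h
  constructor
  · intro h'
    apply h
    refine supp_smul (S := {p | v ≤ lv c p}) _ ?_
    have := mul_mem_fil (F := rdv d R c i F) (G := der d R c j G) (v := v - (n - (2 * c + 1)))
      (by rw [rdv_eq]; exact sig_mem_supp h') (der_mem_fil hn)
    rwa [show v - (n - (2 * (c:ℤ) + 1)) + (n - (2 * c + 1)) = v by ring] at this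
  · intro h'
    apply h
    refine supp_smul (S := {p | v ≤ lv c p}) _ ?_
    have := mul_mem_fil (F := rdv d R c i F) (G := der d R c j G) (w := v - (m - (2 * c + 1)))
      (by rw [rdv_eq]; exact sig_mem_supp (der_mem_fil hm)) h'
    rwa [show m - (2 * (c:ℤ) + 1) + (v - (m - (2 * c + 1))) = v by ring] at this

/-- The BV bracket. -/
def br (π : ι → ι → K) (F G : SF d R c) : SF d R c :=
  fsum fun p : ι × ι => π p.1 p.2 • (rdv d R c p.1 F * der d R c p.2 G)

lemma isSum_br (π : ι → ι → K) (F G : SF d R c) :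
    IsSum (fun p : ι × ι => π p.1 p.2 • (rdv d R c p.1 F * der d R c p.2 G)) (br π F G) :=
  (summ_bracket π F G).isSum

lemma br_add_right (π : ι → ι → K) (F G H : SF d R c) : br π F (G + H) = br π F G + br π F H :=
  (isSum_br π F (G + H)).unique (((isSum_br π F G).add (isSum_br π F H)).congr fun p => by
    rw [map_add, mul_add, smul_add])

lemma br_add_left (π : ι → ι → K) (F G H : SF d R c) : br π (F + G) H = br π F H + br π G H :=
  (isSum_br π (F + G) H).unique (((isSum_br π F H).add (isSum_br π G H)).congr fun p => by
    rw [map_add, add_mul, smul_add])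

/-- The Hamiltonian vector field `{F, -}`. -/
def ad (π : ι → ι → K) (F : SF d R c) : SF d R c →+ SF d R c :=
  AddMonoidHom.mk' (br π F) (br_add_right π F)

@[simp] lemma br_zero_left (π : ι → ι → K) (G : SF d R c) : br π 0 G = 0 := by
  have := br_add_left π 0 0 G; simpa using this

lemma br_neg_left (π : ι → ι → K) (F G : SF d R c) : br π (-F) G = -br π F G := by
  have := br_add_left π F (-F) G
  rw [add_neg_cancel, br_zero_left] at this
  exact (neg_eq_of_add_eq_zero_right this.symm).symm

/-! #### Supports -/

lemma lap_mem_supp {π : ι → ι → K} {S T : Set (Mon ι)}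
    (h : ∀ i j (p : Mon ι), π i j ≠ 0 →
      p + (single i 1, 0) + (single j 1, 0) ∈ S → p ∈ T)
    {F : SF d R c} (hF : F ∈ Supp d R c S) : lap d R c π F ∈ Supp d R c T := by
  refine (isSum_lap π F).mem_supp fun p => ?_
  by_cases h0 : π p.1 p.2 = 0
  · simp [lw, h0, zero_mem]
  · exact supp_smul _ (der_mem_supp (S := {q | q + (single p.2 1, 0) ∈ S})
      (fun q hq => h p.1 p.2 q h0 hq) (der_mem_supp (fun q hq => hq) hF))

lemma br_mem_supp {π : ι → ι → K} {S S' T : Set (Mon ι)}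
    (h : ∀ i j (p q : Mon ι), π i j ≠ 0 →
      p + (single i 1, 0) ∈ S → q + (single j 1, 0) ∈ S' → p + q ∈ T)
    {F G : SF d R c} (hF : F ∈ Supp d R c S) (hG : G ∈ Supp d R c S') :
    br π F G ∈ Supp d R c T := by
  refine (isSum_br π F G).mem_supp fun p => ?_
  by_cases h0 : π p.1 p.2 = 0
  · simp [h0, zero_mem]
  · exact supp_smul _ (mul_mem_supp (S := {q | q + (single p.1 1, 0) ∈ S})
      (T := {q | q + (single p.2 1, 0) ∈ S'}) (fun q hq r hr => h _ _ q r h0 hq hr)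
      (rdv_mem_supp (fun q hq => hq) hF) (der_mem_supp (fun q hq => hq) hG))

lemma lv_single (i : ι) : lv c ((single i 1, 0) : Mon ι) = 2 * c + 1 := by simp [lv]

lemma lap_mem_fil {π : ι → ι → K} {v : ℤ} {F : SF d R c} (hF : F ∈ Fil d R c v) :
    lap d R c π F ∈ Fil d R c (v - 2 * (2 * c + 1)) :=
  lap_mem_supp (fun i j p _ hp => by
    simp only [mem_ofPred_eq, lv_add, lv_single] at *; linarith) hF

lemma br_mem_fil {π : ι → ι → K} {v w : ℤ} {F G : SF d R c} (hF : F ∈ Fil d R c v)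
    (hG : G ∈ Fil d R c w) : br π F G ∈ Fil d R c (v + w - 2 * (2 * c + 1)) :=
  br_mem_supp (fun i j p q _ hp hq => by
    simp only [mem_ofPred_eq, lv_add, lv_single] at *; linarith) hF hG

lemma cont_lap (π : ι → ι → K) : Cont (lap d R c π) :=
  cont_of_shift (-(2 * (2 * c + 1))) fun v F hF => by
    rw [← sub_eq_add_neg]; exact lap_mem_fil hF

lemma cont_ad (π : ι → ι → K) (F : SF d R c) : Cont (ad π F) := by
  obtain ⟨m, hm⟩ := F.exists_mem_fil
  exact cont_of_shift (m - 2 * (2 * c + 1)) fun v G hG => by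
    have := br_mem_fil (π := π) hm hG
    rwa [show m + v - 2 * (2 * (c : ℤ) + 1) = v + (m - 2 * (2 * c + 1)) by ring] at this

lemma lap_par {π : ι → ι → K} (hπ : IsOddPoisson d π) {n : ℤ} {F : SF d R c}
    (hF : F ∈ Par d R c n) : lap d R c π F ∈ Par d R c (n + 1) :=
  lap_mem_supp (fun i j p h0 hp => by
    simp only [mem_ofPred_eq, Prod.fst_add, md_add, md_single] at *
    have := hπ.degree i j h0
    have e : monDegree d p.1 - (n + 1) =
      (monDegree d p.1 + -d i * (1 : ℕ) + -d j * (1 : ℕ)) - n := by push_cast; linarith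
    rw [e]; exact hp) hF

lemma br_par {π : ι → ι → K} (hπ : IsOddPoisson d π) {m n : ℤ} {F G : SF d R c}
    (hF : F ∈ Par d R c m) (hG : G ∈ Par d R c n) : br π F G ∈ Par d R c (m + n + 1) :=
  br_mem_supp (fun i j p q h0 hp hq => by
    simp only [mem_ofPred_eq, Prod.fst_add, md_add, md_single] at *
    have := hπ.degree i j h0
    have e : monDegree d p.1 + monDegree d q.1 - (m + n + 1) =
      (monDegree d p.1 + -d i * (1 : ℕ) - m) + (monDegree d q.1 + -d j * (1 : ℕ) - n) := by
      push_cast; linarith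
    rw [e]; exact hp.add hq) hF hG

/-! #### Identities -/

lemma lap_mul {π : ι → ι → K} [CharZero K] (hπ : IsOddPoisson d π) (F G : SF d R c) :
    lap d R c π (F * G) =
      lap d R c π F * G + sig d R c 1 F * lap d R c π G + br π (sig d R c 1 F) G := by
  have h1 := (isSum_lap π F).mul_right G
  have h2 := (isSum_lap π G).mul_left (sig d R c 1 F)
  have h3 := (isSum_br π (sig d R c 1 F) G).smul (1 / 2 : K)
  have h4 := h3.equiv (Equiv.prodComm ι ι)
  have e : br π (sig d R c 1 F) G =
      (1 / 2 : K) • br π (sig d R c 1 F) G + (1 / 2 : K) • br π (sig d R c 1 F) G := by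
    rw [← add_smul]; norm_num
  rw [e]
  refine (isSum_lap π (F * G)).unique (((h1.add h2).add (h3.add h4)).congr ?_)
  rintro ⟨i, j⟩
  simp only [Equiv.prodComm_apply, Prod.swap_prod_mk]
  by_cases h0 : π i j = 0
  · have h0' : π j i = 0 := by rw [hπ.antisymm, h0, neg_zero]
    simp [lw, h0, h0']
  have hd := hπ.degree i j h0
  have hdj : d j = 1 - d i := by linarith
  have ev : Even (d i * d j) := by
    rw [hdj]
    rcases Int.even_or_odd (d i) with h | h
    · exact h.mul_right _
    · exact (Even.mul_left (by rw [Int.even_sub']; simp [h]) _)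
  have sj : ∀ H, sig d R c (d i) (sig d R c 1 H) = sig d R c (d j) H := fun H => by
    rw [sig_sig, sig_congr (m := d i + 1) (n := d j)]
    exact ⟨d i, by rw [hdj]; ring⟩
  have si : ∀ H, sig d R c (d j) (sig d R c 1 H) = sig d R c (d i) H := fun H => by
    rw [sig_sig, sig_congr (m := d j + 1) (n := d i)]
    exact ⟨1 - d i, by rw [hdj]; ring⟩
  have sij : ∀ H, sig d R c (d i) (sig d R c (d j) H) = sig d R c 1 H := fun H => by
    rw [sig_sig, hd]
  have e1 : sig d R c (d i) (der d R c j F) = der d R c j (sig d R c (d i) F) := by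
    rw [der_sig, sg_even ev, one_smul]
  have hs : sg K (d j) = - sg K (d i) := by
    rw [hdj, sub_eq_add_neg, sg_add, sg_neg, sg_one]; ring
  rw [der_mul, map_add, der_mul, der_mul, sij, e1, rdv_apply, rdv_apply, sj, si, sg_smul (K := K),
    sg_smul (K := K), hs, hπ.antisymm j i]
  unfold lw
  simp only [smul_mul_assoc, mul_smul_comm]
  module

lemma br_eq {π : ι → ι → K} [CharZero K] (hπ : IsOddPoisson d π) (F G : SF d R c) :
    br π F G = lap d R c π (sig d R c 1 F * G) - lap d R c π (sig d R c 1 F) * G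
      - F * lap d R c π G := by
  rw [lap_mul hπ, sig_sig, sig_even (Even.add_self 1)]
  abel

lemma br_mul {π : ι → ι → K} (hπ : IsOddPoisson d π) {n : ℤ} {F : SF d R c}
    (hF : F ∈ Par d R c n) (G H : SF d R c) :
    br π F (G * H) = br π F G * H + sig d R c (n + 1) G * br π F H := by
  refine (isSum_br π F (G * H)).unique ((((isSum_br π F G).mul_right H).add
    ((isSum_br π F H).mul_left (sig d R c (n + 1) G))).congr fun p => ?_)
  by_cases h0 : π p.1 p.2 = 0
  · simp [h0]
  have hd := hπ.degree _ _ h0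
  have h1 : rdv d R c p.1 F ∈ Par d R c (n + d p.1) := by
    rw [rdv_eq]; exact sig_mem_supp (der_par hF)
  have h2 : rdv d R c p.1 F * sig d R c (d p.2) G = sig d R c (n + 1) G * rdv d R c p.1 F := by
    rw [mul_comm_of_par h1, sig_sig, add_assoc, hd]
  rw [der_mul, mul_add, smul_add, mul_smul_comm, smul_mul_assoc, ← mul_assoc (rdv d R c p.1 F),
    ← mul_assoc (rdv d R c p.1 F), h2]
  noncomm_ring

/-- A finite part of the Laplacian. -/
def plap (π : ι → ι → K) (s : Finset (ι × ι)) (F : SF d R c) : SF d R c :=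
  ∑ p ∈ s, lw d π p.1 p.2 • der d R c p.1 (der d R c p.2 F)

lemma plap_plap {π : ι → ι → K} [CharZero K] (hπ : IsOddPoisson d π) (s : Finset (ι × ι))
    (F : SF d R c) : plap π s (plap π s F) = 0 := by
  have e : plap π s (plap π s F) = ∑ p ∈ s, ∑ q ∈ s, (lw d π p.1 p.2 * lw d π q.1 q.2) •
      der d R c p.1 (der d R c p.2 (der d R c q.1 (der d R c q.2 F))) := by
    unfold plap
    refine sum_congr rfl fun p _ => ?_
    rw [map_sum, map_sum, Finset.smul_sum]
    refine sum_congr rfl fun q _ => ?_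
    rw [der_smul, der_smul, smul_smul]
  have h : plap π s (plap π s F) = - plap π s (plap π s F) := by
    nth_rewrite 1 [e]
    rw [Finset.sum_comm, e, ← Finset.sum_neg_distrib]
    refine sum_congr rfl fun q _ => ?_
    rw [← Finset.sum_neg_distrib]
    refine sum_congr rfl fun p _ => ?_
    by_cases h1 : π p.1 p.2 = 0
    · simp [lw, h1]
    by_cases h2 : π q.1 q.2 = 0
    · simp [lw, h2]
    have d1 := hπ.degree _ _ h1
    have d2 := hπ.degree _ _ h2
    rw [der_der p.2 q.1, der_smul, der_der p.1 q.1, der_der p.2 q.2, der_smul, der_smul,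
      der_der p.1 q.2, der_smul]
    simp only [smul_smul, sg_smul (K := K)]
    rw [mul_comm (lw d π q.1 q.2)]
    have : sg K (d p.2 * d q.1) * sg K (d p.1 * d q.1) * sg K (d p.2 * d q.2) *
        sg K (d p.1 * d q.2) = -1 := by
      rw [← sg_add, ← sg_add, ← sg_add,
        show d p.2 * d q.1 + d p.1 * d q.1 + d p.2 * d q.2 + d p.1 * d q.2 =
          (d p.1 + d p.2) * (d q.1 + d q.2) by ring, d1, d2]
      simp
    rw [← neg_smul]
    congr 1
    linear_combination (lw d π p.1 p.2 * lw d π q.1 q.2) * this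
  have h3 : (2 : K) • plap π s (plap π s F) = 0 := by
    rw [two_smul]; nth_rewrite 1 [h]; simp
  rw [← inv_smul_smul₀ (two_ne_zero (α := K)) (plap π s (plap π s F)), h3, smul_zero]

lemma lap_lap {π : ι → ι → K} [CharZero K] (hπ : IsOddPoisson d π) (F : SF d R c) :
    lap d R c π (lap d R c π F) = 0 := by
  classical
  refine eq_zero_of_forall_fil fun v => ?_
  obtain ⟨s₁, h₁⟩ := isSum_lap π F (v + 2 * (2 * c + 1))
  obtain ⟨s₂, h₂⟩ := isSum_lap π (lap d R c π F) v
  have g₁ := h₁ (s₁ ∪ s₂) Finset.subset_union_left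
  have g₂ := h₂ (s₁ ∪ s₂) Finset.subset_union_right
  have g₃ : plap π (s₁ ∪ s₂) (lap d R c π F - plap π (s₁ ∪ s₂) F) ∈ Fil d R c v := by
    refine sum_mem fun p _ => supp_smul _ ?_
    have := der_mem_fil (i := p.1) (der_mem_fil (i := p.2) g₁)
    exact fil_anti (by linarith) this
  have e : plap π (s₁ ∪ s₂) (lap d R c π F - plap π (s₁ ∪ s₂) F) =
      plap π (s₁ ∪ s₂) (lap d R c π F) - plap π (s₁ ∪ s₂) (plap π (s₁ ∪ s₂) F) := by
    unfold plap
    rw [← sum_sub_distrib]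
    exact sum_congr rfl fun p _ => by rw [map_sub, map_sub, smul_sub]
  rw [e, plap_plap hπ, sub_zero] at g₃
  have := add_mem g₂ g₃
  simpa [plap] using this

lemma lap_smul (π : ι → ι → K) (r : K) (F : SF d R c) :
    lap d R c π (r • F) = r • lap d R c π F :=
  (isSum_lap π _).unique (((isSum_lap π F).smul r).congr fun p => by
    rw [der_smul, der_smul, smul_comm])

lemma br_smul_right (π : ι → ι → K) (r : K) (F G : SF d R c) :
    br π F (r • G) = r • br π F G :=
  (isSum_br π _ _).unique (((isSum_br π F G).smul r).congr fun p => by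
    rw [der_smul, mul_smul_comm, smul_comm])

lemma rdv_smul (i : ι) (r : K) (F : SF d R c) : rdv d R c i (r • F) = r • rdv d R c i F := by
  rw [rdv_eq, rdv_eq, der_smul, sig_smul]

lemma br_smul_left (π : ι → ι → K) (r : K) (F G : SF d R c) :
    br π (r • F) G = r • br π F G :=
  (isSum_br π _ _).unique (((isSum_br π F G).smul r).congr fun p => by
    rw [rdv_smul, smul_mul_assoc, smul_comm])

lemma lap_hb_mul (π : ι → ι → K) (m : ℤ) (F : SF d R c) :
    lap d R c π (hb d R c m * F) = hb d R c m * lap d R c π F :=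
  (isSum_lap π _).unique (((isSum_lap π F).mul_left (hb d R c m)).congr fun p => by
    rw [der_hb_mul, der_hb_mul, mul_smul_comm])

lemma br_hb_right (π : ι → ι → K) (m : ℤ) (F G : SF d R c) :
    br π F (hb d R c m * G) = hb d R c m * br π F G :=
  (isSum_br π _ _).unique (((isSum_br π F G).mul_left (hb d R c m)).congr fun p => by
    rw [der_hb_mul, mul_smul_comm, ← mul_assoc, ← hb_comm, mul_assoc])

lemma br_hb_left (π : ι → ι → K) (m : ℤ) (F G : SF d R c) :
    br π (hb d R c m * F) G = hb d R c m * br π F G :=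
  (isSum_br π _ _).unique (((isSum_br π F G).mul_left (hb d R c m)).congr fun p => by
    rw [rdv_eq, der_hb_mul, map_mul, sig_even_par (hb_par m), ← rdv_eq, mul_smul_comm, mul_assoc])

section Nat

variable {R' : Type*} [CommRing R'] [Algebra K R']

lemma mapC_smul {f : R →+ R'} (hf : ∀ (r : K) x, f (r • x) = r • f x) (r : K) (F : SF d R c) :
    mapC f (r • F) = r • mapC f F := by
  ext I g; exact hf r _

lemma mapC_lap {f : R →+ R'} (hf : ∀ (r : K) x, f (r • x) = r • f x) (π : ι → ι → K)
    (F : SF d R c) : mapC f (lap d R c π F) = lap d R' c π (mapC f F) :=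
  ((isSum_lap π F).map (cont_mapC f)).unique ((isSum_lap π _).congr fun p => by
    rw [mapC_smul hf, mapC_der, mapC_der])

lemma mapC_rdv (f : R →+ R') (i : ι) (F : SF d R c) :
    mapC f (rdv d R c i F) = rdv d R' c i (mapC f F) := by
  rw [rdv_eq, rdv_eq, mapC_sig, mapC_der]

lemma mapR_br {f : R →+* R'} (hf : ∀ (r : K) x, f (r • x) = r • f x) (π : ι → ι → K)
    (F G : SF d R c) : mapR f (br π F G) = br π (mapR f F) (mapR f G) :=
  ((isSum_br π F G).map (cont_mapR f)).unique ((isSum_br π _ _).congr fun p => by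
    have h1 : ∀ H, mapR f (rdv d R c p.1 H) = rdv d R' c p.1 (mapR f H) :=
      fun H => mapC_rdv f.toAddMonoidHom p.1 H
    have h2 : ∀ H, mapR f (der d R c p.2 H) = der d R' c p.2 (mapR f H) :=
      fun H => mapC_der f.toAddMonoidHom p.2 H
    have h3 : ∀ H : SF d R c, mapR f (π p.1 p.2 • H) = π p.1 p.2 • mapR f H :=
      fun H => mapC_smul (f := f.toAddMonoidHom) hf _ H
    change mapR f _ = _
    rw [h3, map_mul, h1, h2])

lemma mapC_br {f : R →+ R} (hf : ∀ (r : K) x, f (r • x) = r • f x)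
    (hd : ∀ x y, f (x * y) = f x * y + x * f y) (π : ι → ι → K)
    (F G : SF d R c) : mapC f (br π F G) = br π (mapC f F) G + br π F (mapC f G) :=
  ((isSum_br π F G).map (cont_mapC f)).unique
    (((isSum_br π (mapC f F) G).add (isSum_br π F (mapC f G))).congr fun p => by
      rw [mapC_smul hf, mapC_leibniz f hd, mapC_rdv, mapC_der, smul_add])

end Nat

end BVop

/-! ### The twisted Laplacian and exponentials -/

section Twisted

variable {ι : Type*} [LinearOrder ι] {d : ι → ℤ} {K : Type*} [Field K] [CharZero K]
  {R : Type*} [CommRing R] [Algebra K R] {c : ℕ}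

/-- The operator `ħ Δ`. -/
def dl (d : ι → ℤ) (R : Type*) [CommRing R] [Algebra K R] (c : ℕ) (π : ι → ι → K) :
    SF d R c →+ SF d R c := (AddMonoidHom.mulLeft (hb d R c 1)).comp (lap d R c π)

/-- The twisted Laplacian `ħ Δ + {S, -}`. -/
def tw (π : ι → ι → K) (S : SF d R c) : SF d R c →+ SF d R c := dl d R c π + ad π S

lemma dl_apply (π : ι → ι → K) (F : SF d R c) : dl d R c π F = hb d R c 1 * lap d R c π F := rfl

lemma tw_apply (π : ι → ι → K) (S F : SF d R c) : tw π S F = dl d R c π F + br π S F := rfl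

lemma cont_dl (π : ι → ι → K) : Cont (dl d R c π) := (cont_mul_left _).comp (cont_lap π)

lemma cont_tw (π : ι → ι → K) (S : SF d R c) : Cont (tw π S) := (cont_dl π).add (cont_ad π S)

lemma dl_hb (π : ι → ι → K) (m : ℤ) (F : SF d R c) :
    dl d R c π (hb d R c m * F) = hb d R c m * dl d R c π F := by
  rw [dl_apply, dl_apply, lap_hb_mul, ← mul_assoc, ← mul_assoc, hb_mul_hb, hb_mul_hb, add_comm]

lemma dl_smul (π : ι → ι → K) (r : K) (F : SF d R c) :
    dl d R c π (r • F) = r • dl d R c π F := by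
  rw [dl_apply, dl_apply, lap_smul, mul_smul_comm]

lemma tw_smul (π : ι → ι → K) (S : SF d R c) (r : K) (F : SF d R c) :
    tw π S (r • F) = r • tw π S F := by
  rw [tw_apply, tw_apply, dl_smul, br_smul_right, smul_add]

variable {π : ι → ι → K} (hπ : IsOddPoisson d π)
include hπ

lemma dl_dl (F : SF d R c) : dl d R c π (dl d R c π F) = 0 := by
  rw [dl_apply π F, dl_hb, dl_apply, lap_lap hπ, mul_zero, mul_zero]

lemma dl_par {n : ℤ} {F : SF d R c} (hF : F ∈ Par d R c n) : dl d R c π F ∈ Par d R c (n + 1) := by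
  have := mul_par (hb_par (R := R) (c := c) 1) (lap_par hπ hF)
  rwa [zero_add] at this

lemma tw_par {n : ℤ} {S F : SF d R c} (hS : S ∈ Par d R c 0) (hF : F ∈ Par d R c n) :
    tw π S F ∈ Par d R c (n + 1) := by
  rw [tw_apply]
  have := br_par hπ hS hF
  rw [zero_add] at this
  exact add_mem (dl_par hπ hF) this

lemma dl_mul (F G : SF d R c) : dl d R c π (F * G) = dl d R c π F * G +
    sig d R c 1 F * dl d R c π G + hb d R c 1 * br π (sig d R c 1 F) G := by
  rw [dl_apply, lap_mul hπ, mul_add, mul_add, dl_apply, dl_apply, ← mul_assoc,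
    ← mul_assoc _ (sig d R c 1 F), hb_comm 1 (sig d R c 1 F), mul_assoc (sig d R c 1 F)]

lemma tw_mul {S : SF d R c} (hS : S ∈ Par d R c 0) (F G : SF d R c) :
    tw π S (F * G) = tw π S F * G + sig d R c 1 F * tw π S G +
      hb d R c 1 * br π (sig d R c 1 F) G := by
  rw [tw_apply, dl_mul hπ, br_mul hπ hS, zero_add, tw_apply, tw_apply, add_mul, mul_add]
  abel

lemma hb_mul_br {S : SF d R c} (hS : S ∈ Par d R c 0) (F G : SF d R c) :
    hb d R c 1 * br π F G = tw π S (sig d R c 1 F * G) - tw π S (sig d R c 1 F) * G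
      - F * tw π S G := by
  rw [tw_mul hπ hS, sig_sig, sig_even (Even.add_self 1)]
  abel

lemma br_comm_of_even {F G : SF d R c} (hF : F ∈ Par d R c 0) (hG : G ∈ Par d R c 0) :
    br π F G = br π G F := by
  rw [br_eq hπ, br_eq hπ, sig_even_par hF, sig_even_par hG, central_of_even hF G,
    central_of_even hF (lap d R c π G), central_of_even hG (lap d R c π F)]
  abel

/-- The BV bracket with an odd function, through the twisted Laplacian. -/
lemma tw_br {S : SF d R c} (hS : S ∈ Par d R c 0) (h2 : ∀ G, tw π S (tw π S G) = 0)
    {β : SF d R c} (hβ : β ∈ Par d R c 1) (G : SF d R c) :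
    tw π S (hb d R c 1 * br π β G) =
      hb d R c 1 * br π (tw π S β) G + hb d R c 1 * br π β (tw π S G) := by
  have h0 : tw π S β ∈ Par d R c 0 := by
    have := tw_par hπ hS hβ
    rwa [par_congr (m := 1 + 1) (n := 0) (by decide)] at this
  rw [hb_mul_br hπ hS β G, hb_mul_br hπ hS β (tw π S G), hb_mul_br hπ hS (tw π S β) G,
    sig_odd_par hβ, sig_even_par h0]
  simp only [neg_mul, map_neg, map_sub, h2]
  noncomm_ring

section Exp

variable [Algebra ℚ R]

omit [CharZero K] hπ in
lemma der_ex {a : SF d R c} (ha : a ∈ Fil d R c 1) (ha0 : a ∈ Par d R c 0) (i : ι) :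
    der d R c i (ex a) = ex a * der d R c i a :=
  deriv_ex (cont_der i) (fun G => by rw [der_mul, sig_even_par ha0]) (central_of_even ha0)
    (der_one i) ha

omit [CharZero K] hπ in
lemma br_ex_left {a : SF d R c} (ha : a ∈ Fil d R c 1) (ha0 : a ∈ Par d R c 0) (G : SF d R c) :
    br π (ex a) G = ex a * br π a G :=
  (isSum_br π _ _).unique (((isSum_br π a G).mul_left (ex a)).congr fun p => by
    rw [rdv_eq, der_ex ha ha0, map_mul, sig_even_par (ex_even ha ha0), ← rdv_eq, mul_assoc,
      mul_smul_comm])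

omit [CharZero K] hπ in
lemma br_ex_right {a : SF d R c} (ha : a ∈ Fil d R c 1) (ha0 : a ∈ Par d R c 0) (G : SF d R c) :
    br π G (ex a) = ex a * br π G a :=
  (isSum_br π _ _).unique (((isSum_br π G a).mul_left (ex a)).congr fun p => by
    rw [der_ex ha ha0, ← mul_assoc, ← central_of_even (ex_even ha ha0), mul_assoc, mul_smul_comm])

lemma lap_ex {a : SF d R c} (ha : a ∈ Fil d R c 1) (ha0 : a ∈ Par d R c 0) :
    lap d R c π (ex a) = ex a * (lap d R c π a + (1 / 2 : K) • br π a a) := by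
  refine (isSum_lap π _).unique (((((isSum_lap π a)).add
    ((isSum_br π a a).smul (1 / 2 : K))).mul_left (ex a)).congr fun p => ?_)
  rw [der_ex ha ha0, der_mul, der_ex ha ha0, sig_even_par (ex_even ha ha0), rdv_eq,
    sig_of_par (der_par ha0), zero_add]
  by_cases h0 : π p.1 p.2 = 0
  · simp [lw, h0]
  have : sg R (d p.1 * d p.1) = sg R (d p.1) := by
    refine sg_congr ?_
    rw [← mul_sub_one]; exact Int.even_mul_pred_self _
  rw [this, sg_smul (K := K)]
  unfold lw
  simp only [mul_add, mul_smul_comm, smul_mul_assoc, smul_add, smul_smul, mul_assoc]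
  rw [add_comm]
  congr 2
  ring

lemma tw_ex {S : SF d R c} {a : SF d R c} (ha : a ∈ Fil d R c 1)
    (ha0 : a ∈ Par d R c 0) :
    tw π S (ex a) = ex a * (tw π S a + (1 / 2 : K) • (hb d R c 1 * br π a a)) := by
  rw [tw_apply, br_ex_right ha ha0, dl_apply, lap_ex hπ ha ha0, ← mul_assoc, hb_comm, mul_assoc,
    ← mul_add, tw_apply, dl_apply]
  congr 1
  rw [mul_add, mul_smul_comm]
  abel

lemma tw_ex_mul {S : SF d R c} (hS : S ∈ Par d R c 0) {a : SF d R c} (ha : a ∈ Fil d R c 1)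
    (ha0 : a ∈ Par d R c 0) (G : SF d R c) :
    tw π S (ex a * G) = ex a * tw π (S + hb d R c 1 * a) G + tw π S (ex a) * G := by
  rw [tw_mul hπ hS, sig_even_par (ex_even ha ha0), br_ex_left ha ha0, tw_apply π (S + _),
    br_add_left, br_hb_left, tw_apply π S G, ← mul_assoc (hb d R c 1), hb_comm]
  noncomm_ring

omit [CharZero K] hπ in
lemma ex_mul_cancel {a : SF d R c} (ha : a ∈ Fil d R c 1) (ha0 : a ∈ Par d R c 0) {F G : SF d R c}
    (h : ex a * F = ex a * G) : F = G := by
  have := congrArg (ex (-a) * ·) h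
  simpa only [← mul_assoc, ex_neg_mul_ex ha ha0, one_mul] using this

lemma tw_conj {S : SF d R c} (hS : S ∈ Par d R c 0) {a : SF d R c} (ha : a ∈ Fil d R c 1)
    (ha0 : a ∈ Par d R c 0) (h : tw π S (ex a) = 0) (G : SF d R c) :
    tw π S (ex a * G) = ex a * tw π (S + hb d R c 1 * a) G := by
  rw [tw_ex_mul hπ hS ha ha0, h, zero_mul, add_zero]

lemma tw_tw_of_conj {S : SF d R c} (hS : S ∈ Par d R c 0) {a : SF d R c} (ha : a ∈ Fil d R c 1)
    (ha0 : a ∈ Par d R c 0) (h : tw π S (ex a) = 0) (h2 : ∀ G, tw π S (tw π S G) = 0)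
    (G : SF d R c) : tw π (S + hb d R c 1 * a) (tw π (S + hb d R c 1 * a) G) = 0 := by
  refine ex_mul_cancel ha ha0 ?_
  rw [← tw_conj hπ hS ha ha0 h, ← tw_conj hπ hS ha ha0 h, h2, mul_zero]

end Exp

/-- The expression `2 ħ Δ S + {S, S}` of the quantum master equation. -/
def qme (π : ι → ι → K) (S : SF d R c) : SF d R c := (2 : K) • dl d R c π S + br π S S

lemma qme_add {S a : SF d R c} (hS : S ∈ Par d R c 0) (ha : a ∈ Par d R c 0) :
    qme π (S + hb d R c 1 * a) = qme π S +
      (2 : K) • (hb d R c 1 * (tw π S a + (1 / 2 : K) • (hb d R c 1 * br π a a))) := by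
  unfold qme
  have : br π a S = br π S a := br_comm_of_even hπ ha hS
  rw [map_add, dl_hb, br_add_left, br_add_right, br_add_right, br_hb_left, br_hb_left, br_hb_right,
    br_hb_right, this, tw_apply]
  simp only [mul_add, smul_add, mul_smul_comm, smul_smul]
  have e : (2 : K) * (1 / 2) = 1 := by norm_num
  rw [e, one_smul, two_smul K (hb d R c 1 * br π S a)]
  abel

lemma qme_add_eq_zero_iff [Algebra ℚ R] {S a : SF d R c} (hS : S ∈ Par d R c 0)
    (ha0 : a ∈ Par d R c 0) (ha : a ∈ Fil d R c 1) (h : qme π S = 0) :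
    qme π (S + hb d R c 1 * a) = 0 ↔ tw π S (ex a) = 0 := by
  rw [qme_add hπ hS ha0, h, zero_add, tw_ex hπ ha ha0, smul_eq_zero_iff_right two_ne_zero]
  constructor
  · intro h
    have := congrArg (hb d R c (-1) * ·) h
    simp only [hb_neg_mul_hb, mul_zero] at this
    rw [this, mul_zero]
  · intro h
    have := congrArg (ex (-a) * ·) h
    simp only [← mul_assoc (ex (-a)), ex_neg_mul_ex ha ha0, one_mul, mul_zero] at this
    rw [this, mul_zero]

/-- The bracket with a solution of the classical master equation anticommutes with `ħ Δ`. -/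
lemma dl_br_of_lap {S : SF d R c} (hS : S ∈ Par d R c 0) (h : lap d R c π S = 0) (G : SF d R c) :
    dl d R c π (br π S G) = -br π S (dl d R c π G) := by
  rw [dl_apply, dl_apply, br_hb_right, ← mul_neg]
  congr 1
  rw [br_eq hπ S G, br_eq hπ S (lap d R c π G), sig_even_par hS, h, lap_lap hπ]
  simp only [map_sub, zero_mul, sub_zero, lap_lap hπ, mul_zero, map_zero]
  abel

end Twisted

/-! ### Derivations and linear vector fields -/

section Deriv

variable {ι : Type*} [LinearOrder ι] {d : ι → ℤ} {R : Type*} [CommRing R] {c : ℕ}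

lemma mono_eq_smul (r : R) (I : ι →₀ ℕ) (g : ℤ) :
    mono d c r (I, g) = r • (hb d R c g * mono d c 1 (I, 0)) := by
  classical
  ext J m
  rw [coef_smul, coef_hb_mul, coef_mono, coef_mono]
  have : (J, m - g) = ((I, 0) : Mon ι) ↔ (J, m) = (I, g) := by
    simp only [Prod.mk.injEq]
    constructor <;> rintro ⟨h, h'⟩ <;> exact ⟨h, by omega⟩
  simp only [this]
  split_ifs <;> simp

lemma exists_of_mono_mul_mono {J K I : ι →₀ ℕ} {g : ℤ}
    (h : (mono d c (1 : R) (J, 0) * mono d c 1 (K, 0)).coef I g ≠ 0) :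
    (I, g) = ((J + K, 0) : Mon ι) := by
  classical
  obtain ⟨p, q, hpq, h1, h2⟩ := exists_of_mul_ne h
  have e1 : p = (J, 0) := by
    by_contra h'; rw [coef_mono, if_neg (fun hh => h' hh.1)] at h1; exact h1 rfl
  have e2 : q = (K, 0) := by
    by_contra h'; rw [coef_mono, if_neg (fun hh => h' hh.1)] at h2; exact h2 rfl
  rw [← hpq, e1, e2, Prod.mk_add_mk, add_zero]

lemma coef_mono_mul_mono {J K : ι →₀ ℕ} (h : Admissible d (J + K)) :
    (mono d c (1 : R) (J, 0) * mono d c 1 (K, 0)).coef (J + K) 0 = sg R (kz d J K) := by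
  classical
  have hone : ∀ (A B : ι →₀ ℕ) (m : ℤ), Admissible d B →
      (mono d c (1 : R) (B, 0)).coef A m = if A = B ∧ m = 0 then 1 else 0 := by
    intro A B m hB
    rw [coef_mono]
    by_cases h : A = B
    · subst h; simp [hB]
    · simp [h]
  rw [coef_mul, if_pos h]
  simp only [hone _ _ _ (adm_left h), hone _ _ _ (adm_right h)]
  rw [Finset.sum_eq_single (J, K)]
  · rw [finsum_eq_single _ 0]
    · simp
    · intro h hh; simp [hh]
  · rintro ⟨A, B⟩ - hne
    rw [finsum_eq_zero_of_forall_eq_zero, mul_zero]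
    intro h
    by_cases hA : A = J
    · by_cases hB : B = K
      · exact absurd (by rw [hA, hB]) hne
      · simp [hB]
    · simp [hA]
  · intro h
    rw [mem_antidiagonal] at h
    exact absurd rfl h

lemma mono_mul_mono (J K : ι →₀ ℕ) : mono d c (1 : R) (J, 0) * mono d c 1 (K, 0) =
    mono d c (sg R (kz d J K)) (J + K, 0) := by
  classical
  ext I g
  by_cases e : (I, g) = ((J + K, 0) : Mon ι)
  · simp only [Prod.mk.injEq] at e
    obtain ⟨rfl, rfl⟩ := e
    rw [coef_mono]
    by_cases hI : Admissible d (J + K)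
    · rw [coef_mono_mul_mono hI, if_pos ⟨rfl, hI⟩]
    · rw [if_neg (fun h => hI h.2)]
      by_contra h
      exact hI (SF.adm _ _ _ h)
  · rw [coef_mono, if_neg (fun h => e h.1)]
    by_contra h
    exact e (exists_of_mono_mul_mono h)

lemma phi_mul_mono (i : ι) (J : ι →₀ ℕ) : phi d R c i * mono d c 1 (J, 0) =
    sg R (kz d (single i 1) J) • mono d c 1 (single i 1 + J, 0) := by
  rw [phi, mono_mul_mono]
  classical
  ext I g
  rw [coef_smul, coef_mono, coef_mono]
  split_ifs <;> simp

/-- Induction on products of coordinates. -/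
lemma mono_induction {p : SF d R c → Prop} (h0 : p 0) (h1 : p 1) (hn : ∀ F, p F → p (-F))
    (hm : ∀ i F, p F → p (phi d R c i * F)) (I : ι →₀ ℕ) : p (mono d c 1 (I, 0)) := by
  have key : ∀ (n : ℕ) (I : ι →₀ ℕ), I.degree = n → p (mono d c 1 (I, 0)) := by
    intro n
    induction n with
    | zero =>
      intro I hI
      rw [Finsupp.degree_eq_zero_iff] at hI
      subst hI; exact h1
    | succ n ih =>
      intro I hI
      have hI0 : I ≠ 0 := by rintro rfl; simp at hI
      obtain ⟨i, hi⟩ := Finsupp.support_nonempty_iff.mpr hI0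
      have hle : single i 1 ≤ I := by
        rw [Finsupp.single_le_iff]
        exact Nat.one_le_iff_ne_zero.mpr (Finsupp.mem_support_iff.mp hi)
      obtain ⟨J, rfl⟩ := exists_add_of_le hle
      have hJ : J.degree = n := by
        rw [map_add, degree_single] at hI; omega
      have hp := hm i _ (ih J hJ)
      rw [phi_mul_mono] at hp
      rcases Int.even_or_odd (kz d (single i 1) J) with h | h
      · rwa [sg_even h, one_smul] at hp
      · rw [sg_odd h, neg_one_smul] at hp
        have := hn _ hp
        rwa [neg_neg] at this
  exact key _ I rfl

/-- Two continuous `R`-linear maps which commute with `ħ` are equal if they agree on products of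
coordinates. -/
lemma ext_of_phi {ι' : Type*} [LinearOrder ι'] {d' : ι' → ℤ} {R' : Type*} [CommRing R'] {c' : ℕ}
    {L M : SF d R c →+ SF d' R' c'} (hL : Cont L) (hM : Cont M)
    (hs : ∀ (r : R) g F, L F = M F → L (r • (hb d R c g * F)) = M (r • (hb d R c g * F)))
    (h1 : L 1 = M 1) (hm : ∀ i F, L F = M F → L (phi d R c i * F) = M (phi d R c i * F)) :
    L = M := by
  refine ext_of_mono hL hM fun r p => ?_
  obtain ⟨I, g⟩ := p
  rw [mono_eq_smul]
  refine hs r g _ ?_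
  exact mono_induction (p := fun F => L F = M F) (by simp) h1
    (fun F h => by rw [map_neg, map_neg, h]) hm I

/-- Continuous derivations of parity `n`, linear over the coefficients and `ħ`. -/
structure IsDer (n : ℤ) (δ : SF d R c →+ SF d R c) : Prop where
  cont : Cont δ
  smul : ∀ (r : R) F, δ (r • F) = r • δ F
  hb_mul : ∀ m F, δ (hb d R c m * F) = hb d R c m * δ F
  mul : ∀ F G, δ (F * G) = δ F * G + sig d R c n F * δ G

lemma IsDer.one {n : ℤ} {δ : SF d R c →+ SF d R c} (h : IsDer n δ) : δ 1 = 0 := by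
  have := h.mul 1 1
  rw [map_one (sig d R c n), mul_one, mul_one, one_mul] at this
  simpa using this

lemma IsDer.ext {n : ℤ} {δ δ' : SF d R c →+ SF d R c} (h : IsDer n δ) (h' : IsDer n δ')
    (hp : ∀ i, δ (phi d R c i) = δ' (phi d R c i)) : δ = δ' := by
  refine ext_of_phi h.cont h'.cont (fun r g F e => ?_) (by rw [h.one, h'.one]) fun i F e => ?_
  · rw [h.smul, h'.smul, h.hb_mul, h'.hb_mul, e]
  · rw [h.mul, h'.mul, e, hp]

lemma IsDer.neg {n : ℤ} {δ : SF d R c →+ SF d R c} (h : IsDer n δ) : IsDer n (-δ) where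
  cont := h.cont.neg
  smul r F := by simp [h.smul]
  hb_mul m F := by simp [h.hb_mul]
  mul F G := by simp [h.mul]; abel

/-- The graded commutator of two odd derivations. -/
lemma IsDer.comm {δ δ' : SF d R c →+ SF d R c} (h : IsDer 1 δ) (h' : IsDer 1 δ')
    (hs : ∀ F, sig d R c 1 (δ F) = -δ (sig d R c 1 F))
    (hs' : ∀ F, sig d R c 1 (δ' F) = -δ' (sig d R c 1 F)) :
    IsDer 0 (δ.comp δ' + δ'.comp δ) where
  cont := (h.cont.comp h'.cont).add (h'.cont.comp h.cont)
  smul r F := by simp [h.smul, h'.smul]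
  hb_mul m F := by simp [h.hb_mul, h'.hb_mul, mul_add]
  mul F G := by
    have e : ∀ F, sig d R c 1 (sig d R c 1 F) = F := fun F => by
      rw [sig_sig, sig_even (Even.add_self 1)]
    simp only [AddMonoidHom.add_apply, comp_apply, h.mul, h'.mul, map_add, hs, hs', e,
      sig_even (Even.zero (α := ℤ))]
    noncomm_ring

lemma IsDer.comp_self {δ : SF d R c →+ SF d R c} (h : IsDer 1 δ)
    (hs : ∀ F, sig d R c 1 (δ F) = -δ (sig d R c 1 F)) : IsDer 0 (δ.comp δ) where
  cont := h.cont.comp h.cont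
  smul r F := by simp [h.smul]
  hb_mul m F := by simp [h.hb_mul]
  mul F G := by
    have e : ∀ F, sig d R c 1 (sig d R c 1 F) = F := fun F => by
      rw [sig_sig, sig_even (Even.add_self 1)]
    simp only [comp_apply, h.mul, map_add, hs, e, sig_even (Even.zero (α := ℤ))]
    noncomm_ring

lemma isDer_zero (n : ℤ) : IsDer n (0 : SF d R c →+ SF d R c) where
  cont := fun v => ⟨v, fun _ _ => zero_mem _⟩
  smul r F := by simp
  hb_mul m F := by simp
  mul F G := by simp

/-! #### Vector fields -/

lemma summ_vf {X : ι → SF d R c} {v : ℤ} (hX : ∀ i, X i ∈ Fil d R c v) (F : SF d R c) :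
    Summ (fun i => X i * der d R c i F) := fun w => by
  refine (finite_vars F (w - v)).subset fun i hi hi' => hi ?_
  have := mul_mem_fil (hX i) hi'
  rwa [add_sub_cancel] at this

/-- The vector field with components `X`, which are uniformly bounded below. -/
def vf (X : ι → SF d R c) (v : ℤ) (hX : ∀ i, X i ∈ Fil d R c v) : SF d R c →+ SF d R c where
  toFun F := fsum fun i => X i * der d R c i F
  map_zero' := (isSum_zero.congr fun i => by simp).eq_fsum.symm
  map_add' F G := (summ_vf hX _).isSum.unique
    (((summ_vf hX F).isSum.add (summ_vf hX G).isSum).congr fun i => by rw [map_add, mul_add])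

variable {X : ι → SF d R c} {v : ℤ} {hX : ∀ i, X i ∈ Fil d R c v}

lemma isSum_vf (F : SF d R c) : IsSum (fun i => X i * der d R c i F) (vf X v hX F) :=
  (summ_vf hX F).isSum

lemma vf_phi (j : ι) : vf X v hX (phi d R c j) = X j := by
  classical
  refine (isSum_vf (hX := hX) _).unique ?_
  have := isSum_finset {j} (fun i => X i * der d R c i (phi d R c j)) (fun i hi => by
    rw [der_phi, if_neg (by simpa using hi), mul_zero])
  rwa [Finset.sum_singleton, der_phi, if_pos rfl, mul_one] at this

lemma isDer_vf {n : ℤ} (hp : ∀ i, X i ∈ Par d R c (n + d i)) : IsDer n (vf X v hX) where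
  cont := cont_of_shift (v - (2 * c + 1)) fun w F hF => by
    refine (isSum_vf (hX := hX) F).mem_supp (S := {p | w + (v - (2 * c + 1)) ≤ lv c p}) fun i => ?_
    have := mul_mem_fil (hX i) (der_mem_fil (i := i) hF)
    rwa [show v + (w - (2 * (c : ℤ) + 1)) = w + (v - (2 * c + 1)) by ring] at this
  smul r F := (isSum_vf _).unique (((isSum_vf (hX := hX) F).smul r).congr fun i => by
    rw [der_smul, mul_smul_comm])
  hb_mul m F := (isSum_vf _).unique (((isSum_vf (hX := hX) F).mul_left (hb d R c m)).congr
    fun i => by rw [der_hb_mul, ← mul_assoc, ← mul_assoc, hb_comm])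
  mul F G := (isSum_vf _).unique ((((isSum_vf (hX := hX) F).mul_right G).add
    ((isSum_vf (hX := hX) G).mul_left (sig d R c n F))).congr fun i => by
      rw [der_mul, mul_add, ← mul_assoc, ← mul_assoc (X i), mul_comm_of_par (hp i) (sig d R c (d i) F), sig_sig,
        sig_congr (m := n + d i + d i) (n := n) ⟨d i, by ring⟩, mul_assoc (sig d R c n F)])

lemma vf_mem_supp {S T : Set (Mon ι)} {F : SF d R c}
    (h : ∀ i, ∀ p, p + (single i 1, 0) ∈ S → ∀ q, (X i).coef q.1 q.2 ≠ 0 → q + p ∈ T)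
    (hF : F ∈ Supp d R c S) : vf X v hX F ∈ Supp d R c T :=
  (isSum_vf F).mem_supp fun i =>
    mul_mem_supp (S := {q | (X i).coef q.1 q.2 ≠ 0}) (T := {q | q + (single i 1, 0) ∈ S})
      (fun q hq p hp => h i p hp q hq) (fun q hq => hq) (der_mem_supp (fun q hq => hq) hF)

/-! #### Diagonal operators -/

/-- Multiplication of the coefficient of `φ^I` by `w I`. -/
def diag (d : ι → ℤ) (R : Type*) [CommRing R] (c : ℕ) (w : (ι →₀ ℕ) → R) : SF d R c →+ SF d R c where
  toFun F :=
    { coef := fun I g => w I * F.coef I g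
      adm := fun I g h => F.adm I g (right_ne_zero_of_mul h)
      lf := fun v => (F.lf v).subset fun p hp => ⟨hp.1, right_ne_zero_of_mul hp.2⟩ }
  map_zero' := by ext; simp
  map_add' F G := by ext; simp [mul_add]

@[simp] lemma coef_diag (w : (ι →₀ ℕ) → R) (F : SF d R c) (I : ι →₀ ℕ) (g : ℤ) :
    (diag d R c w F).coef I g = w I * F.coef I g := rfl

lemma diag_mem_supp {w : (ι →₀ ℕ) → R} {S : Set (Mon ι)} {F : SF d R c} (hF : F ∈ Supp d R c S) :
    diag d R c w F ∈ Supp d R c S := fun p hp => hF p (right_ne_zero_of_mul hp)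

lemma cont_diag (w : (ι →₀ ℕ) → R) : Cont (diag d R c w) := fun v => ⟨v, fun _ hF => diag_mem_supp hF⟩

lemma diag_mono (w : (ι →₀ ℕ) → R) (r : R) (I : ι →₀ ℕ) (g : ℤ) :
    diag d R c w (mono d c r (I, g)) = w I • mono d c r (I, g) := by
  classical
  ext J m
  rw [coef_diag, coef_smul, coef_mono]
  split_ifs with h
  · rw [(Prod.mk.inj h.1).1]; rfl
  · simp

lemma diag_mul {w : (ι →₀ ℕ) → R} (hw : ∀ I J, w (I + J) = w I + w J) (F G : SF d R c) :
    diag d R c w (F * G) = diag d R c w F * G + F * diag d R c w G := by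
  classical
  ext I g
  rw [coef_add, coef_diag, coef_mul, coef_mul, coef_mul]
  split_ifs
  swap
  · simp
  rw [Finset.mul_sum, ← sum_add_distrib]
  refine sum_congr rfl fun p hp => ?_
  rw [mem_antidiagonal] at hp
  have h1 : ∀ h, (diag d R c w F).coef p.1 h * G.coef p.2 (g - h) =
      w p.1 * (F.coef p.1 h * G.coef p.2 (g - h)) := fun h => by rw [coef_diag, mul_assoc]
  have h2 : ∀ h, F.coef p.1 h * (diag d R c w G).coef p.2 (g - h) =
      w p.2 * (F.coef p.1 h * G.coef p.2 (g - h)) := fun h => by rw [coef_diag]; ring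
  simp only [h1, h2]
  rw [← mul_finsum' _ _ (finite_mul_support F G p.1 p.2 g),
    ← mul_finsum' _ _ (finite_mul_support F G p.1 p.2 g), ← hp, hw]
  ring

lemma isDer_diag {w : (ι →₀ ℕ) → R} (hw : ∀ I J, w (I + J) = w I + w J) :
    IsDer 0 (diag d R c w) where
  cont := cont_diag w
  smul r F := by ext; simp; ring
  hb_mul m F := by ext; simp
  mul F G := by rw [diag_mul hw, sig_even (Even.zero (α := ℤ))]

/-- A continuous map preserving the value of `w` commutes with `diag w`. -/
lemma diag_comm {w : (ι →₀ ℕ) → R} {L : SF d R c →+ SF d R c} (hL : Cont L)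
    (hs : ∀ (r : R) F, L (r • F) = r • L F)
    (h : ∀ I F, F ∈ Supp d R c {p | p.1 = I} → L F ∈ Supp d R c {p | w p.1 = w I}) (F : SF d R c) :
    L (diag d R c w F) = diag d R c w (L F) := by
  have : L.comp (diag d R c w) = (diag d R c w).comp L := by
    refine ext_of_mono (hL.comp (cont_diag w)) ((cont_diag w).comp hL) fun r p => ?_
    obtain ⟨I, g⟩ := p
    simp only [comp_apply]
    rw [diag_mono, hs]
    have hh := h I (mono d c r (I, g)) (mono_mem rfl)
    ext J m
    rw [coef_smul, coef_diag]
    by_cases h0 : (L (mono d c r (I, g))).coef J m = 0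
    · simp [h0]
    · rw [smul_eq_mul, show w J = w I from hh (J, m) h0]
  exact DFunLike.congr_fun this F

end Deriv

/-! ### Functions of a subset of the coordinates -/

section Restrict

variable {ι : Type*} [LinearOrder ι] {d : ι → ℤ} {R : Type*} [CommRing R] {c : ℕ} {h : ι → Prop}

/-- Extension of a multi-index by zero. -/
def em (I : {i // h i} →₀ ℕ) : ι →₀ ℕ := I.embDomain (Function.Embedding.subtype h)

lemma em_apply (I : {i // h i} →₀ ℕ) (i : {i // h i}) : em I i.1 = I i :=
  Finsupp.embDomain_apply_self (Function.Embedding.subtype h) I i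

lemma em_support (I : {i // h i} →₀ ℕ) {i : ι} (hi : i ∈ (em I).support) : h i := by
  rw [em, Finsupp.support_embDomain, Finset.mem_map] at hi
  obtain ⟨j, -, rfl⟩ := hi
  exact j.2

lemma em_notMem (I : {i // h i} →₀ ℕ) {i : ι} (hi : ¬ h i) : em I i = 0 := by
  by_contra h'
  exact hi (em_support I (Finsupp.mem_support_iff.mpr h'))

lemma em_eq_iff {I : {i // h i} →₀ ℕ} {J : ι →₀ ℕ} :
    em I = J ↔ (∀ i : {i // h i}, I i = J i.1) ∧ ∀ i ∈ J.support, h i := by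
  constructor
  · rintro rfl
    exact ⟨fun i => (em_apply I i).symm, fun i hi => em_support I hi⟩
  · rintro ⟨h1, h2⟩
    ext i
    by_cases hi : h i
    · exact (em_apply I ⟨i, hi⟩).trans (h1 ⟨i, hi⟩)
    · rw [em_notMem I hi]
      by_contra h'
      exact hi (h2 i (Finsupp.mem_support_iff.mpr (Ne.symm h')))

lemma em_injective : Function.Injective (em : ({i // h i} →₀ ℕ) → ι →₀ ℕ) :=
  Finsupp.embDomain_injective _

lemma em_subtypeDomain {J : ι →₀ ℕ} (hJ : ∀ i ∈ J.support, h i) : em (J.subtypeDomain h) = J :=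
  em_eq_iff.mpr ⟨fun _ => rfl, hJ⟩

lemma subtypeDomain_em (I : {i // h i} →₀ ℕ) : (em I).subtypeDomain h = I := by
  ext i; exact em_apply I i

lemma em_add (I J : {i // h i} →₀ ℕ) : em (I + J) = em I + em J :=
  em_eq_iff.mpr ⟨fun i => by simp [em_apply], fun i hi => by
    rcases Finset.mem_union.mp (Finsupp.support_add hi) with h' | h' <;> exact em_support _ h'⟩

lemma em_zero : em (0 : {i // h i} →₀ ℕ) = 0 := em_eq_iff.mpr ⟨fun i => rfl, by simp⟩

lemma em_single (i : {i // h i}) (a : ℕ) : em (single i a) = single i.1 a :=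
  Finsupp.embDomain_single _ _ _

lemma em_sum {M : Type*} [AddCommMonoid M] (I : {i // h i} →₀ ℕ) (f : ι → ℕ → M) :
    (em I).sum f = I.sum fun i a => f i.1 a := Finsupp.sum_embDomain

lemma em_degree (I : {i // h i} →₀ ℕ) : (em I).degree = I.degree :=
  em_sum I fun _ a => a

lemma em_monDegree (I : {i // h i} →₀ ℕ) :
    monDegree d (em I) = monDegree (fun i : {i // h i} => d i.1) I := em_sum I _

lemma em_kz (I J : {i // h i} →₀ ℕ) :
    kz d (em I) (em J) = kz (fun i : {i // h i} => d i.1) I J := by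
  unfold kz
  rw [em_sum]
  refine Finsupp.sum_congr fun i _ => ?_
  rw [em_sum]
  rfl

lemma em_admissible {I : {i // h i} →₀ ℕ} :
    Admissible d (em I) ↔ Admissible (fun i : {i // h i} => d i.1) I := by
  constructor
  · intro hI i hi
    have := hI i.1 hi
    rwa [em_apply] at this
  · intro hI i hi
    by_cases h' : h i
    · have := hI ⟨i, h'⟩ hi
      rwa [← em_apply] at this
    · rw [em_notMem I h']; exact Nat.zero_le _

/-- The monomials in the coordinates satisfying `h`. -/
def OnH (h : ι → Prop) : Set (Mon ι) := {p | ∀ i ∈ p.1.support, h i}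

lemma mem_onH {p : Mon ι} : p ∈ OnH h ↔ ∃ I : {i // h i} →₀ ℕ, p = (em I, p.2) := by
  constructor
  · intro hp; exact ⟨p.1.subtypeDomain h, by rw [em_subtypeDomain hp]⟩
  · rintro ⟨I, e⟩ i hi
    rw [e] at hi
    exact em_support I hi

lemma onH_left {p q : Mon ι} (hpq : p + q ∈ OnH h) : p ∈ OnH h := fun i hi =>
  hpq i (by
    rw [mem_support_iff] at *
    simp only [Prod.fst_add, Finsupp.add_apply]; omega)

lemma onH_right {p q : Mon ι} (hpq : p + q ∈ OnH h) : q ∈ OnH h := by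
  rw [add_comm] at hpq; exact onH_left hpq

lemma onH_add {p q : Mon ι} (hp : p ∈ OnH h) (hq : q ∈ OnH h) : p + q ∈ OnH h := fun i hi => by
  rcases Finset.mem_union.mp (Finsupp.support_add hi) with h' | h'
  · exact hp i h'
  · exact hq i h'

/-- Restriction to the coordinates satisfying `h`, as an additive map. -/
def prjAdd (d : ι → ℤ) (R : Type*) [CommRing R] (c : ℕ) (h : ι → Prop) :
    SF d R c →+ SF (fun i : {i // h i} => d i.1) R c where
  toFun F :=
    { coef := fun I g => F.coef (em I) g
      adm := fun I g hI => em_admissible.mp (F.adm _ g hI)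
      lf := fun v => ((F.lf v).preimage (f := fun p : Mon {i // h i} => (em p.1, p.2))
        (fun p _ q _ e => by
          simp only [Prod.mk.injEq] at e
          exact Prod.ext (em_injective e.1) e.2)).subset fun p hp => ⟨by
            have := hp.1
            simpa [lv, em_degree] using this, hp.2⟩ }
  map_zero' := rfl
  map_add' _ _ := rfl

lemma prjAdd_mul (F G : SF d R c) : prjAdd d R c h (F * G) = prjAdd d R c h F * prjAdd d R c h G := by
  classical
  ext I g
  change (F * G).coef (em I) g = _
  rw [coef_mul, coef_mul]
  by_cases hI : Admissible d (em I)
  swap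
  · rw [if_neg hI, if_neg (fun h' => hI (em_admissible.mpr h'))]
  rw [if_pos hI, if_pos (em_admissible.mp hI)]
  refine Finset.sum_nbij' (fun p => (p.1.subtypeDomain h, p.2.subtypeDomain h))
    (fun p => (em p.1, em p.2)) ?_ ?_ ?_ ?_ ?_
  · rintro ⟨p, q⟩ hp
    rw [mem_antidiagonal] at *
    change p.subtypeDomain h + q.subtypeDomain h = I
    rw [← Finsupp.subtypeDomain_add, hp, subtypeDomain_em]
  · rintro ⟨p, q⟩ hp
    rw [mem_antidiagonal] at *
    rw [← hp, em_add]
  · rintro ⟨p, q⟩ hp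
    rw [mem_antidiagonal] at hp
    have hpq : ((p, 0) : Mon ι) + (q, 0) ∈ OnH h := mem_onH.mpr ⟨I, by simp [← hp]⟩
    exact Prod.ext (em_subtypeDomain (onH_left hpq)) (em_subtypeDomain (onH_right hpq))
  · rintro ⟨p, q⟩ _
    exact Prod.ext (subtypeDomain_em p) (subtypeDomain_em q)
  · rintro ⟨p, q⟩ hp
    rw [mem_antidiagonal] at hp
    have hpq : ((p, 0) : Mon ι) + (q, 0) ∈ OnH h := mem_onH.mpr ⟨I, by simp [← hp]⟩
    have h1 : em (p.subtypeDomain h) = p := em_subtypeDomain (onH_left hpq)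
    have h2 : em (q.subtypeDomain h) = q := em_subtypeDomain (onH_right hpq)
    change sg R (kz d p q) * ∑ᶠ h, F.coef p h * G.coef q (g - h) = sg R (kz _ _ _) *
      ∑ᶠ m, F.coef (em (p.subtypeDomain h)) m * G.coef (em (q.subtypeDomain h)) (g - m)
    rw [← em_kz, h1, h2]

/-- Restriction to the coordinates satisfying `h`. -/
def prj (d : ι → ℤ) (R : Type*) [CommRing R] (c : ℕ) (h : ι → Prop) :
    SF d R c →+* SF (fun i : {i // h i} => d i.1) R c :=
  { prjAdd d R c h with
    map_one' := by
      classical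
      ext I g
      change (1 : SF d R c).coef (em I) g = _
      rw [one_def, one_def, coef_mono, coef_mono]
      have : (em I, g) = (0 : Mon ι) ↔ (I, g) = (0 : Mon {i // h i}) := by
        rw [Prod.mk_eq_zero, Prod.mk_eq_zero, ← em_zero (h := h), em_injective.eq_iff]
      simp only [this, em_admissible]
      congr
    map_mul' := prjAdd_mul }

@[simp] lemma coef_prj (F : SF d R c) (I : {i // h i} →₀ ℕ) (g : ℤ) :
    (prj d R c h F).coef I g = F.coef (em I) g := rfl

lemma prj_injOn {F G : SF d R c} (hF : F ∈ Supp d R c (OnH h)) (hG : G ∈ Supp d R c (OnH h))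
    (e : prj d R c h F = prj d R c h G) : F = G := by
  ext I g
  by_cases hI : ((I, g) : Mon ι) ∈ OnH h
  · obtain ⟨J, hJ⟩ := mem_onH.mp hI
    rw [(Prod.mk.inj hJ).1, ← coef_prj, ← coef_prj, e]
  · have h1 : F.coef I g = 0 := by by_contra h'; exact hI (hF (I, g) h')
    have h2 : G.coef I g = 0 := by by_contra h'; exact hI (hG (I, g) h')
    rw [h1, h2]

open Classical in
/-- Extension of a function of the coordinates satisfying `h`, as an additive map. -/
def incAdd (d : ι → ℤ) (R : Type*) [CommRing R] (c : ℕ) (h : ι → Prop) :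
    SF (fun i : {i // h i} => d i.1) R c →+ SF d R c where
  toFun F :=
    { coef := fun I g => if ∀ i ∈ I.support, h i then F.coef (I.subtypeDomain h) g else 0
      adm := fun I g hI => by
        split_ifs at hI with h'
        · rw [← em_subtypeDomain h']; exact em_admissible.mpr (F.adm _ g hI)
        · exact absurd rfl hI
      lf := fun v => ((F.lf v).image (fun p : Mon {i // h i} => (em p.1, p.2))).subset fun p hp => by
        obtain ⟨hp1, hp2⟩ := hp
        split_ifs at hp2 with h'
        · refine ⟨(p.1.subtypeDomain h, p.2), ⟨?_, hp2⟩, ?_⟩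
          · rw [lv, ← em_degree, em_subtypeDomain h']; exact hp1
          · exact Prod.ext (em_subtypeDomain h') rfl
        · exact absurd rfl hp2 }
  map_zero' := by ext; simp
  map_add' F G := by
    ext I g
    simp only [coef_add]
    split_ifs <;> simp

lemma incAdd_mem (F) : incAdd d R c h F ∈ Supp d R c (OnH h) := fun p hp => by
  by_contra h'
  apply hp
  exact if_neg h'

lemma prj_incAdd (F) : prj d R c h (incAdd d R c h F) = F := by
  classical
  ext I g
  rw [coef_prj]
  change (if _ then _ else _) = _
  rw [if_pos (fun i hi => em_support I hi), subtypeDomain_em]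

lemma one_mem_onH : (1 : SF d R c) ∈ Supp d R c (OnH h) := one_mem_supp (fun i hi => by simp at hi)

lemma mul_mem_onH {F G : SF d R c} (hF : F ∈ Supp d R c (OnH h)) (hG : G ∈ Supp d R c (OnH h)) :
    F * G ∈ Supp d R c (OnH h) := mul_mem_supp (fun _ hp _ hq => onH_add hp hq) hF hG

/-- Extension of a function of the coordinates satisfying `h`. -/
def inc (d : ι → ℤ) (R : Type*) [CommRing R] (c : ℕ) (h : ι → Prop) :
    SF (fun i : {i // h i} => d i.1) R c →+* SF d R c :=
  { incAdd d R c h with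
    map_one' := prj_injOn (incAdd_mem _) one_mem_onH ((prj_incAdd _).trans (map_one _).symm)
    map_mul' := fun F G => prj_injOn (incAdd_mem _) (mul_mem_onH (incAdd_mem F) (incAdd_mem G))
      ((prj_incAdd _).trans ((map_mul _ _ _).trans
        (congrArg₂ (· * ·) (prj_incAdd F) (prj_incAdd G))).symm) }

open Classical in
lemma coef_inc (F) (I : ι →₀ ℕ) (g : ℤ) : (inc d R c h F).coef I g =
    if ∀ i ∈ I.support, h i then F.coef (I.subtypeDomain h) g else 0 := rfl

lemma inc_mem (F) : inc d R c h F ∈ Supp d R c (OnH h) := incAdd_mem F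

@[simp] lemma prj_inc (F) : prj d R c h (inc d R c h F) = F := prj_incAdd F

lemma inc_injective : Function.Injective (inc d R c h) :=
  Function.LeftInverse.injective (prj_inc (d := d))

lemma inc_prj {F : SF d R c} (hF : F ∈ Supp d R c (OnH h)) : inc d R c h (prj d R c h F) = F :=
  prj_injOn (inc_mem _) hF (prj_inc _)

lemma eq_inc {F : SF d R c} (hF : F ∈ Supp d R c (OnH h)) {G} (e : prj d R c h F = G) :
    F = inc d R c h G := by rw [← e, inc_prj hF]

lemma prj_mem_supp {S : Set (Mon ι)} {T : Set (Mon {i // h i})}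
    (hST : ∀ I g, ((em I, g) : Mon ι) ∈ S → (I, g) ∈ T) {F : SF d R c} (hF : F ∈ Supp d R c S) :
    prj d R c h F ∈ Supp _ R c T := fun p hp => hST p.1 p.2 (hF _ hp)

lemma inc_mem_supp {S : Set (Mon ι)} {T : Set (Mon {i // h i})}
    (hST : ∀ I g, (I, g) ∈ T → ((em I, g) : Mon ι) ∈ S) {F} (hF : F ∈ Supp _ R c T) :
    inc d R c h F ∈ Supp d R c S := fun p hp => by
  classical
  rw [coef_inc] at hp
  split_ifs at hp with h'
  · have := hST _ p.2 (hF (p.1.subtypeDomain h, p.2) hp)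
    rwa [em_subtypeDomain h'] at this
  · exact absurd rfl hp

lemma prj_mem_fil {v : ℤ} {F : SF d R c} (hF : F ∈ Fil d R c v) : prj d R c h F ∈ Fil _ R c v :=
  prj_mem_supp (fun I g hI => by simpa [lv, em_degree] using hI) hF

lemma inc_mem_fil {v : ℤ} {F} (hF : F ∈ Fil _ R c v) : inc d R c h F ∈ Fil d R c v :=
  inc_mem_supp (fun I g hI => by simpa [lv, em_degree] using hI) hF

lemma cont_prj : Cont (prj d R c h).toAddMonoidHom := fun v => ⟨v, fun _ hF => prj_mem_fil hF⟩

lemma cont_inc : Cont (inc d R c h).toAddMonoidHom := fun v => ⟨v, fun _ hF => inc_mem_fil hF⟩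

lemma prj_smul {K : Type*} [CommSemiring K] [Algebra K R] (r : K) (F : SF d R c) :
    prj d R c h (r • F) = r • prj d R c h F := by ext; rfl

lemma inc_smul {K : Type*} [CommSemiring K] [Algebra K R] (r : K) (F) :
    inc d R c h (r • F) = r • inc d R c h F :=
  prj_injOn (inc_mem _) (supp_smul r (inc_mem _)) (by rw [prj_smul, prj_inc, prj_inc])

lemma hb_mem_onH (m : ℤ) : hb d R c m ∈ Supp d R c (OnH h) := mono_mem fun i hi => by simp at hi

@[simp] lemma prj_hb (m : ℤ) : prj d R c h (hb d R c m) = hb _ R c m := by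
  classical
  ext I g
  rw [coef_prj, hb, hb, coef_mono, coef_mono]
  have : (em I, g) = ((0, m) : Mon ι) ↔ (I, g) = ((0, m) : Mon {i // h i}) := by
    rw [Prod.mk_inj, Prod.mk_inj, ← em_zero (h := h), em_injective.eq_iff]
  simp only [this, em_admissible]
  congr

@[simp] lemma inc_hb (m : ℤ) : inc d R c h (hb _ R c m) = hb d R c m :=
  (eq_inc (hb_mem_onH m) (prj_hb m)).symm

@[simp] lemma inc_phi (i : {i // h i}) : inc d R c h (phi _ R c i) = phi d R c i.1 := by
  refine (eq_inc (mono_mem fun j hj => ?_) ?_).symm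
  · have : i.1 = j := by simpa [single_apply] using (Finsupp.mem_support_iff.mp hj)
    rw [← this]; exact i.2
  · classical
    ext I g
    rw [coef_prj]
    unfold phi
    rw [coef_mono, coef_mono]
    have : (em I, g) = ((single i.1 1, 0) : Mon ι) ↔
        (I, g) = ((single i 1, 0) : Mon {i // h i}) := by
      rw [Prod.mk_inj, Prod.mk_inj, ← em_single, em_injective.eq_iff]
    simp only [this, em_admissible]
    congr

lemma sig_prj (n : ℤ) (F : SF d R c) : sig _ R c n (prj d R c h F) = prj d R c h (sig d R c n F) := by
  ext I g; simp [em_monDegree]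

lemma sig_inc (n : ℤ) (F) : sig d R c n (inc d R c h F) = inc d R c h (sig _ R c n F) :=
  eq_inc (sig_mem_supp (inc_mem _)) (by rw [← sig_prj, prj_inc])

lemma prj_der (i : {i // h i}) (F : SF d R c) :
    prj d R c h (der d R c i.1 F) = der _ R c i (prj d R c h F) := by
  ext I g
  rw [coef_prj, coef_der, coef_der, coef_prj, em_add, em_single, em_apply, ← em_kz, em_single]

lemma der_mem_onH {F : SF d R c} (i : ι) (hF : F ∈ Supp d R c (OnH h)) :
    der d R c i F ∈ Supp d R c (OnH h) := der_mem_supp (fun _ hp => onH_left hp) hF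

lemma der_inc (i : {i // h i}) (F) :
    der d R c i.1 (inc d R c h F) = inc d R c h (der _ R c i F) :=
  eq_inc (der_mem_onH _ (inc_mem _)) (by rw [prj_der, prj_inc])

lemma der_inc_of_not {i : ι} (hi : ¬ h i) (F) : der d R c i (inc d R c h F) = 0 := by
  have : der d R c i (inc d R c h F) ∈ Supp d R c ∅ :=
    der_mem_supp (S := OnH h) (fun p hp => hi (hp i (by simp))) (inc_mem _)
  ext I g
  by_contra h'
  exact this (I, g) h'

variable {𝕜 : Type*} [Field 𝕜] [Algebra 𝕜 R]

lemma lap_inc (π : ι → ι → 𝕜) (F) : lap d R c π (inc d R c h F) =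
    inc d R c h (lap _ R c (fun i j : {i // h i} => π i j) F) := by
  refine (isSum_lap π _).unique (IsSum.of_injective
    (e := fun p : {i // h i} × {i // h i} => ((p.1.1, p.2.1) : ι × ι))
    (fun p q e => by
      simp only [Prod.mk.injEq] at e
      exact Prod.ext (Subtype.ext e.1) (Subtype.ext e.2))
    (fun p hp => ?_) (((isSum_lap _ F).map cont_inc).congr fun p => ?_))
  · by_cases h1 : h p.1
    · by_cases h2 : h p.2
      · exact absurd ⟨(⟨p.1, h1⟩, ⟨p.2, h2⟩), rfl⟩ hp
      · rw [der_inc_of_not h2, map_zero, smul_zero]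
    · by_cases h2 : h p.2
      · have := der_inc (d := d) (c := c) ⟨p.2, h2⟩ F
        rw [this, der_inc_of_not h1, smul_zero]
      · rw [der_inc_of_not h2, map_zero, smul_zero]
  · change _ = inc d R c h _
    rw [inc_smul, der_inc, der_inc]
    rfl

lemma dl_inc [CharZero 𝕜] (π : ι → ι → 𝕜) (F) : dl d R c π (inc d R c h F) =
    inc d R c h (dl _ R c (fun i j : {i // h i} => π i j) F) := by
  rw [dl_apply, lap_inc, dl_apply, map_mul, inc_hb]

/-- A homomorphism intertwining twisted Laplacians is compatible with the brackets. -/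
lemma map_br_of_intertwines [CharZero 𝕜] {ι' : Type*} [LinearOrder ι'] {d' : ι' → ℤ}
    {R' : Type*} [CommRing R'] [Algebra 𝕜 R'] {c' : ℕ}
    {π : ι → ι → 𝕜} (hπ : IsOddPoisson d π)
    {π' : ι' → ι' → 𝕜} (hπ' : IsOddPoisson d' π') (L : SF d R c →+* SF d' R' c')
    (hL : ∀ m, L (hb d R c m) = hb d' R' c' m) (hs : ∀ F, L (sig d R c 1 F) = sig d' R' c' 1 (L F))
    {S : SF d R c} {S' : SF d' R' c'} (hS : S ∈ Par d R c 0) (hS' : S' ∈ Par d' R' c' 0)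
    (hT : ∀ F, L (tw π S F) = tw π' S' (L F)) (F G : SF d R c) :
    L (br π F G) = br π' (L F) (L G) := by
  have h1 := congrArg L (hb_mul_br hπ hS F G)
  rw [map_mul L, hL, map_sub L, map_sub L, map_mul L, map_mul L, hT, hT, hT, map_mul L, hs,
    ← hb_mul_br hπ' hS'] at h1
  have := congrArg (hb d' R' c' (-1) * ·) h1
  simpa only [hb_neg_mul_hb] using this

end Restrict

/-! ### Linear vector fields and series of lowering operators -/

section Linear

variable {ι : Type*} [LinearOrder ι] {d : ι → ℤ} {R : Type*} [CommRing R] {c : ℕ}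

lemma IsSum.mem_fil {κ : Type*} {y : κ → SF d R c} {z : SF d R c} (hs : IsSum y z) {v : ℤ}
    (hy : ∀ i, y i ∈ Fil d R c v) : z ∈ Fil d R c v := hs.mem_supp (S := {p | v ≤ lv c p}) hy

lemma phi_mem_fil (i : ι) : phi d R c i ∈ Fil d R c (2 * c + 1) := mono_mem (by simp [lv])

lemma phi_par (i : ι) : phi d R c i ∈ Par d R c (d i) := mono_mem (by
  simp only [mem_ofPred_eq, md_single]; exact ⟨-d i, by push_cast; ring⟩)

section VF

variable {X : ι → SF d R c} {v : ℤ} {hX : ∀ i, X i ∈ Fil d R c v}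

lemma sig_vf {n : ℤ} (hp : ∀ i, X i ∈ Par d R c (n + d i)) (m : ℤ) (F : SF d R c) :
    sig d R c m (vf X v hX F) = sg R (m * n) • vf X v hX (sig d R c m F) := by
  refine ((isSum_vf F).map (cont_sig m)).unique (((isSum_vf _).smul (sg R (m * n))).congr fun i => ?_)
  change sig d R c m _ = _
  rw [map_mul, sig_of_par (hp i), der_sig, mul_smul_comm, smul_smul, smul_mul_assoc, ← sg_add,
    mul_add]

lemma der_vf {n : ℤ} (hp : ∀ i, X i ∈ Par d R c (n + d i)) {i : ι}
    (hi : ∀ j, der d R c i (X j) = 0) (F : SF d R c) :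
    der d R c i (vf X v hX F) = sg R (n * d i) • vf X v hX (der d R c i F) := by
  refine ((isSum_vf F).map (cont_der i)).unique
    (((isSum_vf _).smul (sg R (n * d i))).congr fun j => ?_)
  rw [der_mul, hi, zero_mul, zero_add, sig_of_par (hp j), der_der, mul_smul_comm, smul_mul_assoc,
    smul_smul, ← sg_add]
  congr 1
  exact sg_congr ⟨d i * d j, by ring⟩

end VF

section Scalars

variable {K : Type*} [Field K] [Algebra K R]

lemma algebraMap_smul' (r : K) (F : SF d R c) : algebraMap K R r • F = r • F := by
  ext I g
  rw [coef_smul, coef_smul, smul_eq_mul, Algebra.smul_def]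

lemma IsDer.smul' {n : ℤ} {δ : SF d R c →+ SF d R c} (h : IsDer n δ) (r : K) (F : SF d R c) :
    δ (r • F) = r • δ F := by
  rw [← algebraMap_smul', h.smul, algebraMap_smul']

/-- Linear functions. -/
def lcomb (d : ι → ℤ) (R : Type*) [CommRing R] [Algebra K R] (c : ℕ) : (ι →₀ K) →ₗ[K] SF d R c :=
  linearCombination K (phi d R c)

lemma lcomb_apply (x : ι →₀ K) : lcomb d R c x = x.sum fun i r => r • phi d R c i := rfl

lemma lcomb_mem {S : Set (Mon ι)} {x : ι →₀ K}
    (h : ∀ i, x i ≠ 0 → ((single i 1, 0) : Mon ι) ∈ S) : lcomb d R c x ∈ Supp d R c S :=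
  sum_mem fun i hi => supp_smul _ (mono_mem (h i (Finsupp.mem_support_iff.mp hi)))

lemma lcomb_mem_fil (x : ι →₀ K) : lcomb d R c x ∈ Fil d R c (2 * c + 1) :=
  sum_mem fun i _ => supp_smul _ (phi_mem_fil i)

/-- The vector field with linear components given by the rows of a matrix. -/
def lin (d : ι → ℤ) (R : Type*) [CommRing R] [Algebra K R] (c : ℕ) (μ : ι → ι →₀ K) :
    SF d R c →+ SF d R c :=
  vf (fun j => lcomb d R c (μ j)) (2 * c + 1) fun _ => lcomb_mem_fil _

lemma lin_phi (μ : ι → ι →₀ K) (j : ι) : lin d R c μ (phi d R c j) = lcomb d R c (μ j) := vf_phi j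

lemma lcomb_par {n : ℤ} {μ : ι → ι →₀ K} (h : ∀ j i, μ j i ≠ 0 → Even (d i - d j - n)) (j : ι) :
    lcomb d R c (μ j) ∈ Par d R c (n + d j) := lcomb_mem fun i hi => by
  have h' := h j i hi
  simp only [mem_ofPred_eq, md_single]
  obtain ⟨a, ha⟩ := h'
  exact ⟨-a - n - d j, by push_cast; linarith⟩

lemma isDer_lin {n : ℤ} {μ : ι → ι →₀ K} (h : ∀ j i, μ j i ≠ 0 → Even (d i - d j - n)) :
    IsDer n (lin d R c μ) := isDer_vf (lcomb_par h)

lemma lin_lcomb {n : ℤ} {μ : ι → ι →₀ K} (h : ∀ j i, μ j i ≠ 0 → Even (d i - d j - n)) (x : ι →₀ K) :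
    lin d R c μ (lcomb d R c x) = lcomb d R c (linearCombination K μ x) := by
  rw [lcomb_apply, Finsupp.sum, map_sum, linearCombination_apply, Finsupp.sum, map_sum]
  exact sum_congr rfl fun i _ => by rw [(isDer_lin h).smul', lin_phi, map_smul]

lemma lin_mem_supp {μ : ι → ι →₀ K} {S T : Set (Mon ι)} {F : SF d R c}
    (h : ∀ i j, μ i j ≠ 0 → ∀ p, p + (single i 1, 0) ∈ S → p + (single j 1, 0) ∈ T)
    (hF : F ∈ Supp d R c S) : lin d R c μ F ∈ Supp d R c T :=
  vf_mem_supp (fun i p hp q hq => by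
    have : q ∈ {q : Mon ι | ∃ j, μ i j ≠ 0 ∧ q = (single j 1, 0)} :=
      lcomb_mem (S := {q : Mon ι | ∃ j, μ i j ≠ 0 ∧ q = (single j 1, 0)})
        (fun j hj => Set.mem_ofPred_eq.mpr ⟨j, hj, rfl⟩) q hq
    obtain ⟨j, hj, rfl⟩ := this
    rw [add_comm]
    exact h i j hj p hp) hF

lemma lin_mem_fil {μ : ι → ι →₀ K} {v : ℤ} {F : SF d R c} (hF : F ∈ Fil d R c v) :
    lin d R c μ F ∈ Fil d R c v :=
  lin_mem_supp (S := {p | v ≤ lv c p}) (T := {p | v ≤ lv c p}) (fun i j _ p hp => by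
    simp only [mem_ofPred_eq, lv_add, lv_single] at *; exact hp) hF

lemma sig_lin {n : ℤ} {μ : ι → ι →₀ K} (h : ∀ j i, μ j i ≠ 0 → Even (d i - d j - n)) (m : ℤ)
    (F : SF d R c) : sig d R c m (lin d R c μ F) = sg R (m * n) • lin d R c μ (sig d R c m F) :=
  sig_vf (lcomb_par h) m F

lemma lin_par {n m : ℤ} {μ : ι → ι →₀ K} (h : ∀ j i, μ j i ≠ 0 → Even (d i - d j - n))
    {F : SF d R c} (hF : F ∈ Par d R c m) : lin d R c μ F ∈ Par d R c (m + n) :=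
  lin_mem_supp (fun i j hij p hp => by
    simp only [mem_ofPred_eq, Prod.fst_add, md_add, md_single] at *
    obtain ⟨a, ha⟩ := h i j hij
    obtain ⟨b, hb⟩ := hp
    push_cast at hb ⊢
    exact ⟨b - a - n, by linarith⟩) hF

lemma der_lin {n : ℤ} {μ : ι → ι →₀ K} (h : ∀ j i, μ j i ≠ 0 → Even (d i - d j - n)) {i : ι}
    (hi : ∀ j, μ j i = 0) (F : SF d R c) :
    der d R c i (lin d R c μ F) = sg R (n * d i) • lin d R c μ (der d R c i F) :=
  der_vf (lcomb_par h) (fun j => by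
    classical
    rw [lcomb_apply, Finsupp.sum, map_sum]
    refine sum_eq_zero fun l _ => ?_
    rw [der_smul, der_phi]
    split_ifs with e
    · subst e; rw [hi, zero_smul]
    · rw [smul_zero]) F

lemma mapR_phi {R' : Type*} [CommRing R'] (f : R →+* R') (i : ι) :
    mapR f (phi d R c i) = phi d R' c i := by
  classical
  ext I g
  rw [coef_mapR, phi, phi, coef_mono, coef_mono]
  split_ifs <;> simp

lemma mapR_lin {R' : Type*} [CommRing R'] [Algebra K R'] {f : R →+* R'}
    (hf : ∀ (r : K) x, f (r • x) = r • f x) (μ : ι → ι →₀ K) (F : SF d R c) :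
    mapR f (lin d R c μ F) = lin d R' c μ (mapR f F) :=
  ((isSum_vf F).map (cont_mapR f)).unique ((isSum_vf _).congr fun j => by
    have h2 : ∀ H, mapR f (der d R c j H) = der d R' c j (mapR f H) :=
      fun H => mapC_der f.toAddMonoidHom j H
    change mapR f _ = _
    rw [map_mul, h2, lcomb_apply, lcomb_apply, Finsupp.sum, Finsupp.sum, map_sum]
    congr 1
    refine sum_congr rfl fun i _ => ?_
    have := mapC_smul (f := f.toAddMonoidHom) hf (μ j i) (phi d R c i)
    exact (this.trans (by rw [show mapC f.toAddMonoidHom (phi d R c i) = mapR f (phi d R c i) from rfl,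
      mapR_phi])))

end Scalars

/-! #### Lowering operators -/

/-- The monomials of level at least `v` or polynomial degree at most `m`. -/
def LowSet (ι : Type*) (c : ℕ) (v m : ℤ) : Set (Mon ι) := {p | v ≤ lv c p ∨ (p.1.degree : ℤ) ≤ m}

/-- Operators preserving the level and lowering the polynomial degree. -/
def Lowers (L : SF d R c →+ SF d R c) : Prop :=
  ∀ v m F, F ∈ Supp d R c (LowSet ι c v m) → L F ∈ Supp d R c (LowSet ι c v (m - 1))

lemma exists_mem_lowSet (F : SF d R c) (v : ℤ) : ∃ m : ℕ, F ∈ Supp d R c (LowSet ι c v m) := by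
  obtain ⟨m, hm⟩ := ((F.lf v).image fun p => p.1.degree).bddAbove
  refine ⟨m, fun p hp => ?_⟩
  by_cases h : v ≤ lv c p
  · exact Or.inl h
  · exact Or.inr (by exact_mod_cast hm ⟨p, ⟨(not_le.mp h).le, hp⟩, rfl⟩)

lemma mem_fil_of_lowSet {F : SF d R c} {v m : ℤ} (hm : m < 0) (h : F ∈ Supp d R c (LowSet ι c v m)) :
    F ∈ Fil d R c v := fun p hp => (h p hp).resolve_right (by
  have : (0 : ℤ) ≤ p.1.degree := Int.natCast_nonneg _
  linarith)

lemma Lowers.mem_fil {L : SF d R c →+ SF d R c} (hL : Lowers L) {v : ℤ} {F : SF d R c}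
    (hF : F ∈ Fil d R c v) : L F ∈ Fil d R c v :=
  mem_fil_of_lowSet (m := -1 - 1) (by norm_num) (hL v (-1) F fun p hp => Or.inl (hF p hp))

lemma Lowers.cont {L : SF d R c →+ SF d R c} (hL : Lowers L) : Cont L :=
  fun v => ⟨v, fun _ hF => hL.mem_fil hF⟩

lemma Lowers.iterate_mem {L : SF d R c →+ SF d R c} (hL : Lowers L) {v m : ℤ} {F : SF d R c}
    (hF : F ∈ Supp d R c (LowSet ι c v m)) (n : ℕ) :
    (L^[n] F) ∈ Supp d R c (LowSet ι c v (m - n)) := by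
  induction n with
  | zero => simpa using hF
  | succ n ih =>
    rw [iterate_succ_apply']
    have := hL _ _ _ ih
    rwa [show m - (n : ℤ) - 1 = m - ((n + 1 : ℕ) : ℤ) by push_cast; ring] at this

lemma Lowers.summ {L : SF d R c →+ SF d R c} (hL : Lowers L) (w : ℕ → R) (F : SF d R c) :
    Summ (fun n : ℕ => w n • L^[n] F) := summ_nat fun v => by
  obtain ⟨m, hm⟩ := exists_mem_lowSet F v
  refine ⟨m + 1, fun n hn => supp_smul (S := {p | v ≤ lv c p}) _
    (mem_fil_of_lowSet (m := m - n) (by omega) (hL.iterate_mem hm n))⟩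

/-- The operator `∑ w_n L^n`. -/
def Lowers.ser {L : SF d R c →+ SF d R c} (hL : Lowers L) (w : ℕ → R) : SF d R c →+ SF d R c where
  toFun F := fsum fun n : ℕ => w n • L^[n] F
  map_zero' := (isSum_zero.congr fun n => by
    rw [show L^[n] 0 = 0 from iterate_map_zero L n, smul_zero]).eq_fsum.symm
  map_add' F G := (hL.summ w _).isSum.unique (((hL.summ w F).isSum.add (hL.summ w G).isSum).congr
    fun n => by rw [iterate_map_add, smul_add])

lemma Lowers.isSum_ser {L : SF d R c →+ SF d R c} (hL : Lowers L) (w : ℕ → R) (F : SF d R c) :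
    IsSum (fun n : ℕ => w n • L^[n] F) (hL.ser w F) := (hL.summ w F).isSum

lemma Lowers.ser_mem_supp {L : SF d R c →+ SF d R c} (hL : Lowers L) (w : ℕ → R) {F : SF d R c}
    {S : Set (Mon ι)} (hF : F ∈ Supp d R c S) (hS : ∀ F ∈ Supp d R c S, L F ∈ Supp d R c S) :
    hL.ser w F ∈ Supp d R c S := (hL.isSum_ser w F).mem_supp fun n => supp_smul _ (by
  induction n with
  | zero => exact hF
  | succ n ih => rw [iterate_succ_apply']; exact hS _ ih)

lemma Lowers.ser_of_eq_zero {L : SF d R c →+ SF d R c} (hL : Lowers L) {w : ℕ → R} (h0 : w 0 = 1)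
    {F : SF d R c} (hF : L F = 0) : hL.ser w F = F := by
  refine (hL.isSum_ser w F).unique ?_
  have := (isSum_zero (κ := ℕ) (d := d) (R := R) (c := c)).congr
    (y' := fun n => w (n + 1) • L^[n + 1] F) (fun n => by
      rw [Function.iterate_succ_apply, hF, show L^[n] 0 = 0 from iterate_map_zero L n, smul_zero])
  have := IsSum.of_succ (y := fun n => w n • L^[n] F) this
  simpa [h0] using this

/-- The inverse of `1 - L`. -/
def Lowers.geo {L : SF d R c →+ SF d R c} (hL : Lowers L) : SF d R c →+ SF d R c := hL.ser fun _ => 1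

lemma Lowers.geo_eq_right {L : SF d R c →+ SF d R c} (hL : Lowers L) (F : SF d R c) :
    hL.geo (L F) = hL.geo F - F := by
  have := (hL.isSum_ser (fun _ => 1) F).succ
  exact (hL.isSum_ser (fun _ => 1) (L F)).unique (by simpa [Lowers.geo] using this)

lemma Lowers.geo_eq_left {L : SF d R c →+ SF d R c} (hL : Lowers L) (F : SF d R c) :
    L (hL.geo F) = hL.geo F - F := by
  have := (hL.isSum_ser (fun _ => 1) F).succ
  exact ((hL.isSum_ser (fun _ => 1) F).map hL.cont).unique
    (z' := hL.ser (fun _ => 1) F - F) (by simpa [iterate_succ_apply'] using this)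

/-! #### Diagonal operators and shifts -/

lemma diag_shift {w : (ι →₀ ℕ) → R} {L : SF d R c →+ SF d R c} (hL : Cont L)
    (hs : ∀ (r : R) F, L (r • F) = r • L F) (s : R)
    (h : ∀ I F, F ∈ Supp d R c {p | p.1 = I} → L F ∈ Supp d R c {p | w p.1 = w I + s})
    (F : SF d R c) : diag d R c w (L F) = L (diag d R c w F) + s • L F := by
  have hc : Cont (DistribSMul.toAddMonoidHom (SF d R c) s) := fun v =>
    ⟨v, fun F hF => supp_smul (S := {p | v ≤ lv c p}) s hF⟩
  have : (diag d R c w).comp L = L.comp (diag d R c w) +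
      (DistribSMul.toAddMonoidHom (SF d R c) s).comp L := by
    refine ext_of_mono ((cont_diag w).comp hL) ((hL.comp (cont_diag w)).add (hc.comp hL)) fun r p => ?_
    obtain ⟨I, g⟩ := p
    simp only [comp_apply, AddMonoidHom.add_apply, DistribSMul.toAddMonoidHom_apply]
    rw [diag_mono, hs]
    have hh := h I (mono d c r (I, g)) (mono_mem rfl)
    ext J m
    rw [coef_add, coef_smul, coef_diag, coef_smul]
    by_cases h0 : (L (mono d c r (I, g))).coef J m = 0
    · simp [h0]
    · rw [show w J = w I + s from hh (J, m) h0, add_mul]; rfl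
  exact DFunLike.congr_fun this F

end Linear

/-! ### The perturbed deformation retract -/

/-- The algebraic core of the homological perturbation lemma. -/
lemma perturbation_identity {E : Type*} [Ring E] {q D K Y J : E} (h1 : q * K + K * q = J - 1)
    (hDD : D * D = 0) (hqD : q * D = -(D * q)) (hKDJ : K * D * J = 0)
    (hY1 : D * K * Y = Y - 1) (hY2 : Y * (D * K) = Y - 1) :
    J * Y - 1 = (q + D) * (K * Y) + K * Y * (q + D) := by
  have e1 : Y * (D * K * q - q * D * K) * Y = Y * q - q * Y := by
    calc _ = (Y * (D * K)) * q * Y - Y * q * (D * K * Y) := by noncomm_ring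
      _ = _ := by rw [hY2, hY1]; noncomm_ring
  have e2 : D * K * q - q * D * K = D * (J - 1) := by
    rw [hqD, ← h1]; noncomm_ring
  have e3 : Y * D * Y = Y * D := by
    have : Y = 1 + D * K * Y := by rw [hY1]; noncomm_ring
    calc Y * D * Y = Y * D * (1 + D * K * Y) := by rw [← this]
      _ = Y * D + Y * (D * D) * K * Y := by noncomm_ring
      _ = _ := by rw [hDD]; noncomm_ring
  have e4 : Y * D * J = D * J := by
    have : Y = 1 + Y * (D * K) := by rw [hY2]; noncomm_ring
    calc Y * D * J = (1 + Y * (D * K)) * D * J := by rw [← this]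
      _ = D * J + Y * D * (K * D * J) := by noncomm_ring
      _ = _ := by rw [hKDJ]; noncomm_ring
  have e5 : Y * q + Y * D = q * Y + D * J * Y := by
    rw [e2] at e1
    calc Y * q + Y * D = q * Y + (Y * q - q * Y) + Y * D := by noncomm_ring
      _ = q * Y + Y * D * J * Y - Y * D * Y + Y * D := by rw [← e1]; noncomm_ring
      _ = _ := by rw [e3, e4]; noncomm_ring
  symm
  calc (q + D) * (K * Y) + K * Y * (q + D) = q * K * Y + D * K * Y + K * (Y * q + Y * D) := by
        noncomm_ring
    _ = (q * K + K * q) * Y + (Y - 1) + K * D * J * Y := by rw [e5, hY1]; noncomm_ring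
    _ = _ := by rw [h1, hKDJ]; noncomm_ring

lemma perturbation_identity_apply {A : Type*} [AddCommGroup A] {q D K Y J : A →+ A}
    (h1 : ∀ x, q (K x) + K (q x) = J x - x) (hDD : ∀ x, D (D x) = 0)
    (hqD : ∀ x, q (D x) = -D (q x)) (hKDJ : ∀ x, K (D (J x)) = 0)
    (hY1 : ∀ x, D (K (Y x)) = Y x - x) (hY2 : ∀ x, Y (D (K x)) = Y x - x) (x : A) :
    J (Y x) - x = (q (K (Y x)) + D (K (Y x))) + K (Y (q x + D x)) :=
  DFunLike.congr_fun (perturbation_identity (E := AddMonoid.End A) (q := q) (D := D) (K := K)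
    (Y := Y) (J := J) (AddMonoidHom.ext h1) (AddMonoidHom.ext hDD) (AddMonoidHom.ext hqD)
    (AddMonoidHom.ext hKDJ) (AddMonoidHom.ext hY1) (AddMonoidHom.ext hY2)) x

section Count

variable {ι : Type*} {h : ι → Prop}

lemma countNonH_add (I J : ι →₀ ℕ) : countNonH h (I + J) = countNonH h I + countNonH h J := by
  classical
  unfold countNonH
  exact Finsupp.sum_add_index' (fun i => by split_ifs <;> rfl) (fun i a b => by split_ifs <;> rfl)

open Classical in
lemma countNonH_single (i : ι) : countNonH h (single i 1) = if h i then 0 else 1 := by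
  unfold countNonH
  exact Finsupp.sum_single_index (by split_ifs <;> rfl)

lemma countNonH_eq_zero {I : ι →₀ ℕ} : countNonH h I = 0 ↔ ∀ i ∈ I.support, h i := by
  classical
  unfold countNonH Finsupp.sum
  rw [Finset.sum_eq_zero_iff]
  refine forall₂_congr fun i hi => ?_
  beta_reduce
  split_ifs with h'
  · simp [h']
  · simp only [h', iff_false]; exact Finsupp.mem_support_iff.mp hi

end Count

section Hodge

variable {ι : Type*} [LinearOrder ι] {d : ι → ℤ} {𝕜 : Type*} [Field 𝕜] [CharZero 𝕜]
  {R : Type*} [CommRing R] [Algebra 𝕜 R] {c : ℕ}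

/-- The matrix form of a Hodge decomposition: `μ` and `κ` are the matrices of the differential and
of its contracting homotopy acting on the coordinate functions. -/
structure HodgeData (d : ι → ℤ) (π : ι → ι → 𝕜) (h : ι → Prop) (μ κ : ι → ι →₀ 𝕜) : Prop where
  poisson : IsOddPoisson d π
  block : ∀ i j, π i j ≠ 0 → (h i ↔ h j)
  kdeg : ∀ j i, κ j i ≠ 0 → d i = d j + 1
  qdeg : ∀ j i, μ j i ≠ 0 → d i = d j - 1
  kH : ∀ j i, κ j i ≠ 0 → ¬ h j ∧ ¬ h i
  qH : ∀ j i, μ j i ≠ 0 → ¬ h j ∧ ¬ h i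
  kk : ∀ j, linearCombination 𝕜 κ (κ j) = 0
  qq : ∀ j, linearCombination 𝕜 μ (μ j) = 0
  homot : ∀ j, ¬ h j → linearCombination 𝕜 μ (κ j) + linearCombination 𝕜 κ (μ j) =
    -single j 1

variable {π : ι → ι → 𝕜} {h : ι → Prop} {μ κ : ι → ι →₀ 𝕜} (hd : HodgeData d π h μ κ)
include hd

namespace HodgeData

lemma kpar (j i) (hji : κ j i ≠ 0) : Even (d i - d j - 1) := by
  rw [hd.kdeg j i hji]; exact ⟨0, by ring⟩

lemma qpar (j i) (hji : μ j i ≠ 0) : Even (d i - d j - 1) := by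
  rw [hd.qdeg j i hji]; exact ⟨-1, by ring⟩

lemma κ_zero {j : ι} (hj : h j) : κ j = 0 := by
  ext i; by_contra h'; exact (hd.kH j i h').1 hj

lemma μ_zero {j : ι} (hj : h j) : μ j = 0 := by
  ext i; by_contra h'; exact (hd.qH j i h').1 hj

lemma isDer_k : IsDer 1 (lin d R c κ) := isDer_lin hd.kpar

lemma isDer_q : IsDer 1 (lin d R c μ) := isDer_lin hd.qpar

lemma sig_k (F : SF d R c) : sig d R c 1 (lin d R c κ F) = -lin d R c κ (sig d R c 1 F) := by
  rw [sig_lin hd.kpar]; simp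

lemma sig_q (F : SF d R c) : sig d R c 1 (lin d R c μ F) = -lin d R c μ (sig d R c 1 F) := by
  rw [sig_lin hd.qpar]; simp

lemma k_k (F : SF d R c) : lin d R c κ (lin d R c κ F) = 0 := by
  have e : (lin d R c κ).comp (lin d R c κ) = 0 :=
    (hd.isDer_k.comp_self hd.sig_k).ext (isDer_zero 0) fun i => by
      rw [comp_apply, lin_phi, lin_lcomb hd.kpar, hd.kk, map_zero,
        AddMonoidHom.zero_apply]
  exact DFunLike.congr_fun e F

lemma q_q (F : SF d R c) : lin d R c μ (lin d R c μ F) = 0 := by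
  have e : (lin d R c μ).comp (lin d R c μ) = 0 :=
    (hd.isDer_q.comp_self hd.sig_q).ext (isDer_zero 0) fun i => by
      rw [comp_apply, lin_phi, lin_lcomb hd.qpar, hd.qq, map_zero,
        AddMonoidHom.zero_apply]
  exact DFunLike.congr_fun e F

lemma q_k_add (F : SF d R c) : lin d R c μ (lin d R c κ F) + lin d R c κ (lin d R c μ F) =
    -diag d R c (fun I => (countNonH h I : R)) F := by
  classical
  have hw : ∀ I J : ι →₀ ℕ, (countNonH h (I + J) : R) = countNonH h I + countNonH h J :=
    fun I J => by rw [countNonH_add]; push_cast; ring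
  suffices e : (lin d R c μ).comp (lin d R c κ) + (lin d R c κ).comp (lin d R c μ) =
      -diag d R c (fun I => (countNonH h I : R)) from DFunLike.congr_fun e F
  refine (hd.isDer_q.comm hd.isDer_k hd.sig_q hd.sig_k).ext (isDer_diag hw).neg fun i => ?_
  rw [AddMonoidHom.add_apply, comp_apply, comp_apply, lin_phi, lin_phi,
    lin_lcomb hd.kpar, lin_lcomb hd.qpar, ← map_add, AddMonoidHom.neg_apply]
  have e : diag d R c (fun I => (countNonH h I : R)) (phi d R c i) =
      (countNonH h (single i 1) : R) • phi d R c i := diag_mono _ _ _ _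
  rw [e, countNonH_single]
  by_cases hi : h i
  · simp [hi, hd.κ_zero hi, hd.μ_zero hi]
  · rw [hd.homot i hi, if_neg hi]
    simp [lcomb]

lemma count_lin {ν : ι → ι →₀ 𝕜} (hν : ∀ j i, ν j i ≠ 0 → ¬ h j ∧ ¬ h i) {T : Set ℕ} {F : SF d R c}
    (hF : F ∈ Supp d R c {p | countNonH h p.1 ∈ T}) :
    lin d R c ν F ∈ Supp d R c {p | countNonH h p.1 ∈ T} := by
  classical
  refine lin_mem_supp (fun i j hij p hp => ?_) hF
  obtain ⟨h1, h2⟩ := hν i j hij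
  simp only [mem_ofPred_eq, Prod.fst_add, countNonH_add, countNonH_single] at *
  simpa [h1, h2] using hp

lemma diag_lin {n : ℤ} {ν : ι → ι →₀ 𝕜} (hν : ∀ j i, ν j i ≠ 0 → ¬ h j ∧ ¬ h i)
    (hp : ∀ j i, ν j i ≠ 0 → Even (d i - d j - n)) (f : ℕ → R) (F : SF d R c) :
    lin d R c ν (diag d R c (fun I => f (countNonH h I)) F) =
      diag d R c (fun I => f (countNonH h I)) (lin d R c ν F) :=
  diag_comm (isDer_lin hp).cont (isDer_lin hp).smul (fun I F hF => by
    have := hd.count_lin hν (T := {countNonH h I}) (supp_mono (fun p hp => by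
      rw [mem_ofPred_eq] at *; rw [hp]; rfl) hF)
    exact supp_mono (fun p hp => by
      rw [mem_ofPred_eq, Set.mem_singleton_iff] at hp; rw [mem_ofPred_eq, hp]) this) F

lemma lin_inc {ν : ι → ι →₀ 𝕜} (hν : ∀ j i, ν j i ≠ 0 → ¬ h j ∧ ¬ h i) (F) :
    lin d R c ν (inc d R c h F) = 0 :=
  (isSum_vf _).unique (isSum_zero.congr fun j => by
    by_cases hj : h j
    · have : ν j = 0 := by ext i; by_contra h'; exact (hν j i h').1 hj
      rw [this, map_zero, zero_mul]
    · rw [der_inc_of_not hj, mul_zero])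

end HodgeData

/-- The homotopy `K`. -/
def Kop (d : ι → ℤ) (h : ι → Prop) (κ : ι → ι →₀ 𝕜) : SF d 𝕜 0 →+ SF d 𝕜 0 :=
  (diag d 𝕜 0 fun I => ((countNonH h I : ℕ) : 𝕜)⁻¹).comp (lin d 𝕜 0 κ)

omit hd [CharZero 𝕜] in
lemma Kop_mem_supp {S T : Set (Mon ι)} {F : SF d 𝕜 0}
    (hST : ∀ i j, κ i j ≠ 0 → ∀ p, p + (single i 1, 0) ∈ S → p + (single j 1, 0) ∈ T)
    (hF : F ∈ Supp d 𝕜 0 S) : Kop d h κ F ∈ Supp d 𝕜 0 T := diag_mem_supp (lin_mem_supp hST hF)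

omit hd [CharZero 𝕜] in
lemma Kop_mem_fil {v : ℤ} {F : SF d 𝕜 0} (hF : F ∈ Fil d 𝕜 0 v) : Kop d h κ F ∈ Fil d 𝕜 0 v :=
  diag_mem_supp (S := {p | v ≤ lv 0 p}) (lin_mem_fil hF)

omit hd [CharZero 𝕜] in
lemma cont_Kop : Cont (Kop d h κ) := fun v => ⟨v, fun _ hF => Kop_mem_fil hF⟩

omit hd in
lemma dl_lowSet {v m : ℤ} {F : SF d R 0} (hF : F ∈ Supp d R 0 (LowSet ι 0 v m)) :
    dl d R 0 π F ∈ Supp d R 0 (LowSet ι 0 v (m - 1)) := by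
  have h1 : lap d R 0 π F ∈ Supp d R 0 (LowSet ι 0 (v - 2) (m - 1)) := by
    refine lap_mem_supp (fun i j p _ hp => ?_) hF
    rcases hp with hp | hp
    · left; rw [lv_add, lv_add, lv_single, lv_single] at hp; push_cast at *; linarith
    · right; simp only [Prod.fst_add, map_add, degree_single] at hp; push_cast at hp; linarith
  rw [dl_apply]
  refine mul_mem_supp (S := {p | p = (0, 1)}) ?_ (mono_mem rfl) h1
  rintro p rfl q hq
  rcases hq with hq | hq
  · left; rw [lv_add]; simp only [lv] at *; simp at *; linarith
  · right; simpa using hq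

omit hd [CharZero 𝕜] in
lemma lin_lowSet {v m : ℤ} {F : SF d R 0} (hF : F ∈ Supp d R 0 (LowSet ι 0 v m)) :
    lin d R 0 κ F ∈ Supp d R 0 (LowSet ι 0 v m) := by
  refine lin_mem_supp (fun i j _ p hp => ?_) hF
  rcases hp with hp | hp
  · left; rw [lv_add, lv_single] at *; exact hp
  · right; simpa using hp

omit hd in
lemma lowers_dl_Kop : Lowers ((dl d 𝕜 0 π).comp (Kop d h κ)) := by
  intro v m F hF
  rw [comp_apply]
  refine dl_lowSet ?_
  unfold Kop
  rw [comp_apply]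
  exact diag_mem_supp (lin_lowSet hF)

/-- The series `∑ (ħ Δ K)^n`. -/
def Yop (d : ι → ℤ) (π : ι → ι → 𝕜) (h : ι → Prop) (κ : ι → ι →₀ 𝕜) : SF d 𝕜 0 →+ SF d 𝕜 0 :=
  (lowers_dl_Kop (d := d) (π := π) (h := h) (κ := κ)).geo

omit hd in
lemma dl_Kop_Yop (F : SF d 𝕜 0) : dl d 𝕜 0 π (Kop d h κ (Yop d π h κ F)) = Yop d π h κ F - F := by
  have := (lowers_dl_Kop (d := d) (π := π) (h := h) (κ := κ)).geo_eq_left F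
  rw [comp_apply] at this
  exact this

omit hd in
lemma Yop_dl_Kop (F : SF d 𝕜 0) : Yop d π h κ (dl d 𝕜 0 π (Kop d h κ F)) = Yop d π h κ F - F := by
  have := (lowers_dl_Kop (d := d) (π := π) (h := h) (κ := κ)).geo_eq_right F
  rw [comp_apply] at this
  exact this

namespace HodgeData

lemma Kop_Kop (F : SF d 𝕜 0) : Kop d h κ (Kop d h κ F) = 0 := by
  unfold Kop
  simp only [comp_apply]
  rw [hd.diag_lin hd.kH hd.kpar (fun n => (n : 𝕜)⁻¹), hd.k_k, map_zero, map_zero]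

lemma Kop_inc (F) : Kop d h κ (inc d 𝕜 0 h F) = 0 := by
  unfold Kop
  rw [comp_apply, hd.lin_inc hd.kH, map_zero]

omit hd [CharZero 𝕜] in
lemma _root_.BVCalc.SF.prj_Kop (F : SF d 𝕜 0) : prj d 𝕜 0 h (Kop d h κ F) = 0 := by
  ext I g
  rw [coef_prj]
  change ((countNonH h (em I) : ℕ) : 𝕜)⁻¹ * _ = 0
  rw [countNonH_eq_zero.mpr fun i hi => em_support I hi]
  simp

omit hd in
lemma _root_.BVCalc.SF.inc_prj_eq (F : SF d 𝕜 0) : inc d 𝕜 0 h (prj d 𝕜 0 h F) =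
    F - diag d 𝕜 0 (fun I => ((countNonH h I : ℕ) : 𝕜)⁻¹)
      (diag d 𝕜 0 (fun I => ((countNonH h I : ℕ) : 𝕜)) F) := by
  classical
  ext I g
  rw [coef_inc, coef_sub, coef_diag, coef_diag]
  by_cases hI : ∀ i ∈ I.support, h i
  · rw [if_pos hI, coef_prj, em_subtypeDomain hI, countNonH_eq_zero.mpr hI]; simp
  · rw [if_neg hI]
    have : ((countNonH h I : ℕ) : 𝕜) ≠ 0 := by
      rw [Nat.cast_ne_zero]; exact fun h' => hI (countNonH_eq_zero.mp h')
    field_simp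
    simp

lemma q_Kop_add (F : SF d 𝕜 0) : lin d 𝕜 0 μ (Kop d h κ F) + Kop d h κ (lin d 𝕜 0 μ F) =
    inc d 𝕜 0 h (prj d 𝕜 0 h F) - F := by
  unfold Kop
  simp only [comp_apply]
  rw [hd.diag_lin hd.qH hd.qpar (fun n => (n : 𝕜)⁻¹), ← map_add, hd.q_k_add, inc_prj_eq, map_neg]
  abel

lemma Yop_Kop (F : SF d 𝕜 0) : Yop d π h κ (Kop d h κ F) = Kop d h κ F :=
  lowers_dl_Kop.ser_of_eq_zero rfl (by rw [comp_apply, hd.Kop_Kop, map_zero])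

lemma Kop_dl_inc (F) : Kop d h κ (dl d 𝕜 0 π (inc d 𝕜 0 h F)) = 0 := by
  rw [dl_inc, hd.Kop_inc]

/-- The homotopy identity of the perturbed retract. -/
lemma perturbed_homotopy (hqD : ∀ F, lin d 𝕜 0 μ (dl d 𝕜 0 π F) = -dl d 𝕜 0 π (lin d 𝕜 0 μ F))
    (F : SF d 𝕜 0) :
    inc d 𝕜 0 h (prj d 𝕜 0 h (Yop d π h κ F)) - F =
      (lin d 𝕜 0 μ (Kop d h κ (Yop d π h κ F)) + dl d 𝕜 0 π (Kop d h κ (Yop d π h κ F))) +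
      Kop d h κ (Yop d π h κ (lin d 𝕜 0 μ F + dl d 𝕜 0 π F)) := by
  have h1 : ∀ F, Kop d h κ (dl d 𝕜 0 π (((inc d 𝕜 0 h).toAddMonoidHom.comp
      (prj d 𝕜 0 h).toAddMonoidHom) F)) = 0 := fun F => hd.Kop_dl_inc _
  exact perturbation_identity_apply (J := (inc d 𝕜 0 h).toAddMonoidHom.comp
    (prj d 𝕜 0 h).toAddMonoidHom) hd.q_Kop_add (dl_dl hd.poisson) hqD h1
    dl_Kop_Yop Yop_dl_Kop F

end HodgeData

end Hodge

/-! ### The genus of the effective action -/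

section Genus

open Polynomial

variable {ι : Type*} [LinearOrder ι] {d : ι → ℤ} {K : Type*} [Field K] [CharZero K]
  {R : Type*} [CommRing R] [Algebra K R] {c : ℕ}
  {π : ι → ι → K} {h : ι → Prop} {μ κ : ι → ι →₀ K}

lemma mem_supp_inter {S T : Set (Mon ι)} {F : SF d R c} (hS : F ∈ Supp d R c S)
    (hT : F ∈ Supp d R c T) : F ∈ Supp d R c (S ∩ T) := fun p hp => ⟨hS p hp, hT p hp⟩

lemma mem_supp_of_dt {S : Set (Mon ι)} {F : SF d K[X] c} (h1 : dt F ∈ Supp d K[X] c S)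
    (h0 : ev 0 F ∈ Supp d K c S) : F ∈ Supp d K[X] c S := fun p hp => by
  by_contra hpS
  apply hp
  have e1 : derivative (F.coef p.1 p.2) = 0 := by
    by_contra h'; exact hpS (h1 p h')
  have e0 : (F.coef p.1 p.2).eval 0 = 0 := by
    by_contra h'; exact hpS (h0 p h')
  have := Polynomial.eq_C_of_derivative_eq_zero e1
  rw [this] at e0 ⊢
  rw [eval_C] at e0
  rw [e0, C_0]

lemma dt_smul_cst (p : K[X]) (F : SF d K c) : dt (p • cst F) = derivative p • cst F := by
  ext1; funext I g
  simp [coef_dt, coef_smul, coef_cst]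

lemma ev_smul_cst (x : K) (p : K[X]) (F : SF d K c) : ev x (p • cst F) = p.eval x • F := by
  ext I g
  simp [coef_ev, coef_smul, coef_cst]

lemma C_smul (r x : K) : (C : K →+* K[X]) (r • x) = r • C x := by rw [smul_eq_mul, C_mul, smul_eq_C_mul]

lemma dl_cst (F : SF d K c) : dl d K[X] c π (cst F) = cst (dl d K c π F) := by
  have h1 : cst (lap d K c π F) = lap d K[X] c π (cst F) :=
    mapC_lap (f := (C : K →+* K[X]).toAddMonoidHom) C_smul π F
  have h2 : cst (hb d K c 1) = hb d K[X] c 1 := by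
    classical
    ext1; funext I g
    rw [coef_cst, hb, hb, coef_mono, coef_mono]
    split_ifs <;> simp
  rw [dl_apply, dl_apply, map_mul, h1, h2]

/-- The anticommutator of `ħ Δ` and the vector field of `κ`. -/
def lapk (d : ι → ℤ) (R : Type*) [CommRing R] [Algebra K R] (π : ι → ι → K) (κ : ι → ι →₀ K) :
    SF d R 0 →+ SF d R 0 := (dl d R 0 π).comp (lin d R 0 κ) + (lin d R 0 κ).comp (dl d R 0 π)

lemma lapk_apply (F : SF d R 0) : lapk d R π κ F =
    dl d R 0 π (lin d R 0 κ F) + lin d R 0 κ (dl d R 0 π F) := rfl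

lemma lowers_lapk : Lowers (lapk d R π κ) := fun v m F hF => by
  rw [lapk_apply]
  exact add_mem (dl_lowSet (lin_lowSet hF)) (lin_lowSet (dl_lowSet hF))

lemma lapk_cst (F : SF d K 0) : lapk d K[X] π κ (cst F) = cst (lapk d K π κ F) := by
  have : ∀ F, lin d K[X] 0 κ (cst F) = cst (lin d K 0 κ F) := fun F => (mapR_lin C_smul κ F).symm
  rw [lapk_apply, lapk_apply, this, dl_cst, dl_cst, this, map_add]

/-- The weights of the exponential series of half an operator. -/
def hw (K : Type*) [Field K] (n : ℕ) : K := ((2 : K) ^ n * (n.factorial : K))⁻¹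

lemma hw_succ (n : ℕ) : hw K (n + 1) * (2 * ((n : K) + 1)) = hw K n := by
  have h1 : ((n : K) + 1) ≠ 0 := by exact_mod_cast Nat.succ_ne_zero n
  have h2 : ((n.factorial : ℕ) : K) ≠ 0 := by exact_mod_cast Nat.factorial_ne_zero n
  have h3 : (2 : K) ^ n ≠ 0 := pow_ne_zero _ two_ne_zero
  unfold hw
  rw [Nat.factorial_succ, pow_succ]
  push_cast
  field_simp

/-- The exponential of half the anticommutator. -/
def elapk (d : ι → ℤ) (π : ι → ι → K) (κ : ι → ι →₀ K) : SF d K 0 →+ SF d K 0 :=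
  (lowers_lapk (d := d) (π := π) (κ := κ)).ser (hw K)

namespace HodgeData

variable (hd : HodgeData d π h μ κ)
include hd

open Classical in
lemma lap_split (F : SF d R c) : lap d R c π F =
    lap d R c (fun i j => if h i then π i j else 0) F +
      lap d R c (fun i j => if h i then 0 else π i j) F :=
  (isSum_lap π F).unique (((isSum_lap _ F).add (isSum_lap _ F)).congr fun p => by
    unfold lw; beta_reduce; split_ifs <;> simp)

open Classical in
lemma lin_lapH (F : SF d R c) : lin d R c κ (lap d R c (fun i j => if h i then π i j else 0) F) =
    -lap d R c (fun i j => if h i then π i j else 0) (lin d R c κ F) :=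
  ((isSum_lap _ F).map hd.isDer_k.cont).unique ((isSum_lap _ _).neg.congr fun p => by
    by_cases h0 : (if h p.1 then π p.1 p.2 else 0) = 0
    · simp [lw, h0]
    have h1 : h p.1 := by by_contra h'; simp [h'] at h0
    have h2 : π p.1 p.2 ≠ 0 := by simpa [h1] using h0
    have h3 := (hd.block _ _ h2).mp h1
    have key : ∀ i, h i → ∀ G : SF d R c, lin d R c κ (der d R c i G) =
        sg R (d i) • der d R c i (lin d R c κ G) := fun i hi G => by
      rw [der_lin hd.kpar (fun j => by by_contra h'; exact (hd.kH j i h').2 hi), one_mul, smul_smul,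
        sg_mul_self, one_smul]
    rw [hd.isDer_k.smul', key _ h1, key _ h3, der_smul, smul_smul, ← sg_add,
      hd.poisson.degree _ _ h2, sg_one, neg_one_smul, smul_neg])

lemma dl_eq : ∃ L : SF d R c →+ SF d R c, Cont L ∧ (∀ (r : R) F, L (r • F) = r • L F) ∧
    (∀ n, ∀ F ∈ Supp d R c {p | countNonH h p.1 = n}, L F ∈ Supp d R c {p | countNonH h p.1 + 2 = n}) ∧
    ∀ F, dl d R c π (lin d R c κ F) + lin d R c κ (dl d R c π F) =
      L (lin d R c κ F) + lin d R c κ (L F) := by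
  classical
  set π' : ι → ι → K := fun i j => if h i then 0 else π i j with hπ'
  refine ⟨dl d R c π', cont_dl π', fun r F => ?_, fun n F hF => ?_, fun F => ?_⟩
  · rw [dl_apply, dl_apply, ← mul_smul_comm]
    congr 1
    exact (isSum_lap _ _).unique (((isSum_lap π' F).smul r).congr fun p => by
      rw [der_smul, der_smul, smul_comm])
  · rw [dl_apply]
    refine mul_mem_supp (S := {p | p = (0, 1)}) (T := {p | countNonH h p.1 + 2 = n}) ?_
      (mono_mem rfl) (lap_mem_supp (fun i j p hij hp => ?_) hF)
    · rintro p rfl q hq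
      simpa using hq
    · have h1 : ¬ h i := fun h' => hij (by simp [hπ', h'])
      have h2 : ¬ h j := fun h' => h1 ((hd.block i j (by simpa [hπ', h1] using hij)).mpr h')
      simp only [mem_ofPred_eq, Prod.fst_add, countNonH_add, countNonH_single, h1, h2] at *
      simpa using hp
  · simp only [dl_apply, lap_split hd, mul_add, map_add, hd.isDer_k.hb_mul, hd.lin_lapH, mul_neg]
    simp only [hπ']
    abel

lemma count_lapk (F : SF d R 0) : diag d R 0 (fun I => (countNonH h I : R)) (lapk d R π κ F) =
    lapk d R π κ (diag d R 0 (fun I => (countNonH h I : R)) F) + (-2 : R) • lapk d R π κ F := by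
  obtain ⟨L, hL1, hL2, hL3, hL4⟩ := hd.dl_eq (R := R) (c := 0)
  have e : lapk d R π κ = L.comp (lin d R 0 κ) + (lin d R 0 κ).comp L :=
    AddMonoidHom.ext hL4
  refine diag_shift lowers_lapk.cont (fun r F => ?_) (-2) (fun I F hF => ?_) F
  · rw [e]
    simp [hL2, hd.isDer_k.smul]
  · have h0 : F ∈ Supp d R 0 {p | countNonH h p.1 ∈ ({countNonH h I} : Set ℕ)} :=
      supp_mono (fun p hp => by rw [mem_ofPred_eq] at *; rw [hp]; rfl) hF
    have h1 := hL3 _ _ (hd.count_lin hd.kH h0)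
    have h2 := hd.count_lin hd.kH (T := {m | m + 2 = countNonH h I}) (hL3 _ _ h0)
    rw [e]
    refine supp_mono (fun p hp => ?_) (add_mem h1 h2)
    simp only [mem_ofPred_eq] at *
    rw [← hp]; push_cast; ring

lemma prj_lin (F : SF d K 0) : prj d K 0 h (lin d K 0 κ F) = 0 := by
  classical
  have h1 : lin d K 0 κ F ∈ Supp d K 0 {p | countNonH h p.1 ≠ 0} :=
    lin_mem_supp (S := Set.univ) (fun i j hij p _ => by
      simp [countNonH_add, countNonH_single, (hd.kH i j hij).2]) fun _ _ => trivial
  ext I g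
  by_contra h'
  exact h1 (em I, g) h' (countNonH_eq_zero.mpr fun i hi => em_support I hi)

lemma prj_elapk_count (F : SF d K 0) :
    prj d K 0 h (elapk d π κ (diag d K 0 (fun I => (countNonH h I : K)) F)) =
      prj d K 0 h (elapk d π κ (lapk d K π κ F)) := by
  set N := diag d K 0 (fun I => (countNonH h I : K)) with hN
  have hPN : ∀ G, prj d K 0 h (N G) = 0 := fun G => by
    ext I g
    rw [coef_prj, coef_diag, countNonH_eq_zero.mpr fun i hi => em_support I hi]; simp
  have hit : ∀ n : ℕ, prj d K 0 h ((lapk d K π κ)^[n] (N F)) =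
      (2 * (n : K)) • prj d K 0 h ((lapk d K π κ)^[n] F) := by
    have : ∀ n : ℕ, (lapk d K π κ)^[n] (N F) = N ((lapk d K π κ)^[n] F) +
        (2 * (n : K)) • (lapk d K π κ)^[n] F := by
      intro n
      induction n with
      | zero => simp
      | succ n ih =>
        have hs : ∀ (r : K) G, lapk d K π κ (r • G) = r • lapk d K π κ G := fun r G => by
          rw [lapk_apply, lapk_apply, hd.isDer_k.smul, dl_smul, dl_smul, hd.isDer_k.smul, smul_add]
        rw [iterate_succ_apply', ih, map_add, hs, iterate_succ_apply', hN,
          hd.count_lapk]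
        push_cast
        module
    intro n
    rw [this, map_add, hPN, zero_add, prj_smul]
  have h1 := ((lowers_lapk (π := π) (κ := κ)).isSum_ser (hw K) (N F)).map (cont_prj (h := h))
  have h2 := ((lowers_lapk (π := π) (κ := κ)).isSum_ser (hw K) (lapk d K π κ F)).map (cont_prj (h := h))
  refine h1.unique ?_
  have h3 := h2.congr (y' := fun n : ℕ => prj d K 0 h (hw K (n + 1) • (lapk d K π κ)^[n + 1] (N F)))
    fun n => by
      change _ = prj d K 0 h (hw K n • _)
      rw [prj_smul, hit, smul_smul, prj_smul, ← hw_succ n, Function.iterate_succ_apply]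
      push_cast; rfl
  have h4 := IsSum.of_succ (y := fun n : ℕ => prj d K 0 h (hw K n • (lapk d K π κ)^[n] (N F))) h3
  have h5 : prj d K 0 h (hw K 0 • (lapk d K π κ)^[0] (N F)) = 0 := by
    rw [prj_smul, Function.iterate_zero_apply, hPN, smul_zero]
  rw [h5, zero_add] at h4
  exact h4

lemma prj_elapk_lin (F : SF d K 0) : prj d K 0 h (elapk d π κ (lin d K 0 κ F)) = 0 := by
  refine (((lowers_lapk (π := π) (κ := κ)).isSum_ser (hw K) _).map (cont_prj (h := h))).unique
    (isSum_zero.congr fun n => ?_)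
  have : ∀ n : ℕ, (lapk d K π κ)^[n] (lin d K 0 κ F) = lin d K 0 κ ((lapk d K π κ)^[n] F) := by
    intro n
    induction n with
    | zero => rfl
    | succ n ih =>
      rw [iterate_succ_apply', ih, iterate_succ_apply', lapk_apply, lapk_apply,
        map_add, hd.k_k, hd.k_k, map_zero, zero_add, add_zero]
  change prj d K 0 h _ = 0
  rw [prj_smul, this, hd.prj_lin, smul_zero]

/-- The perturbed projection through the exponential of a second order operator. -/
lemma prj_Yop (F : SF d K 0) :
    prj d K 0 h (Yop d π h κ F) = prj d K 0 h (elapk d π κ F) := by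
  set x := Yop d π h κ F with hx
  set u := diag d K 0 (fun I => ((countNonH h I : ℕ) : K)⁻¹) x with hu
  have e1 : diag d K 0 (fun I => (countNonH h I : K)) u = x - inc d K 0 h (prj d K 0 h x) := by
    rw [inc_prj_eq, sub_sub_cancel, hu]
    ext I g
    simp only [coef_diag]; ring
  have e2 : lin d K 0 κ u = Kop d h κ x := hd.diag_lin hd.kH hd.kpar (fun n => (n : K)⁻¹) x
  have e3 : F = inc d K 0 h (prj d K 0 h x) + (diag d K 0 (fun I => (countNonH h I : K)) u -
      lapk d K π κ u) + lin d K 0 κ (dl d K 0 π u) := by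
    rw [lapk_apply, e1, e2, hx, dl_Kop_Yop]; abel
  have e4 : elapk d π κ (inc d K 0 h (prj d K 0 h x)) = inc d K 0 h (prj d K 0 h x) :=
    lowers_lapk.ser_of_eq_zero (by simp [hw]) (by
      rw [lapk_apply, hd.lin_inc hd.kH, dl_inc, hd.lin_inc hd.kH, map_zero, add_zero])
  conv_rhs => rw [e3]
  simp only [map_add, map_sub, e4, hd.prj_elapk_count, hd.prj_elapk_lin, prj_inc, sub_self, add_zero]

lemma lapk_par {F : SF d R 0} (hF : F ∈ Par d R 0 0) : lapk d R π κ F ∈ Par d R 0 0 := by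
  rw [lapk_apply, par_congr (m := 0) (n := 0 + 1 + 1) (by decide)]
  exact add_mem (dl_par hd.poisson (lin_par hd.kpar hF)) (lin_par hd.kpar (dl_par hd.poisson hF))

lemma lapk_one : lapk d R π κ 1 = 0 := by
  rw [lapk_apply, hd.isDer_k.one, map_zero, zero_add, dl_apply]
  have : lap d R 0 π (1 : SF d R 0) = 0 :=
    (isSum_lap π _).unique (isSum_zero.congr fun p => by rw [der_one, map_zero, smul_zero])
  rw [this, mul_zero, map_zero]

lemma lapk_ex [Algebra ℚ R] {a : SF d R 0} (ha : a ∈ Fil d R 0 1) (ha0 : a ∈ Par d R 0 0) :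
    lapk d R π κ (ex a) = ex a * (lapk d R π κ a + hb d R 0 1 * br π a (lin d R 0 κ a) +
      (1 / 2 : K) • lin d R 0 κ (hb d R 0 1 * br π a a)) := by
  have h0 : (0 : SF d R 0) ∈ Par d R 0 0 := zero_mem _
  have ht : ∀ G, tw π (0 : SF d R 0) G = dl d R 0 π G := fun G => by rw [tw_apply, br_zero_left, add_zero]
  have hkex : lin d R 0 κ (ex a) = ex a * lin d R 0 κ a :=
    deriv_ex hd.isDer_k.cont (fun G => by rw [hd.isDer_k.mul, sig_even_par ha0])
      (central_of_even ha0) hd.isDer_k.one ha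
  have h1 := tw_ex_mul hd.poisson h0 ha ha0 (lin d R 0 κ a)
  have h2 := tw_ex hd.poisson (S := 0) ha ha0
  simp only [ht] at h1 h2
  rw [zero_add, tw_apply, br_hb_left, h2] at h1
  rw [lapk_apply, hkex, h1, h2, hd.isDer_k.mul, sig_even_par (ex_even ha ha0), hkex, map_add,
    hd.isDer_k.smul', lapk_apply]
  set M := dl d R 0 π a + (1 / 2 : K) • (hb d R 0 1 * br π a a) with hM
  have hMp : M ∈ Par d R 0 (0 + 1) := by
    refine add_mem (dl_par hd.poisson ha0) (supp_smul _ ?_)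
    have := mul_par (hb_par (R := R) (c := 0) 1) (br_par hd.poisson ha0 ha0)
    rwa [zero_add, zero_add] at this
  have hk1 : lin d R 0 κ a ∈ Par d R 0 (0 + 1) := lin_par hd.kpar ha0
  have hanti : M * lin d R 0 κ a = -(lin d R 0 κ a * M) := by
    rw [mul_comm_of_par hMp, sig_of_par hk1]; simp
  rw [mul_assoc, hanti, mul_assoc]
  noncomm_ring

/-- The genus of the effective action is nonnegative. -/
lemma genus_lg {b : SF d K 0} (hb1 : b ∈ Fil d K 0 1) (hb0 : b ∈ Par d K 0 0)
    (hbg : b ∈ Supp d K 0 {p | -1 ≤ p.2}) :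
    lg (prj d K 0 h (Yop d π h κ (ex b))) ∈ Supp _ K 0 {p | -1 ≤ p.2} := by
  set G := lapk d K[X] π κ with hG
  set w : ℕ → K[X] := fun n => C (hw K n) * X ^ n with hw'
  set Z := (lowers_lapk (R := K[X]) (d := d) (π := π) (κ := κ)).ser w (cst (ex b)) with hZ
  have hit : ∀ n : ℕ, G^[n] (cst (ex b)) = cst ((lapk d K π κ)^[n] (ex b)) := by
    intro n
    induction n with
    | zero => rfl
    | succ n ih => rw [iterate_succ_apply', ih, iterate_succ_apply', hG, lapk_cst]
  have hsZ : IsSum (fun n : ℕ => w n • cst ((lapk d K π κ)^[n] (ex b))) Z :=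
    (lowers_lapk.isSum_ser w (cst (ex b))).congr fun n => by rw [← hit]
  have hev : ∀ x : K, IsSum (fun n : ℕ => (hw K n * x ^ n) • (lapk d K π κ)^[n] (ex b)) (ev x Z) :=
    fun x => (hsZ.map (cont_ev x)).congr fun n => by
      change _ = ev x _
      rw [ev_smul_cst, hw']; simp
  have hZ0 : ev 0 Z = ex b := by
    refine (hev 0).unique ?_
    have := isSum_finset {0} (fun n : ℕ => (hw K n * 0 ^ n) • (lapk d K π κ)^[n] (ex b))
      fun n hn => by
        rw [Finset.mem_singleton] at hn
        rw [zero_pow hn, mul_zero, zero_smul]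
    simpa [hw] using this
  have hZ1 : ev 1 Z = elapk d π κ (ex b) :=
    (hev 1).unique ((lowers_lapk.isSum_ser (hw K) (ex b)).congr fun n => by simp)
  have hdZ : dt Z = (1 / 2 : K) • G Z := by
    refine IsSum.unique (y := fun n : ℕ => (derivative (w (n + 1))) •
      cst ((lapk d K π κ)^[n + 1] (ex b))) ?_ ?_
    · have := ((hsZ.map cont_dt).congr (y' := fun n : ℕ => derivative (w n) •
        cst ((lapk d K π κ)^[n] (ex b))) fun n => by rw [dt_smul_cst]).succ
      have e : derivative (w 0) = 0 := by simp [hw']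
      simpa only [e, zero_smul, sub_zero] using this
    · refine ((hsZ.map lowers_lapk.cont).smul (1 / 2 : K)).congr fun n => ?_
      have hs : ∀ (r : K[X]) H, G (r • H) = r • G H := fun r H => by
        have : ∀ H, lap d K[X] 0 π (r • H) = r • lap d K[X] 0 π H := fun H =>
          (isSum_lap π _).unique (((isSum_lap π H).smul r).congr fun p => by
            rw [der_smul, der_smul, smul_comm])
        rw [hG, lapk_apply, lapk_apply, hd.isDer_k.smul, dl_apply, dl_apply, dl_apply, dl_apply,
          this, this, mul_smul_comm, mul_smul_comm, hd.isDer_k.smul, smul_add]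
      rw [hs, hG, lapk_cst, ← iterate_succ_apply' (lapk d K π κ), ← algebraMap_smul',
        smul_smul, hw']
      congr 1
      beta_reduce
      rw [Polynomial.derivative_C_mul_X_pow, ← hw_succ n, Polynomial.algebraMap_apply,
        Algebra.algebraMap_self, RingHom.id_apply, ← mul_assoc, ← C_mul]
      congr 2
      push_cast; ring
  have hZf : Z - 1 ∈ Fil d K[X] 0 1 := by
    have h1 : (lowers_lapk (R := K[X]) (d := d) (π := π) (κ := κ)).ser w 1 = 1 :=
      lowers_lapk.ser_of_eq_zero (by simp [hw', hw]) hd.lapk_one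
    rw [← h1, hZ, ← map_sub, ← map_one cst, ← map_sub]
    exact lowers_lapk.ser_mem_supp (S := {p | 1 ≤ lv 0 p}) w
      (cst_mem_supp (ex_sub_one_mem le_rfl hb1)) fun _ h => lowers_lapk.mem_fil h
  have hZp : Z ∈ Par d K[X] 0 0 := lowers_lapk.ser_mem_supp (S := {p | Even (monDegree d p.1 - 0)}) w
    (cst_mem_supp (ex_even hb1 hb0)) fun _ h => hd.lapk_par h
  set a := lg Z with ha
  have haf : a ∈ Fil d K[X] 0 1 := lg_mem_fil hZf
  have hap : a ∈ Par d K[X] 0 0 := lg_even hZf hZp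
  have hea : ex a = Z := ex_lg hZf hZp
  have hev0 : ev 0 a = b := by
    rw [ha, ev_lg 0 hZf, hZ0, lg_ex hb1 hb0]
  have hda : dt a = (1 / 2 : K) • (G a + hb d K[X] 0 1 * br π a (lin d K[X] 0 κ a) +
      (1 / 2 : K) • lin d K[X] 0 κ (hb d K[X] 0 1 * br π a a)) := by
    refine ex_mul_cancel haf hap ?_
    rw [← dt_ex haf hap, hea, hdZ, ← hea, hG, hd.lapk_ex haf hap, mul_smul_comm]
  have hbr : ∀ v (F : SF d K[X] 0), F ∈ Fil d K[X] 0 1 →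
      a ∈ Supp d K[X] 0 {p | v ≤ lv 0 p ∨ -1 ≤ p.2} →
      F ∈ Supp d K[X] 0 {p | v ≤ lv 0 p ∨ -1 ≤ p.2} →
      hb d K[X] 0 1 * br π a F ∈ Supp d K[X] 0 {p | v + 1 ≤ lv 0 p ∨ -1 ≤ p.2} := by
    intro v F hF haS hFS
    refine mul_mem_supp (S := {p | p = (0, 1)}) (T := {p | v + 1 - 2 ≤ lv 0 p ∨ -2 ≤ p.2}) ?_
      (mono_mem rfl) (br_mem_supp (fun i j p q _ hp hq => ?_) (mem_supp_inter haf haS)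
        (mem_supp_inter hF hFS))
    · rintro p rfl q hq
      rw [mem_ofPred_eq] at hq
      rw [mem_ofPred_eq, lv_add]
      rcases hq with hq | hq
      · left; simp only [lv] at *; simp at *; linarith
      · right; simp; linarith
    · obtain ⟨hp1, hp2⟩ := hp
      obtain ⟨hq1, hq2⟩ := hq
      simp only [mem_ofPred_eq, lv_add, lv_single] at *
      push_cast at *
      simp only [Prod.snd_add, add_zero] at hp2 hq2
      rcases hp2 with hp2 | hp2
      · left; linarith
      · rcases hq2 with hq2 | hq2
        · left; linarith
        · right; simp only [Prod.snd_add]; linarith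
  have hlin : ∀ v (F : SF d K[X] 0), F ∈ Supp d K[X] 0 {p | v ≤ lv 0 p ∨ -1 ≤ p.2} →
      lin d K[X] 0 κ F ∈ Supp d K[X] 0 {p | v ≤ lv 0 p ∨ -1 ≤ p.2} := fun v F hF =>
    lin_mem_supp (fun i j _ p hp => by
      simp only [mem_ofPred_eq, lv_add, lv_single, Prod.snd_add] at *; exact hp) hF
  have key : ∀ v, a ∈ Supp d K[X] 0 {p | v ≤ lv 0 p ∨ -1 ≤ p.2} →
      a ∈ Supp d K[X] 0 {p | v + 1 ≤ lv 0 p ∨ -1 ≤ p.2} := by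
    intro v hv
    have step : ∀ m : ℤ, a ∈ Supp d K[X] 0 ({p | v + 1 ≤ lv 0 p ∨ -1 ≤ p.2} ∪
        {p | (p.1.degree : ℤ) ≤ m}) → a ∈ Supp d K[X] 0 ({p | v + 1 ≤ lv 0 p ∨ -1 ≤ p.2} ∪
        {p | (p.1.degree : ℤ) ≤ m - 1}) := by
      intro m hm
      have hk : ∀ {m} {F : SF d K[X] 0}, F ∈ Supp d K[X] 0 ({p | v + 1 ≤ lv 0 p ∨ -1 ≤ p.2} ∪
        {p | (p.1.degree : ℤ) ≤ m}) → lin d K[X] 0 κ F ∈ Supp d K[X] 0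
          ({p | v + 1 ≤ lv 0 p ∨ -1 ≤ p.2} ∪ {p | (p.1.degree : ℤ) ≤ m}) := fun {m F} hF =>
        lin_mem_supp (fun i j _ p hp => by
          simp only [Set.mem_union, mem_ofPred_eq, lv_add, lv_single, Prod.snd_add, Prod.fst_add,
            map_add, degree_single] at *
          exact hp) hF
      have hD : ∀ {m} {F : SF d K[X] 0}, F ∈ Supp d K[X] 0 ({p | v + 1 ≤ lv 0 p ∨ -1 ≤ p.2} ∪
        {p | (p.1.degree : ℤ) ≤ m}) → dl d K[X] 0 π F ∈ Supp d K[X] 0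
          ({p | v + 1 ≤ lv 0 p ∨ -1 ≤ p.2} ∪ {p | (p.1.degree : ℤ) ≤ m - 1}) := fun {m F} hF => by
        rw [dl_apply]
        refine mul_mem_supp (S := {p | p = (0, 1)}) (T := {p | v + 1 - 2 ≤ lv 0 p ∨ -2 ≤ p.2} ∪
          {p | (p.1.degree : ℤ) ≤ m - 1}) ?_ (mono_mem rfl) (lap_mem_supp (fun i j p _ hp => ?_) hF)
        · rintro p rfl q hq
          simp only [Set.mem_union, mem_ofPred_eq] at hq
          simp only [Set.mem_union, mem_ofPred_eq, lv_add]
          rcases hq with (hq | hq) | hq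
          · left; left; simp only [lv] at *; simp at *; linarith
          · left; right; simp; linarith
          · right; simpa using hq
        · simp only [Set.mem_union, mem_ofPred_eq, lv_add, lv_single, Prod.snd_add,
            Prod.fst_add, map_add, degree_single, add_zero] at *
          push_cast at *
          rcases hp with (hp | hp) | hp
          · left; left; linarith
          · left; right; linarith
          · right; linarith
      refine mem_supp_of_dt ?_ ?_
      · rw [hda]
        refine supp_smul _ (add_mem (add_mem ?_ ?_) (supp_smul _ ?_))
        · rw [hG, lapk_apply]; exact add_mem (hD (hk hm)) (hk (hD hm))
        · exact supp_mono Set.subset_union_left (hbr v _ (lin_mem_fil haf) hv (hlin v _ hv))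
        · exact supp_mono Set.subset_union_left (hlin (v + 1) _ (hbr v _ haf hv hv))
      · rw [hev0]
        exact supp_mono (fun p hp => Or.inl (Or.inr hp)) hbg
    obtain ⟨m, hm⟩ := exists_mem_lowSet a (v + 1)
    have h1 : ∀ n : ℕ, a ∈ Supp d K[X] 0 ({p | v + 1 ≤ lv 0 p ∨ -1 ≤ p.2} ∪
        {p | (p.1.degree : ℤ) ≤ m - n}) := by
      intro n
      induction n with
      | zero => exact supp_mono (fun p hp => hp.imp Or.inl (by simp)) hm
      | succ n ih =>
        have := step _ ih
        rwa [show (m : ℤ) - n - 1 = m - ((n + 1 : ℕ) : ℤ) by push_cast; ring] at this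
    refine supp_mono (fun p hp => hp.resolve_right fun h' => ?_) (h1 (m + 1))
    rw [mem_ofPred_eq] at h'
    push_cast at h'
    have : (0 : ℤ) ≤ p.1.degree := Int.natCast_nonneg _
    linarith
  have hall : ∀ n : ℕ, a ∈ Supp d K[X] 0 {p | 1 + (n : ℤ) ≤ lv 0 p ∨ -1 ≤ p.2} := by
    intro n
    induction n with
    | zero => exact supp_mono (fun p hp => Or.inl (by simpa using hp)) haf
    | succ n ih =>
      have := key _ ih
      push_cast
      rwa [add_assoc] at this
  have hfin : a ∈ Supp d K[X] 0 {p | -1 ≤ p.2} := fun p hp => by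
    refine (hall (lv 0 p).toNat p hp).resolve_left fun h' => ?_
    have := Int.self_le_toNat (lv 0 p)
    linarith
  have hZ1f : ev 1 Z - 1 ∈ Fil d K 0 1 := by
    rw [← map_one (ev 1), ← map_sub]; exact ev_mem_supp 1 hZf
  have e := lg_map (prj d K 0 h) cont_prj hZ1f (by
    rw [← map_one (prj d K 0 h), ← map_sub]; exact prj_mem_fil hZ1f)
  rw [hd.prj_Yop, ← hZ1, ← e, ← ev_lg 1 hZf]
  exact prj_mem_supp (S := {p | -1 ≤ p.2}) (fun I g hI => hI) (ev_mem_supp 1 hfin)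

end HodgeData

end Genus

/-! ### Flows of raising vector fields -/

section Flow

open Polynomial

variable {ι : Type*} [LinearOrder ι] {d : ι → ℤ} {K : Type*} [Field K] [CharZero K] {c : ℕ}

/-- Operators which strictly raise the level. -/
def Raises {R : Type*} [CommRing R] (X : SF d R c →+ SF d R c) : Prop :=
  ∀ v, ∀ F ∈ Fil d R c v, X F ∈ Fil d R c (v + 1)

lemma Raises.mem_fil {R : Type*} [CommRing R] {X : SF d R c →+ SF d R c} (hX : Raises X) {v : ℤ}
    {F : SF d R c} (hF : F ∈ Fil d R c v) : X F ∈ Fil d R c v := fil_anti (by linarith) (hX v F hF)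

lemma Raises.iterate_mem {R : Type*} [CommRing R] {X : SF d R c →+ SF d R c} (hX : Raises X) {v : ℤ}
    {F : SF d R c} (hF : F ∈ Fil d R c v) (n : ℕ) : X^[n] F ∈ Fil d R c (v + n) := by
  induction n with
  | zero => simpa using hF
  | succ n ih =>
    rw [iterate_succ_apply']
    have := hX _ _ ih
    push_cast; rwa [← add_assoc]

section Inverse

variable {R : Type*} [CommRing R] {N : SF d R c →+ SF d R c} (hN : Raises N)
include hN

lemma Raises.summ (F : SF d R c) : Summ (fun n : ℕ => N^[n] F) := summ_nat fun v => by
  obtain ⟨m, hm⟩ := F.exists_mem_fil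
  exact ⟨(v - m).toNat, fun n hn => fil_anti (by omega) (hN.iterate_mem hm n)⟩

lemma Raises.fsum_sub (F : SF d R c) :
    fsum (fun n : ℕ => N^[n] F) - N (fsum fun n : ℕ => N^[n] F) = F := by
  have h1 := (hN.summ F).isSum
  have hc : Cont N := fun v => ⟨v, fun _ h => hN.mem_fil h⟩
  have h2 := (h1.map hc).unique (h1.succ.congr fun n => (iterate_succ_apply' N n F).symm)
  rw [h2]; simp

lemma Raises.eq_zero {F : SF d R c} (h : N F = F) : F = 0 := by
  obtain ⟨m, hm⟩ := F.exists_mem_fil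
  exact fil_induction hm fun v hv => by rw [← h]; exact hN v F hv

end Inverse

lemma dt_mem_fil {v : ℤ} {F : SF d K[X] c} (h : F ∈ Fil d K[X] c v) : dt F ∈ Fil d K[X] c v :=
  dt_mem_supp (S := {p | v ≤ lv c p}) h

lemma eq_zero_of_dt_family {α : Type*} {Δ : α → SF d K[X] c} (h0 : ∀ a, ev 0 (Δ a) = 0)
    (hs : ∀ a, ∃ b b', dt (Δ a) = Δ b + Δ b') (a : α) : Δ a = 0 := by
  refine eq_zero_of_dt_iterate fun k => ?_
  induction k generalizing a with
  | zero => exact h0 a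
  | succ k ih =>
    obtain ⟨b, b', h⟩ := hs a
    rw [Function.iterate_succ_apply, h, iterate_map_add, map_add, ih, ih, add_zero]

variable {X : SF d K[X] c →+ SF d K[X] c}

/-- The time derivative plus a time-dependent operator. -/
def Dt (X : SF d K[X] c →+ SF d K[X] c) : SF d K[X] c →+ SF d K[X] c := dt + X

lemma Dt_apply (X : SF d K[X] c →+ SF d K[X] c) (G : SF d K[X] c) : Dt X G = dt G + X G := rfl

lemma dt_add_iterate_mem (hX : Raises X) {v : ℤ} {G : SF d K[X] c} (hG : G ∈ Fil d K[X] c v) (n : ℕ) :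
    (Dt X)^[n] G - (dt : SF d K[X] c →+ SF d K[X] c)^[n] G ∈ Fil d K[X] c (v + 1) ∧ (Dt X)^[n] G ∈ Fil d K[X] c v := by
  induction n with
  | zero =>
    refine ⟨?_, hG⟩
    rw [Function.iterate_zero, Function.iterate_zero, id, sub_self]
    exact zero_mem _
  | succ n ih =>
    rw [iterate_succ_apply', iterate_succ_apply', Dt_apply]
    refine ⟨?_, add_mem (dt_mem_fil ih.2) (hX.mem_fil ih.2)⟩
    rw [add_sub_right_comm, ← map_sub]
    exact add_mem (dt_mem_fil ih.1) (hX _ _ ih.2)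

lemma coef_dt_iterate (k : ℕ) (F : SF d K[X] c) (I : ι →₀ ℕ) (g : ℤ) :
    ((dt : SF d K[X] c →+ SF d K[X] c)^[k] F).coef I g = derivative^[k] (F.coef I g) := by
  induction k with
  | zero => rfl
  | succ k ih => rw [iterate_succ_apply', iterate_succ_apply', coef_dt, ih]

lemma exists_iterate_mem (hX : Raises X) (v : ℤ) (G : SF d K[X] c) :
    ∃ N, ∀ n ≥ N, (Dt X)^[n] G ∈ Fil d K[X] c v := by
  obtain ⟨m, hm⟩ := G.exists_mem_fil
  have step : ∀ (v : ℤ) (G : SF d K[X] c), G ∈ Fil d K[X] c v →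
      ∃ N, (Dt X)^[N] G ∈ Fil d K[X] c (v + 1) := by
    intro v G hG
    obtain ⟨N, hN⟩ := ((G.lf v).image fun p => (G.coef p.1 p.2).natDegree).bddAbove
    refine ⟨N + 1, ?_⟩
    have h1 : (dt : SF d K[X] c →+ SF d K[X] c)^[N + 1] G ∈ Fil d K[X] c (v + 1) := fun p hp => by
      by_contra h'
      rw [coef_dt_iterate] at hp
      refine hp (Polynomial.iterate_derivative_eq_zero ?_)
      have h0 : G.coef p.1 p.2 ≠ 0 := by
        intro h0; rw [h0] at hp; exact hp (iterate_map_zero _ _)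
      rw [mem_ofPred_eq] at h'
      exact Nat.lt_succ_of_le (hN ⟨p, ⟨by linarith, h0⟩, rfl⟩)
    have := add_mem (dt_add_iterate_mem hX hG (N + 1)).1 h1
    rwa [sub_add_cancel] at this
  have h2 : ∀ j : ℕ, ∃ N, (Dt X)^[N] G ∈ Fil d K[X] c (m + j) := by
    intro j
    induction j with
    | zero => exact ⟨0, by simpa using hm⟩
    | succ j ih =>
      obtain ⟨N, hN⟩ := ih
      obtain ⟨N', hN'⟩ := step _ _ hN
      refine ⟨N' + N, ?_⟩
      rw [Function.iterate_add_apply]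
      push_cast; rwa [← add_assoc]
  obtain ⟨N, hN⟩ := h2 (v - m).toNat
  refine ⟨N, fun n hn => ?_⟩
  obtain ⟨k, rfl⟩ := Nat.exists_eq_add_of_le hn
  rw [add_comm, Function.iterate_add_apply]
  exact fil_anti (by omega) (dt_add_iterate_mem hX hN k).2

/-- The `k`-th Taylor term of the flow. -/
def flowTerm (X : SF d K[X] c →+ SF d K[X] c) (G : SF d K[X] c) (k : ℕ) : SF d K[X] c :=
  (C ((k.factorial : K)⁻¹) * (Polynomial.X : K[X]) ^ k) • cst (ev 0 ((Dt X)^[k] G))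

lemma summ_flowTerm (hX : Raises X) (G : SF d K[X] c) : Summ (flowTerm X G) := summ_nat fun v => by
  obtain ⟨N, hN⟩ := exists_iterate_mem hX v G
  exact ⟨N, fun n hn => by
    have := cst_mem_supp (ev_mem_supp 0 (hN n hn))
    exact supp_smul (S := {p | v ≤ lv c p}) _ this⟩

lemma flowTerm_add (F G : SF d K[X] c) (k : ℕ) :
    flowTerm X (F + G) k = flowTerm X F k + flowTerm X G k := by
  unfold flowTerm
  rw [iterate_map_add, map_add, map_add, smul_add]

/-- The flow of a vector field, as an additive map. -/
def flowAdd (hX : Raises X) : SF d K[X] c →+ SF d K[X] c where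
  toFun G := fsum (flowTerm X G)
  map_zero' := (isSum_zero.congr fun k => by
    unfold flowTerm
    rw [iterate_map_zero, map_zero, map_zero, smul_zero]).eq_fsum.symm
  map_add' F G := (summ_flowTerm hX _).isSum.unique
    (((summ_flowTerm hX F).isSum.add (summ_flowTerm hX G).isSum).congr fun k => flowTerm_add F G k)

lemma isSum_flowAdd (hX : Raises X) (G : SF d K[X] c) : IsSum (flowTerm X G) (flowAdd hX G) :=
  (summ_flowTerm hX G).isSum

lemma ev_flowAdd (hX : Raises X) (G : SF d K[X] c) : ev 0 (flowAdd hX G) = ev 0 G := by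
  refine ((isSum_flowAdd hX G).map (cont_ev 0)).unique ?_
  have := isSum_finset {0} (fun k : ℕ => ev 0 (flowTerm X G k)) fun k hk => by
    rw [Finset.mem_singleton] at hk
    rw [flowTerm, ev_smul_cst]
    simp [hk]
  have e : ev 0 (flowTerm X G 0) = ev 0 G := by rw [flowTerm, ev_smul_cst]; simp
  rwa [Finset.sum_singleton, e] at this

lemma dt_flowAdd (hX : Raises X) (G : SF d K[X] c) :
    dt (flowAdd hX G) = flowAdd hX ((Dt X) G) := by
  have h1 := ((isSum_flowAdd hX G).map cont_dt).succ
  have e : dt (flowTerm X G 0) = 0 := by rw [flowTerm, dt_smul_cst]; simp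
  rw [e, sub_zero] at h1
  refine h1.unique ((isSum_flowAdd hX _).congr fun k => ?_)
  have hk : ((k : K) + 1) ≠ 0 := by exact_mod_cast Nat.succ_ne_zero k
  rw [flowTerm, flowTerm, dt_smul_cst, Function.iterate_succ_apply,
    Polynomial.derivative_C_mul_X_pow, Nat.factorial_succ, Nat.add_sub_cancel]
  congr 3
  push_cast
  rw [mul_inv]
  field_simp

lemma flowAdd_mem_supp (hX : Raises X) {S : Set (Mon ι)}
    (hS : ∀ F ∈ Supp d K[X] c S, X F ∈ Supp d K[X] c S) {F : SF d K[X] c}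
    (hF : F ∈ Supp d K[X] c S) : flowAdd hX F ∈ Supp d K[X] c S :=
  (isSum_flowAdd hX F).mem_supp fun k => by
  have : (Dt X)^[k] F ∈ Supp d K[X] c S := by
    induction k with
    | zero => exact hF
    | succ k ih => rw [iterate_succ_apply']; exact add_mem (dt_mem_supp ih) (hS _ ih)
  exact supp_smul _ (cst_mem_supp (ev_mem_supp 0 this))

lemma flowAdd_mem_fil (hX : Raises X) {v : ℤ} {F : SF d K[X] c} (hF : F ∈ Fil d K[X] c v) :
    flowAdd hX F ∈ Fil d K[X] c v :=
  flowAdd_mem_supp (S := {p | v ≤ lv c p}) hX (fun _ h => hX.mem_fil h) hF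

lemma cont_flowAdd (hX : Raises X) : Cont (flowAdd hX) := fun v => ⟨v, fun _ h => flowAdd_mem_fil hX h⟩

lemma flowAdd_of_eq_zero (hX : Raises X) {G : SF d K[X] c} (h : (Dt X) G = 0) :
    flowAdd hX G = cst (ev 0 G) :=
  eq_of_dt (by rw [dt_flowAdd, h, map_zero, dt_cst]) (by rw [ev_flowAdd, ev_cst])

variable (hd : IsDer 0 X)
include hd

lemma flowAdd_smul (hX : Raises X) (p : K[X]) (G : SF d K[X] c) :
    flowAdd hX (p • G) = p • flowAdd hX G := by
  have hdt : ∀ (p : K[X]) (G : SF d K[X] c), dt (p • G) = derivative p • G + p • dt G := fun p G => by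
    ext1; funext I g
    simp [coef_dt, coef_smul]
  have hev : ∀ (p : K[X]) (G : SF d K[X] c), ev 0 (p • G) = p.eval 0 • ev 0 G := fun p G => by
    ext I g; simp [coef_ev, coef_smul]
  rw [← sub_eq_zero]
  refine eq_zero_of_dt_family (α := K[X] × SF d K[X] c)
    (Δ := fun a => flowAdd hX (a.1 • a.2) - a.1 • flowAdd hX a.2) (fun a => ?_) (fun a => ?_) (p, G)
  · rw [map_sub, ev_flowAdd, hev, hev, ev_flowAdd, sub_self]
  · refine ⟨(derivative a.1, a.2), (a.1, (Dt X) a.2), ?_⟩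
    simp only
    rw [map_sub, dt_flowAdd, hdt, dt_flowAdd, Dt_apply, hdt, hd.smul,
      Dt_apply, smul_add, map_add, map_add, map_add (flowAdd hX) (a.1 • dt a.2)]
    abel

lemma flowAdd_mul (hX : Raises X) (F G : SF d K[X] c) :
    flowAdd hX (F * G) = flowAdd hX F * flowAdd hX G := by
  rw [← sub_eq_zero]
  refine eq_zero_of_dt_family (α := SF d K[X] c × SF d K[X] c)
    (Δ := fun a => flowAdd hX (a.1 * a.2) - flowAdd hX a.1 * flowAdd hX a.2)
    (fun a => ?_) (fun a => ?_) (F, G)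
  · rw [map_sub, ev_flowAdd, map_mul, map_mul, ev_flowAdd, ev_flowAdd, sub_self]
  · refine ⟨((Dt X) a.1, a.2), (a.1, (Dt X) a.2), ?_⟩
    have e : (Dt X) (a.1 * a.2) = (Dt X) a.1 * a.2 + a.1 * (Dt X) a.2 := by
      simp only [Dt_apply, dt_mul, hd.mul, sig_even (Even.zero (α := ℤ))]
      noncomm_ring
    simp only
    rw [map_sub, dt_flowAdd, e, dt_mul, dt_flowAdd, dt_flowAdd, map_add]
    abel

/-- The flow of a raising vector field. -/
def flow (hX : Raises X) : SF d K[X] c →+* SF d K[X] c :=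
  { flowAdd hX with
    map_one' := by
      change flowAdd hX 1 = 1
      rw [flowAdd_of_eq_zero hX (by rw [Dt_apply, dt_one, hd.one, add_zero]), map_one,
        map_one]
    map_mul' := flowAdd_mul hd hX }

/-- The flow at time `t` on functions which do not depend on the time. -/
def flowAt (hX : Raises X) (t : K) : SF d K c →+* SF d K c := (ev t).comp ((flow hd hX).comp cst)

lemma flowAt_apply (hX : Raises X) (t : K) (F : SF d K c) :
    flowAt hd hX t F = ev t (flow hd hX (cst F)) := rfl

lemma flowAt_zero (hX : Raises X) (F : SF d K c) : flowAt hd hX 0 F = F :=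
  (ev_flowAdd hX (cst F)).trans (ev_cst 0 F)

omit [CharZero K] hd in
lemma cst_hb (m : ℤ) : cst (hb d K c m) = hb d K[X] c m := by
  classical
  ext1; funext I g
  rw [coef_cst, hb, hb, coef_mono, coef_mono]
  split_ifs <;> simp

lemma flow_hb (hX : Raises X) (m : ℤ) : flow hd hX (hb d K[X] c m) = hb d K[X] c m := by
  have h1 : X (hb d K[X] c m) = 0 := by
    have := hd.hb_mul m 1
    rwa [mul_one, hd.one, mul_zero] at this
  refine (flowAdd_of_eq_zero hX ?_).trans ?_
  · rw [Dt_apply, h1, ← cst_hb, dt_cst, add_zero]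
  · rw [← cst_hb, ev_cst]

lemma flowAt_hb (hX : Raises X) (t : K) (m : ℤ) : flowAt hd hX t (hb d K c m) = hb d K c m := by
  rw [flowAt_apply, cst_hb, flow_hb, ← cst_hb, ev_cst]

lemma flowAt_smul (hX : Raises X) (t r : K) (F : SF d K c) :
    flowAt hd hX t (r • F) = r • flowAt hd hX t F := by
  have e : cst (r • F) = (C r : K[X]) • cst F := by
    ext1; funext I g; simp [coef_cst, coef_smul]
  rw [flowAt_apply, e, show flow hd hX ((C r : K[X]) • cst F) = (C r : K[X]) • flow hd hX (cst F) from
    flowAdd_smul hd hX _ _]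
  ext I g; simp [coef_ev, coef_smul, flowAt_apply]

lemma flowAt_mem_supp (hX : Raises X) (t : K) {S : Set (Mon ι)}
    (hS : ∀ F ∈ Supp d K[X] c S, X F ∈ Supp d K[X] c S) {F : SF d K c} (hF : F ∈ Supp d K c S) :
    flowAt hd hX t F ∈ Supp d K c S := ev_mem_supp t (flowAdd_mem_supp hX hS (cst_mem_supp hF))

lemma cont_flowAt (hX : Raises X) (t : K) : Cont (flowAt hd hX t).toAddMonoidHom := fun v =>
  ⟨v, fun _ h => flowAt_mem_supp hd hX t (S := {p | v ≤ lv c p}) (fun _ h => hX.mem_fil h) h⟩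

/-- Evaluation of a transported family. -/
lemma ev_flow (hX : Raises X) (t : K) (G : SF d K[X] c) :
    ev t (flow hd hX G) = flowAt hd hX t (ev t G) := by
  have : (ev t).toAddMonoidHom.comp (flowAdd hX) =
      (flowAt hd hX t).toAddMonoidHom.comp (ev t).toAddMonoidHom := by
    refine ext_of_mono ((cont_ev t).comp (cont_flowAdd hX))
      ((cont_flowAt hd hX t).comp (cont_ev t)) fun r p => ?_
    have e : mono d c r p = r • cst (mono d c (1 : K) p) := by
      classical
      ext1; funext I g
      rw [coef_smul, coef_cst, coef_mono, coef_mono]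
      split_ifs <;> simp
    change ev t (flowAdd hX _) = flowAt hd hX t (ev t _)
    rw [e, flowAdd_smul hd, ev_smul_cst, flowAt_smul]
    ext I g; simp [coef_ev, coef_smul, flowAt_apply, flow]
  exact DFunLike.congr_fun this G

lemma flowAt_sub_mem (hX : Raises X) (t : K) {v : ℤ} {F : SF d K c} (hF : F ∈ Fil d K c v) :
    flowAt hd hX t F - F ∈ Fil d K c (v + 1) := by
  have h1 := (isSum_flowAdd hX (cst F)).succ
  have e : flowTerm X (cst F) 0 = cst F := by rw [flowTerm]; simp
  rw [e] at h1
  have h2 : flowAdd hX (cst F) - cst F ∈ Fil d K[X] c (v + 1) := h1.mem_fil fun n => by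
    refine supp_smul (S := {p | v + 1 ≤ lv c p}) _ (cst_mem_supp (ev_mem_supp 0 ?_))
    rw [Function.iterate_succ_apply]
    refine (dt_add_iterate_mem hX ?_ n).2
    rw [Dt_apply, dt_cst, zero_add]
    exact hX _ _ (cst_mem_supp hF)
  have := ev_mem_supp t h2
  rwa [map_sub, ev_cst] at this

lemma raises_sub_flowAt (hX : Raises X) (t : K) :
    Raises (AddMonoidHom.id (SF d K c) - (flowAt hd hX t).toAddMonoidHom) := fun v F hF => by
  have := neg_mem (flowAt_sub_mem hd hX t hF)
  rwa [neg_sub] at this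

lemma flowAt_bijective (hX : Raises X) (t : K) : Function.Bijective (flowAt hd hX t) := by
  have hN := raises_sub_flowAt hd hX t
  constructor
  · intro F G h
    rw [← sub_eq_zero]
    refine hN.eq_zero ?_
    change (F - G) - flowAt hd hX t (F - G) = F - G
    rw [map_sub, h, sub_self, sub_zero]
  · intro F
    refine ⟨fsum fun n : ℕ => (AddMonoidHom.id (SF d K c) - (flowAt hd hX t).toAddMonoidHom)^[n] F,
      Eq.trans ?_ (hN.fsum_sub F)⟩
    rw [AddMonoidHom.sub_apply, AddMonoidHom.id_apply, sub_sub_cancel]; rfl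

/-- The inverse of the flow. -/
def flowInv (hX : Raises X) (t : K) : SF d K c →+* SF d K c :=
  (RingEquiv.ofBijective _ (flowAt_bijective hd hX t)).symm.toRingHom

lemma flowAt_flowInv (hX : Raises X) (t : K) (F : SF d K c) :
    flowAt hd hX t (flowInv hd hX t F) = F :=
  (RingEquiv.ofBijective _ (flowAt_bijective hd hX t)).apply_symm_apply F

lemma flowInv_flowAt (hX : Raises X) (t : K) (F : SF d K c) :
    flowInv hd hX t (flowAt hd hX t F) = F :=
  (RingEquiv.ofBijective _ (flowAt_bijective hd hX t)).symm_apply_apply F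

lemma isSum_flowInv (hX : Raises X) (t : K) (F : SF d K c) :
    IsSum (fun n : ℕ => (AddMonoidHom.id (SF d K c) - (flowAt hd hX t).toAddMonoidHom)^[n] F)
      (flowInv hd hX t F) := by
  have hN := raises_sub_flowAt hd hX t
  have h1 := hN.fsum_sub F
  rw [AddMonoidHom.sub_apply, AddMonoidHom.id_apply, sub_sub_cancel] at h1
  have : flowInv hd hX t F =
      fsum fun n : ℕ => (AddMonoidHom.id (SF d K c) - (flowAt hd hX t).toAddMonoidHom)^[n] F := by
    nth_rewrite 1 [← h1]
    exact flowInv_flowAt hd hX t _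
  rw [this]
  exact (hN.summ F).isSum

lemma flowInv_mem_supp (hX : Raises X) (t : K) {S : Set (Mon ι)}
    (hS : ∀ F ∈ Supp d K[X] c S, X F ∈ Supp d K[X] c S) {F : SF d K c} (hF : F ∈ Supp d K c S) :
    flowInv hd hX t F ∈ Supp d K c S := (isSum_flowInv hd hX t F).mem_supp fun n => by
  induction n with
  | zero => exact hF
  | succ n ih =>
    rw [iterate_succ_apply']
    exact sub_mem ih (flowAt_mem_supp hd hX t hS ih)

lemma flowInv_mem_fil (hX : Raises X) (t : K) {v : ℤ} {F : SF d K c} (hF : F ∈ Fil d K c v) :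
    flowInv hd hX t F ∈ Fil d K c v :=
  flowInv_mem_supp hd hX t (S := {p | v ≤ lv c p}) (fun _ h => hX.mem_fil h) hF

lemma cont_flowInv (hX : Raises X) (t : K) : Cont (flowInv hd hX t).toAddMonoidHom := fun v =>
  ⟨v, fun _ h => flowInv_mem_fil hd hX t h⟩

lemma flowInv_hb (hX : Raises X) (t : K) (m : ℤ) : flowInv hd hX t (hb d K c m) = hb d K c m := by
  nth_rewrite 1 [← flowAt_hb hd hX t m]
  exact flowInv_flowAt hd hX t _

lemma flowInv_smul (hX : Raises X) (t r : K) (F : SF d K c) :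
    flowInv hd hX t (r • F) = r • flowInv hd hX t F := by
  apply (flowAt_bijective hd hX t).1
  rw [flowAt_flowInv, flowAt_smul, flowAt_flowInv]

/-- The flow intertwines families of operators which are preserved by the vector field. -/
lemma flow_intertwines (hX : Raises X) {T T₀ : SF d K[X] c →+ SF d K[X] c}
    (hT : ∀ G, (Dt X) (T G) = T ((Dt X) G)) (hT0 : ∀ G, dt (T₀ G) = T₀ (dt G))
    (h0 : ∀ G G', ev 0 G = ev 0 G' → ev 0 (T G) = ev 0 (T₀ G')) (G : SF d K[X] c) :
    flow hd hX (T G) = T₀ (flow hd hX G) := by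
  rw [← sub_eq_zero]
  refine eq_zero_of_dt_family (Δ := fun G => flow hd hX (T G) - T₀ (flow hd hX G)) (fun G => ?_)
    (fun G => ⟨(Dt X) G, 0, ?_⟩) G
  · rw [map_sub, sub_eq_zero]
    exact (ev_flowAdd hX _).trans (h0 _ _ (ev_flowAdd hX G).symm)
  · have e : ∀ G, dt (flow hd hX G) = flow hd hX ((Dt X) G) := dt_flowAdd hX
    simp only [map_sub, map_zero, sub_zero, add_zero]
    rw [e, hT, hT0, e]

end Flow

/-! ### The effective action -/

section Effective

open Polynomial

section Deg

variable {ι : Type*} [LinearOrder ι] {d : ι → ℤ} {R : Type*} [CommRing R] {c : ℕ}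

/-- Series which are homogeneous of degree `n`. -/
abbrev Deg (d : ι → ℤ) (R : Type*) [CommRing R] (c : ℕ) (n : ℤ) : AddSubgroup (SF d R c) :=
  Supp d R c {p | monDegree d p.1 = n}

lemma par_of_deg {n : ℤ} {F : SF d R c} (hF : F ∈ Deg d R c n) : F ∈ Par d R c n :=
  supp_mono (fun p hp => by rw [mem_ofPred_eq] at hp ⊢; rw [hp, sub_self]; exact Even.zero) hF

lemma mul_deg {m n : ℤ} {F G : SF d R c} (hF : F ∈ Deg d R c m) (hG : G ∈ Deg d R c n) :
    F * G ∈ Deg d R c (m + n) := by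
  refine mul_mem_supp ?_ hF hG
  intro p hp q hq
  rw [mem_ofPred_eq] at hp hq ⊢
  rw [Prod.fst_add, md_add, hp, hq]

lemma md_zero : monDegree d (0 : ι →₀ ℕ) = 0 := by simp [monDegree]

lemma one_deg : (1 : SF d R c) ∈ Deg d R c 0 := one_mem_supp md_zero

lemma hb_deg (m : ℤ) : hb d R c m ∈ Deg d R c 0 := mono_mem md_zero

lemma md_closed (p : Mon ι) (hp : p ∈ {p : Mon ι | monDegree d p.1 = 0}) (q : Mon ι)
    (hq : q ∈ {p : Mon ι | monDegree d p.1 = 0}) : p + q ∈ {p : Mon ι | monDegree d p.1 = 0} := by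
  rw [mem_ofPred_eq] at *
  rw [Prod.fst_add, md_add, hp, hq, add_zero]

lemma ex_deg [Algebra ℚ R] {F : SF d R c} (hF : F ∈ Fil d R c 1) (h : F ∈ Deg d R c 0) :
    ex F ∈ Deg d R c 0 := ex_mem_supp hF md_zero md_closed h

lemma lg_deg [Algebra ℚ R] {F : SF d R c} (hF : F - 1 ∈ Fil d R c 1) (h : F ∈ Deg d R c 0) :
    lg F ∈ Deg d R c 0 := lg_mem_supp hF md_closed (sub_mem h one_deg)

lemma hb_mul_deg {n : ℤ} (m : ℤ) {F : SF d R c} (h : F ∈ Deg d R c n) :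
    hb d R c m * F ∈ Deg d R c n := by
  have := mul_deg (hb_deg m) h
  rwa [zero_add] at this

lemma hb_mem_fil (m : ℤ) : hb d R c m ∈ Fil d R c ((2 * c + 2) * m) :=
  mono_mem (by rw [mem_ofPred_eq, lv]; simp)

lemma hb_mul_mem_fil {v : ℤ} (m : ℤ) {F : SF d R c} (h : F ∈ Fil d R c v) :
    hb d R c m * F ∈ Fil d R c ((2 * c + 2) * m + v) := mul_mem_fil (hb_mem_fil m) h

variable {K : Type*} [Field K] [Algebra K R] {π : ι → ι → K}

lemma br_deg (hπ : IsOddPoisson d π) {m n : ℤ} {F G : SF d R c} (hF : F ∈ Deg d R c m)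
    (hG : G ∈ Deg d R c n) : br π F G ∈ Deg d R c (m + n + 1) := by
  refine br_mem_supp ?_ hF hG
  intro i j p q hij hp hq
  have := hπ.degree i j hij
  rw [mem_ofPred_eq] at *
  rw [Prod.fst_add, md_add, md_single] at *
  push_cast at *
  linarith

lemma lap_deg (hπ : IsOddPoisson d π) {n : ℤ} {F : SF d R c} (hF : F ∈ Deg d R c n) :
    lap d R c π F ∈ Deg d R c (n + 1) := by
  refine lap_mem_supp ?_ hF
  intro i j p hij hp
  have := hπ.degree i j hij
  rw [mem_ofPred_eq] at *
  rw [Prod.fst_add, Prod.fst_add, md_add, md_add, md_single, md_single] at hp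
  push_cast at hp
  linarith

end Deg

variable {ι : Type*} [LinearOrder ι] {d : ι → ℤ} {K : Type*} [Field K] [CharZero K]
  {π : ι → ι → K} {h : ι → Prop} {μ κ : ι → ι →₀ K}

lemma Kop_deg (hd : HodgeData d π h μ κ) {n : ℤ} {F : SF d K 0} (hF : F ∈ Deg d K 0 n) :
    Kop d h κ F ∈ Deg d K 0 (n - 1) := by
  refine Kop_mem_supp ?_ hF
  intro i j hij p hp
  have := hd.kdeg i j hij
  rw [mem_ofPred_eq] at *
  rw [Prod.fst_add, md_add, md_single] at *
  push_cast at *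
  linarith

lemma Yop_mem_supp {S : Set (Mon ι)} {F : SF d K 0} (hF : F ∈ Supp d K 0 S)
    (hS : ∀ F ∈ Supp d K 0 S, dl d K 0 π (Kop d h κ F) ∈ Supp d K 0 S) :
    Yop d π h κ F ∈ Supp d K 0 S := lowers_dl_Kop.ser_mem_supp _ hF hS

lemma Yop_mem_fil {v : ℤ} {F : SF d K 0} (hF : F ∈ Fil d K 0 v) : Yop d π h κ F ∈ Fil d K 0 v := by
  have hS : ∀ F ∈ Fil d K 0 v, ((dl d K 0 π).comp (Kop d h κ)) F ∈ Fil d K 0 v :=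
    fun _ h => lowers_dl_Kop.mem_fil h
  exact Yop_mem_supp (S := {p | v ≤ lv 0 p}) hF hS

lemma dl_deg (hπ : IsOddPoisson d π) {n : ℤ} {F : SF d K 0} (hF : F ∈ Deg d K 0 n) :
    dl d K 0 π F ∈ Deg d K 0 (n + 1) := by
  rw [dl_apply]; exact hb_mul_deg 1 (lap_deg hπ hF)

lemma Yop_deg (hd : HodgeData d π h μ κ) {n : ℤ} {F : SF d K 0} (hF : F ∈ Deg d K 0 n) :
    Yop d π h κ F ∈ Deg d K 0 n := Yop_mem_supp hF fun F h => by
  have := dl_deg hd.poisson (Kop_deg hd h)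
  rwa [sub_add_cancel] at this

lemma Kop_one : Kop d h κ (1 : SF d K 0) = 0 := by
  have e : lin d K 0 κ (1 : SF d K 0) = 0 := (IsSum.unique (isSum_vf 1)
    (isSum_zero.congr fun i => by rw [der_one, mul_zero]))
  change diag d K 0 _ (lin d K 0 κ 1) = 0
  rw [e, map_zero]

lemma Yop_one : Yop d π h κ (1 : SF d K 0) = 1 :=
  lowers_dl_Kop.ser_of_eq_zero rfl (by
    change dl d K 0 π (Kop d h κ 1) = 0
    rw [Kop_one, map_zero])

/-- A free action `Sf`, and an interaction `ħ b`, over a Hodge decomposition. -/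
structure Action (d : ι → ℤ) (π : ι → ι → K) (h : ι → Prop) (μ κ : ι → ι →₀ K)
    (Sf b : SF d K 0) : Prop extends HodgeData d π h μ κ where
  finrow : ∀ i, {j | π i j ≠ 0}.Finite
  free_deg : Sf ∈ Deg d K 0 0
  free_supp : Sf ∈ Supp d K 0 {p | p.1.degree = 2 ∧ p.2 = 0}
  free_lap : lap d K 0 π Sf = 0
  free_self : br π Sf Sf = 0
  free_br : ∀ F, br π Sf F = lin d K 0 μ F
  int_fil : b ∈ Fil d K 0 1
  int_deg : b ∈ Deg d K 0 0
  int_genus : b ∈ Supp d K 0 {p | -1 ≤ p.2}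
  closed : tw π Sf (ex b) = 0

/-- The exponential of the effective action. -/
def eff (d : ι → ℤ) (π : ι → ι → K) (h : ι → Prop) (κ : ι → ι →₀ K) (b : SF d K 0) :
    SF (fun i : {i // h i} => d i.1) K 0 := prj d K 0 h (Yop d π h κ (ex b))

/-- The effective action, divided by `ħ`. -/
def effAct (d : ι → ℤ) (π : ι → ι → K) (h : ι → Prop) (κ : ι → ι →₀ K) (b : SF d K 0) :
    SF (fun i : {i // h i} => d i.1) K 0 := lg (eff d π h κ b)

/-- The pullback of the effective action, divided by `ħ`. -/
def incAct (d : ι → ℤ) (π : ι → ι → K) (h : ι → Prop) (κ : ι → ι →₀ K) (b : SF d K 0) :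
    SF d K 0 := inc d K 0 h (effAct d π h κ b)

/-- The distinguished primitive. -/
def prim (d : ι → ℤ) (π : ι → ι → K) (h : ι → Prop) (κ : ι → ι →₀ K) (b : SF d K 0) :
    SF d K 0 := Kop d h κ (Yop d π h κ (ex b))

namespace Action

variable {Sf b : SF d K 0} (S : Action d π h μ κ Sf b)
include S

lemma int_par : b ∈ Par d K 0 0 := par_of_deg S.int_deg

lemma free_par : Sf ∈ Par d K 0 0 := par_of_deg S.free_deg

lemma tw_free (F : SF d K 0) : tw π Sf F = lin d K 0 μ F + dl d K 0 π F := by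
  rw [tw_apply, S.free_br, add_comm]

lemma q_dl (F : SF d K 0) : lin d K 0 μ (dl d K 0 π F) = -dl d K 0 π (lin d K 0 μ F) := by
  rw [← S.free_br, ← S.free_br, dl_br_of_lap S.poisson S.free_par S.free_lap, neg_neg]

lemma tw_tw_free (F : SF d K 0) : tw π Sf (tw π Sf F) = 0 := by
  rw [S.tw_free, S.tw_free, map_add, map_add, S.q_q, S.q_dl, dl_dl S.poisson]
  abel

lemma eff_sub_one : eff d π h κ b - 1 ∈ Fil _ K 0 1 := by
  have : Yop d π h κ (ex b) - 1 ∈ Fil d K 0 1 := by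
    rw [← Yop_one (π := π) (h := h) (κ := κ), ← map_sub]
    exact Yop_mem_fil (ex_sub_one_mem le_rfl S.int_fil)
  have := prj_mem_fil (h := h) this
  rwa [map_sub, map_one] at this

lemma eff_deg : eff d π h κ b ∈ Deg _ K 0 0 :=
  prj_mem_supp (fun I g hI => by
    rw [mem_ofPred_eq] at hI ⊢; rwa [em_monDegree] at hI)
    (Yop_deg S.toHodgeData (ex_deg S.int_fil S.int_deg))

lemma effAct_fil : effAct d π h κ b ∈ Fil _ K 0 1 := lg_mem_fil S.eff_sub_one

lemma effAct_deg : effAct d π h κ b ∈ Deg _ K 0 0 := lg_deg S.eff_sub_one S.eff_deg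

lemma effAct_genus : effAct d π h κ b ∈ Supp _ K 0 {p | -1 ≤ p.2} :=
  S.genus_lg S.int_fil S.int_par S.int_genus

lemma ex_effAct : ex (effAct d π h κ b) = eff d π h κ b :=
  ex_lg S.eff_sub_one (par_of_deg S.eff_deg)

lemma incAct_fil : incAct d π h κ b ∈ Fil d K 0 1 := inc_mem_fil S.effAct_fil

lemma incAct_deg : incAct d π h κ b ∈ Deg d K 0 0 :=
  inc_mem_supp (fun I g hI => by
    rw [mem_ofPred_eq] at hI ⊢; rwa [em_monDegree]) S.effAct_deg

lemma incAct_par : incAct d π h κ b ∈ Par d K 0 0 := par_of_deg S.incAct_deg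

lemma incAct_genus : incAct d π h κ b ∈ Supp d K 0 {p | -1 ≤ p.2} :=
  inc_mem_supp (fun _ _ hI => hI) S.effAct_genus

lemma ex_incAct : ex (incAct d π h κ b) = inc d K 0 h (eff d π h κ b) := by
  rw [← S.ex_effAct]
  exact (ex_map (inc d K 0 h) cont_inc S.effAct_fil S.incAct_fil).symm

lemma prim_deg : prim d π h κ b ∈ Deg d K 0 (-1) :=
  Kop_deg S.toHodgeData (Yop_deg S.toHodgeData (ex_deg S.int_fil S.int_deg))

lemma prim_fil : prim d π h κ b ∈ Fil d K 0 1 := by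
  have : prim d π h κ b = Kop d h κ (Yop d π h κ (ex b - 1)) := by
    rw [map_sub, map_sub, Yop_one, Kop_one, sub_zero]; rfl
  rw [this]
  exact Kop_mem_fil (Yop_mem_fil (ex_sub_one_mem le_rfl S.int_fil))

lemma prim_degree : prim d π h κ b ∈ Supp d K 0 {p | 1 ≤ p.1.degree} := by
  refine Kop_mem_supp (S := Set.univ) ?_ (mem_supp.2 fun _ _ => trivial)
  intro i j _ p _
  rw [mem_ofPred_eq, Prod.fst_add, map_add, degree_single]
  omega

lemma ex_incAct_sub : ex (incAct d π h κ b) - ex b = tw π Sf (prim d π h κ b) := by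
  have := S.perturbed_homotopy S.q_dl (ex b)
  rw [← S.tw_free, ← S.tw_free, S.closed, map_zero, map_zero, add_zero] at this
  rw [S.ex_incAct]; exact this

lemma Yop_prim : Yop d π h κ (prim d π h κ b) = prim d π h κ b := S.Yop_Kop _

lemma prj_Yop_prim : prj d K 0 h (Yop d π h κ (prim d π h κ b)) = 0 := by
  rw [S.Yop_prim]; exact prj_Kop _

lemma Kop_Yop_prim : Kop d h κ (Yop d π h κ (prim d π h κ b)) = 0 := by
  rw [S.Yop_prim]; exact S.Kop_Kop _

lemma prim_unique {F : SF d K 0} (h1 : ex (incAct d π h κ b) - ex b = tw π Sf F)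
    (h2 : prj d K 0 h (Yop d π h κ F) = 0) (h3 : Kop d h κ (Yop d π h κ F) = 0) :
    F = prim d π h κ b := by
  have e : ∀ F : SF d K 0, ex (incAct d π h κ b) - ex b = tw π Sf F →
      prj d K 0 h (Yop d π h κ F) = 0 → Kop d h κ (Yop d π h κ F) = 0 →
      F = -Kop d h κ (Yop d π h κ (ex (incAct d π h κ b) - ex b)) := fun F h1 h2 h3 => by
    have := S.perturbed_homotopy S.q_dl F
    rw [← S.tw_free, ← S.tw_free, h2, h3, ← h1, map_zero, map_zero, zero_sub, zero_add] at this
    rw [← this, neg_neg]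
  rw [e F h1 h2 h3, ← e _ S.ex_incAct_sub S.prj_Yop_prim S.Kop_Yop_prim]

lemma tw_ex_incAct : tw π Sf (ex (incAct d π h κ b)) = 0 := by
  rw [← sub_add_cancel (ex (incAct d π h κ b)) (ex b), S.ex_incAct_sub, map_add, S.tw_tw_free,
    S.closed, add_zero]

lemma poissonH : IsOddPoisson (fun i : {i // h i} => d i.1) (fun i j : {i // h i} => π i j) :=
  ⟨fun i j hij => S.poisson.degree i j hij, fun i j => S.poisson.antisymm i j⟩

lemma tw_inc (w : SF (fun i : {i // h i} => d i.1) K 0) (F) :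
    tw π (Sf + inc d K 0 h w) (inc d K 0 h F) =
      inc d K 0 h (tw (fun i j : {i // h i} => π i j) w F) := by
  have hbr : br π (inc d K 0 h w) (inc d K 0 h F) =
      inc d K 0 h (br (fun i j : {i // h i} => π i j) w F) := by
    rw [br_eq S.poisson, br_eq S.poissonH, sig_inc, ← map_mul, lap_inc, lap_inc, lap_inc]
    simp only [map_sub, map_mul]
  rw [tw_apply, br_add_left, S.free_br, S.lin_inc S.qH, zero_add, hbr, dl_inc, tw_apply, map_add]

lemma dl_eff : dl _ K 0 (fun i j : {i // h i} => π i j) (eff d π h κ b) = 0 := by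
  apply inc_injective
  have := S.tw_ex_incAct
  rw [S.ex_incAct, S.tw_free, S.lin_inc S.qH, zero_add, dl_inc] at this
  rw [this, map_zero]

lemma qme_effAct : qme (fun i j : {i // h i} => π i j) (hb _ K 0 1 * effAct d π h κ b) = 0 := by
  have h0 : qme (fun i j : {i // h i} => π i j) (0 : SF (fun i : {i // h i} => d i.1) K 0) = 0 := by
    have e : br (fun i j : {i // h i} => π i j) (0 : SF (fun i : {i // h i} => d i.1) K 0) 0 = 0 :=
      map_zero (ad (fun i j : {i // h i} => π i j) (0 : SF (fun i : {i // h i} => d i.1) K 0))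
    simp only [qme, map_zero, smul_zero, e, add_zero]
  have := (qme_add_eq_zero_iff S.poissonH (zero_mem _) (par_of_deg S.effAct_deg) S.effAct_fil h0).2
    (by
      have e : br (fun i j : {i // h i} => π i j) (0 : SF (fun i : {i // h i} => d i.1) K 0)
          (ex (effAct d π h κ b)) = 0 := by
        have := br_smul_left (fun i j : {i // h i} => π i j) (0 : K)
          (0 : SF (fun i : {i // h i} => d i.1) K 0) (ex (effAct d π h κ b))
        rwa [zero_smul, zero_smul] at this
      rw [tw_apply, e, add_zero, S.ex_effAct, S.dl_eff])
  rwa [zero_add] at this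

lemma qme_free : qme π Sf = 0 := by
  simp only [qme, dl_apply, S.free_lap, S.free_self, mul_zero, smul_zero, add_zero]

lemma qme_add_incAct : qme π (Sf + hb d K 0 1 * incAct d π h κ b) = 0 :=
  (qme_add_eq_zero_iff S.poisson S.free_par S.incAct_par S.incAct_fil S.qme_free).2 S.tw_ex_incAct

end Action

end Effective

/-! ### Hamiltonian flows -/

section Up

variable {ι : Type*} [LinearOrder ι] {d : ι → ℤ} {R : Type*} [CommRing R]

lemma two_mul_lv_le (p : Mon ι) : 2 * lv 0 p ≤ lv 1 p := by
  have : (0 : ℤ) ≤ p.1.degree := Int.natCast_nonneg _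
  simp only [lv]; push_cast; linarith

lemma up_lf (F : SF d R 0) (v : ℤ) : {p : Mon ι | lv 1 p ≤ v ∧ F.coef p.1 p.2 ≠ 0}.Finite :=
  (F.lf (v / 2)).subset fun p hp => ⟨by
    have := two_mul_lv_le p
    have := hp.1
    omega, hp.2⟩

/-- The inclusion of the series which are finite in every weight into the larger ring of series
which are finite for the level in which the quadratic functions of genus `-1` are positive. -/
def up (d : ι → ℤ) (R : Type*) [CommRing R] : SF d R 0 →+* SF d R 1 where
  toFun F := ⟨F.coef, F.adm, up_lf F⟩
  map_zero' := rfl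
  map_one' := rfl
  map_add' _ _ := rfl
  map_mul' F G := by
    apply coef_injective; funext I g
    have e := coef_mul (c := 1) ⟨F.coef, F.adm, up_lf F⟩ ⟨G.coef, G.adm, up_lf G⟩ I g
    exact (coef_mul F G I g).trans e.symm

lemma up_mem_supp {S : Set (Mon ι)} {F : SF d R 0} (h : F ∈ Supp d R 0 S) : up d R F ∈ Supp d R 1 S := h

lemma cont_up : Cont (up d R).toAddMonoidHom := fun v => ⟨v.toNat, fun F hF p hp => by
  have h1 : ((v.toNat : ℕ) : ℤ) ≤ lv 0 p := hF p hp
  have := two_mul_lv_le p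
  rw [mem_ofPred_eq]; omega⟩

lemma up_der (i : ι) (F : SF d R 0) : up d R (der d R 0 i F) = der d R 1 i (up d R F) := by
  apply coef_injective; funext I g
  rw [coef_der]; exact coef_der i F I g

lemma up_sig (n : ℤ) (F : SF d R 0) : up d R (sig d R 0 n F) = sig d R 1 n (up d R F) := rfl

lemma up_hb (m : ℤ) : up d R (hb d R 0 m) = hb d R 1 m := rfl

lemma up_phi (i : ι) : up d R (phi d R 0 i) = phi d R 1 i := rfl

variable {K : Type*} [Field K] [Algebra K R]

lemma up_smul (r : K) (F : SF d R 0) : up d R (r • F) = r • up d R F := rfl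

lemma up_br (π : ι → ι → K) (F G : SF d R 0) : up d R (br π F G) = br π (up d R F) (up d R G) := by
  refine ((isSum_br π F G).map cont_up).unique ((isSum_br π _ _).congr fun p => ?_)
  change up d R (_ • (_ * _)) = _
  rw [up_smul, map_mul, up_der, rdv_eq, up_sig, up_der, rdv_eq]

end Up

section Hamiltonian

open Polynomial

variable {ι : Type*} [LinearOrder ι] {d : ι → ℤ} {K : Type*} [Field K] [CharZero K] {c : ℕ}
  {π : ι → ι → K}

lemma br_smul_right' {R : Type*} [CommRing R] [Algebra K R] (r : R) (F G : SF d R c) :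
    br π F (r • G) = r • br π F G :=
  (isSum_br π _ _).unique (((isSum_br π F G).smul r).congr fun p => by
    rw [der_smul, mul_smul_comm, smul_comm])

lemma br_odd_even (hπ : IsOddPoisson d π) {R : Type*} [CommRing R] [Algebra K R] {β S : SF d R c}
    (hβ : β ∈ Par d R c 1) (hS : S ∈ Par d R c 0) : br π β S = -br π S β := by
  have h1 : lap d R c π S ∈ Par d R c 1 := lap_par hπ hS
  rw [br_eq hπ, br_eq hπ, sig_even_par hS, sig_odd_par hβ, central_of_even hS β,
    central_of_even hS (lap d R c π β), mul_comm_of_par h1 β, sig_odd_par hβ, neg_mul, map_neg, map_neg,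
    neg_mul, neg_mul]
  abel

/-- The vector field `-ħ {β, -}`. -/
def bvf (π : ι → ι → K) (β : SF d K[X] c) : SF d K[X] c →+ SF d K[X] c :=
  -((AddMonoidHom.mulLeft (hb d K[X] c 1)).comp (ad π β))

lemma bvf_apply (β G : SF d K[X] c) : bvf π β G = -(hb d K[X] c 1 * br π β G) := rfl

lemma raises_bvf {β : SF d K[X] c} (hβ : β ∈ Fil d K[X] c (2 * c + 1)) : Raises (bvf π β) :=
  fun v F hF => by
    have := hb_mul_mem_fil 1 (br_mem_fil (π := π) hβ hF)
    exact neg_mem (fil_anti (by linarith) this)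

lemma isDer_bvf (hπ : IsOddPoisson d π) {β : SF d K[X] c} (hβ : β ∈ Par d K[X] c 1) :
    IsDer 0 (bvf π β) where
  cont := Cont.neg ((cont_mul_left _).comp (cont_ad π β))
  smul r F := by rw [bvf_apply, bvf_apply, br_smul_right', mul_smul_comm, smul_neg]
  hb_mul m F := by
    rw [bvf_apply, bvf_apply, br_hb_right, ← mul_assoc, hb_comm 1 (hb _ _ _ m), mul_assoc, mul_neg]
  mul F G := by
    have h2 : Even ((1 : ℤ) + 1) := ⟨1, rfl⟩
    rw [bvf_apply, bvf_apply, bvf_apply, br_mul hπ hβ, sig_even h2, sig_even Even.zero,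
      mul_add, ← mul_assoc, ← mul_assoc, hb_comm 1 F, mul_assoc F]
    noncomm_ring

lemma bvf_deg (hπ : IsOddPoisson d π) {β : SF d K[X] c} (hβ : β ∈ Deg d K[X] c (-1)) {n : ℤ}
    {F : SF d K[X] c} (hF : F ∈ Deg d K[X] c n) : bvf π β F ∈ Deg d K[X] c n := by
  have := neg_mem (hb_mul_deg 1 (br_deg hπ hβ hF))
  rwa [show -1 + n + 1 = n by ring] at this

lemma up_bvf (β G : SF d K[X] 0) : up d _ (bvf π β G) = bvf π (up d _ β) (up d _ G) := by
  rw [bvf_apply, bvf_apply, map_neg, map_mul, up_br, up_hb]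

lemma up_flow {X : SF d K[X] 0 →+ SF d K[X] 0} {X' : SF d K[X] 1 →+ SF d K[X] 1}
    (hd : IsDer 0 X) (hd' : IsDer 0 X') (hX : Raises X) (hX' : Raises X')
    (h : ∀ G, up d _ (X G) = X' (up d _ G)) (G : SF d K[X] 0) :
    up d _ (flow hd hX G) = flow hd' hX' (up d _ G) := by
  refine ((isSum_flowAdd hX G).map cont_up).unique ((isSum_flowAdd hX' (up d _ G)).congr fun k => ?_)
  have e : (Dt X')^[k] (up d _ G) = up d _ ((Dt X)^[k] G) := by
    induction k with
    | zero => rfl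
    | succ k ih =>
      rw [iterate_succ_apply', iterate_succ_apply', ih, Dt_apply, Dt_apply,
        map_add, h]
      rfl
  unfold flowTerm
  rw [e]
  rfl

lemma up_flowAt {X : SF d K[X] 0 →+ SF d K[X] 0} {X' : SF d K[X] 1 →+ SF d K[X] 1}
    (hd : IsDer 0 X) (hd' : IsDer 0 X') (hX : Raises X) (hX' : Raises X')
    (h : ∀ G, up d _ (X G) = X' (up d _ G)) (t : K) (F : SF d K 0) :
    up d _ (flowAt hd hX t F) = flowAt hd' hX' t (up d _ F) := by
  have := congrArg (ev t) (up_flow hd hd' hX hX' h (cst F))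
  exact this

end Hamiltonian

section Evolution

open Polynomial

variable {ι : Type*} [LinearOrder ι] {d : ι → ℤ} {K : Type*} [Field K] [CharZero K]
  {π : ι → ι → K} {h : ι → Prop} {μ κ : ι → ι →₀ K}

/-- The path of exponentials. -/
def expPath (d : ι → ℤ) (π : ι → ι → K) (h : ι → Prop) (κ : ι → ι →₀ K) (b : SF d K 0) :
    SF d K[X] 0 := (1 - X : K[X]) • cst (ex (incAct d π h κ b)) + (X : K[X]) • cst (ex b)

/-- The path of interactions, divided by `ħ`. -/
def path (d : ι → ℤ) (π : ι → ι → K) (h : ι → Prop) (κ : ι → ι →₀ K) (b : SF d K 0) :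
    SF d K[X] 0 := lg (expPath d π h κ b)

/-- The Hamiltonian of the flow. -/
def ham (d : ι → ℤ) (π : ι → ι → K) (h : ι → Prop) (κ : ι → ι →₀ K) (b : SF d K 0) :
    SF d K[X] 0 := ex (-path d π h κ b) * cst (prim d π h κ b)

/-- The path of actions. -/
def actPath (d : ι → ℤ) (π : ι → ι → K) (h : ι → Prop) (κ : ι → ι →₀ K) (Sf b : SF d K 0) :
    SF d K[X] 0 := cst Sf + hb d K[X] 0 1 * path d π h κ b

lemma ext_of_cst {c : ℕ} {L M : SF d K[X] c →+ SF d K[X] c} (hL : Cont L) (hM : Cont M)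
    (sL : ∀ (r : K[X]) F, L (r • F) = r • L F) (sM : ∀ (r : K[X]) F, M (r • F) = r • M F)
    (h : ∀ F, L (cst F) = M (cst F)) : L = M := by
  refine ext_of_mono hL hM fun r p => ?_
  have e : mono d c r p = r • cst (mono d c (1 : K) p) := by
    classical
    ext1; funext I g
    rw [coef_smul, coef_cst, coef_mono, coef_mono]
    split_ifs <;> simp
  rw [e, sL, sM, h]

lemma tw_cst (S F : SF d K 0) : tw π (cst S) (cst F) = cst (tw π S F) := by
  rw [tw_apply, tw_apply, dl_cst, map_add]
  congr 1
  exact (mapR_br C_smul π S F).symm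

lemma tw_smul' {R : Type*} [CommRing R] [Algebra K R] {c : ℕ} (S : SF d R c) (r : R) (F : SF d R c) :
    tw π S (r • F) = r • tw π S F := by
  have : lap d R c π (r • F) = r • lap d R c π F :=
    (isSum_lap π _).unique (((isSum_lap π F).smul r).congr fun p => by
      rw [der_smul, der_smul, smul_comm])
  rw [tw_apply, tw_apply, br_smul_right', dl_apply, dl_apply, this, mul_smul_comm, smul_add]

lemma ev_hb {c : ℕ} (t : K) (m : ℤ) : ev t (hb d K[X] c m) = hb d K c m := by
  rw [← cst_hb, ev_cst]

lemma ev_smul' {c : ℕ} (t r : K) (F : SF d K[X] c) : ev t (r • F) = r • ev t F := by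
  ext I g; simp [coef_ev, coef_smul]

lemma ev_br {c : ℕ} (t : K) (F G : SF d K[X] c) : ev t (br π F G) = br π (ev t F) (ev t G) :=
  mapR_br (f := evalRingHom t) (fun r x => by simp) π F G

lemma ev_dl {c : ℕ} (t : K) (F : SF d K[X] c) : ev t (dl d K[X] c π F) = dl d K c π (ev t F) := by
  rw [dl_apply, dl_apply, map_mul, ev_hb]
  congr 1
  exact mapC_lap (f := (evalRingHom t).toAddMonoidHom) (fun r x => by simp) π F

lemma ev_tw {c : ℕ} (t : K) (S F : SF d K[X] c) : ev t (tw π S F) = tw π (ev t S) (ev t F) := by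
  rw [tw_apply, tw_apply, map_add, ev_dl, ev_br]

lemma dt_hb {c : ℕ} (m : ℤ) : dt (hb d K[X] c m) = 0 := by rw [← cst_hb, dt_cst]

lemma dt_dl {c : ℕ} (F : SF d K[X] c) : dt (dl d K[X] c π F) = dl d K[X] c π (dt F) := by
  rw [dl_apply, dl_apply, dt_mul, dt_hb, zero_mul, zero_add]
  congr 1
  exact mapC_lap (f := derivative.toAddMonoidHom) (fun r x => by simp) π F

lemma dt_br {c : ℕ} (F G : SF d K[X] c) : dt (br π F G) = br π (dt F) G + br π F (dt G) := by
  have h1 : ∀ (r : K) (x : K[X]), (derivative : K[X] →ₗ[K] K[X]).toAddMonoidHom (r • x) =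
    r • (derivative : K[X] →ₗ[K] K[X]).toAddMonoidHom x := fun r x => derivative.map_smul r x
  have h2 : ∀ x y : K[X], (derivative : K[X] →ₗ[K] K[X]).toAddMonoidHom (x * y) =
    (derivative : K[X] →ₗ[K] K[X]).toAddMonoidHom x * y +
      x * (derivative : K[X] →ₗ[K] K[X]).toAddMonoidHom y := fun x y => derivative_mul
  exact mapC_br h1 h2 π F G

namespace Action

variable {Sf b : SF d K 0} (S : Action d π h μ κ Sf b)
include S

lemma expPath_eq : expPath d π h κ b = 1 + ((1 - X : K[X]) • cst (ex (incAct d π h κ b) - 1) +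
    (X : K[X]) • cst (ex b - 1)) := by
  rw [map_sub, map_sub, map_one, smul_sub, smul_sub, expPath, sub_smul, sub_smul, one_smul, one_smul]
  abel

lemma expPath_sub_one : expPath d π h κ b - 1 ∈ Fil d K[X] 0 1 := by
  rw [S.expPath_eq, add_sub_cancel_left]
  exact add_mem (supp_smul (S := {p | 1 ≤ lv 0 p}) _ (cst_mem_supp (ex_sub_one_mem le_rfl S.incAct_fil)))
    (supp_smul (S := {p | 1 ≤ lv 0 p}) _ (cst_mem_supp (ex_sub_one_mem le_rfl S.int_fil)))

lemma expPath_deg : expPath d π h κ b ∈ Deg d K[X] 0 0 :=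
  add_mem (supp_smul _ (cst_mem_supp (ex_deg S.incAct_fil S.incAct_deg)))
    (supp_smul _ (cst_mem_supp (ex_deg S.int_fil S.int_deg)))

lemma path_fil : path d π h κ b ∈ Fil d K[X] 0 1 := lg_mem_fil S.expPath_sub_one

lemma path_deg : path d π h κ b ∈ Deg d K[X] 0 0 := lg_deg S.expPath_sub_one S.expPath_deg

lemma path_par : path d π h κ b ∈ Par d K[X] 0 0 := par_of_deg S.path_deg

lemma ex_path : ex (path d π h κ b) = expPath d π h κ b :=
  ex_lg S.expPath_sub_one (par_of_deg S.expPath_deg)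

lemma ev_expPath (t : K) : ev t (expPath d π h κ b) =
    (1 - t) • ex (incAct d π h κ b) + t • ex b := by
  rw [expPath, map_add, ev_smul_cst, ev_smul_cst]; simp

lemma ev_path (t : K) : ev t (path d π h κ b) =
    lg ((1 - t) • ex (incAct d π h κ b) + t • ex b) := by
  rw [path, ev_lg t S.expPath_sub_one, S.ev_expPath]

lemma ev_path_zero : ev 0 (path d π h κ b) = incAct d π h κ b := by
  rw [S.ev_path, sub_zero, one_smul, zero_smul, add_zero, lg_ex S.incAct_fil S.incAct_par]

lemma ev_path_one : ev 1 (path d π h κ b) = b := by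
  rw [S.ev_path, sub_self, one_smul, zero_smul, zero_add, lg_ex S.int_fil S.int_par]

lemma neg_path_fil : -path d π h κ b ∈ Fil d K[X] 0 1 := neg_mem S.path_fil

lemma ham_deg : ham d π h κ b ∈ Deg d K[X] 0 (-1) := by
  have := mul_deg (ex_deg S.neg_path_fil (neg_mem S.path_deg)) (cst_mem_supp S.prim_deg)
  rwa [zero_add] at this

lemma ham_par : ham d π h κ b ∈ Par d K[X] 0 1 := by
  rw [par_congr (n := -1) (by decide)]; exact par_of_deg S.ham_deg

lemma ham_fil : ham d π h κ b ∈ Fil d K[X] 0 1 := by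
  have h1 : ex (-path d π h κ b) ∈ Fil d K[X] 0 0 := by
    have := add_mem (fil_anti (by norm_num) (ex_sub_one_mem le_rfl S.neg_path_fil))
      (one_mem_supp (R := K[X]) (d := d) (c := 0) (S := {p | 0 ≤ lv 0 p}) (by simp [lv]))
    rwa [sub_add_cancel] at this
  have := mul_mem_fil h1 (cst_mem_supp S.prim_fil)
  rwa [zero_add] at this

lemma ham_degree : ham d π h κ b ∈ Supp d K[X] 0 {p | 1 ≤ p.1.degree} := by
  refine mul_mem_supp (S := Set.univ) ?_ (mem_supp.2 fun _ _ => trivial) (cst_mem_supp S.prim_degree)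
  intro p _ q hq
  rw [mem_ofPred_eq] at *
  rw [Prod.fst_add, map_add]; omega

lemma up_ham_fil : up d _ (ham d π h κ b) ∈ Fil d K[X] 1 3 := fun p hp => by
  have h1 : 1 ≤ lv 0 p := S.ham_fil p hp
  have h2 : 1 ≤ p.1.degree := S.ham_degree p hp
  rw [mem_ofPred_eq]
  simp only [lv] at *
  push_cast at *
  linarith [(by exact_mod_cast h2 : (1 : ℤ) ≤ p.1.degree)]

lemma path_mul_ham : ex (path d π h κ b) * ham d π h κ b = cst (prim d π h κ b) := by
  rw [ham, ← mul_assoc, ex_mul_ex_neg S.path_fil S.path_par, one_mul]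

lemma ev_ham (t : K) : ev t (ham d π h κ b) = ex (-ev t (path d π h κ b)) * prim d π h κ b := by
  rw [ham, map_mul, ev_ex t S.neg_path_fil, map_neg, ev_cst]

lemma cst_free_par : cst Sf ∈ Par d K[X] 0 0 := cst_mem_supp S.free_par

lemma actPath_deg : actPath d π h κ Sf b ∈ Deg d K[X] 0 0 :=
  add_mem (cst_mem_supp S.free_deg) (hb_mul_deg 1 S.path_deg)

lemma actPath_par : actPath d π h κ Sf b ∈ Par d K[X] 0 0 := par_of_deg S.actPath_deg

lemma tw_ex_path : tw π (cst Sf) (ex (path d π h κ b)) = 0 := by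
  rw [S.ex_path, expPath, map_add, tw_smul', tw_smul', tw_cst, tw_cst, S.tw_ex_incAct, S.closed,
    map_zero, smul_zero, smul_zero, add_zero]

lemma tw_tw_cst (G : SF d K[X] 0) : tw π (cst Sf) (tw π (cst Sf) G) = 0 := by
  have e : (tw π (cst Sf)).comp (tw π (cst Sf)) = (0 : SF d K[X] 0 →+ SF d K[X] 0) := by
    refine ext_of_cst ((cont_tw _ _).comp (cont_tw _ _)) (fun v => ⟨0, fun _ _ => zero_mem _⟩)
      (fun r F => ?_) (fun r F => (smul_zero r).symm) fun F => ?_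
    · rw [comp_apply, comp_apply, tw_smul', tw_smul']
    · rw [comp_apply, AddMonoidHom.zero_apply, tw_cst, tw_cst, S.tw_tw_free, map_zero]
  exact DFunLike.congr_fun e G

lemma tw_tw_path (G : SF d K[X] 0) :
    tw π (actPath d π h κ Sf b) (tw π (actPath d π h κ Sf b) G) = 0 :=
  tw_tw_of_conj S.poisson S.cst_free_par S.path_fil S.path_par S.tw_ex_path S.tw_tw_cst G

lemma dt_path : dt (path d π h κ b) = -tw π (actPath d π h κ Sf b) (ham d π h κ b) := by
  refine ex_mul_cancel S.path_fil S.path_par ?_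
  rw [← dt_ex S.path_fil S.path_par, mul_neg, actPath,
    ← tw_conj S.poisson S.cst_free_par S.path_fil S.path_par S.tw_ex_path, S.path_mul_ham, tw_cst,
    ← S.ex_incAct_sub, S.ex_path, expPath, map_add, dt_smul_cst, dt_smul_cst]
  simp only [derivative_sub, derivative_one, derivative_X, zero_sub, neg_smul, one_smul, map_sub]
  abel

lemma dt_actPath : dt (actPath d π h κ Sf b) =
    -(hb d K[X] 0 1 * tw π (actPath d π h κ Sf b) (ham d π h κ b)) := by
  rw [actPath, map_add, dt_cst, zero_add, dt_mul, dt_hb, zero_mul, zero_add, S.dt_path, mul_neg]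
  rfl

lemma Dt_tw (G : SF d K[X] 0) :
    Dt (bvf π (ham d π h κ b)) (tw π (actPath d π h κ Sf b) G) =
      tw π (actPath d π h κ Sf b) (Dt (bvf π (ham d π h κ b)) G) := by
  rw [Dt_apply, Dt_apply, map_add, bvf_apply, bvf_apply, map_neg,
    tw_br S.poisson S.actPath_par S.tw_tw_path S.ham_par]
  have h1 : dt (tw π (actPath d π h κ Sf b) G) = tw π (actPath d π h κ Sf b) (dt G) -
      hb d K[X] 0 1 * br π (tw π (actPath d π h κ Sf b) (ham d π h κ b)) G := by
    rw [tw_apply, map_add, dt_dl, dt_br, S.dt_actPath, br_neg_left, br_hb_left, tw_apply _ _ (dt G)]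
    abel
  rw [h1]
  abel

lemma isDer_ham : IsDer 0 (bvf π (ham d π h κ b)) := isDer_bvf S.poisson S.ham_par

lemma raises_ham : Raises (bvf π (ham d π h κ b)) := raises_bvf (by simpa using S.ham_fil)

lemma isDer_up_ham : IsDer 0 (bvf π (up d _ (ham d π h κ b))) := isDer_bvf S.poisson S.ham_par

lemma raises_up_ham : Raises (bvf π (up d _ (ham d π h κ b))) :=
  raises_bvf (by simpa using S.up_ham_fil)

/-- The flow of the Hamiltonian vector field. -/
def Flow : SF d K[X] 0 →+* SF d K[X] 0 := flow S.isDer_ham S.raises_ham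

/-- The flow at time `t`. -/
def FlowAt (t : K) : SF d K 0 →+* SF d K 0 := flowAt S.isDer_ham S.raises_ham t

lemma Flow_tw (G : SF d K[X] 0) : S.Flow (tw π (actPath d π h κ Sf b) G) =
    tw π (cst (Sf + hb d K 0 1 * incAct d π h κ b)) (S.Flow G) := by
  refine flow_intertwines S.isDer_ham S.raises_ham S.Dt_tw (T₀ := tw π _) (fun G => ?_) (fun G G' e => ?_) G
  · rw [tw_apply, tw_apply, map_add, dt_dl, dt_br, dt_cst]
    have : br π (0 : SF d K[X] 0) G = 0 := by
      have := br_smul_left π (0 : K) (0 : SF d K[X] 0) G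
      rwa [zero_smul, zero_smul] at this
    rw [this, zero_add]
  · rw [ev_tw, ev_tw, e, ev_cst, actPath, map_add, ev_cst, map_mul, ev_hb, S.ev_path_zero]

lemma FlowAt_tw (F : SF d K 0) : S.FlowAt 1 (tw π (Sf + hb d K 0 1 * b) F) =
    tw π (Sf + hb d K 0 1 * incAct d π h κ b) (S.FlowAt 1 F) := by
  have h1 := congrArg (ev 1) (S.Flow_tw (cst F))
  rw [ev_tw, ev_cst] at h1
  have h2 := ev_flow S.isDer_ham S.raises_ham 1 (tw π (actPath d π h κ Sf b) (cst F))
  rw [ev_tw, ev_cst, actPath, map_add, ev_cst, map_mul, ev_hb, S.ev_path_one] at h2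
  exact h2.symm.trans h1

lemma FlowAt_mem_deg (t : K) {n : ℤ} {F : SF d K 0} (hF : F ∈ Deg d K 0 n) :
    S.FlowAt t F ∈ Deg d K 0 n :=
  flowAt_mem_supp _ _ t (fun _ h => bvf_deg S.poisson S.ham_deg h) hF

/-- The logarithm of the semidensity, up to the Berezinian. -/
lemma dt_Flow_actPath : dt (S.Flow (hb d K[X] 0 (-1) * actPath d π h κ Sf b)) =
    -S.Flow (dl d K[X] 0 π (ham d π h κ b)) := by
  have e : dt (S.Flow (hb d K[X] 0 (-1) * actPath d π h κ Sf b)) =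
      S.Flow (Dt (bvf π (ham d π h κ b)) (hb d K[X] 0 (-1) * actPath d π h κ Sf b)) :=
    dt_flowAdd S.raises_ham _
  rw [e, ← map_neg, Dt_apply, dt_mul, dt_hb, zero_mul, zero_add, S.dt_actPath, bvf_apply, br_hb_right,
    mul_neg, hb_neg_mul_hb, hb_mul_hb_neg, tw_apply]
  rw [br_odd_even S.poisson S.ham_par S.actPath_par]
  congr 1
  abel

end Action

end Evolution

/-! ### The Berezinian -/

section Rows

variable {ι : Type*} {d : ι → ℤ} {R : Type*} [CommRing R] {c : ℕ} {α α' : Type*}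

lemma IsSum.rows {y : α × α' → SF d R c} {z : SF d R c} {w : α → SF d R c} (h : IsSum y z)
    (hw : ∀ a, IsSum (fun a' => y (a, a')) (w a)) : IsSum w z := by
  classical
  intro v
  obtain ⟨s₀, hs⟩ := h v
  refine ⟨s₀.image Prod.fst, fun t ht => ?_⟩
  choose u hu using fun a => hw a v
  have h1 := hs (t ×ˢ (t.biUnion u ∪ s₀.image Prod.snd)) fun p hp => Finset.mem_product.2
    ⟨ht (Finset.mem_image_of_mem _ hp),
      Finset.mem_union_right _ (Finset.mem_image_of_mem _ hp)⟩
  have h2 : ∑ a ∈ t, (w a - ∑ a' ∈ t.biUnion u ∪ s₀.image Prod.snd, y (a, a')) ∈ Fil d R c v :=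
    sum_mem fun a ha => hu a _ ((Finset.subset_biUnion_of_mem u ha).trans Finset.subset_union_left)
  have h3 := sub_mem h1 h2
  rw [sum_sub_distrib, Finset.sum_product] at h3
  simpa using h3

lemma IsSum.sub_sum_mem {y : α → SF d R c} {z : SF d R c} (h : IsSum y z) {v : ℤ} {s : Finset α}
    (hs : ∀ a ∉ s, y a ∈ Fil d R c v) : z - ∑ a ∈ s, y a ∈ Fil d R c v := by
  classical
  obtain ⟨s₀, h0⟩ := h v
  have h1 := h0 (s₀ ∪ s) Finset.subset_union_left
  have h2 : ∑ a ∈ (s₀ ∪ s) \ s, y a ∈ Fil d R c v :=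
    sum_mem fun a ha => hs a (Finset.mem_sdiff.1 ha).2
  have h3 := add_mem h1 h2
  rw [← Finset.sum_sdiff (Finset.subset_union_right : s ⊆ s₀ ∪ s)] at h3
  convert h3 using 1
  abel

lemma Summ.of_imp {y : α → SF d R c} {y' : α' → SF d R c} (h : Summ y) {f : α' → α}
    (hf : Function.Injective f) (h' : ∀ a v, y (f a) ∈ Fil d R c v → y' a ∈ Fil d R c v) : Summ y' :=
  fun v => ((h v).preimage hf.injOn).subset fun a ha hy => ha (h' a v hy)

end Rows

/-- A trace of a derivation of a power. -/
lemma trace_deriv_pow {M A : Type*} [Ring M] [AddCommGroup A] (δ : M →+ M)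
    (hδ : ∀ x y, δ (x * y) = δ x * y + x * δ y) (tr : M →+ A) (E : M → Prop)
    (hE : ∀ x y, E x → E y → E (x * y)) (hE1 : E 1) (hEδ : ∀ x, E x → E (δ x))
    (htr : ∀ x y, E x → E y → tr (x * y) = tr (y * x)) {a : M} (ha : E a) (m n : ℕ) :
    tr (a ^ m * δ (a ^ (n + 1))) = (n + 1) • tr (a ^ (m + n) * δ a) := by
  have hp : ∀ n : ℕ, E (a ^ n) := fun n => by
    induction n with
    | zero => rwa [pow_zero]
    | succ n ih => rw [pow_succ]; exact hE _ _ ih ha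
  induction n generalizing m with
  | zero => simp
  | succ n ih =>
    rw [pow_succ' a (n + 1), hδ, mul_add, map_add, ← mul_assoc (a ^ m) a, ← pow_succ, ih,
      ← mul_assoc, htr _ _ (hE _ _ (hp m) (hEδ a ha)) (hp _), ← mul_assoc, ← pow_add,
      show n + 1 + m = m + (n + 1) by ring, show m + 1 + n = m + (n + 1) by ring,
      add_smul (n + 1) 1, one_smul, add_comm]

section Mat

variable {ι : Type*} [LinearOrder ι] {d : ι → ℤ} {R : Type*} [CommRing R] {c : ℕ}

open Classical in
/-- Powers of an infinite matrix. -/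
def mpow (N : ι → ι → SF d R c) : ℕ → ι → ι → SF d R c
  | 0 => fun j i => if j = i then 1 else 0
  | n + 1 => fun j i => fsum fun k => N j k * mpow N n k i

/-- The supertrace. -/
def strc (N : ι → ι → SF d R c) : SF d R c := fsum fun i => sg R (d i) • N i i

/-- The supertrace of the logarithm of `1 + N`. -/
def lber [Algebra ℚ R] (N : ι → ι → SF d R c) : SF d R c :=
  fsum fun n : ℕ => ((-1) ^ n * ((n : ℚ) + 1)⁻¹) • strc (mpow N (n + 1))

/-- Matrices with entries of positive level, finitely many of bounded level. -/
structure IsSmall (N : ι → ι → SF d R c) : Prop where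
  fil : ∀ j i, N j i ∈ Fil d R c 1
  summ : Summ fun p : ι × ι => N p.1 p.2

variable {N : ι → ι → SF d R c} (hN : IsSmall N)
include hN

lemma IsSmall.exists_finset (v : ℤ) : ∃ s : Finset ι, ∀ j i, ¬ (j ∈ s ∧ i ∈ s) → N j i ∈ Fil d R c v := by
  classical
  refine ⟨(hN.summ v).toFinset.image Prod.fst ∪ (hN.summ v).toFinset.image Prod.snd,
    fun j i hji => ?_⟩
  by_contra h'
  have h1 : (j, i) ∈ (hN.summ v).toFinset := (hN.summ v).mem_toFinset.2 h'
  exact hji ⟨Finset.mem_union_left _ (Finset.mem_image_of_mem Prod.fst h1),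
    Finset.mem_union_right _ (Finset.mem_image_of_mem Prod.snd h1)⟩

lemma one_mem_fil : (1 : SF d R c) ∈ Fil d R c 0 :=
  one_mem_supp (S := {p | 0 ≤ lv c p}) (by simp [lv])

lemma IsSmall.summ_row {M : ι → ι → SF d R c} (hM : ∀ j i, M j i ∈ Fil d R c 0) (j i : ι) :
    Summ fun k => N j k * M k i := hN.summ.of_imp (f := fun k => (j, k)) (fun _ _ h => by simpa using h)
  fun k v h => by
    have := mul_mem_fil h (hM k i)
    rwa [add_zero] at this

lemma IsSmall.mpow_mem (n : ℕ) (j i : ι) : mpow N n j i ∈ Fil d R c n := by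
  classical
  induction n generalizing j i with
  | zero =>
    change (if j = i then 1 else 0) ∈ _
    split_ifs
    · exact one_mem_fil hN
    · exact zero_mem _
  | succ n ih =>
    refine (hN.summ_row (fun j i => fil_anti (by positivity) (ih j i)) j i).isSum.mem_fil fun k => ?_
    have := mul_mem_fil (hN.fil j k) (ih k i)
    rwa [add_comm] at this

lemma IsSmall.isSum_mpow (n : ℕ) (j i : ι) : IsSum (fun k => N j k * mpow N n k i) (mpow N (n + 1) j i) :=
  (hN.summ_row (fun j i => fil_anti (by positivity) (hN.mpow_mem n j i)) j i).isSum

lemma IsSmall.mpow_mem_of_not {v : ℤ} {s : Finset ι}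
    (hs : ∀ j i, ¬ (j ∈ s ∧ i ∈ s) → N j i ∈ Fil d R c v) (n : ℕ) (j i : ι) (hji : ¬ (j ∈ s ∧ i ∈ s)) :
    mpow N (n + 1) j i ∈ Fil d R c v := by
  classical
  have step : ∀ j k : ι, ∀ n i, N j k ∈ Fil d R c v → N j k * mpow N n k i ∈ Fil d R c v :=
    fun j k n i h => by
      have := mul_mem_fil h (hN.mpow_mem n k i)
      exact fil_anti (by linarith [Int.natCast_nonneg n]) this
  induction n generalizing j i with
  | zero =>
    refine (hN.isSum_mpow 0 j i).mem_fil fun k => ?_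
    by_cases hk : k = i
    · subst hk; exact step _ _ _ _ (hs _ _ hji)
    · change _ * (if k = i then 1 else 0) ∈ _
      rw [if_neg hk, mul_zero]; exact zero_mem _
  | succ n ih =>
    refine (hN.isSum_mpow (n + 1) j i).mem_fil fun k => ?_
    by_cases h1 : j ∈ s ∧ k ∈ s
    · have h2 := ih k i fun h => hji ⟨h1.1, h.2⟩
      have := mul_mem_fil (hN.fil j k) h2
      exact fil_anti (by linarith) this
    · exact step _ _ _ _ (hs _ _ h1)

lemma IsSmall.summ_strc (n : ℕ) : Summ fun i => sg R (d i) • mpow N (n + 1) i i := fun v => by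
  obtain ⟨s, hs⟩ := hN.exists_finset v
  refine s.finite_toSet.subset fun i hi => ?_
  by_contra h'
  exact hi (sg_smul_mem_iff.2 (hN.mpow_mem_of_not hs n i i fun h => h' h.1))

lemma IsSmall.isSum_strc (n : ℕ) :
    IsSum (fun i => sg R (d i) • mpow N (n + 1) i i) (strc (mpow N (n + 1))) := (hN.summ_strc n).isSum

lemma IsSmall.strc_mem (n : ℕ) : strc (mpow N (n + 1)) ∈ Fil d R c (n + 1) :=
  (hN.isSum_strc n).mem_fil fun i => sg_smul_mem_iff.2 (by exact_mod_cast hN.mpow_mem (n + 1) i i)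

lemma IsSmall.isSum_lber [Algebra ℚ R] :
    IsSum (fun n : ℕ => ((-1) ^ n * ((n : ℚ) + 1)⁻¹) • strc (mpow N (n + 1))) (lber N) :=
  (summ_nat fun v => ⟨v.toNat, fun n hn =>
    supp_smul _ (fil_anti (by omega) (hN.strc_mem n))⟩ : Summ _).isSum

section Trunc

variable {v : ℤ} {s : Finset ι} (hs : ∀ j i, ¬ (j ∈ s ∧ i ∈ s) → N j i ∈ Fil d R c v)
include hs

open Classical in
lemma IsSmall.mpow_sub_mem (n : ℕ) (j i : s) :
    mpow N n j i - ((Matrix.of fun j i : s => N j i) ^ n) j i ∈ Fil d R c v := by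
  induction n generalizing j i with
  | zero =>
    rw [pow_zero, Matrix.one_apply]
    change (if (j : ι) = i then 1 else 0) - _ ∈ _
    simp only [Subtype.coe_inj]
    rw [sub_self]; exact zero_mem _
  | succ n ih =>
    have h1 := (hN.isSum_mpow n j i).sub_sum_mem (v := v) (s := s) fun k hk => by
      have := mul_mem_fil (hs j k fun h => hk h.2) (hN.mpow_mem n k i)
      exact fil_anti (by linarith [Int.natCast_nonneg n]) this
    rw [pow_succ', Matrix.mul_apply]
    have h2 : ∑ k : s, (N j k * mpow N n k i - N j k * ((Matrix.of fun j i : s => N j i) ^ n) k i) ∈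
        Fil d R c v := sum_mem fun k _ => by
      rw [← mul_sub]
      have := mul_mem_fil (hN.fil j k) (ih k i)
      exact fil_anti (by linarith) this
    rw [sum_sub_distrib, Finset.sum_coe_sort s (fun k => N j k * mpow N n k i)] at h2
    have := add_mem h1 h2
    rw [sub_add_sub_cancel] at this
    exact this

end Trunc

end Mat

section Trace

variable {ι : Type*} [LinearOrder ι] {d : ι → ℤ} {R : Type*} [CommRing R] {c : ℕ} (s : Finset ι)

/-- The supertrace of a finite matrix. -/
def fstr (d : ι → ℤ) (R : Type*) [CommRing R] (c : ℕ) : Matrix s s (SF d R c) →+ SF d R c where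
  toFun A := ∑ i : s, sg R (d i) • A i i
  map_zero' := by simp
  map_add' A B := by simp [smul_add, sum_add_distrib]

lemma fstr_apply (A : Matrix s s (SF d R c)) : fstr s d R c A = ∑ i : s, sg R (d i) • A i i := rfl

/-- Even matrices. -/
def EvenMat (A : Matrix s s (SF d R c)) : Prop :=
  ∀ j i : s, A j i ∈ Par d R c (d j + d i)

variable {s}

lemma EvenMat.mul {A B : Matrix s s (SF d R c)} (hA : EvenMat s A) (hB : EvenMat s B) :
    EvenMat s (A * B) := fun j i => by
  rw [Matrix.mul_apply]
  refine sum_mem fun k _ => ?_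
  have := mul_par (hA j k) (hB k i)
  rwa [par_congr (n := d j + d i) ⟨d k, by ring⟩] at this

lemma evenMat_one [DecidableEq s] : EvenMat s (1 : Matrix s s (SF d R c)) := fun j i => by
  rw [Matrix.one_apply]
  split_ifs with h
  · subst h; rw [par_congr (n := 0) ⟨d j, by ring⟩]
    exact one_mem_supp (by simp [monDegree])
  · exact zero_mem _

lemma fstr_mul_comm {A B : Matrix s s (SF d R c)} (hA : EvenMat s A) (hB : EvenMat s B) :
    fstr s d R c (A * B) = fstr s d R c (B * A) := by
  simp only [fstr_apply, Matrix.mul_apply, Finset.smul_sum]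
  rw [Finset.sum_comm]
  refine sum_congr rfl fun k _ => sum_congr rfl fun i _ => ?_
  rw [mul_comm_of_par (hA i k), sig_of_par (hB k i), smul_mul_assoc, smul_smul, ← sg_add]
  congr 1
  refine sg_congr ?_
  rw [show (d i : ℤ) + (d i + d k) * (d k + d i) - d k = (d i - d k) + (d i + d k) * (d i + d k) by ring]
  rcases Int.even_or_odd (d (i : ι)) with h1 | h1 <;> rcases Int.even_or_odd (d (k : ι)) with h2 | h2 <;>
    simp [Int.even_add, Int.even_sub, Int.even_mul, Int.not_even_iff_odd.2, *]

end Trace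

section LogDeriv

open Polynomial

variable {ι : Type*} [LinearOrder ι] {d : ι → ℤ} {K : Type*} [Field K] [CharZero K] {c : ℕ}

/-- The derivative of `log Ber (1 + N)`, if the derivative of `N` is `(1 + N) Y`. -/
lemma dt_lber {N Y : ι → ι → SF d K[X] c} (hN : IsSmall N)
    (hp : ∀ j i, N j i ∈ Par d K[X] c (d j + d i)) (hY : ∀ j i, Y j i ∈ Fil d K[X] c 0)
    (hd : ∀ j i, IsSum (fun k => N j k * Y k i) (dt (N j i) - Y j i)) {z : SF d K[X] c}
    (hz : IsSum (fun i => sg K[X] (d i) • Y i i) z) (hsz : Summ fun i => Y i i) : dt (lber N) = z := by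
  classical
  rw [← sub_eq_zero]
  refine eq_zero_of_forall_fil fun v => ?_
  obtain ⟨s₁, hs₁⟩ := hN.exists_finset v
  set s := s₁ ∪ (hsz v).toFinset with hs_def
  have hs : ∀ j i, ¬ (j ∈ s ∧ i ∈ s) → N j i ∈ Fil d K[X] c v := fun j i h => hs₁ j i fun h' =>
    h ⟨Finset.mem_union_left _ h'.1, Finset.mem_union_left _ h'.2⟩
  have hYs : ∀ i ∉ s, sg K[X] (d i) • Y i i ∈ Fil d K[X] c v := fun i hi => by
    refine sg_smul_mem_iff.2 ?_
    by_contra h'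
    exact hi (Finset.mem_union_right _ ((hsz v).mem_toFinset.2 h'))
  set A : Matrix s s (SF d K[X] c) := Matrix.of fun j i => N j i with hA
  set B : Matrix s s (SF d K[X] c) := Matrix.of fun j i => Y j i with hB
  set δ : Matrix s s (SF d K[X] c) →+ Matrix s s (SF d K[X] c) := dt.mapMatrix with hδ
  have hfil : ∀ {w : ℤ} (M : Matrix s s (SF d K[X] c)), (∀ j i, M j i ∈ Fil d K[X] c w) →
      fstr s d K[X] c M ∈ Fil d K[X] c w := fun M hM => sum_mem fun i _ => sg_smul_mem_iff.2 (hM i i)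
  have hmul : ∀ {w w' : ℤ} (M M' : Matrix s s (SF d K[X] c)), (∀ j i, M j i ∈ Fil d K[X] c w) →
      (∀ j i, M' j i ∈ Fil d K[X] c w') → ∀ j i, (M * M') j i ∈ Fil d K[X] c (w + w') :=
    fun M M' h h' j i => by
      rw [Matrix.mul_apply]; exact sum_mem fun k _ => mul_mem_fil (h j k) (h' k i)
  have hApow : ∀ n : ℕ, ∀ j i, (A ^ n) j i ∈ Fil d K[X] c n := fun n => by
    induction n with
    | zero =>
      intro j i
      rw [pow_zero, Matrix.one_apply]
      split_ifs
      · exact one_mem_fil hN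
      · exact zero_mem _
    | succ n ih =>
      rw [pow_succ]
      push_cast
      exact hmul _ _ ih fun j i => hN.fil j i
  have hδmul : ∀ x y, δ (x * y) = δ x * y + x * δ y := fun x y => by
    ext1 j i
    simp only [hδ, AddMonoidHom.mapMatrix_apply, Matrix.map_apply, Matrix.mul_apply, Matrix.add_apply,
      map_sum, dt_mul, sum_add_distrib]
  have htr : ∀ n : ℕ, dt (fstr s d K[X] c (A ^ (n + 1))) =
      (n + 1) • fstr s d K[X] c (A ^ n * δ A) := fun n => by
    have := trace_deriv_pow δ hδmul (fstr s d K[X] c) (EvenMat s) (fun _ _ h h' => h.mul h')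
      evenMat_one (fun x h j i => dt_mem_supp (h j i)) (fun _ _ h h' => fstr_mul_comm h h')
      (a := A) (fun j i => hp j i) 0 n
    rw [pow_zero, one_mul, zero_add] at this
    rw [← this, fstr_apply, fstr_apply, map_sum]
    refine sum_congr rfl fun i _ => ?_
    rw [sg_smul (K := K), sg_smul (K := K)]
    exact mapC_smul (f := (derivative : K[X] →ₗ[K] K[X]).toAddMonoidHom)
      (fun r x => derivative.map_smul r x) _ _
  have hstr : ∀ n : ℕ, strc (mpow N (n + 1)) - fstr s d K[X] c (A ^ (n + 1)) ∈ Fil d K[X] c v :=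
    fun n => by
      have h1 := (hN.isSum_strc n).sub_sum_mem (v := v) (s := s) fun i hi =>
        sg_smul_mem_iff.2 (hN.mpow_mem_of_not hs n i i fun h => hi h.1)
      have h2 : ∑ i : s, (sg K[X] (d i) • mpow N (n + 1) i i - sg K[X] (d i) • (A ^ (n + 1)) i i) ∈
          Fil d K[X] c v := sum_mem fun i _ => by
        rw [← smul_sub]; exact sg_smul_mem_iff.2 (hN.mpow_sub_mem hs (n + 1) i i)
      rw [sum_sub_distrib, Finset.sum_coe_sort s (fun i => sg K[X] (d i) • mpow N (n + 1) i i)] at h2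
      have := add_mem h1 h2
      rwa [sub_add_sub_cancel] at this
  have hδA : ∀ j i, (δ A - (1 + A) * B) j i ∈ Fil d K[X] c v := fun j i => by
    have h1 := (hd j i).sub_sum_mem (v := v) (s := s) fun k hk => by
      have := mul_mem_fil (hs j k fun h => hk h.2) (hY k i)
      rwa [add_zero] at this
    rw [Matrix.sub_apply, add_mul, one_mul, Matrix.add_apply, Matrix.mul_apply, ← sub_sub]
    rwa [← Finset.sum_coe_sort s (fun k => N j k * Y k i)] at h1
  set M := v.toNat with hM
  set q : ℕ → ℚ := fun n => (-1) ^ n * ((n : ℚ) + 1)⁻¹ with hq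
  have h1 : lber N - ∑ n ∈ Finset.range M, q n • fstr s d K[X] c (A ^ (n + 1)) ∈ Fil d K[X] c v := by
    have h1 := hN.isSum_lber.sub_sum_mem (v := v) (s := Finset.range M) fun n hn => by
      rw [Finset.mem_range] at hn
      exact supp_smul (S := {p | v ≤ lv c p}) _ (fil_anti (by omega) (hN.strc_mem n))
    have h2 : ∑ n ∈ Finset.range M, (q n • strc (mpow N (n + 1)) -
        q n • fstr s d K[X] c (A ^ (n + 1))) ∈ Fil d K[X] c v := sum_mem fun n _ => by
      rw [← smul_sub]; exact supp_smul (S := {p | v ≤ lv c p}) _ (hstr n)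
    rw [sum_sub_distrib] at h2
    have := add_mem h1 h2
    rwa [sub_add_sub_cancel] at this
  have h2 := dt_mem_fil h1
  have h3 : dt (∑ n ∈ Finset.range M, q n • fstr s d K[X] c (A ^ (n + 1))) =
      ∑ n ∈ Finset.range M, ((-1) ^ n : ℤ) • fstr s d K[X] c (A ^ n * δ A) := by
    rw [map_sum]
    refine sum_congr rfl fun n _ => ?_
    have e : dt (q n • fstr s d K[X] c (A ^ (n + 1))) = q n • dt (fstr s d K[X] c (A ^ (n + 1))) :=
      map_rat_smul dt _ _
    rw [e, htr, ← Nat.cast_smul_eq_nsmul ℚ, smul_smul, ← Int.cast_smul_eq_zsmul ℚ]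
    congr 1
    have : ((n : ℚ) + 1) ≠ 0 := by positivity
    rw [hq]; push_cast; field_simp
  have h4 : ∑ n ∈ Finset.range M, ((-1) ^ n : ℤ) • fstr s d K[X] c (A ^ n * δ A) -
      ∑ n ∈ Finset.range M, ((-1) ^ n : ℤ) • fstr s d K[X] c (A ^ n * ((1 + A) * B)) ∈
        Fil d K[X] c v := by
    rw [← sum_sub_distrib]
    refine sum_mem fun n _ => ?_
    rw [← smul_sub, ← map_sub, ← mul_sub]
    refine zsmul_mem (hfil _ fun j i => ?_) _
    have := hmul _ _ (hApow n) hδA j i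
    exact fil_anti (by linarith [Int.natCast_nonneg n]) this
  have h5 : ∀ M : ℕ, ∑ n ∈ Finset.range M, ((-1) ^ n : ℤ) • fstr s d K[X] c (A ^ n * ((1 + A) * B)) =
      fstr s d K[X] c B - ((-1) ^ M : ℤ) • fstr s d K[X] c (A ^ M * B) := fun M => by
    induction M with
    | zero => simp
    | succ M ih =>
      rw [Finset.sum_range_succ, ih, ← mul_assoc, mul_add, mul_one, ← pow_succ, add_mul, map_add,
        smul_add, pow_succ (-1 : ℤ), mul_neg_one, neg_smul]
      abel
  have h6 : ((-1) ^ M : ℤ) • fstr s d K[X] c (A ^ M * B) ∈ Fil d K[X] c v :=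
    zsmul_mem (hfil _ fun j i => fil_anti (by omega) (hmul _ _ (hApow M) (fun j i => hY j i) j i)) _
  have h7 := hz.sub_sum_mem hYs
  rw [← Finset.sum_coe_sort s (fun i => sg K[X] (d i) • Y i i)] at h7
  rw [map_sub, h3] at h2
  rw [h5] at h4
  have h8 := sub_mem (sub_mem (add_mem h2 h4) h6) h7
  have e : fstr s d K[X] c B = ∑ i : s, sg K[X] (d i) • Y i i := rfl
  rw [e] at h8
  convert h8 using 1
  abel

end LogDeriv

section ChainRule

variable {ι : Type*} [LinearOrder ι] {d : ι → ℤ} {R : Type*} [CommRing R] {c : ℕ}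
  (L : SF d R c →+* SF d R c) (hf : ∀ v, ∀ F ∈ Fil d R c v, L F ∈ Fil d R c v)
include hf

lemma summ_chain (j : ι) (F : SF d R c) :
    Summ fun k => der d R c j (L (phi d R c k)) * L (der d R c k F) := fun v =>
  (finite_vars F v).subset fun k hk h => hk (by
    have h1 := mul_mem_fil (der_mem_fil (i := j) (hf _ _ (phi_mem_fil (R := R) (d := d) (c := c) k)))
      (hf _ _ h)
    exact fil_anti (by linarith) h1)

/-- The chain rule. -/
lemma isSum_der_comp (hs : ∀ (r : R) F, L (r • F) = r • L F)
    (hh : ∀ m, L (hb d R c m) = hb d R c m) (hp : ∀ i, L (phi d R c i) ∈ Par d R c (d i)) (j : ι)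
    (F : SF d R c) :
    IsSum (fun k => der d R c j (L (phi d R c k)) * L (der d R c k F)) (der d R c j (L F)) := by
  have hsum := fun F => (summ_chain L hf j F).isSum
  let M : SF d R c →+ SF d R c :=
    { toFun := fun F => fsum fun k => der d R c j (L (phi d R c k)) * L (der d R c k F)
      map_zero' := (isSum_zero.congr fun k => by rw [map_zero, map_zero, mul_zero]).eq_fsum.symm
      map_add' := fun F G => (hsum _).unique (((hsum F).add (hsum G)).congr fun k => by
        rw [map_add, map_add, mul_add]) }
  have hM : ∀ F, IsSum (fun k => der d R c j (L (phi d R c k)) * L (der d R c k F)) (M F) := hsum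
  have hcL : Cont L.toAddMonoidHom := fun v => ⟨v, hf v⟩
  have e : (der d R c j).comp L.toAddMonoidHom = M := by
    refine ext_of_phi ((cont_der j).comp hcL) (cont_of_shift (-(2 * c + 1)) fun v F hF => ?_)
      (fun r g F h => ?_) ?_ fun i F h => ?_
    · refine (hM F).mem_fil fun k => ?_
      have h1 := mul_mem_fil (der_mem_fil (i := j) (hf _ _ (phi_mem_fil (R := R) (d := d) (c := c) k)))
        (hf _ _ (der_mem_fil (i := k) hF))
      exact fil_anti (by linarith) h1
    · refine IsSum.unique ?_ (hM _)
      have h1 := ((hM F).mul_left (hb d R c g)).smul r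
      rw [← h] at h1
      have e : ((der d R c j).comp L.toAddMonoidHom) (r • (hb d R c g * F)) =
          r • (hb d R c g * ((der d R c j).comp L.toAddMonoidHom) F) := by
        change der d R c j (L _) = r • (_ * der d R c j (L F))
        rw [hs, map_mul, hh, der_smul, der_hb_mul]
      rw [e]
      refine h1.congr fun k => ?_
      rw [der_smul, der_hb_mul, hs, map_mul, hh, mul_smul_comm, ← mul_assoc, ← mul_assoc, hb_comm]
    · refine IsSum.unique ?_ (hM _)
      have e : ((der d R c j).comp L.toAddMonoidHom) 1 = 0 := by
        change der d R c j (L 1) = 0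
        rw [map_one, der_one]
      rw [e]
      exact isSum_zero.congr fun k => by rw [der_one, map_zero, mul_zero]
    · classical
      refine IsSum.unique ?_ (hM _)
      have e : ((der d R c j).comp L.toAddMonoidHom) (phi d R c i * F) =
          der d R c j (L (phi d R c i)) * L F + sig d R c (d j) (L (phi d R c i)) * M F := by
        rw [← h]
        change der d R c j (L _) = _
        rw [map_mul, der_mul]; rfl
      rw [e]
      have h1 := isSum_finset {i}
        (fun k => der d R c j (L (phi d R c k)) * L ((if k = i then 1 else 0) * F)) fun k hk => by
          rw [Finset.mem_singleton] at hk
          rw [if_neg hk, zero_mul, map_zero, mul_zero]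
      rw [Finset.sum_singleton, if_pos rfl, one_mul] at h1
      refine (h1.add ((hM F).mul_left (sig d R c (d j) (L (phi d R c i))))).congr fun k => ?_
      have h2 : der d R c j (L (phi d R c k)) ∈ Par d R c (d k + d j) := der_par (hp k)
      rw [der_mul, der_phi, map_add, mul_add, sig_of_par (phi_par i), smul_mul_assoc, hs,
        map_mul L (phi d R c i)]
      congr 1
      rw [mul_smul_comm, ← mul_assoc, mul_comm_of_par h2, sig_of_par (hp i), sig_of_par (hp i),
        smul_mul_assoc, smul_mul_assoc, smul_mul_assoc, smul_smul, ← sg_add, mul_assoc]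
      congr 1
      exact sg_congr ⟨d k * d i, by ring⟩
  have := hM F
  rwa [← e] at this

end ChainRule

section MapBer

variable {ι : Type*} [LinearOrder ι] {d : ι → ℤ} {R : Type*} [CommRing R] {c : ℕ}
  {R' : Type*} [CommRing R']

lemma mpow_map (f : SF d R c →+* SF d R' c) (hf : Cont f.toAddMonoidHom) {N : ι → ι → SF d R c}
    (hN : IsSmall N) (n : ℕ) (j i : ι) : f (mpow N n j i) = mpow (fun j i => f (N j i)) n j i := by
  classical
  induction n generalizing j i with
  | zero =>
    change f (if j = i then 1 else 0) = if j = i then 1 else 0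
    split_ifs <;> simp
  | succ n ih =>
    exact ((hN.isSum_mpow n j i).map hf).eq_fsum.trans (congrArg fsum (funext fun k => by
      change f (_ * _) = _
      rw [map_mul, ih]))

lemma lber_map [Algebra ℚ R] [Algebra ℚ R'] (f : SF d R c →+* SF d R' c) (hf : Cont f.toAddMonoidHom)
    {N : ι → ι → SF d R c} (hN : IsSmall N) : f (lber N) = lber fun j i => f (N j i) := by
  refine (hN.isSum_lber.map hf).eq_fsum.trans (congrArg fsum (funext fun n => ?_))
  have e : f.toAddMonoidHom (((-1) ^ n * ((n : ℚ) + 1)⁻¹) • strc (mpow N (n + 1))) =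
    ((-1) ^ n * ((n : ℚ) + 1)⁻¹) • f.toAddMonoidHom (strc (mpow N (n + 1))) :=
      map_rat_smul f.toAddMonoidHom _ _
  rw [e]
  congr 1
  refine ((hN.isSum_strc n).map hf).eq_fsum.trans (congrArg fsum (funext fun i => ?_))
  rw [← mpow_map f hf hN]
  change f (_ • _) = _ • f _
  rcases Int.even_or_odd (d i) with h | h
  · rw [sg_even h, sg_even h, one_smul, one_smul]
  · rw [sg_odd h, sg_odd h, neg_smul, neg_smul, one_smul, one_smul, map_neg]

end MapBer

section Berezinian

open Polynomial

variable {ι : Type*} [LinearOrder ι] {d : ι → ℤ} {K : Type*} [Field K] [CharZero K]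
  {π : ι → ι → K} {h : ι → Prop} {μ κ : ι → ι →₀ K}

lemma rdv_odd {R : Type*} [CommRing R] {c : ℕ} {β : SF d R c} (hβ : β ∈ Par d R c 1) (j : ι) :
    rdv d R c j β = der d R c j β := by
  rw [rdv_eq, sig_of_par (der_par hβ), 
    sg_even (by rw [add_comm (1 : ℤ)]; exact Int.even_mul_succ_self _), one_smul]

lemma phi_deg {R : Type*} [CommRing R] {c : ℕ} (i : ι) : phi d R c i ∈ Deg d R c (-(d i)) :=
  mono_mem (by rw [mem_ofPred_eq, md_single]; simp)

lemma isSum_br_phi {R : Type*} [CommRing R] [Algebra K R] {c : ℕ} (F : SF d R c) (i : ι) :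
    IsSum (fun j => π j i • rdv d R c j F) (br π F (phi d R c i)) := by
  classical
  refine (isSum_br π F (phi d R c i)).rows fun j => ?_
  have := isSum_finset {i} (fun k => π j k • (rdv d R c j F * der d R c k (phi d R c i))) fun k hk => by
    rw [Finset.mem_singleton] at hk
    rw [der_phi, if_neg hk, mul_zero, smul_zero]
  rwa [Finset.sum_singleton, der_phi, if_pos rfl, mul_one] at this

namespace Action

variable {Sf b : SF d K 0} (S : Action d π h μ κ Sf b)
include S

lemma Flow_mem_fil (v : ℤ) (F : SF d K[X] 0) (hF : F ∈ Fil d K[X] 0 v) : S.Flow F ∈ Fil d K[X] 0 v :=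
  flowAdd_mem_fil S.raises_ham hF

lemma Flow_smul (r : K[X]) (F : SF d K[X] 0) : S.Flow (r • F) = r • S.Flow F :=
  flowAdd_smul S.isDer_ham S.raises_ham r F

lemma Flow_hb (m : ℤ) : S.Flow (hb d K[X] 0 m) = hb d K[X] 0 m := flow_hb S.isDer_ham S.raises_ham m

lemma Flow_deg {n : ℤ} {F : SF d K[X] 0} (hF : F ∈ Deg d K[X] 0 n) : S.Flow F ∈ Deg d K[X] 0 n :=
  flowAdd_mem_supp S.raises_ham (fun _ h => bvf_deg S.poisson S.ham_deg h) hF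

lemma Flow_phi_par (i : ι) : S.Flow (phi d K[X] 0 i) ∈ Par d K[X] 0 (d i) := by
  rw [par_congr (n := -d i) ⟨d i, by ring⟩]
  exact par_of_deg (S.Flow_deg (phi_deg i))

/-- The displacement of the coordinates under the flow. -/
lemma dt_Flow_phi (i : ι) : dt (S.Flow (phi d K[X] 0 i)) =
    S.Flow (bvf π (ham d π h κ b) (phi d K[X] 0 i)) := by
  have e : dt (S.Flow (phi d K[X] 0 i)) = S.Flow (Dt (bvf π (ham d π h κ b)) (phi d K[X] 0 i)) :=
    dt_flowAdd S.raises_ham _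
  have e2 : dt (phi d K[X] 0 i) = 0 := by
    have : cst (phi d K 0 i) = phi d K[X] 0 i := mapR_phi C i
    rw [← this, dt_cst]
  rw [e, Dt_apply, e2, zero_add]

lemma summ_bvf_phi : Summ fun i => bvf π (ham d π h κ b) (phi d K[X] 0 i) := fun v => by
  refine ((finite_vars (ham d π h κ b) (v - 2)).biUnion fun j _ => S.finrow j).subset fun i hi => ?_
  by_contra h'
  refine hi (neg_mem ?_)
  have h1 : br π (ham d π h κ b) (phi d K[X] 0 i) ∈ Fil d K[X] 0 (v - 2) :=
    (isSum_br_phi _ i).mem_fil fun j => by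
      rw [rdv_odd S.ham_par]
      by_cases hj : der d K[X] 0 j (ham d π h κ b) ∈ Fil d K[X] 0 (v - 2)
      · exact supp_smul (S := {p | v - 2 ≤ lv 0 p}) _ hj
      · have : π j i = 0 := by
          by_contra h2
          exact h' (Set.mem_biUnion (x := j) hj h2)
        rw [this, zero_smul]; exact zero_mem _
  have := hb_mul_mem_fil 1 h1
  exact fil_anti (by norm_num) this

/-- The displacement of the coordinates under the flow. -/
def disp (i : ι) : SF d K[X] 0 := S.Flow (phi d K[X] 0 i) - phi d K[X] 0 i

omit S in
lemma cst_phi (i : ι) : cst (phi d K 0 i) = phi d K[X] 0 i := mapR_phi C i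

lemma dt_disp (i : ι) : dt (S.disp i) = S.Flow (bvf π (ham d π h κ b) (phi d K[X] 0 i)) := by
  rw [disp, map_sub, S.dt_Flow_phi, ← cst_phi, dt_cst, sub_zero]

lemma ev_disp (i : ι) : ev 0 (S.disp i) = 0 := by
  have e : ev 0 (S.Flow (phi d K[X] 0 i)) = ev 0 (phi d K[X] 0 i) := ev_flowAdd S.raises_ham _
  rw [disp, map_sub, e, sub_self]

lemma disp_mem {i : ι} {v : ℤ} (hv : bvf π (ham d π h κ b) (phi d K[X] 0 i) ∈ Fil d K[X] 0 v) :
    S.disp i ∈ Fil d K[X] 0 v :=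
  mem_supp_of_dt (by rw [S.dt_disp]; exact S.Flow_mem_fil _ _ hv) (by rw [S.ev_disp]; exact zero_mem _)

lemma bvf_phi_mem (i : ι) : bvf π (ham d π h κ b) (phi d K[X] 0 i) ∈ Fil d K[X] 0 2 := by
  have := S.raises_ham 1 _ (by simpa using phi_mem_fil (R := K[X]) (d := d) (c := 0) i)
  exact this

lemma disp_fil (i : ι) : S.disp i ∈ Fil d K[X] 0 2 := S.disp_mem (S.bvf_phi_mem i)

lemma summ_disp : Summ S.disp := S.summ_bvf_phi.of_imp (f := id) Function.injective_id
  fun _ _ h => S.disp_mem h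

lemma disp_deg (i : ι) : S.disp i ∈ Deg d K[X] 0 (-(d i)) :=
  sub_mem (S.Flow_deg (phi_deg i)) (phi_deg i)

/-- The matrix `∂Φ - 1`. -/
def jac (j i : ι) : SF d K[X] 0 := der d K[X] 0 j (S.disp i)

lemma isSmall_jac : IsSmall S.jac where
  fil j i := by
    have := der_mem_fil (i := j) (S.disp_fil i)
    exact this
  summ v := by
    refine (((S.summ_disp (v + 1)).biUnion fun i _ =>
      (finite_vars (S.disp i) v).image fun j => (j, i))).subset fun p hp => ?_
    refine Set.mem_biUnion (x := p.2) (fun h1 => hp ?_) ⟨p.1, hp, rfl⟩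
    have := der_mem_fil (i := p.1) h1
    exact fil_anti (by norm_num) this

lemma jac_par (j i : ι) : S.jac j i ∈ Par d K[X] 0 (d j + d i) := by
  have := der_par (i := j) (par_of_deg (S.disp_deg i))
  rwa [par_congr (n := d j + d i) ⟨-d i, by ring⟩] at this

lemma dt_lber_jac : dt (lber S.jac) = (2 : K) • S.Flow (dl d K[X] 0 π (ham d π h κ b)) := by
  set β := ham d π h κ b with hβ
  have hz : IsSum (fun i => sg K[X] (d i) • S.Flow (der d K[X] 0 i (bvf π β (phi d K[X] 0 i))))
      ((2 : K) • S.Flow (dl d K[X] 0 π β)) := by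
    have h1 : IsSum (fun i => -((1 / 2 * sg K (d i)) • der d K[X] 0 i (br π β (phi d K[X] 0 i))))
        (lap d K[X] 0 π β) := (isSum_lap π β).rows fun i => by
      refine (((isSum_br_phi β i).map (cont_der i)).smul (1 / 2 * sg K (d i))).neg.congr fun j => ?_
      rw [rdv_odd S.ham_par, der_smul, smul_smul, lw, S.poisson.antisymm i j, ← neg_smul]
      congr 1; ring
    have hcL : Cont S.Flow.toAddMonoidHom := fun v => ⟨v, S.Flow_mem_fil v⟩
    have hs : ∀ (r : K) F, S.Flow (r • F) = r • S.Flow F := fun r F => by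
      rw [← algebraMap_smul' (R := K[X]) r, S.Flow_smul, algebraMap_smul']
    refine (((h1.mul_left (hb d K[X] 0 1)).map hcL).smul (2 : K)).congr fun i => ?_
    change _ = (2 : K) • S.Flow _
    rw [bvf_apply, map_neg, der_hb_mul, map_neg, mul_neg, map_neg, mul_smul_comm, hs, smul_neg,
      smul_neg, smul_smul, sg_smul (K := K)]
    congr 2
    ring
  refine dt_lber S.isSmall_jac S.jac_par (Y := fun k i => S.Flow (der d K[X] 0 k (bvf π β (phi d K[X] 0 i))))
    (fun j i => S.Flow_mem_fil _ _ ?_) (fun j i => ?_) hz ?_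
  · have := der_mem_fil (i := j) (S.bvf_phi_mem i)
    exact fil_anti (by norm_num) this
  · classical
    have h1 := isSum_der_comp S.Flow S.Flow_mem_fil S.Flow_smul S.Flow_hb S.Flow_phi_par j
      (bvf π β (phi d K[X] 0 i))
    have e : dt (S.jac j i) = der d K[X] 0 j (S.Flow (bvf π β (phi d K[X] 0 i))) := by
      rw [← S.dt_disp]
      exact mapC_der (derivative : K[X] →ₗ[K] K[X]).toAddMonoidHom j (S.disp i)
    rw [← e] at h1
    have h2 := isSum_finset {j} (fun k => (if k = j then 1 else 0) *
      S.Flow (der d K[X] 0 k (bvf π β (phi d K[X] 0 i)))) fun k hk => by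
        rw [Finset.mem_singleton] at hk
        rw [if_neg hk, zero_mul]
    rw [Finset.sum_singleton, if_pos rfl, one_mul] at h2
    refine (h1.sub h2).congr fun k => ?_
    rw [jac, disp, map_sub, der_phi, ← sub_mul]
    simp only [eq_comm]
  · exact hz.summ.of_imp (f := id) Function.injective_id fun i v hi => sg_smul_mem_iff.1 hi

/-- The Berezinian relates the exponents of the semidensities. -/
lemma semidensity_log : hb d K 0 (-1) * Sf + incAct d π h κ b =
    S.FlowAt 1 (hb d K 0 (-1) * Sf + b) +
      (1 / 2 : K) • lber fun j i => der d K 0 j (S.FlowAt 1 (phi d K 0 i) - phi d K 0 i) := by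
  set Z := S.Flow (hb d K[X] 0 (-1) * actPath d π h κ Sf b) + (1 / 2 : K) • lber S.jac with hZ
  have h1 : dt Z = 0 := by
    have e : dt ((1 / 2 : K) • lber S.jac) = (1 / 2 : K) • dt (lber S.jac) :=
      mapC_smul (f := (derivative : K[X] →ₗ[K] K[X]).toAddMonoidHom)
        (fun r x => derivative.map_smul r x) _ _
    rw [hZ, map_add, S.dt_Flow_actPath, e, S.dt_lber_jac, smul_smul]
    norm_num
  have h2 : Z = cst (ev 0 Z) := eq_of_dt (by rw [h1, dt_cst]) (by rw [ev_cst])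
  have hev : ∀ t : K, ev t Z = ev t (S.Flow (hb d K[X] 0 (-1) * actPath d π h κ Sf b)) +
      (1 / 2 : K) • lber fun j i => ev t (S.jac j i) := fun t => by
    rw [hZ, map_add, ev_smul', lber_map (ev t) (cont_ev t) S.isSmall_jac]
  have hact : ∀ t : K, ev t (hb d K[X] 0 (-1) * actPath d π h κ Sf b) =
      hb d K 0 (-1) * Sf + ev t (path d π h κ b) := fun t => by
    rw [map_mul, ev_hb, actPath, map_add, ev_cst, map_mul, ev_hb, mul_add, hb_neg_mul_hb]
  have hjac : ∀ t j i, ev t (S.jac j i) = der d K 0 j (S.FlowAt t (phi d K 0 i) - phi d K 0 i) :=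
    fun t j i => by
      have e : S.FlowAt t (phi d K 0 i) - phi d K 0 i = ev t (S.disp i) := by
        rw [disp, map_sub, ← cst_phi, ev_cst]; rfl
      rw [e]
      exact mapC_der (evalRingHom t).toAddMonoidHom j (S.disp i)
  have h3 : ev 1 Z = ev 0 Z := by rw [h2, ev_cst, ev_cst]
  rw [hev, hev] at h3
  have e0 : ev 0 (S.Flow (hb d K[X] 0 (-1) * actPath d π h κ Sf b)) =
    ev 0 (hb d K[X] 0 (-1) * actPath d π h κ Sf b) := ev_flowAdd S.raises_ham _
  have e1 : ev 1 (S.Flow (hb d K[X] 0 (-1) * actPath d π h κ Sf b)) =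
    S.FlowAt 1 (ev 1 (hb d K[X] 0 (-1) * actPath d π h κ Sf b)) := ev_flow _ S.raises_ham 1 _
  have e2 : lber (fun j i => ev 0 (S.jac j i)) = 0 := by
    have e : (fun j i => ev 0 (S.jac j i)) = fun _ _ => (0 : SF d K 0) := by
      funext j i
      rw [jac]
      exact (mapC_der (evalRingHom (0 : K)).toAddMonoidHom j (S.disp i)).trans
        ((congrArg (der d K 0 j) (S.ev_disp i)).trans (map_zero _))
    rw [e]
    have hp : ∀ n j i, mpow (fun _ _ : ι => (0 : SF d K 0)) (n + 1) j i = 0 := fun n j i =>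
      (isSum_zero.congr fun k => by rw [zero_mul]).eq_fsum.symm
    refine (isSum_zero.congr fun n => ?_).eq_fsum.symm
    have : strc (mpow (fun _ _ : ι => (0 : SF d K 0)) (n + 1)) = 0 :=
      (isSum_zero.congr fun i => by rw [hp, smul_zero]).eq_fsum.symm
    rw [this, smul_zero]
  rw [e0, e1, e2, hact, hact, S.ev_path_one, S.ev_path_zero, smul_zero, add_zero] at h3
  rw [← h3]
  simp only [hjac]

end Action

end Berezinian

/-! ### Coefficients -/

section Coefficients

variable {ι : Type*} [LinearOrder ι] {d : ι → ℤ} {K : Type*} [RCLike K] {c : ℕ}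

lemma koszul_eq (I J : ι →₀ ℕ) : (koszul d I J : K) = sg K (kz d I J) := zpow_eq_sg _

lemma coef_one_eq : (1 : SF d K c).coef = one := by
  classical
  funext I g
  rw [one_def, coef_mono, one]
  by_cases h : I = 0 ∧ g = 0
  · rw [if_pos h, if_pos ⟨Prod.ext h.1 h.2, h.1 ▸ admissible_zero d⟩]
  · rw [if_neg h, if_neg fun h' => h ⟨congrArg Prod.fst h'.1, congrArg Prod.snd h'.1⟩]

lemma coef_phi_eq (i : ι) : (phi d K c i).coef = coord i := by
  classical
  funext I g
  rw [phi, coef_mono, coord]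
  by_cases h : I = single i 1 ∧ g = 0
  · rw [if_pos h, if_pos ⟨Prod.ext h.1 h.2, h.1 ▸ admissible_single d i⟩]
  · rw [if_neg h, if_neg fun h' => h ⟨congrArg Prod.fst h'.1, congrArg Prod.snd h'.1⟩]

lemma coef_hb_eq (m : ℤ) (F : SF d K c) : (hb d K c m * F).coef = hbar m F.coef := by
  funext I g; rw [coef_hb_mul]; rfl

lemma coef_add_eq (F G : SF d K c) : (F + G).coef = F.coef + G.coef := rfl

lemma coef_sub_eq (F G : SF d K c) : (F - G).coef = F.coef - G.coef := rfl

lemma coef_neg_eq (F : SF d K c) : (-F).coef = -F.coef := rfl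

lemma coef_smul_eq (r : K) (F : SF d K c) : (r • F).coef = r • F.coef := rfl

lemma coef_mul_eq (F G : SF d K c) : (F * G).coef = BV.mul d F.coef G.coef := by
  funext I g
  rw [coef_mul, BV.mul]
  split_ifs
  · refine sum_congr rfl fun p _ => ?_
    rw [koszul_eq, ← smul_eq_mul, smul_finsum' _ (finite_mul_support F G p.1 p.2 g)]
    exact finsum_congr fun h => by rw [smul_eq_mul, mul_assoc]
  · rfl

lemma coef_pow_eq (F : SF d K c) (n : ℕ) : (F ^ n).coef = BV.pow d F.coef n := by
  induction n with
  | zero => rw [pow_zero, coef_one_eq]; rfl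
  | succ n ih => rw [pow_succ', coef_mul_eq, ih]; rfl

lemma coef_rat_smul (q : ℚ) (F : SF d K c) (I : ι →₀ ℕ) (g : ℤ) :
    (q • F).coef I g = (q : K) * F.coef I g := by
  rw [coef_smul, Rat.smul_def]

lemma coef_ex_eq {F : SF d K c} (hF : F ∈ Fil d K c 1) : (ex F).coef = expo d F.coef := by
  funext I g
  rw [(isSum_ex hF).coef, expo]
  exact finsum_congr fun n => by rw [coef_rat_smul, coef_pow_eq]; push_cast; rfl

lemma coef_lg_eq {F : SF d K c} (hF : F - 1 ∈ Fil d K c 1) : (lg F).coef = logar d F.coef := by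
  funext I g
  rw [(isSum_lg hF).coef, logar]
  exact finsum_congr fun n => by
    rw [coef_rat_smul, coef_pow_eq, coef_sub_eq, coef_one_eq]; push_cast; rfl

lemma coef_der_eq (i : ι) (F : SF d K c) : (der d K c i F).coef = leftDeriv d i F.coef := by
  funext I g; rw [coef_der, leftDeriv, koszul_eq]

lemma coef_rdv_eq (i : ι) (F : SF d K c) : (rdv d K c i F).coef = rightDeriv d i F.coef := by
  funext I g
  rw [rdv_apply, coef_smul, coef_der, rightDeriv, koszul_eq]
  change sg K (d i) * (_ * (sg K (d i * monDegree d (I + single i 1)) * F.coef _ g)) = _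
  by_cases h0 : F.coef (I + single i 1) g = 0
  · rw [h0]; simp
  rw [sg_kz_comm d (F.adm _ _ h0), md_add, md_single]
  have e : sg K (monDegree d I * (-d i * ((1 : ℕ) : ℤ))) =
      sg K (d i) * sg K (d i * (monDegree d I + -d i * ((1 : ℕ) : ℤ))) := by
    rw [← sg_add]
    refine sg_congr ?_
    have := Int.even_mul_pred_self (d i)
    obtain ⟨k, hk⟩ := this
    refine ⟨-(monDegree d I * d i) + k, ?_⟩
    push_cast
    linear_combination hk
  rw [e]; ring

variable (Ω : ι → ι → K)

lemma coef_lap_eq (F : SF d K c) :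
    (lap d K c (inverse Ω) F).coef = laplacian d Ω F.coef := by
  funext I g
  rw [(isSum_lap _ F).coef, laplacian, ← smul_eq_mul (1 / 2 : K), smul_finsum]
  refine finsum_congr fun p => ?_
  rw [coef_smul, coef_der_eq, coef_der_eq, lw, zpow_eq_sg]
  simp only [smul_eq_mul]
  ring

lemma coef_br_eq (F G : SF d K c) :
    (br (inverse Ω) F G).coef = bracket d Ω F.coef G.coef := by
  funext I g
  rw [(isSum_br _ F G).coef, bracket]
  exact finsum_congr fun p => by
    rw [coef_smul, coef_mul_eq, coef_rdv_eq, coef_der_eq, smul_eq_mul]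

lemma coef_tw_eq (S F : SF d K c) :
    (tw (inverse Ω) S F).coef = twisted d Ω S.coef F.coef := by
  rw [tw_apply, coef_add_eq, coef_br_eq, dl_apply, coef_hb_eq, coef_lap_eq]; rfl

lemma coef_qme_eq (S : SF d K c) : (qme (inverse Ω) S).coef =
    (2 : K) • hbar 1 (laplacian d Ω S.coef) + bracket d Ω S.coef S.coef := by
  rw [qme, coef_add_eq, coef_smul_eq, coef_br_eq, dl_apply, coef_hb_eq, coef_lap_eq]

variable {h : ι → Prop}

lemma coef_inc_eq (F : SF (fun i : {i // h i} => d i.1) K c) :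
    (inc d K c h F).coef = incl h F.coef := by
  funext I g; rw [coef_inc, incl]

variable (h) (κ : ι → ι →₀ K)

lemma isSum_lin (F : SF d K c) :
    IsSum (fun p : ι × ι => κ p.1 p.2 • (phi d K c p.2 * der d K c p.1 F)) (lin d K c κ F) := by
  have h1 : Summ (fun p : ι × ι => κ p.1 p.2 • (phi d K c p.2 * der d K c p.1 F)) := fun v => by
    refine ((finite_vars F v).biUnion fun i _ =>
      (κ i).support.finite_toSet.image fun j => (i, j)).subset fun p hp => ?_
    by_cases h0 : κ p.1 p.2 = 0
    · exact absurd (by beta_reduce; rw [h0, zero_smul]; exact zero_mem _) hp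
    refine Set.mem_biUnion (x := p.1) (fun h2 => hp ?_) ⟨p.2, Finsupp.mem_support_iff.2 h0, rfl⟩
    have := mul_mem_fil (phi_mem_fil (R := K) (d := d) (c := c) p.2) h2
    exact supp_smul (S := {p | v ≤ lv c p}) _ (fil_anti (by linarith) this)
  have h2 := h1.isSum.rows (w := fun i => lcomb d K c (κ i) * der d K c i F) fun i => by
    have := isSum_finset (κ i).support (fun j => κ i j • (phi d K c j * der d K c i F)) fun j hj => by
      rw [Finsupp.notMem_support_iff.1 hj, zero_smul]
    convert this using 1
    rw [lcomb_apply, Finsupp.sum, Finset.sum_mul]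
    exact sum_congr rfl fun j _ => smul_mul_assoc _ _ _
  have h3 : IsSum (fun i => lcomb d K c (κ i) * der d K c i F) (lin d K c κ F) := isSum_vf F
  rw [h3.unique h2]
  exact h1.isSum

/-- The matrix of the homotopy in the conventions of the contraction. -/
lemma coef_Kop_eq {k : ι → ι → K} (hk : ∀ i j, κ i j = -k i j) (F : SF d K 0) :
    (Kop d h κ F).coef = contraction d h k F.coef := by
  funext I g
  change _ * (lin d K 0 κ F).coef I g = _
  rw [(isSum_lin κ F).coef, contraction]
  congr 1
  exact finsum_congr fun p => by rw [coef_smul, hk, coef_mul_eq, coef_phi_eq, coef_der_eq, smul_eq_mul]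

variable {k : ι → ι → K} (hk : ∀ i j, κ i j = -k i j)
include hk

lemma coef_iter_eq (n : ℕ) (F : SF d K 0) :
    (((dl d K 0 (inverse Ω)).comp (Kop d h κ))^[n] F).coef = iterLapContraction d Ω h k n F.coef := by
  induction n with
  | zero => rfl
  | succ n ih =>
    rw [iterate_succ_apply', iterLapContraction, iterate_succ_apply']
    rw [iterLapContraction] at ih
    rw [← ih, comp_apply, dl_apply, coef_hb_eq, coef_lap_eq, coef_Kop_eq h κ hk]

lemma isSum_Yop (F : SF d K 0) :
    IsSum (fun n : ℕ => ((dl d K 0 (inverse Ω)).comp (Kop d h κ))^[n] F) (Yop d (inverse Ω) h κ F) :=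
  ((lowers_dl_Kop (d := d) (π := inverse Ω) (h := h) (κ := κ)).isSum_ser (fun _ => (1 : K)) F).congr
    fun n => (one_smul _ _).symm

lemma coef_Kop_Yop_eq (F : SF d K 0) :
    (Kop d h κ (Yop d (inverse Ω) h κ F)).coef = pertContraction d Ω h k F.coef := by
  funext I g
  rw [((isSum_Yop Ω h κ hk F).map cont_Kop).coef, pertContraction]
  exact finsum_congr fun n => by rw [coef_Kop_eq h κ hk, coef_iter_eq Ω h κ hk]

lemma coef_prj_Yop_eq (F : SF d K 0) :
    (prj d K 0 h (Yop d (inverse Ω) h κ F)).coef = pertProj d Ω h k F.coef := by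
  funext I g
  refine (((isSum_Yop Ω h κ hk F).map (cont_prj (h := h))).coef I g).trans ?_
  rw [pertProj]
  refine finsum_congr fun n => ?_
  rw [← coef_iter_eq Ω h κ hk]; rfl

end Coefficients

section Functions

variable {ι : Type*} [LinearOrder ι] {d : ι → ℤ} {K : Type*} [RCLike K]

lemma lv_zero_eq (I : ι →₀ ℕ) (g : ℤ) : lv 0 (I, g) = weight I g := by
  simp only [lv, weight]; push_cast; ring

lemma isFunWeight_coef {m : ℤ} {F : SF d K 0} (hF : F ∈ Fil d K 0 m) : IsFunWeight d m F.coef where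
  admissible := F.adm
  weight_ge I g h := by rw [← lv_zero_eq]; exact hF (I, g) h
  finite w := (F.lf w).subset fun p hp => ⟨(lv_zero_eq _ _).trans hp.1 |>.le, hp.2⟩

lemma exists_of_isFunWeight {m : ℤ} {F : Coef ι K} (hF : IsFunWeight d m F) :
    ∃ F' ∈ Fil d K 0 m, F'.coef = F := by
  refine ⟨⟨F, hF.admissible, fun v => ?_⟩, fun p hp => ?_, rfl⟩
  · refine ((Set.finite_Icc m v).biUnion fun w _ => hF.finite w).subset fun p hp => ?_
    have h1 := hp.1
    rw [show lv 0 p = weight p.1 p.2 from lv_zero_eq _ _] at h1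
    exact Set.mem_biUnion (x := weight p.1 p.2) ⟨hF.weight_ge _ _ hp.2, h1⟩ ⟨rfl, hp.2⟩
  · exact (hF.weight_ge _ _ hp).trans (lv_zero_eq _ _).ge

lemma isFunPos_coef {F : SF d K 0} (hF : F ∈ Fil d K 0 1) : IsFunPos d F.coef := isFunWeight_coef hF

lemma hasDegree_coef {n : ℤ} {c : ℕ} {F : SF d K c} (hF : F ∈ Deg d K c n) : HasDegree d n F.coef :=
  fun I g h => hF (I, g) h

lemma deg_of_hasDegree {n : ℤ} {c : ℕ} {F : SF d K c} (h : HasDegree d n F.coef) : F ∈ Deg d K c n :=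
  fun p hp => h p.1 p.2 hp

lemma exists_of_isFun {F : Coef ι K} (hF : IsFun d F) : ∃ F' ∈ Fil d K 0 0, F'.coef = F := by
  refine exists_of_isFunWeight ⟨hF.admissible, fun I g h => ?_, fun w => ?_⟩
  · have := hF.genus I g h
    simp only [weight]; omega
  · refine ((Set.finite_Icc 0 w).biUnion fun g _ =>
      ((hF.finite (w - 2 * g).toNat g).image fun I => (I, g))).subset fun p hp => ?_
    have h1 := hF.genus _ _ hp.2
    have h2 : 2 * p.2 + (p.1.degree : ℤ) = w := hp.1
    refine Set.mem_biUnion (x := p.2) ⟨h1, by omega⟩ ⟨p.1, ⟨by omega, hp.2⟩, rfl⟩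

lemma isFun_coef {F : SF d K 0} (hg : F ∈ Supp d K 0 {p | 0 ≤ p.2}) : IsFun d F.coef where
  admissible := F.adm
  finite n g := ((F.lf (2 * g + n)).image Prod.fst).subset fun I hI =>
    ⟨(I, g), ⟨by simp only [lv]; push_cast; rw [hI.1]; linarith, hI.2⟩, rfl⟩
  genus I g h := hg (I, g) h

end Functions

/-! ### Pullbacks along formal maps -/

section Pullback

variable {ι : Type*} [LinearOrder ι] {d : ι → ℤ} {K : Type*} [RCLike K] {c : ℕ}
  {ι' : Type*} [LinearOrder ι'] {d' : ι' → ℤ}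

lemma phi_pow (i : ι) (a : ℕ) : phi d K c i ^ a = mono d c 1 (single i a, 0) := by
  induction a with
  | zero => rw [pow_zero, Finsupp.single_zero]; rfl
  | succ a ih =>
    rw [pow_succ', ih, phi, mono_mul_mono, kz_single, if_neg (lt_irrefl i), sg_zero,
      ← Finsupp.single_add, add_comm]

lemma mono_list (J : ι →₀ ℕ) {l : List ι} (hl : l.Pairwise (· < ·)) :
    (l.map fun i => phi d K c i ^ J i).prod =
      mono d c 1 ((l.map fun i => single i (J i)).sum, 0) := by
  induction l with
  | nil => rfl
  | cons i l ih =>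
    rw [List.pairwise_cons] at hl
    have h1 : kz d (single i (J i)) (l.map fun i => single i (J i)).sum = 0 := by
      have := hl.1
      clear ih hl
      induction l with
      | nil => simp [kz]
      | cons j l ih =>
        rw [List.map_cons, List.sum_cons, kz_add_right, kz_single,
          if_neg (this j List.mem_cons_self).not_gt, ih fun k hk => this k (List.mem_cons_of_mem _ hk),
          add_zero]
    rw [List.map_cons, List.prod_cons, ih hl.2, phi_pow, mono_mul_mono, h1, sg_zero, List.map_cons,
      List.sum_cons]

lemma mono_sort (J : ι →₀ ℕ) : ((J.support.sort (· ≤ ·)).map fun i => phi d K c i ^ J i).prod =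
    mono d c 1 (J, 0) := by
  rw [mono_list J (J.support.sortedLT_sort).pairwise]
  congr 2
  rw [← Multiset.sum_coe, ← Multiset.map_coe, Finset.sort_eq]
  exact J.sum_single

/-- `L` is the pullback along the formal map with components `Φ`. -/
structure IsPullback (L : SF d' K c →+* SF d K c) (Φ : ι' → Coef ι K) : Prop where
  cont : Cont L.toAddMonoidHom
  smul : ∀ (r : K) F, L (r • F) = r • L F
  hb : ∀ m, L (hb d' K c m) = SF.hb d K c m
  coef : ∀ i, (L (phi d' K c i)).coef = Φ i

lemma IsPullback.coef_mono {L : SF d' K c →+* SF d K c} {Φ : ι' → Coef ι K} (h : IsPullback L Φ)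
    (J : ι' →₀ ℕ) : (L (mono d' c 1 (J, 0))).coef = monPullback d Φ J := by
  rw [← mono_sort, map_list_prod, List.map_map, monPullback]
  induction J.support.sort (· ≤ ·) with
  | nil => exact coef_one_eq
  | cons i l ih =>
    rw [List.map_cons, List.prod_cons, coef_mul_eq, ih, List.map_cons, List.foldr_cons,
      Function.comp_apply, map_pow, coef_pow_eq, h.coef]

lemma IsPullback.eq {L : SF d' K c →+* SF d K c} {Φ : ι' → Coef ι K} (h : IsPullback L Φ)
    (F : SF d' K c) : pullback d Φ F.coef = (L F).coef := by
  funext I g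
  refine Eq.symm ((((isSum_monomials F).map h.cont).coef I g).trans ?_)
  rw [pullback]
  refine finsum_congr fun p => ?_
  change (L _).coef I g = _
  rw [← h.coef_mono, show mono d' c (F.coef p.1 p.2) p = _ from mono_eq_smul (F.coef p.1 p.2) p.1 p.2,
    h.smul, map_mul, h.hb, coef_smul, coef_hb_mul, smul_eq_mul]

lemma IsPullback.comp {ι'' : Type*} [LinearOrder ι''] {d'' : ι'' → ℤ} {L : SF d' K c →+* SF d K c}
    {Φ : ι' → Coef ι K} (h : IsPullback L Φ) {M : SF d'' K c →+* SF d' K c} {Ψ : ι'' → Coef ι' K}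
    (h' : IsPullback M Ψ) : IsPullback (L.comp M) (BV.comp d Ψ Φ) where
  cont := h.cont.comp h'.cont
  smul r F := by rw [RingHom.comp_apply, h'.smul, h.smul]; rfl
  hb m := by rw [RingHom.comp_apply, h'.hb, h.hb]
  coef i := by
    change (L (M _)).coef = pullback d Φ (Ψ i)
    rw [← h.eq, h'.coef]

lemma isPullback_inc (h : ι → Prop) : IsPullback (inc d K c h) (projMap h) where
  cont := cont_inc
  smul := inc_smul
  hb := inc_hb
  coef i := by rw [inc_phi, coef_phi_eq]; rfl

section Morphism

variable {Ω : ι → ι → K} {Ω' : ι' → ι' → K} (hπ : IsOddPoisson d (inverse Ω))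
  (hπ' : IsOddPoisson d' (inverse Ω')) {L : SF d' K 0 →+* SF d K 0} {Φ : ι' → Coef ι K}
  (hL : IsPullback L Φ) (hs : ∀ F, L (sig d' K 0 1 F) = sig d K 0 1 (L F))
  {S : SF d K 0} {S' : SF d' K 0}
  (hT : ∀ F, L (tw (inverse Ω') S' F) = tw (inverse Ω) S (L F))
include hπ hπ' hL hs hT

lemma isPoisson_of_intertwines (hS : S ∈ Par d K 0 0) (hS' : S' ∈ Par d' K 0 0) :
    IsPoisson d d' Ω Ω' Φ := fun m n F G hF hG => by
  obtain ⟨F, -, rfl⟩ := exists_of_isFunWeight hF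
  obtain ⟨G, -, rfl⟩ := exists_of_isFunWeight hG
  rw [hL.eq, hL.eq, ← coef_br_eq, ← coef_br_eq, hL.eq,
    map_br_of_intertwines hπ' hπ L hL.hb hs hS' hS hT]

lemma isQuantumMorphism (hS : IsQuantumLInfty d Ω S.coef) (hS' : IsQuantumLInfty d' Ω' S'.coef)
    (hΦ : IsFormalMap d d' Φ) : IsQuantumMorphism d d' Ω S.coef Ω' S'.coef Φ where
  source := hS
  target := hS'
  formalMap := hΦ
  poisson := isPoisson_of_intertwines hπ hπ' hL hs hT (par_of_deg (deg_of_hasDegree hS.degree))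
    (par_of_deg (deg_of_hasDegree hS'.degree))
  intertwines m F hF := by
    obtain ⟨F, -, rfl⟩ := exists_of_isFunWeight hF
    rw [hL.eq, ← coef_tw_eq, ← coef_tw_eq, hL.eq, hT]

end Morphism

lemma map_sig_of_deg {L : SF d' K c →+* SF d K c} (hL : Cont L.toAddMonoidHom)
    (h : ∀ n, ∀ F ∈ Deg d' K c n, L F ∈ Deg d K c n) (F : SF d' K c) :
    L (sig d' K c 1 F) = sig d K c 1 (L F) := by
  have e : L.toAddMonoidHom.comp (sig d' K c 1).toAddMonoidHom =
      (sig d K c 1).toAddMonoidHom.comp L.toAddMonoidHom := by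
    refine ext_of_mono (hL.comp (cont_sig 1)) ((cont_sig 1).comp hL) fun r p => ?_
    have h1 : mono d' c r p ∈ Deg d' K c (monDegree d' p.1) := mono_mem rfl
    change L (sig d' K c 1 _) = sig d K c 1 (L _)
    rw [sig_of_par (par_of_deg h1), sig_of_par (par_of_deg (h _ _ h1))]
    rcases Int.even_or_odd (1 * monDegree d' p.1) with h2 | h2
    · rw [sg_even h2, one_smul, one_smul]
    · rw [sg_odd h2, neg_smul, neg_smul, one_smul, one_smul, map_neg]
  exact DFunLike.congr_fun e F

lemma coef_mpow_eq {N : ι → ι → SF d K c} (hN : IsSmall N) (n : ℕ) (j i : ι) :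
    (mpow N n j i).coef = matPow d (fun j i => (N j i).coef) n j i := by
  classical
  induction n generalizing j i with
  | zero =>
    change (if j = i then 1 else 0 : SF d K c).coef = if j = i then one else 0
    split_ifs
    · exact coef_one_eq
    · rfl
  | succ n ih =>
    funext I g
    rw [(hN.isSum_mpow n j i).coef, matPow]
    exact finsum_congr fun k => by rw [coef_mul_eq, ih]

lemma coef_lber_eq {Φ : ι → SF d K c}
    (hN : IsSmall fun j i => der d K c j (Φ i - phi d K c i)) :
    (lber fun j i => der d K c j (Φ i - phi d K c i)).coef = logBer d fun i => (Φ i).coef := by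
  have e : jacobianSubOne d (fun i => (Φ i).coef) =
      fun j i => (der d K c j (Φ i - phi d K c i)).coef := by
    funext j i
    rw [coef_der_eq, coef_sub_eq, coef_phi_eq, jacobianSubOne]
  funext I g
  rw [hN.isSum_lber.coef, logBer]
  refine finsum_congr fun n => ?_
  rw [coef_rat_smul, (hN.isSum_strc n).coef, e]
  push_cast
  congr 1
  exact finsum_congr fun i => by rw [coef_smul, coef_mpow_eq hN, zpow_eq_sg, smul_eq_mul]

end Pullback

section Families

open Polynomial

variable {ι : Type*} [LinearOrder ι] {d : ι → ℤ} {K : Type*} [RCLike K] {c : ℕ}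

lemma contDiff_eval (p : K[X]) :
    ContDiff ℝ ((⊤ : ℕ∞) : WithTop ℕ∞) fun t : ℝ => p.eval (t : K) := by
  simp only [eval_eq_sum_range]
  exact ContDiff.sum fun i _ => contDiff_const.mul ((RCLike.ofRealCLM (K := K)).contDiff.pow i)

lemma hasDerivAt_eval (p : K[X]) (t : ℝ) :
    HasDerivAt (fun t : ℝ => p.eval (t : K)) ((derivative p).eval (t : K)) t := by
  have := (p.hasDerivAt (t : K)).scomp t (RCLike.ofRealCLM (K := K)).hasDerivAt
  rw [RCLike.ofRealCLM_apply, RCLike.ofReal_one, one_smul] at this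
  exact this

lemma isFunPosFamily_ev {G : SF d K[X] 0} (hG : G ∈ Fil d K[X] 0 1) :
    IsFunPosFamily d fun t : ℝ => (ev (t : K) G).coef where
  pos t _ := isFunPos_coef (ev_mem_supp _ hG)
  finite w := (G.lf w).subset fun p hp => by
    obtain ⟨h1, t, -, h2⟩ := hp
    refine ⟨((lv_zero_eq p.1 p.2).trans h1).le, fun h0 => h2 ?_⟩
    rw [coef_ev, h0, eval_zero]
  smooth I g := by
    simp only [coef_ev]
    exact (contDiff_eval _).contDiffOn

lemma parity_of_deg {F : SF d K c} (hF : F ∈ Deg d K c 0) : parity d F.coef = F.coef := by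
  funext I g
  rw [parity]
  by_cases h : F.coef I g = 0
  · rw [h, mul_zero]
  · rw [show monDegree d I = 0 from hF (I, g) h, zpow_zero, one_mul]

lemma pow_deg_zero {F : SF d K c} (hF : F ∈ Deg d K c 0) (n : ℕ) : F ^ n ∈ Deg d K c 0 :=
  pow_mem_supp md_zero md_closed hF n

lemma formPow_coef {α β : ℝ → SF d K 0} (hα : ∀ t, α t ∈ Deg d K 0 0) (n : ℕ) :
    formPow d (fun t => (α t).coef, fun t => (β t).coef) n =
      (fun t => (α t ^ n).coef, fun t => ((n : K) • (α t ^ (n - 1) * β t)).coef) := by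
  induction n with
  | zero =>
    rw [formPow]
    refine Prod.ext (funext fun t => ?_) (funext fun t => ?_)
    · change one = (α t ^ 0).coef
      rw [pow_zero, coef_one_eq]
    · change 0 = (((0 : ℕ) : K) • _ : SF d K 0).coef
      rw [Nat.cast_zero, zero_smul]; rfl
  | succ n ih =>
    rw [formPow, ih, formMul]
    refine Prod.ext (funext fun t => ?_) (funext fun t => ?_)
    · change BV.mul d (α t).coef (α t ^ n).coef = (α t ^ (n + 1)).coef
      rw [← coef_mul_eq, pow_succ']
    · change BV.mul d (α t).coef ((n : K) • (α t ^ (n - 1) * β t)).coef +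
        BV.mul d (β t).coef (parity d (α t ^ n).coef) = (((n + 1 : ℕ) : K) • (α t ^ n * β t)).coef
      rw [parity_of_deg (pow_deg_zero (hα t) n), ← coef_mul_eq, ← coef_mul_eq, ← coef_add_eq,
        ← central_of_even (par_of_deg (pow_deg_zero (hα t) n)) (β t), mul_smul_comm, ← mul_assoc,
        ← pow_succ', Nat.cast_succ, add_smul, one_smul]
      cases n with
      | zero => simp
      | succ n => rfl

lemma formExp_coef {α β : ℝ → SF d K 0} (hα : ∀ t, α t ∈ Deg d K 0 0)
    (hf : ∀ t, α t ∈ Fil d K 0 1) :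
    formExp d (fun t => (α t).coef, fun t => (β t).coef) =
      (fun t => (ex (α t)).coef, fun t => (ex (α t) * β t).coef) := by
  unfold formExp
  simp only [formPow_coef hα]
  refine Prod.ext (funext fun t => ?_) (funext fun t => funext fun I => funext fun g => ?_)
  · refine Eq.trans ?_ (coef_ex_eq (hf t)).symm
    funext I g
    exact finsum_congr fun n => by rw [coef_pow_eq]
  · have h1 := ((isSum_ex (hf t)).mul_right (β t)).congr
      (y' := fun n : ℕ => (((n + 1).factorial : ℕ) : K)⁻¹ • (((n + 1 : ℕ) : K) • (α t ^ (n + 1 - 1) * β t)))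
      fun n => by
        rw [smul_smul, smul_mul_assoc, Nat.add_sub_cancel, Nat.factorial_succ]
        have h0 : ((n : K) + 1) ≠ 0 := by exact_mod_cast n.succ_ne_zero
        ext I g
        rw [coef_rat_smul, coef_smul, smul_eq_mul]
        congr 1
        push_cast
        field_simp
    have h2 := (IsSum.of_succ (y := fun n : ℕ => ((n.factorial : ℕ) : K)⁻¹ •
      ((n : K) • (α t ^ (n - 1) * β t))) h1).coef I g
    rw [Nat.cast_zero, zero_smul, smul_zero, zero_add] at h2
    exact h2.symm

end Families

end SF

section Linear

variable {K : Type*} [RCLike K] {V : Type*} [AddCommGroup V] [Module K V] {ι : Type*}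
  {e : Module.Basis ι K V}

lemma repr_mem_of_disjoint {U U' : Submodule K V} (hU : Disjoint U U')
    (he : ∀ i, e i ∈ U ∨ e i ∈ U') {v : V} (hv : v ∈ U) {i : ι} (hi : e.repr v i ≠ 0) :
    e i ∈ U := by
  classical
  by_contra hi'
  set x := e.repr v
  have h1 : linearCombination K e (x.filter fun i => e i ∈ U) ∈ U :=
    Submodule.sum_mem _ fun j hj => U.smul_mem _ (by
      rw [Finsupp.support_filter, mem_filter] at hj; exact hj.2)
  have h2 : linearCombination K e (x.filter fun i => e i ∉ U) ∈ U' :=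
    Submodule.sum_mem _ fun j hj => U'.smul_mem _ (by
      rw [Finsupp.support_filter, mem_filter] at hj; exact (he j).resolve_left hj.2)
  have h3 : linearCombination K e (x.filter fun i => e i ∈ U) +
      linearCombination K e (x.filter fun i => e i ∉ U) = v := by
    rw [← map_add, Finsupp.filter_add_filter_not, e.linearCombination_repr]
  have h4 : linearCombination K e (x.filter fun i => e i ∉ U) ∈ U := by
    rw [← eq_sub_iff_add_eq'] at h3
    rw [h3]; exact U.sub_mem hv h1
  have h5 := congrArg (fun w => e.repr w i) (Submodule.disjoint_def.1 hU _ h4 h2)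
  simp only [e.repr_linearCombination, map_zero, Finsupp.zero_apply] at h5
  rw [Finsupp.filter_apply_pos (fun i => e i ∉ U) _ hi'] at h5
  exact hi h5

lemma mem_of_repr {U : Submodule K V} {v : V} (h : ∀ i, e.repr v i ≠ 0 → e i ∈ U) : v ∈ U := by
  rw [← e.linearCombination_repr v]
  exact Submodule.sum_mem _ fun i hi => U.smul_mem _ (h i (Finsupp.mem_support_iff.1 hi))

/-- The transpose of `-f`, for a linear map `f` with finite rows. -/
def opMat (e : Module.Basis ι K V) (f : V →ₗ[K] V) (hf : ∀ j, {i | e.repr (f (e i)) j ≠ 0}.Finite)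
    (j : ι) : ι →₀ K :=
  Finsupp.ofSupportFinite (fun i => -e.repr (f (e i)) j) ((hf j).subset fun i hi => by
    simpa using hi)

lemma opMat_apply (f : V →ₗ[K] V) (hf) (j i : ι) : opMat e f hf j i = -e.repr (f (e i)) j := rfl

lemma linearCombination_opMat (f g : V →ₗ[K] V) (hf hg) (j i : ι) :
    linearCombination K (opMat e g hg) (opMat e f hf j) i = e.repr (f (g (e i))) j := by
  rw [linearCombination_apply, Finsupp.sum, Finsupp.finsetSum_apply]
  conv_rhs => rw [← e.linearCombination_repr (g (e i)), linearCombination_apply,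
    Finsupp.sum, map_sum, map_sum, Finsupp.finsetSum_apply]
  have e1 : ∀ l, (opMat e f hf j l • opMat e g hg l) i =
      (e.repr (f (e.repr (g (e i)) l • e l))) j := fun l => by
    rw [Finsupp.smul_apply, opMat_apply, opMat_apply, map_smul, map_smul, Finsupp.smul_apply,
      smul_eq_mul, smul_eq_mul, neg_mul_neg, mul_comm]
  simp only [e1]
  classical
  refine (Finset.sum_subset (Finset.subset_union_left (s₂ := (e.repr (g (e i))).support)) ?_).trans
    (Finset.sum_subset (Finset.subset_union_right (s₁ := (opMat e f hf j).support)) ?_).symm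
  · intro l _ hl
    rw [Finsupp.notMem_support_iff] at hl
    rw [← e1, hl, zero_smul]; rfl
  · intro l _ hl
    rw [Finsupp.notMem_support_iff] at hl
    rw [hl, zero_smul, map_zero, map_zero]; rfl

section Graded

variable {𝒱 : ℤ → Submodule K V} {d : ι → ℤ} (hG : IsGraded 𝒱) (he : ∀ i, e i ∈ 𝒱 (d i))
include hG he

lemma deg_eq_of_mem {i : ι} {n : ℤ} (hi : e i ∈ 𝒱 n) : d i = n := by
  by_contra hne
  exact e.ne_zero i (Submodule.disjoint_def.1 (hG.internal.submodule_iSupIndep.pairwiseDisjoint hne)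
    _ (he i) hi)

lemma deg_of_repr {n : ℤ} {v : V} (hv : v ∈ 𝒱 n) {i : ι} (hi : e.repr v i ≠ 0) : d i = n := by
  refine deg_eq_of_mem hG he (repr_mem_of_disjoint (hG.internal.submodule_iSupIndep n)
    (fun j => ?_) hv hi)
  by_cases hj : d j = n
  · exact Or.inl (hj ▸ he j)
  · exact Or.inr (Submodule.mem_iSup_of_mem (d j) (Submodule.mem_iSup_of_mem hj (he j)))

lemma finite_deg (n : ℤ) : {i | d i = n}.Finite := by
  have := hG.finite n
  have hl : LinearIndependent K fun i : {i // d i = n} => (⟨e i.1, (congrArg 𝒱 i.2).le (he i.1)⟩ : 𝒱 n) :=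
    LinearIndependent.of_comp (𝒱 n).subtype
      (e.linearIndependent.comp (fun i : {i // d i = n} => i.1) Subtype.val_injective)
  exact Set.finite_coe_iff.1 hl.finite_of_isNoetherian

end Graded

section Symplectic

variable [LinearOrder ι] {𝒱 : ℤ → Submodule K V} {ω : V →ₗ[K] V →ₗ[K] K} {d : ι → ℤ} (hG : IsGraded 𝒱)
  (hω : IsOddSymplectic 𝒱 ω) (he : ∀ i, e i ∈ 𝒱 (d i))
include hG hω he

lemma nondegenerate_left {n : ℤ} {v : V} (hv : v ∈ 𝒱 n) (h : ∀ w ∈ 𝒱 (1 - n), ω v w = 0) :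
    v = 0 := by
  refine hω.nondegenerate v fun w => ?_
  rw [← e.linearCombination_repr w, linearCombination_apply, Finsupp.sum, map_sum]
  refine sum_eq_zero fun i _ => ?_
  rw [map_smul]
  by_cases hi : d i = 1 - n
  · rw [h _ (hi ▸ he i), smul_zero]
  · rw [hω.degree n (d i) (by omega) v hv _ (he i), smul_zero]

lemma nondegenerate_right {w : V} (h : ∀ i, ω (e i) w = 0) : w = 0 := by
  classical
  have h0 : ∀ v, ω v w = 0 := fun v => by
    rw [← e.linearCombination_repr v, linearCombination_apply, Finsupp.sum, map_sum,
      LinearMap.sum_apply]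
    exact sum_eq_zero fun i _ => by rw [map_smul, LinearMap.smul_apply, h, smul_zero]
  refine e.repr.map_eq_zero_iff.1 (Finsupp.ext fun i => ?_)
  by_contra hi
  have h1 : (linearCombination K e ((e.repr w).filter fun j => d j = d i)) = 0 := by
    have hm : (linearCombination K e ((e.repr w).filter fun j => d j = d i)) ∈ 𝒱 (d i) :=
      Submodule.sum_mem _ fun j hj => Submodule.smul_mem _ _ (by
        rw [Finsupp.support_filter, mem_filter] at hj
        exact hj.2 ▸ he j)
    refine nondegenerate_left hG hω he hm fun v hv => ?_
    rw [hω.antisymm _ _ _ hm _ hv, neg_eq_zero]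
    refine mul_eq_zero_of_right _ ?_
    have h2 := h0 v
    rw [← e.linearCombination_repr w, ← Finsupp.filter_add_filter_not (e.repr w)
      (fun j => d j = d i), map_add, map_add] at h2
    have h3 : ω v (linearCombination K e ((e.repr w).filter fun j => ¬ d j = d i)) = 0 := by
      rw [linearCombination_apply, Finsupp.sum, map_sum]
      refine sum_eq_zero fun j hj => ?_
      rw [Finsupp.support_filter, mem_filter] at hj
      rw [map_smul, hω.degree _ _ (by have := hj.2; omega) v hv _ (he j), smul_zero]
    rwa [h3, add_zero] at h2
  have h2 := congrArg (fun w => e.repr w i) h1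
  simp only [e.repr_linearCombination, map_zero, Finsupp.zero_apply] at h2
  rw [Finsupp.filter_apply_pos (fun j => d j = d i) _ rfl] at h2
  exact hi h2

lemma exists_dual (k : ι) : ∃ w ∈ 𝒱 (1 - d k), ∀ v, ω v w = e.repr v k := by
  have := hG.finite (d k)
  have := hG.finite (1 - d k)
  let p : 𝒱 (1 - d k) →ₗ[K] 𝒱 (d k) →ₗ[K] K :=
    (ω.flip.domRestrict (𝒱 (1 - d k))).compl₂ (𝒱 (d k)).subtype
  have hp : ∀ v w, p v w = ω w v := fun _ _ => rfl
  have h1 : Function.Injective p := by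
    refine (injective_iff_map_eq_zero p).2 fun w hw => ?_
    refine Subtype.ext (nondegenerate_right hG hω he (w := w) fun i => ?_)
    by_cases hi : d i = d k
    · exact LinearMap.congr_fun hw ⟨e i, hi ▸ he i⟩
    · exact hω.degree (d i) (1 - d k) (by omega) _ (he i) _ w.2
  have h2 : Function.Injective p.flip := by
    refine (injective_iff_map_eq_zero p.flip).2 fun v hv => ?_
    exact Subtype.ext (nondegenerate_left hG hω he v.2 fun w hw =>
      LinearMap.congr_fun hv ⟨w, hw⟩)
  obtain ⟨w, hw⟩ := (LinearMap.IsPerfPair.of_injective h1 h2).bijective_left.2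
    ((e.coord k).domRestrict (𝒱 (d k)))
  refine ⟨w, w.2, fun v => ?_⟩
  have h3 : ω.flip w = e.coord k := e.ext fun i => by
    by_cases hi : d i = d k
    · exact LinearMap.congr_fun hw ⟨e i, hi ▸ he i⟩
    · rw [LinearMap.flip_apply, hω.degree (d i) (1 - d k) (by omega) _ (he i) _ w.2, e.coord_apply,
        e.repr_self, Finsupp.single_eq_of_ne fun h => hi (congrArg d h.symm)]
  exact LinearMap.congr_fun h3 v

lemma exists_inverse (k : ι) : ∃ w ∈ 𝒱 (1 - d k), (∀ v, ω v w = e.repr v k) ∧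
    ∀ j, inverse (fun i j => ω (e i) (e j)) j k = e.repr w j := by
  classical
  obtain ⟨w, hw, h⟩ := exists_dual hG hω he k
  have hs : ∀ (x : ι →₀ K) i, (x.sum fun j a => ω (e i) (e j) * a) =
      ω (e i) (linearCombination K e x) := fun x i => by
    rw [linearCombination_apply, Finsupp.sum, Finsupp.sum, map_sum]
    exact sum_congr rfl fun j _ => by rw [map_smul, smul_eq_mul, mul_comm]
  have hk : ∀ i, ω (e i) w = if i = k then 1 else 0 := fun i => by
    rw [h, e.repr_self, single_apply]
  have hex : ∃ x : ι →₀ K, ∀ i, (x.sum fun j a => ω (e i) (e j) * a) = if i = k then 1 else 0 :=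
    ⟨e.repr w, fun i => by rw [hs, e.linearCombination_repr, hk]⟩
  refine ⟨w, hw, h, fun j => ?_⟩
  have h1 : inverse (fun i j => ω (e i) (e j)) j k = hex.choose j := by
    unfold inverse
    rw [dif_pos]
  have h2 : linearCombination K e hex.choose = w := by
    rw [← sub_eq_zero]
    refine nondegenerate_right hG hω he fun i => ?_
    rw [map_sub, ← hs, hk, sub_eq_zero]
    exact hex.choose_spec i
  rw [h1, ← h2, e.repr_linearCombination]

lemma isOddPoisson_inverse {d : ι → ℤ} (he : ∀ i, e i ∈ 𝒱 (d i)) :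
    SF.IsOddPoisson d (inverse fun i j => ω (e i) (e j)) := by
  have hdeg : ∀ i j, inverse (fun i j => ω (e i) (e j)) i j ≠ 0 → d i + d j = 1 := fun i j h => by
    obtain ⟨w, hw, -, h2⟩ := exists_inverse hG hω he j
    rw [h2] at h
    have := deg_of_repr hG he hw h
    omega
  refine ⟨hdeg, fun i j => ?_⟩
  obtain ⟨w, hw, h1, h2⟩ := exists_inverse hG hω he j
  obtain ⟨w', hw', h1', h2'⟩ := exists_inverse hG hω he i
  have h3 := hω.antisymm _ _ _ hw _ hw'
  rw [h1, h1', ← h2, ← h2'] at h3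
  by_cases h : d i + d j = 1
  · have h4 : Even ((1 - d j) * (1 - d i)) := by
      rw [show (1 - d j) * (1 - d i) = (1 - d j) * d j by rw [show 1 - d i = d j by omega],
        mul_comm, show d j * (1 - d j) = -(d j * (d j - 1)) by ring]
      exact (Int.even_mul_pred_self _).neg
    rwa [h4.neg_one_zpow, one_mul] at h3
  · rw [not_not.1 (mt (hdeg i j) h), not_not.1 (mt (hdeg j i) (by omega)), neg_zero]

lemma finite_inverse (i : ι) : {j | inverse (fun i j => ω (e i) (e j)) i j ≠ 0}.Finite :=
  (finite_deg hG he (1 - d i)).subset fun j hj => by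
    have := (isOddPoisson_inverse hG hω he he).degree i j hj
    change d j = 1 - d i
    omega

end Symplectic

end Linear

section Hodge

variable {K : Type*} [RCLike K] {V : Type*} [AddCommGroup V] [Module K V]
  {𝒱 : ℤ → Submodule K V} {ω : V →ₗ[K] V →ₗ[K] K} {Q : V →ₗ[K] V}
  {H B C : Submodule K V} {ι : Type*} {e : Module.Basis ι K V} {d : ι → ℤ}

section Decomposition

variable (hH : IsHodgeDecomposition ω Q H B C)
include hH

lemma eq_zero_of_mem_C {x : V} (hx : x ∈ C) (h : Q x = 0) : x = 0 :=
  Submodule.disjoint_def.1 hH.complement.disjoint x (LinearMap.mem_ker.2 h) hx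

lemma Q_of_mem_H {x : V} (hx : x ∈ H) : Q x = 0 :=
  LinearMap.mem_ker.1 (hH.cycles ▸ Submodule.mem_sup_left hx)

lemma Q_of_mem_B {x : V} (hx : x ∈ B) : Q x = 0 :=
  LinearMap.mem_ker.1 (hH.cycles ▸ Submodule.mem_sup_right hx)

lemma Q_mem_B (x : V) : Q x ∈ B := hH.boundaries ▸ LinearMap.mem_range_self Q x

lemma disjoint_C : Disjoint C (H ⊔ B) := hH.cycles ▸ hH.complement.disjoint.symm

lemma disjoint_H : Disjoint H (B ⊔ C) := by
  refine Submodule.disjoint_def.2 fun x hx hx' => ?_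
  obtain ⟨b, hb, c, hc, rfl⟩ := Submodule.mem_sup.1 hx'
  have h := Q_of_mem_H hH hx
  rw [map_add, Q_of_mem_B hH hb, zero_add] at h
  rw [eq_zero_of_mem_C hH hc h, add_zero] at hx ⊢
  exact (Submodule.mem_bot K).1 (hH.disjoint ▸ ⟨hx, hb⟩)

lemma disjoint_B : Disjoint B (H ⊔ C) := by
  refine Submodule.disjoint_def.2 fun x hx hx' => ?_
  obtain ⟨b, hb, c, hc, rfl⟩ := Submodule.mem_sup.1 hx'
  have h := Q_of_mem_B hH hx
  rw [map_add, Q_of_mem_H hH hb, zero_add] at h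
  rw [eq_zero_of_mem_C hH hc h, add_zero] at hx ⊢
  exact (Submodule.mem_bot K).1 (hH.disjoint ▸ ⟨hb, hx⟩)

variable (ha : ∀ i, e i ∈ H ∨ e i ∈ B ∨ e i ∈ C)
include ha

lemma repr_H {v : V} (hv : v ∈ H) {i : ι} (hi : e.repr v i ≠ 0) : e i ∈ H :=
  repr_mem_of_disjoint (disjoint_H hH) (fun i => (ha i).imp_right fun h =>
    h.elim (fun h => Submodule.mem_sup_left h) fun h => Submodule.mem_sup_right h) hv hi

lemma repr_B {v : V} (hv : v ∈ B) {i : ι} (hi : e.repr v i ≠ 0) : e i ∈ B :=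
  repr_mem_of_disjoint (disjoint_B hH) (fun i => (ha i).elim
    (fun h => Or.inr (Submodule.mem_sup_left h)) fun h => h.imp_right
      fun h => Submodule.mem_sup_right h) hv hi

lemma repr_C {v : V} (hv : v ∈ C) {i : ι} (hi : e.repr v i ≠ 0) : e i ∈ C :=
  repr_mem_of_disjoint (disjoint_C hH) (fun i => (ha i).elim
    (fun h => Or.inr (Submodule.mem_sup_left h)) fun h => h.elim
      (fun h => Or.inr (Submodule.mem_sup_right h)) fun h => Or.inl h) hv hi

omit ha in
lemma notMem_H_of_B {i : ι} (hi : e i ∈ B) : e i ∉ H := fun h =>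
  e.ne_zero i (Submodule.disjoint_def.1 (disjoint_H hH) _ h (Submodule.mem_sup_left hi))

omit ha in
lemma notMem_H_of_C {i : ι} (hi : e i ∈ C) : e i ∉ H := fun h =>
  e.ne_zero i (Submodule.disjoint_def.1 (disjoint_H hH) _ h (Submodule.mem_sup_right hi))

omit ha in
lemma notMem_B_of_C {i : ι} (hi : e i ∈ C) : e i ∉ B := fun h =>
  e.ne_zero i (Submodule.disjoint_def.1 (disjoint_B hH) _ h (Submodule.mem_sup_right hi))

omit hH ha in
lemma homotopy_mem (v : V) : homotopy Q C e v ∈ C := by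
  have h : LinearMap.range (homotopy Q C e) ≤ C := by
    unfold homotopy
    rw [Module.Basis.constr_range, Submodule.span_le]
    rintro _ ⟨j, rfl⟩
    beta_reduce
    split_ifs with h
    · exact C.neg_mem h.choose_spec.1
    · exact C.zero_mem
  exact h (LinearMap.mem_range_self _ v)

omit ha in
lemma homotopy_eq_zero {j : ι} (hj : e j ∉ B) : homotopy Q C e (e j) = 0 := by
  unfold homotopy
  rw [Module.Basis.constr_basis, dif_neg]
  rintro ⟨c, -, hc⟩
  exact hj (hc ▸ Q_mem_B hH c)

omit ha in
lemma Q_homotopy {j : ι} (hj : e j ∈ B) : Q (homotopy Q C e (e j)) = -e j := by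
  have h : ∃ c ∈ C, Q c = e j := by
    rw [hH.boundaries] at hj
    obtain ⟨v, hv⟩ := hj
    obtain ⟨z, hz, c, hc, rfl⟩ := Submodule.mem_sup.1
      (hH.complement.sup_eq_top ▸ Submodule.mem_top : v ∈ LinearMap.ker Q ⊔ C)
    exact ⟨c, hc, by rw [← hv, map_add, LinearMap.mem_ker.1 hz, zero_add]⟩
  unfold homotopy
  rw [Module.Basis.constr_basis, dif_pos h, map_neg, h.choose_spec.2]

lemma homotopy_of_mem_C {x : V} (hx : x ∈ C) : homotopy Q C e x = 0 := by
  rw [← e.linearCombination_repr x, linearCombination_apply, Finsupp.sum, map_sum]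
  exact sum_eq_zero fun i hi => by
    rw [map_smul, homotopy_eq_zero hH (notMem_B_of_C hH (repr_C hH ha hx
      (Finsupp.mem_support_iff.1 hi))), smul_zero]

lemma Q_homotopy_of_mem {x : V} (hx : x ∈ B) : Q (homotopy Q C e x) = -x := by
  conv_rhs => rw [← e.linearCombination_repr x, linearCombination_apply, Finsupp.sum]
  conv_lhs => rw [← e.linearCombination_repr x, linearCombination_apply, Finsupp.sum]
  rw [map_sum, map_sum, ← Finset.sum_neg_distrib]
  exact sum_congr rfl fun i hi => by
    rw [map_smul, map_smul, Q_homotopy hH (repr_B hH ha hx (Finsupp.mem_support_iff.1 hi)), smul_neg]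

lemma homotopy_Q {j : ι} (hj : e j ∉ H) :
    homotopy Q C e (Q (e j)) + Q (homotopy Q C e (e j)) = -e j := by
  obtain hB | hC := (ha j).resolve_left hj
  · rw [Q_of_mem_B hH hB, map_zero, zero_add, Q_homotopy hH hB]
  · rw [homotopy_of_mem_C hH ha hC, map_zero, add_zero, ← add_eq_zero_iff_eq_neg]
    exact eq_zero_of_mem_C hH (C.add_mem (homotopy_mem _) hC)
      (by rw [map_add, Q_homotopy_of_mem hH ha (Q_mem_B hH _), neg_add_cancel])

end Decomposition

variable (hV : IsDGSymplectic 𝒱 ω Q) (hH : IsHodgeDecomposition ω Q H B C)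
  (he : IsAdaptedBasis 𝒱 H B C e d)
include hV hH he

lemma homotopy_deg (i : ι) : homotopy Q C e (e i) ∈ 𝒱 (d i - 1) := by
  classical
  by_cases hi : e i ∈ B
  swap
  · rw [homotopy_eq_zero hH hi]; exact zero_mem _
  set c := homotopy Q C e (e i) with hc
  refine mem_of_repr (e := e) fun j hj => ?_
  suffices h : d j = d i - 1 from h ▸ he.homogeneous j
  by_contra hne
  set x := linearCombination K e ((e.repr c).filter fun l => d l = d j) with hx
  set y := linearCombination K e ((e.repr c).filter fun l => ¬ d l = d j) with hy
  have hxy : x + y = c := by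
    rw [hx, hy, ← map_add, Finsupp.filter_add_filter_not, e.linearCombination_repr]
  have hxC : x ∈ C := Submodule.sum_mem _ fun l hl => Submodule.smul_mem _ _ (by
    rw [Finsupp.support_filter, mem_filter] at hl
    exact repr_C hH he.adapted (homotopy_mem _) (Finsupp.mem_support_iff.1 hl.1))
  have hxj : x ∈ 𝒱 (d j) := Submodule.sum_mem _ fun l hl => Submodule.smul_mem _ _ (by
    rw [Finsupp.support_filter, mem_filter] at hl
    exact hl.2 ▸ he.homogeneous l)
  have hU : ∀ n v, n ≠ d j + 1 → v ∈ 𝒱 n → v ∈ ⨆ m, ⨆ _ : m ≠ d j + 1, 𝒱 m := fun n v hn hv =>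
    Submodule.mem_iSup_of_mem n (Submodule.mem_iSup_of_mem hn hv)
  have hQy : Q y ∈ ⨆ m, ⨆ _ : m ≠ d j + 1, 𝒱 m := by
    rw [hy, linearCombination_apply, Finsupp.sum, map_sum]
    refine Submodule.sum_mem _ fun l hl => ?_
    rw [Finsupp.support_filter, mem_filter] at hl
    rw [map_smul]
    exact Submodule.smul_mem _ _ (hU (d l + 1) _ (fun h => hl.2 (by omega))
      (hV.degree _ _ (he.homogeneous l)))
  have hQx : Q x = -e i - Q y := by
    rw [← Q_homotopy hH hi, ← hc, ← hxy, map_add, add_sub_cancel_right]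
  have h0 : Q x = 0 := Submodule.disjoint_def.1 (hV.graded.internal.submodule_iSupIndep (d j + 1)) _
    (hV.degree _ _ hxj) (hQx ▸ Submodule.sub_mem _ (Submodule.neg_mem _
      (hU (d i) _ (fun h => hne (by omega)) (he.homogeneous i))) hQy)
  have h1 := congrArg (fun w => e.repr w j) (eq_zero_of_mem_C hH hxC h0)
  simp only [hx, e.repr_linearCombination, map_zero, Finsupp.zero_apply] at h1
  rw [Finsupp.filter_apply_pos (fun l => d l = d j) _ rfl] at h1
  exact hj h1

lemma homotopy_repr {j i : ι} (h : e.repr (homotopy Q C e (e i)) j ≠ 0) : d i = d j + 1 := by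
  have := deg_of_repr hV.graded he.homogeneous (homotopy_deg hV hH he i) h
  omega

lemma finite_homotopy (j : ι) : {i | e.repr (homotopy Q C e (e i)) j ≠ 0}.Finite :=
  (finite_deg hV.graded he.homogeneous (d j + 1)).subset fun _ hi => homotopy_repr hV hH he hi

omit hH in
lemma Q_repr {j i : ι} (h : e.repr (Q (e i)) j ≠ 0) : d i = d j - 1 := by
  have := deg_of_repr hV.graded he.homogeneous (hV.degree _ _ (he.homogeneous i)) h
  omega

omit hH in
lemma finite_Q (j : ι) : {i | e.repr (Q (e i)) j ≠ 0}.Finite :=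
  (finite_deg hV.graded he.homogeneous (d j - 1)).subset fun _ hi => Q_repr hV he hi

lemma orthogonal_symm {x y : V} (hx : x ∈ B ⊔ C) (hy : y ∈ H) : ω x y = 0 := by
  have h1 : ∀ i, e.repr x i ≠ 0 → e i ∈ B ⊔ C := fun i hi =>
    repr_mem_of_disjoint (disjoint_H hH).symm (fun i => (he.adapted i).elim Or.inr fun h =>
      Or.inl (h.elim (fun h => Submodule.mem_sup_left h) fun h => Submodule.mem_sup_right h)) hx hi
  rw [← e.linearCombination_repr x, ← e.linearCombination_repr y,
    linearCombination_apply, linearCombination_apply, Finsupp.sum, Finsupp.sum,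
    map_sum, map_sum]
  refine sum_eq_zero fun j hj => ?_
  rw [LinearMap.sum_apply]
  refine sum_eq_zero fun i hi => ?_
  rw [map_smul, map_smul, LinearMap.smul_apply, hV.symplectic.antisymm _ _ _ (he.homogeneous i) _
    (he.homogeneous j), hH.orthogonal _ (repr_H hH he.adapted hy (Finsupp.mem_support_iff.1 hj)) _
    (h1 i (Finsupp.mem_support_iff.1 hi)), mul_zero, neg_zero, smul_zero, smul_zero]

variable [LinearOrder ι]

lemma dual_mem_H {k : ι} (hk : e k ∈ H) {w : V} (hw : ∀ v, ω v w = e.repr v k) : w ∈ H := by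
  have htop : (H ⊔ (B ⊔ C)) = ⊤ := by
    rw [← sup_assoc, hH.cycles, hH.complement.sup_eq_top]
  obtain ⟨x, hx, y, hy, rfl⟩ := Submodule.mem_sup.1 (htop ▸ Submodule.mem_top : w ∈ H ⊔ (B ⊔ C))
  have h0 : y = 0 := by
    refine nondegenerate_right hV.graded hV.symplectic he.homogeneous fun i => ?_
    by_cases hi : e i ∈ H
    · exact hH.orthogonal _ hi _ hy
    · have hi' : e i ∈ B ⊔ C := ((he.adapted i).resolve_left hi).elim
        (fun h => Submodule.mem_sup_left h) fun h => Submodule.mem_sup_right h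
      have h1 := hw (e i)
      rw [map_add, orthogonal_symm hV hH he hi' hx, zero_add, e.repr_self,
        Finsupp.single_eq_of_ne fun h => hi (by rw [← h]; exact hk)] at h1
      exact h1
  rwa [h0, add_zero]

lemma inverse_block {i j : ι} (hij : inverse (fun i j => ω (e i) (e j)) i j ≠ 0) :
    e i ∈ H ↔ e j ∈ H := by
  have key : ∀ i j, inverse (fun i j => ω (e i) (e j)) i j ≠ 0 → e j ∈ H → e i ∈ H :=
    fun i j hij hj => by
      obtain ⟨w, -, h1, h2⟩ := exists_inverse hV.graded hV.symplectic he.homogeneous j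
      exact repr_H hH he.adapted (dual_mem_H hV hH he hj h1) (h2 i ▸ hij)
  refine ⟨key j i ?_, key i j hij⟩
  rwa [(isOddPoisson_inverse hV.graded hV.symplectic he.homogeneous he.homogeneous).antisymm,
    neg_ne_zero]

lemma inverse_restrict (i j : {i // e i ∈ H}) :
    inverse (fun i j : {i // e i ∈ H} => ω (e i) (e j)) i j =
      inverse (fun i j => ω (e i) (e j)) i.1 j.1 := by
  classical
  obtain ⟨w, hw, h1, h2⟩ := exists_inverse hV.graded hV.symplectic he.homogeneous j.1
  have hs : ∀ (x : {i // e i ∈ H} →₀ K) (i : ι), (x.sum fun j a => ω (e i) (e j) * a) =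
      ω (e i) (linearCombination K (fun i : {i // e i ∈ H} => e i) x) := fun x i => by
    rw [linearCombination_apply, Finsupp.sum, Finsupp.sum, map_sum]
    exact sum_congr rfl fun j _ => by rw [map_smul, smul_eq_mul, mul_comm]
  have hk : ∀ i, ω (e i) w = if i = j.1 then 1 else 0 := fun i => by
    rw [h1, e.repr_self, single_apply]
  have hm : ∀ x : {i // e i ∈ H} →₀ K,
      linearCombination K (fun i : {i // e i ∈ H} => e i) x ∈ H := fun x =>
    Submodule.sum_mem _ fun l _ => Submodule.smul_mem _ _ l.2
  have hlc : ∀ x : {i // e i ∈ H} →₀ K,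
      linearCombination K (fun i : {i // e i ∈ H} => e i) x =
        linearCombination K e (x.embDomain (Function.Embedding.subtype _)) := fun x => by
    rw [Finsupp.linearCombination_embDomain]; rfl
  have hex : ∃ x : {i // e i ∈ H} →₀ K, ∀ i : {i // e i ∈ H},
      (x.sum fun j a => ω (e i) (e j) * a) = if i = j then 1 else 0 := by
    refine ⟨(e.repr w).subtypeDomain _, fun i => ?_⟩
    rw [hs, hlc, ← Finsupp.extendDomain_eq_embDomain_subtype, Finsupp.extendDomain_subtypeDomain _
      fun i hi => repr_H hH he.adapted (dual_mem_H hV hH he j.2 h1) (Finsupp.mem_support_iff.1 hi),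
      e.linearCombination_repr, hk]
    simp only [Subtype.ext_iff]
  have h4 : inverse (fun i j : {i // e i ∈ H} => ω (e i) (e j)) i j = hex.choose i := by
    unfold inverse
    split_ifs with h
    · congr! 5
    · exact absurd (by convert hex) h
  have h5 : linearCombination K (fun i : {i // e i ∈ H} => e i) hex.choose = w := by
    rw [← sub_eq_zero]
    refine nondegenerate_right hV.graded hV.symplectic he.homogeneous fun l => ?_
    by_cases hl : e l ∈ H
    · rw [map_sub, ← hs, hk, sub_eq_zero, hex.choose_spec ⟨l, hl⟩]
      simp only [Subtype.ext_iff]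
    · have hl' : e l ∈ B ⊔ C := ((he.adapted l).resolve_left hl).elim
        (fun h => Submodule.mem_sup_left h) fun h => Submodule.mem_sup_right h
      exact orthogonal_symm hV hH he hl' (H.sub_mem (hm _) (dual_mem_H hV hH he j.2 h1))
  rw [h4, h2, ← h5, hlc, e.repr_linearCombination]
  exact (Finsupp.embDomain_apply_self (Function.Embedding.subtype _) _ i).symm

lemma hodgeData : SF.HodgeData d (inverse fun i j => ω (e i) (e j)) (fun i => e i ∈ H)
    (opMat e Q (finite_Q hV he)) (opMat e (homotopy Q C e) (finite_homotopy hV hH he)) where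
  poisson := isOddPoisson_inverse hV.graded hV.symplectic he.homogeneous he.homogeneous
  block i j := inverse_block hV hH he
  kdeg j i h := homotopy_repr hV hH he (neg_ne_zero.1 h)
  qdeg j i h := Q_repr hV he (neg_ne_zero.1 h)
  kH j i h := by
    rw [opMat_apply, neg_ne_zero] at h
    refine ⟨notMem_H_of_C hH (repr_C hH he.adapted (homotopy_mem _) h), ?_⟩
    by_contra hi
    rw [homotopy_eq_zero hH fun hB => notMem_H_of_B hH hB hi] at h
    exact h (by rw [map_zero]; rfl)
  qH j i h := by
    rw [opMat_apply, neg_ne_zero] at h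
    refine ⟨notMem_H_of_B hH (repr_B hH he.adapted (Q_mem_B hH _) h), fun hi => h ?_⟩
    rw [Q_of_mem_H hH hi, map_zero]; rfl
  kk j := by
    ext i
    rw [linearCombination_opMat, homotopy_of_mem_C hH he.adapted (homotopy_mem _), map_zero]; rfl
  qq j := by
    ext i
    rw [linearCombination_opMat, hV.square, map_zero]; rfl
  homot j hj := by
    classical
    ext i
    rw [Finsupp.add_apply, linearCombination_opMat, linearCombination_opMat, ← Finsupp.add_apply,
      ← map_add]
    by_cases hi : e i ∈ H
    · rw [Q_of_mem_H hH hi, homotopy_eq_zero hH fun hB => notMem_H_of_B hH hB hi, map_zero,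
        map_zero, add_zero, map_zero, Finsupp.neg_apply,
        Finsupp.single_eq_of_ne fun h => hj (by rw [← h]; exact hi), neg_zero]
      rfl
    · rw [homotopy_Q hH he.adapted hi, map_neg, e.repr_self, Finsupp.neg_apply, Finsupp.neg_apply,
        single_apply, single_apply]
      simp only [eq_comm]

end Hodge

namespace SF

section Free

variable {K : Type*} [RCLike K] {V : Type*} [AddCommGroup V] [Module K V]
  {𝒱 : ℤ → Submodule K V} {ω : V →ₗ[K] V →ₗ[K] K} {Q : V →ₗ[K] V}
  {ι : Type*} [LinearOrder ι] {e : Module.Basis ι K V} {d : ι → ℤ}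

/-- The coefficients of the free action. -/
def frc (d : ι → ℤ) (ω : V →ₗ[K] V →ₗ[K] K) (Q : V →ₗ[K] V) (e : Module.Basis ι K V)
    (i j : ι) : K := (-1) ^ (d i) * ω (e i) (Q (e j))

lemma phi_mul_phi_mem (i j : ι) : phi d K 0 i * phi d K 0 j ∈
    Supp d K 0 {p | p = (single i 1 + single j 1, 0)} := by
  unfold phi
  rw [mono_mul_mono]
  exact mono_mem rfl

lemma phi_mul_comm (i j : ι) :
    phi d K 0 j * phi d K 0 i = sg K (d i * d j) • (phi d K 0 i * phi d K 0 j) := by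
  rw [mul_comm_of_par (phi_par j), sig_of_par (phi_par i), smul_mul_assoc, mul_comm (d j)]

section Symmetry

variable (hV : IsDGSymplectic 𝒱 ω Q) (he : ∀ i, e i ∈ 𝒱 (d i))
include hV he

lemma frc_deg {i j : ι} (h : frc d ω Q e i j ≠ 0) : d i + d j = 0 := by
  by_contra hne
  refine h ?_
  rw [frc, hV.symplectic.degree _ _ (by omega) _ (he i) _ (hV.degree _ _ (he j)), mul_zero]

lemma frc_symm (i j : ι) : frc d ω Q e i j = sg K (d i * d j) * frc d ω Q e j i := by
  by_cases h : d i + d j = 0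
  swap
  · rw [not_not.1 (mt (frc_deg hV he) h), not_not.1 (mt (frc_deg hV he) (by omega)), mul_zero]
  have h1 := hV.compatible _ _ (he j) (e i)
  have h2 := hV.symplectic.antisymm _ _ _ (he i) _ (hV.degree _ _ (he j))
  have hj : d j = -d i := by omega
  rw [frc, frc, h2]
  rcases Int.even_or_odd (d i) with hi | hi
  · have hj' : Even (d j) := hj ▸ hi.neg
    rw [hj'.neg_one_zpow, one_mul] at h1
    rw [hi.neg_one_zpow, hj'.neg_one_zpow, (hi.mul_right _).neg_one_zpow, sg_even (hi.mul_right _)]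
    linear_combination -h1
  · have hj' : Odd (d j) := hj ▸ hi.neg
    rw [hj'.neg_one_zpow] at h1
    rw [hi.neg_one_zpow, hj'.neg_one_zpow, (hj'.add_one.mul_left _).neg_one_zpow,
      sg_odd (hi.mul hj')]
    linear_combination h1

lemma frc_mul_symm (i j : ι) : frc d ω Q e j i • (phi d K 0 j * phi d K 0 i) =
    frc d ω Q e i j • (phi d K 0 i * phi d K 0 j) := by
  rw [phi_mul_comm, frc_symm hV he i j, smul_smul, mul_comm]

lemma freeAction_ne_zero {i j : ι} (h : frc d ω Q e i j ≠ 0) :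
    freeAction d ω Q e (single i 1 + single j 1) 0 ≠ 0 := by
  have hadm : Admissible d (single i 1 + single j 1) := by
    intro l hl
    by_contra h2
    rw [Finsupp.add_apply, single_apply, single_apply] at h2
    have h3 : i = l ∧ j = l := by
      constructor <;> by_contra h4 <;> rw [if_neg h4] at h2 <;> split_ifs at h2 <;> omega
    have h4 := frc_deg hV he h
    rw [h3.1, h3.2] at h4
    obtain ⟨m, hm⟩ := hl
    omega
  set T : ι × ι → K := fun p => (frc d ω Q e p.1 p.2 • (phi d K 0 p.1 * phi d K 0 p.2)).coef
    (single i 1 + single j 1) 0 with hT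
  have h1 : freeAction d ω Q e (single i 1 + single j 1) 0 =
      (1 / 2) * ∑ᶠ p, T p := by
    unfold freeAction
    congr 1
    refine finsum_congr fun p => ?_
    rw [← coef_phi_eq (c := 0), ← coef_phi_eq (c := 0), ← coef_mul_eq]
    rfl
  have h2 : T (i, j) ≠ 0 := by
    rw [hT]
    beta_reduce
    rw [coef_smul, smul_eq_mul]
    refine mul_ne_zero h ?_
    unfold phi
    rw [coef_mono_mul_mono hadm]
    exact left_ne_zero_of_mul_eq_one (sg_mul_self _)
  have h3 : T (j, i) = T (i, j) := by
    rw [hT]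
    beta_reduce
    rw [frc_mul_symm hV he]
  have h4 : Function.support T ⊆ (({(i, j), (j, i)} : Finset (ι × ι)) : Set (ι × ι)) := by
    intro p hp
    rw [Function.mem_support, hT] at hp
    have h5 := supp_smul (frc d ω Q e p.1 p.2) (phi_mul_phi_mem p.1 p.2)
      (single i 1 + single j 1, 0) hp
    have h6 : single i 1 + single j 1 =
      single p.1 1 + single p.2 1 := congrArg Prod.fst h5
    rw [Finsupp.single_add_single_eq_single_add_single one_ne_zero one_ne_zero] at h6
    simp only [Finset.coe_insert, Finset.coe_singleton, Set.mem_insert_iff,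
      Set.mem_singleton_iff, Prod.ext_iff]
    rcases h6 with ⟨a, b⟩ | ⟨-, a, b⟩ | ⟨a, -⟩
    · exact Or.inl ⟨a.symm, b.symm⟩
    · exact Or.inr ⟨b.symm, a.symm⟩
    · omega
  rw [h1, finsum_eq_sum_of_support_subset T h4]
  refine mul_ne_zero (by norm_num) ?_
  by_cases hij : i = j
  · subst hij
    simpa using h2
  · rw [Finset.sum_pair (fun h => hij (congrArg Prod.fst h)), h3, ← two_mul]
    exact mul_ne_zero two_ne_zero h2

end Symmetry

/-- The free action, as a sum over finitely many indices. -/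
def freeSum (d : ι → ℤ) (ω : V →ₗ[K] V →ₗ[K] K) (Q : V →ₗ[K] V) (e : Module.Basis ι K V)
    (t : Finset ι) : SF d K 0 :=
  (1 / 2 : K) • ∑ i ∈ t, ∑ j ∈ t, frc d ω Q e i j • (phi d K 0 i * phi d K 0 j)

lemma rdv_phi_mul_phi (i a b : ι) : rdv d K 0 i (phi d K 0 a * phi d K 0 b) =
    (if i = b then phi d K 0 a else 0) + if i = a then sg K (d a * d b) • phi d K 0 b else 0 := by
  rw [rdv_apply, sig_of_par (mul_par (phi_par a) (phi_par b)), der_smul, der_mul, der_phi, der_phi,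
    sig_of_par (phi_par a), smul_smul, ← sg_add]
  have e1 : sg K (d i + d i * (d a + d b)) • ((if i = a then (1 : SF d K 0) else 0) * phi d K 0 b) =
      if i = a then sg K (d a * d b) • phi d K 0 b else 0 := by
    split_ifs with h
    · subst h
      rw [one_mul]
      congr 1
      refine sg_congr ?_
      rw [show d i + d i * (d i + d b) - d i * d b = d i * (d i + 1) by ring]
      exact Int.even_mul_succ_self _
    · rw [zero_mul, smul_zero]
  have e2 : sg K (d i + d i * (d a + d b)) • (sg K (d i * d a) • phi d K 0 a *
      (if i = b then (1 : SF d K 0) else 0)) = if i = b then phi d K 0 a else 0 := by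
    split_ifs with h
    · subst h
      rw [mul_one, smul_smul, ← sg_add, sg_even, one_smul]
      rw [show d i + d i * (d a + d i) + d i * d a = d i * (d i + 1) + 2 * (d i * d a) by ring]
      exact (Int.even_mul_succ_self _).add (even_two_mul _)
    · rw [mul_zero, smul_zero]
  rw [smul_add, e1, e2, add_comm]

section FreeSum

variable {t : Finset ι} (ht : ∀ i j, frc d ω Q e i j ≠ 0 → i ∈ t ∧ j ∈ t)
include ht

lemma coef_freeSum : (freeSum d ω Q e t).coef = freeAction d ω Q e := by
  funext I g
  rw [freeSum, ← Finset.sum_product', coef_smul, coef_sum, smul_eq_mul, freeAction]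
  congr 1
  rw [finsum_eq_sum_of_support_subset (s := t ×ˢ t)]
  · refine sum_congr rfl fun p _ => ?_
    rw [← coef_phi_eq (c := 0), ← coef_phi_eq (c := 0), ← coef_mul_eq]
    rfl
  · intro p hp
    rw [Finset.mem_coe, Finset.mem_product]
    refine ht _ _ fun h => hp ?_
    change frc d ω Q e p.1 p.2 * _ = 0
    rw [h, zero_mul]

variable (hV : IsDGSymplectic 𝒱 ω Q) (he : ∀ i, e i ∈ 𝒱 (d i))
include hV he

lemma rdv_freeSum (i : ι) :
    rdv d K 0 i (freeSum d ω Q e t) = ∑ a ∈ t, frc d ω Q e a i • phi d K 0 a := by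
  rw [freeSum, rdv_smul, map_sum]
  simp only [map_sum, rdv_smul, rdv_phi_mul_phi, smul_add, sum_add_distrib, smul_ite,
    smul_zero]
  have h1 : ∀ a, (∑ b ∈ t, if i = b then frc d ω Q e a b • phi d K 0 a else 0) =
      frc d ω Q e a i • phi d K 0 a := fun a => by
    rw [Finset.sum_ite_eq]
    split_ifs with h
    · rfl
    · rw [not_not.1 (mt (ht a i) fun h' => h h'.2), zero_smul]
  have h2 : ∀ b, (∑ a ∈ t, if i = a then frc d ω Q e a b • sg K (d a * d b) • phi d K 0 b else 0) =
      frc d ω Q e b i • phi d K 0 b := fun b => by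
    rw [Finset.sum_ite_eq, frc_symm hV he b i, smul_smul, mul_comm (d b), mul_comm]
    split_ifs with h
    · rfl
    · rw [not_not.1 (mt (ht i b) fun h' => h h'.1), mul_zero, zero_smul]
  rw [Finset.sum_comm (s := t) (t := t) (f := fun a b =>
    if i = a then frc d ω Q e a b • sg K (d a * d b) • phi d K 0 b else 0)]
  simp only [h1, h2]
  rw [← smul_add, ← two_smul K, smul_smul]
  norm_num

lemma br_freeSum_phi (j : ι) (hf : ∀ j, {i | e.repr (Q (e i)) j ≠ 0}.Finite) :
    br (inverse fun i j => ω (e i) (e j)) (freeSum d ω Q e t) (phi d K 0 j) =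
      lin d K 0 (opMat e Q hf) (phi d K 0 j) := by
  obtain ⟨w, -, h1, h2⟩ := exists_inverse hV.graded hV.symplectic he j
  have hs := isSum_finset t (fun i => inverse (fun i j => ω (e i) (e j)) i j •
    rdv d K 0 i (freeSum d ω Q e t)) fun i hi => by
      rw [rdv_freeSum ht hV he, sum_eq_zero fun a _ => by
        rw [not_not.1 (mt (ht a i) fun h' => hi h'.2), zero_smul], smul_zero]
  rw [(isSum_br_phi _ j).unique hs, lin_phi, lcomb]
  have h3 : opMat e Q hf j = ∑ i ∈ t, ∑ a ∈ t,
      single a (e.repr w i * frc d ω Q e a i) := by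
    classical
    ext a
    rw [Finsupp.finsetSum_apply]
    have h4 : ∀ i, (∑ a ∈ t, single a (e.repr w i * frc d ω Q e a i)) a =
        e.repr w i * frc d ω Q e a i := fun i => by
      rw [Finsupp.finsetSum_apply]
      simp only [single_apply]
      rw [Finset.sum_ite_eq']
      split_ifs with h
      · rfl
      · rw [not_not.1 (mt (ht a i) fun h' => h h'.1), mul_zero]
    simp only [h4]
    have h5 := hV.compatible _ _ (he a) w
    rw [h1] at h5
    have h6 : (-1) ^ d a * ω (e a) (Q w) = ∑ i ∈ (e.repr w).support, e.repr w i * frc d ω Q e a i := by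
      conv_lhs => rw [← e.linearCombination_repr w]
      rw [linearCombination_apply, Finsupp.sum, map_sum, map_sum, Finset.mul_sum]
      refine sum_congr rfl fun i _ => ?_
      rw [map_smul, map_smul, smul_eq_mul, frc]
      ring
    rw [opMat_apply, neg_eq_of_add_eq_zero_right h5, h6]
    refine (Finset.sum_subset (Finset.subset_union_left (s₂ := t)) fun i _ hi => ?_).trans
      (Finset.sum_subset (Finset.subset_union_right (s₁ := (e.repr w).support)) fun i _ hi => ?_).symm
    · rw [Finsupp.notMem_support_iff.1 hi, zero_mul]
    · rw [not_not.1 (mt (ht a i) fun h' => hi h'.2), mul_zero]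
  rw [h3, map_sum]
  refine sum_congr rfl fun i _ => ?_
  rw [rdv_freeSum ht hV he, map_sum, Finset.smul_sum, h2]
  refine sum_congr rfl fun a _ => ?_
  rw [Finsupp.linearCombination_single, smul_smul]

lemma br_freeSum (hf : ∀ j, {i | e.repr (Q (e i)) j ≠ 0}.Finite) (hp : freeSum d ω Q e t ∈ Par d K 0 0)
    (hq : ∀ j i, opMat e Q hf j i ≠ 0 → Even (d i - d j - 1)) (F : SF d K 0) :
    br (inverse fun i j => ω (e i) (e j)) (freeSum d ω Q e t) F = lin d K 0 (opMat e Q hf) F := by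
  have hπ := isOddPoisson_inverse hV.graded hV.symplectic he he
  have h1 : IsDer 1 (ad (inverse fun i j => ω (e i) (e j)) (freeSum d ω Q e t)) :=
    { cont := cont_ad _ _
      smul := fun r F => br_smul_right _ r _ F
      hb_mul := fun m F => br_hb_right _ m _ F
      mul := fun F G => br_mul hπ hp F G }
  have h2 := h1.ext (isDer_lin hq) fun j => br_freeSum_phi ht hV he j hf
  exact DFunLike.congr_fun h2 F

omit hV he in
lemma freeSum_supp : freeSum d ω Q e t ∈ Supp d K 0 {p | p.1.degree = 2 ∧ p.2 = 0} := by
  refine supp_smul _ (sum_mem fun i _ => sum_mem fun j _ => supp_smul _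
    (supp_mono ?_ (phi_mul_phi_mem i j)))
  rintro _ rfl
  simp

lemma freeSum_deg : freeSum d ω Q e t ∈ Deg d K 0 0 := by
  refine supp_smul _ (sum_mem fun i _ => sum_mem fun j _ => ?_)
  by_cases h : frc d ω Q e i j = 0
  · rw [h, zero_smul]; exact zero_mem _
  · refine supp_smul _ ?_
    have h1 := mul_deg (phi_deg (d := d) (R := K) (c := 0) i) (phi_deg j)
    rwa [show -d i + -d j = 0 by have := frc_deg hV he h; omega] at h1

end FreeSum

end Free

section Free

variable {K : Type*} [RCLike K] {V : Type*} [AddCommGroup V] [Module K V]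
  {𝒱 : ℤ → Submodule K V} {ω : V →ₗ[K] V →ₗ[K] K} {Q : V →ₗ[K] V} {H B C : Submodule K V}
  {ι : Type*} [LinearOrder ι] {e : Module.Basis ι K V} {d : ι → ℤ}

lemma lap_eq_zero_of_quadratic {π : ι → ι → K} (hπ : IsOddPoisson d π) {F : SF d K 0}
    (h0 : F ∈ Deg d K 0 0) (h2 : F ∈ Supp d K 0 {p | p.1.degree = 2 ∧ p.2 = 0}) :
    lap d K 0 π F = 0 := by
  have h1 := lap_deg hπ h0
  have h3 : lap d K 0 π F ∈ Supp d K 0 {p | p.1.degree = 0} := by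
    refine lap_mem_supp ?_ h2
    intro i j p _ hp
    have := hp.1
    simp only [Prod.fst_add, map_add, degree_single] at this
    rw [mem_ofPred_eq]
    omega
  ext I g
  by_contra hne
  have h4 : I = 0 := (Finsupp.degree_eq_zero_iff I).1 (h3 (I, g) hne)
  have h5 : monDegree d I = 0 + 1 := h1 (I, g) hne
  rw [h4, md_zero] at h5
  omega

lemma br_self_eq_zero_of_quadratic {π : ι → ι → K} (hπ : IsOddPoisson d π) {F X : SF d K 0}
    (h0 : F ∈ Deg d K 0 0) (h2 : F ∈ Supp d K 0 {p | p.1.degree = 2 ∧ p.2 = 0})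
    (hX : X ∈ Fil d K 0 3) (h : qme π (F + X) = 0) : br π F F = 0 := by
  have hF : F ∈ Fil d K 0 2 := by
    refine supp_mono ?_ h2
    rintro ⟨I, g⟩ ⟨h3, h4⟩
    change (2 : ℤ) ≤ lv 0 (I, g)
    rw [lv_zero_eq, weight]
    simp only at h3 h4
    omega
  have h3 : br π F F ∈ Supp d K 0 {p | p.1.degree = 2 ∧ p.2 = 0} := by
    refine br_mem_supp ?_ h2 h2
    rintro i j ⟨p, g⟩ ⟨q, k⟩ _ ⟨h4, h5⟩ ⟨h6, h7⟩
    simp only [Prod.mk_add_mk, map_add, degree_single, add_zero] at h4 h5 h6 h7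
    rw [mem_ofPred_eq]
    simp only [Prod.mk_add_mk, map_add]
    omega
  have h4 : br π F F ∈ Fil d K 0 3 := by
    have e1 : br π F F = -((2 : K) • (hb d K 0 1 * lap d K 0 π X) + (br π F X + br π X F + br π X X)) := by
      rw [qme, map_add, dl_apply, lap_eq_zero_of_quadratic hπ h0 h2, mul_zero, zero_add, br_add_left, br_add_right,
        br_add_right] at h
      rw [← sub_eq_zero, ← h, dl_apply]
      abel
    have f1 := hb_mul_mem_fil (d := d) 1 (lap_mem_fil (π := π) hX)
    have f2 := br_mem_fil (π := π) hF hX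
    have f3 := br_mem_fil (π := π) hX hF
    have f4 := br_mem_fil (π := π) hX hX
    rw [e1]
    exact neg_mem (add_mem (supp_smul _ (fil_anti (by norm_num) f1)) (add_mem (add_mem
      (fil_anti (by norm_num) f2) (fil_anti (by norm_num) f3)) (fil_anti (by norm_num) f4)))
  ext I g
  by_contra hne
  obtain ⟨h5, h6⟩ := h3 (I, g) hne
  have h7 : (3 : ℤ) ≤ lv 0 (I, g) := h4 (I, g) hne
  rw [lv_zero_eq, weight] at h7
  simp only at h5 h6
  omega

lemma exists_action (hV : IsDGSymplectic 𝒱 ω Q) (hH : IsHodgeDecomposition ω Q H B C)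
    (he : IsAdaptedBasis 𝒱 H B C e d) {S : Coef ι K}
    (hS : IsQuantumLInfty d (fun i j => ω (e i) (e j)) S)
    (hfree : ∀ I g, weight I g ≤ 2 → S I g = freeAction d ω Q e I g) :
    ∃ Sf b : SF d K 0, Sf.coef = freeAction d ω Q e ∧
      b.coef = hbar (-1) (S - freeAction d ω Q e) ∧
      Action d (inverse fun i j => ω (e i) (e j)) (fun i => e i ∈ H) (opMat e Q (finite_Q hV he))
        (opMat e (homotopy Q C e) (finite_homotopy hV hH he)) Sf b := by
  classical
  have hD := hodgeData hV hH he
  obtain ⟨S, -, rfl⟩ := exists_of_isFun hS.isFun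
  set t := (hS.isFun.finite 2 0).toFinset.biUnion fun I => I.support with ht'
  have ht : ∀ i j, frc d ω Q e i j ≠ 0 → i ∈ t ∧ j ∈ t := fun i j h => by
    have h1 := freeAction_ne_zero hV he.homogeneous h
    have h2 : (single i 1 + single j 1 : ι →₀ ℕ).degree = 2 := by simp
    rw [← hfree _ _ (by rw [weight, h2]; norm_num)] at h1
    have h3 : ∀ l, (single i 1 + single j 1 : ι →₀ ℕ) l ≠ 0 → l ∈ t := fun l hl =>
      Finset.mem_biUnion.2 ⟨_, (hS.isFun.finite 2 0).mem_toFinset.2 ⟨h2, h1⟩,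
        Finsupp.mem_support_iff.2 hl⟩
    exact ⟨h3 i (by simp), h3 j (by simp)⟩
  set Sf := freeSum d ω Q e t with hSf
  have hcoef : Sf.coef = freeAction d ω Q e := coef_freeSum ht
  have hdeg : Sf ∈ Deg d K 0 0 := freeSum_deg ht hV he.homogeneous
  have hsupp : Sf ∈ Supp d K 0 {p | p.1.degree = 2 ∧ p.2 = 0} := freeSum_supp ht
  have hX : S - Sf ∈ Fil d K 0 3 := mem_fil'.2 fun p hp => by
    rw [show p = (p.1, p.2) from rfl, lv_zero_eq] at hp
    rw [coef_sub_eq, hcoef]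
    exact sub_eq_zero.2 (hfree _ _ (by omega))
  have hXdeg : S - Sf ∈ Deg d K 0 0 := sub_mem (deg_of_hasDegree hS.degree) hdeg
  have hSX : S = Sf + (S - Sf) := (add_sub_cancel _ _).symm
  have hq : qme (inverse fun i j => ω (e i) (e j)) S = 0 :=
    coef_injective ((coef_qme_eq _ S).trans hS.master)
  have hself : br (inverse fun i j => ω (e i) (e j)) Sf Sf = 0 :=
    br_self_eq_zero_of_quadratic hD.poisson hdeg hsupp hX (by rw [← hSX, hq])
  have hlap := lap_eq_zero_of_quadratic hD.poisson hdeg hsupp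
  have hbfil : hb d K 0 (-1) * (S - Sf) ∈ Fil d K 0 1 :=
    fil_anti (by norm_num) (hb_mul_mem_fil (-1) hX)
  have hbdeg := hb_mul_deg (-1) hXdeg
  refine ⟨Sf, hb d K 0 (-1) * (S - Sf), hcoef, by rw [coef_hb_eq, coef_sub_eq, hcoef], hD,
    finite_inverse hV.graded hV.symplectic he.homogeneous, hdeg, hsupp, hlap, hself,
    br_freeSum ht hV he.homogeneous _ (par_of_deg hdeg) hD.qpar, hbfil, hbdeg, fun p hp => ?_,
    (qme_add_eq_zero_iff hD.poisson (par_of_deg hdeg) (par_of_deg hbdeg) hbfil ?_).1 ?_⟩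
  · rw [coef_hb_mul] at hp
    rw [mem_ofPred_eq]
    by_contra hlt
    refine hp ?_
    rw [coef_sub_eq, Pi.sub_apply, Pi.sub_apply]
    have h1 : S.coef p.1 (p.2 - -1) = 0 := by
      by_contra h
      have := hS.isFun.genus _ _ h
      omega
    have h2 : Sf.coef p.1 (p.2 - -1) = 0 := by
      by_contra h
      have := (hsupp (p.1, p.2 - -1) h).2
      simp only at this
      omega
    rw [h1, h2, sub_zero]
  · rw [qme, dl_apply, hlap, hself, mul_zero, smul_zero, add_zero]
  · rw [show hb d K 0 1 * (hb d K 0 (-1) * (S - Sf)) = S - Sf from hb_mul_hb_neg 1 _, ← hSX, hq]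

end Free

open Polynomial

section Flow

variable {ι : Type*} [LinearOrder ι] {d : ι → ℤ} {K : Type*} [RCLike K] {Ω : ι → ι → K}
  {h : ι → Prop} {μ κ : ι → ι →₀ K}

namespace Action

variable {Sf b : SF d K 0} (S : Action d (inverse Ω) h μ κ Sf b)
include S

lemma FlowAt_apply (t : K) (F : SF d K 0) : S.FlowAt t F = ev t (S.Flow (cst F)) := rfl

lemma ev_disp_apply (t : K) (i : ι) :
    S.FlowAt t (phi d K 0 i) - phi d K 0 i = ev t (S.disp i) := by
  rw [disp, map_sub, FlowAt_apply, cst_phi, ← cst_phi (K := K) i, ev_cst]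

lemma FlowAt_mem_fil (t : K) {v : ℤ} {F : SF d K 0} (hF : F ∈ Fil d K 0 v) :
    S.FlowAt t F ∈ Fil d K 0 v := by
  have h1 := flowAt_sub_mem S.isDer_ham S.raises_ham t hF
  have h2 := add_mem (fil_anti (by linarith) h1) hF
  rwa [sub_add_cancel] at h2

lemma isPullback_FlowAt (t : K) :
    IsPullback (S.FlowAt t) fun i => (S.FlowAt t (phi d K 0 i)).coef where
  cont := cont_flowAt S.isDer_ham S.raises_ham t
  smul := flowAt_smul S.isDer_ham S.raises_ham t
  hb := flowAt_hb S.isDer_ham S.raises_ham t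
  coef _ := rfl

/-- The inverse of the flow at time `1`. -/
def FlowInv : SF d K 0 →+* SF d K 0 := flowInv S.isDer_ham S.raises_ham 1

lemma FlowAt_FlowInv (F : SF d K 0) : S.FlowAt 1 (S.FlowInv F) = F :=
  flowAt_flowInv S.isDer_ham S.raises_ham 1 F

lemma FlowInv_FlowAt (F : SF d K 0) : S.FlowInv (S.FlowAt 1 F) = F :=
  flowInv_flowAt S.isDer_ham S.raises_ham 1 F

lemma FlowInv_mem_fil {v : ℤ} {F : SF d K 0} (hF : F ∈ Fil d K 0 v) :
    S.FlowInv F ∈ Fil d K 0 v := flowInv_mem_fil S.isDer_ham S.raises_ham 1 hF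

lemma FlowInv_deg {n : ℤ} {F : SF d K 0} (hF : F ∈ Deg d K 0 n) : S.FlowInv F ∈ Deg d K 0 n :=
  flowInv_mem_supp S.isDer_ham S.raises_ham 1 (fun _ h => bvf_deg S.poisson S.ham_deg h) hF

lemma FlowInv_tw (F : SF d K 0) : S.FlowInv (tw (inverse Ω) (Sf + hb d K 0 1 * incAct d (inverse Ω) h κ b) F) =
    tw (inverse Ω) (Sf + hb d K 0 1 * b) (S.FlowInv F) := by
  rw [← S.FlowInv_FlowAt (tw (inverse Ω) (Sf + hb d K 0 1 * b) (S.FlowInv F)), S.FlowAt_tw,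
    S.FlowAt_FlowInv]

lemma isPullback_FlowInv : IsPullback S.FlowInv fun i => (S.FlowInv (phi d K 0 i)).coef where
  cont := cont_flowInv S.isDer_ham S.raises_ham 1
  smul := flowInv_smul S.isDer_ham S.raises_ham 1
  hb := flowInv_hb S.isDer_ham S.raises_ham 1
  coef _ := rfl

omit S in
lemma isNearIdentity_of_disp {L : SF d K 0 →+* SF d K 0}
    (hfil : ∀ F ∈ Fil d K 0 1, L F ∈ Fil d K 0 1)
    (hdeg : ∀ i, L (phi d K 0 i) ∈ Deg d K 0 (-(d i)))
    (h2 : ∀ i, L (phi d K 0 i) - phi d K 0 i ∈ Fil d K 0 2)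
    (hs : Summ fun i => L (phi d K 0 i) - phi d K 0 i) :
    IsNearIdentity d fun i => (L (phi d K 0 i)).coef where
  formalMap := ⟨fun i => isFunPos_coef (hfil _ (fil_anti (by norm_num) (phi_mem_fil i))),
    fun i => hasDegree_coef (hdeg i)⟩
  displacement i := by
    rw [← coef_phi_eq (c := 0), ← coef_sub_eq]
    exact isFunWeight_coef (h2 i)
  finite w := (hs (w + 1)).subset fun i hi => by
    obtain ⟨I, g, h3, h4⟩ := hi
    rw [← coef_phi_eq (c := 0), ← coef_sub_eq] at h4
    intro h5
    have h6 : w + 1 ≤ lv 0 (I, g) := h5 (I, g) h4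
    rw [lv_zero_eq] at h6
    omega

lemma summ_sub_phi (t : K) : Summ fun i => S.FlowAt t (phi d K 0 i) - phi d K 0 i := fun v =>
  (S.summ_disp v).subset fun i hi hi' => hi (by
    beta_reduce; rw [S.ev_disp_apply]; exact ev_mem_supp t hi')

lemma sub_phi_fil (t : K) (i : ι) : S.FlowAt t (phi d K 0 i) - phi d K 0 i ∈ Fil d K 0 2 := by
  rw [S.ev_disp_apply]; exact ev_mem_supp t (S.disp_fil i)

lemma isNearIdentity_FlowAt (t : K) :
    IsNearIdentity d fun i => (S.FlowAt t (phi d K 0 i)).coef :=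
  isNearIdentity_of_disp (fun _ => S.FlowAt_mem_fil t) (fun i => S.FlowAt_mem_deg t (phi_deg i))
    (S.sub_phi_fil t) (S.summ_sub_phi t)

lemma FlowInv_sub_phi (i : ι) : S.FlowInv (phi d K 0 i) - phi d K 0 i =
    -S.FlowInv (S.FlowAt 1 (phi d K 0 i) - phi d K 0 i) := by
  rw [map_sub, S.FlowInv_FlowAt, neg_sub]

lemma isNearIdentity_FlowInv : IsNearIdentity d fun i => (S.FlowInv (phi d K 0 i)).coef :=
  isNearIdentity_of_disp (fun _ => S.FlowInv_mem_fil) (fun i => S.FlowInv_deg (phi_deg i))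
    (fun i => by rw [S.FlowInv_sub_phi]; exact neg_mem (S.FlowInv_mem_fil (S.sub_phi_fil 1 i)))
    fun v => (S.summ_sub_phi 1 v).subset fun i hi hi' => hi (by
      beta_reduce; rw [S.FlowInv_sub_phi]; exact neg_mem (S.FlowInv_mem_fil hi'))

lemma comp_FlowInv_FlowAt : BV.comp d (fun i => (S.FlowInv (phi d K 0 i)).coef)
    (fun i => (S.FlowAt 1 (phi d K 0 i)).coef) = coord := by
  funext i
  rw [BV.comp, (S.isPullback_FlowAt 1).eq, S.FlowAt_FlowInv, coef_phi_eq]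

lemma comp_FlowAt_FlowInv : BV.comp d (fun i => (S.FlowAt 1 (phi d K 0 i)).coef)
    (fun i => (S.FlowInv (phi d K 0 i)).coef) = coord := by
  funext i
  rw [BV.comp, S.isPullback_FlowInv.eq, S.FlowInv_FlowAt, coef_phi_eq]

lemma isFlow {X : ℝ → Coef ι K → Coef ι K} (hX : ∀ t G, X t G =
    -hbar 1 (bracket d Ω (ev (t : K) (ham d (inverse Ω) h κ b)).coef G)) :
    IsFlow d X fun t i => (S.FlowAt (t : K) (phi d K 0 i)).coef where
  start := by
    funext i
    rw [RCLike.ofReal_zero, show S.FlowAt 0 (phi d K 0 i) = phi d K 0 i from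
      flowAt_zero S.isDer_ham S.raises_ham _, coef_phi_eq]
  nearIdentity t _ := S.isNearIdentity_FlowAt (t : K)
  smooth i I g := by
    simp only [FlowAt_apply, coef_ev]
    exact (contDiff_eval _).contDiffOn
  deriv t _ m F hF I g := by
    obtain ⟨F, -, rfl⟩ := exists_of_isFunWeight hF
    have h1 : X t F.coef = (ev (t : K) (bvf (inverse Ω) (ham d (inverse Ω) h κ b) (cst F))).coef := by
      rw [hX, bvf_apply, map_neg, map_mul, ev_hb, ev_br, ev_cst, coef_neg_eq, coef_hb_eq, coef_br_eq]
    have h2 : (S.FlowAt (t : K) (ev (t : K)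
        (bvf (inverse Ω) (ham d (inverse Ω) h κ b) (cst F)))).coef I g =
        (derivative ((S.Flow (cst F)).coef I g)).eval (t : K) := by
      have h3 : dt (S.Flow (cst F)) = S.Flow (bvf (inverse Ω) (ham d (inverse Ω) h κ b) (cst F)) := by
        refine (dt_flowAdd S.raises_ham (cst F)).trans ?_
        rw [Dt_apply, dt_cst, zero_add]; rfl
      have h4 : ev (t : K) (S.Flow (bvf (inverse Ω) (ham d (inverse Ω) h κ b) (cst F))) = _ :=
        ev_flow S.isDer_ham S.raises_ham (t : K) _
      rw [← coef_dt, h3, ← coef_ev, h4]; rfl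
    simp only [h1, (S.isPullback_FlowAt _).eq, h2]
    simp only [FlowAt_apply, coef_ev]
    exact (hasDerivAt_eval _ t).hasDerivWithinAt

/-- The flow at time `1`, acting on functions that may contain arbitrary negative powers of `ħ`. -/
def UpFlowAt : SF d K 1 →+* SF d K 1 := flowAt S.isDer_up_ham S.raises_up_ham 1

lemma up_FlowAt (F : SF d K 0) : up d K (S.FlowAt 1 F) = S.UpFlowAt (up d K F) :=
  up_flowAt S.isDer_ham S.isDer_up_ham S.raises_ham S.raises_up_ham (fun G => up_bvf _ G) 1 F

lemma isPullback_UpFlowAt : IsPullback S.UpFlowAt fun i => (S.FlowAt 1 (phi d K 0 i)).coef where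
  cont := cont_flowAt S.isDer_up_ham S.raises_up_ham 1
  smul := flowAt_smul S.isDer_up_ham S.raises_up_ham 1
  hb := flowAt_hb S.isDer_up_ham S.raises_up_ham 1
  coef i := by rw [← up_phi, ← S.up_FlowAt]; rfl

lemma up_add_free_fil {a : SF d K 0} (ha : a ∈ Fil d K 0 1) :
    up d K (hb d K 0 (-1) * Sf + a) ∈ Fil d K 1 1 := by
  rw [map_add, map_mul, up_hb]
  refine add_mem ?_ (supp_mono ?_ (up_mem_supp ha))
  · have h1 : up d K Sf ∈ Fil d K 1 6 := by
      refine supp_mono ?_ (up_mem_supp S.free_supp)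
      rintro ⟨I, g⟩ ⟨h1, h2⟩
      rw [mem_ofPred_eq]
      simp only at h1 h2
      simp [lv, h1, h2]
    exact fil_anti (by norm_num) (hb_mul_mem_fil (-1) h1)
  · intro p hp
    rw [mem_ofPred_eq] at hp ⊢
    have := two_mul_lv_le p
    omega

lemma isSmall_sub_phi : IsSmall fun j i => der d K 0 j (S.FlowAt 1 (phi d K 0 i) - phi d K 0 i) := by
  have h1 : (fun j i => der d K 0 j (S.FlowAt 1 (phi d K 0 i) - phi d K 0 i)) =
      fun j i => ev 1 (S.jac j i) := by
    funext j i
    rw [S.ev_disp_apply]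
    exact (mapC_der (evalRingHom (1 : K)).toAddMonoidHom j (S.disp i)).symm
  rw [h1]
  exact ⟨fun j i => ev_mem_supp 1 (S.isSmall_jac.fil j i), fun v =>
    (S.isSmall_jac.summ v).subset fun p hp hp' => hp (ev_mem_supp 1 hp')⟩

lemma semidensity : expo d (hbar (-1) (Sf.coef + hbar 1 (incAct d (inverse Ω) h κ b).coef)) =
    semiPullback d (fun i => (S.FlowAt 1 (phi d K 0 i)).coef)
      (expo d (hbar (-1) (Sf.coef + hbar 1 b.coef))) := by
  have hc : ∀ a : SF d K 0, hbar (-1) (Sf.coef + hbar 1 a.coef) =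
      (up d K (hb d K 0 (-1) * Sf + a)).coef := fun a => by
    have : hb d K 0 (-1) * Sf + a = hb d K 0 (-1) * (Sf + hb d K 0 1 * a) := by
      rw [mul_add, hb_neg_mul_hb]
    rw [this, ← coef_hb_eq, ← coef_add_eq, ← coef_hb_eq]
    rfl
  set Y := hb d K 0 (-1) * Sf + b with hY
  set l := (1 / 2 : K) • lber fun j i => der d K 0 j (S.FlowAt 1 (phi d K 0 i) - phi d K 0 i) with hl
  have hlog : hb d K 0 (-1) * Sf + incAct d (inverse Ω) h κ b = S.FlowAt 1 Y + l := S.semidensity_log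
  have hX1 := S.up_add_free_fil S.incAct_fil
  have hXd := add_mem (hb_mul_deg (-1) S.free_deg) S.incAct_deg
  have hY1 := S.up_add_free_fil S.int_fil
  have hYd := add_mem (hb_mul_deg (-1) S.free_deg) S.int_deg
  have hZ1 : S.UpFlowAt (up d K Y) ∈ Fil d K 1 1 := by
    have h1 := flowAt_sub_mem S.isDer_up_ham S.raises_up_ham 1 hY1
    have h2 := add_mem (fil_anti (by norm_num) h1) hY1
    rwa [sub_add_cancel] at h2
  have hl' : l = hb d K 0 (-1) * Sf + incAct d (inverse Ω) h κ b - S.FlowAt 1 Y := by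
    rw [hlog, add_sub_cancel_left]
  have hl1 : up d K l ∈ Fil d K 1 1 := by
    rw [hl', map_sub, S.up_FlowAt]
    exact sub_mem hX1 hZ1
  have hld : l ∈ Deg d K 0 0 := by
    rw [hl']
    exact sub_mem hXd (S.FlowAt_mem_deg 1 hYd)
  have hpar : ∀ {F : SF d K 0}, F ∈ Deg d K 0 0 → up d K F ∈ Par d K 1 0 := fun hF =>
    par_of_deg (up_mem_supp hF)
  have hlc : (1 / 2 : K) • logBer d (fun i => (S.FlowAt 1 (phi d K 0 i)).coef) = (up d K l).coef := by
    rw [← coef_lber_eq S.isSmall_sub_phi, ← coef_smul_eq]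
    rfl
  rw [hc, hc, semiPullback, hlc, ← coef_ex_eq hX1, ← coef_ex_eq hY1, ← coef_ex_eq hl1,
    S.isPullback_UpFlowAt.eq, ex_map _ S.isPullback_UpFlowAt.cont hY1 hZ1, ← coef_mul_eq, hlog,
    map_add, S.up_FlowAt]
  congr 1
  refine ex_add hZ1 hl1 ?_ (hpar hld)
  rw [← S.up_FlowAt]
  exact hpar (S.FlowAt_mem_deg 1 hYd)

end Action

end Flow

open Polynomial

section Results

variable {ι : Type*} [LinearOrder ι] {d : ι → ℤ} {K : Type*} [RCLike K] {Ω : ι → ι → K}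

lemma hbar_neg_hbar (m : ℤ) (F : Coef ι K) : hbar (-m) (hbar m F) = F := by
  funext I g
  rw [hbar, hbar, sub_neg_eq_add, add_sub_cancel_right]

lemma hbar_hbar_neg (m : ℤ) (F : Coef ι K) : hbar m (hbar (-m) F) = F := by
  funext I g
  rw [hbar, hbar, sub_neg_eq_add, sub_add_cancel]

lemma hb_mul_genus {F : SF d K 0} (hF : F ∈ Supp d K 0 {p | -1 ≤ p.2}) :
    hb d K 0 1 * F ∈ Supp d K 0 {p | 0 ≤ p.2} := fun p hp => by
  rw [coef_hb_mul] at hp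
  have h1 : -1 ≤ p.2 - 1 := hF (p.1, p.2 - 1) hp
  rw [mem_ofPred_eq]
  omega

lemma isQuantumLInfty_coef {Sf a : SF d K 0} (hfd : Sf ∈ Deg d K 0 0)
    (hf : Sf ∈ Supp d K 0 {p | p.1.degree = 2 ∧ p.2 = 0}) (had : a ∈ Deg d K 0 0)
    (ha : a ∈ Fil d K 0 1) (hg : a ∈ Supp d K 0 {p | -1 ≤ p.2})
    (hq : qme (inverse Ω) (Sf + hb d K 0 1 * a) = 0) :
    IsQuantumLInfty d Ω (Sf + hb d K 0 1 * a).coef := by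
  have h3 : hb d K 0 1 * a ∈ Fil d K 0 3 := fil_anti (by norm_num) (hb_mul_mem_fil 1 ha)
  have key : ∀ I g, (Sf + hb d K 0 1 * a).coef I g ≠ 0 → (I.degree = 2 ∧ g = 0) ∨ 3 ≤ weight I g :=
    fun I g h => by
      by_cases h1 : Sf.coef I g = 0
      · refine Or.inr ?_
        rw [← lv_zero_eq]
        refine h3 (I, g) fun h2 => h ?_
        change Sf.coef I g + (hb d K 0 1 * a).coef I g = 0
        rw [h1, h2, add_zero]
      · exact Or.inl (hf (I, g) h1)
  refine ⟨isFun_coef (add_mem (supp_mono ?_ hf) (hb_mul_genus hg)),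
    hasDegree_coef (add_mem hfd (hb_mul_deg 1 had)), fun I h => ?_, fun I h => ?_, ?_⟩
  · rintro p ⟨-, h⟩
    exact h.ge
  · have := key I 0 h
    rw [weight] at this
    omega
  · have := key I 1 h
    rw [weight] at this
    omega
  · rw [← coef_qme_eq, hq]
    rfl

variable {h : ι → Prop} {μ κ : ι → ι →₀ K}

namespace Action

variable {Sf b : SF d K 0} (S : Action d (inverse Ω) h μ κ Sf b)
include S

lemma ev_ex_path (t : K) : ex (ev t (path d (inverse Ω) h κ b)) =
    (1 - t) • ex (incAct d (inverse Ω) h κ b) + t • ex b := by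
  rw [← S.ev_expPath, ← S.ex_path]
  exact (ex_map (ev t) (cont_ev t) S.path_fil (ev_mem_supp t S.path_fil)).symm

lemma ev_path_mul_ham (t : K) : ex (ev t (path d (inverse Ω) h κ b)) *
    ev t (ham d (inverse Ω) h κ b) = prim d (inverse Ω) h κ b := by
  rw [← ex_map (ev t) (cont_ev t) S.path_fil (ev_mem_supp t S.path_fil), ← map_mul,
    S.path_mul_ham, ev_cst]

lemma isHomotopy : IsHomotopy d Ω Sf.coef
    (fun t => hbar 1 (ev (t : K) (path d (inverse Ω) h κ b)).coef)
    (fun t => hbar 1 (ev (t : K) (ham d (inverse Ω) h κ b)).coef)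
    (hbar 1 (incAct d (inverse Ω) h κ b).coef) (hbar 1 b.coef) where
  familyA := by
    simp only [hbar_neg_hbar]
    exact isFunPosFamily_ev S.path_fil
  familyB := by
    simp only [hbar_neg_hbar]
    exact isFunPosFamily_ev S.ham_fil
  degreeA t _ := by
    rw [← coef_hb_eq]
    exact hasDegree_coef (hb_mul_deg 1 (ev_mem_supp _ S.path_deg))
  degreeB t _ := by
    rw [← coef_hb_eq]
    exact hasDegree_coef (hb_mul_deg 1 (ev_mem_supp _ S.ham_deg))
  closed := by
    simp only [hbar_neg_hbar]
    rw [formExp_coef (fun t => ev_mem_supp _ S.path_deg) fun t => ev_mem_supp _ S.path_fil]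
    intro t _
    simp only [S.ev_path_mul_ham]
    constructor
    · rw [← coef_tw_eq, S.ev_ex_path, map_add, tw_smul, tw_smul, S.tw_ex_incAct, S.closed,
        smul_zero, smul_zero, add_zero]
      rfl
    · intro I g
      have h1 : ∀ s : ℝ, parity d (ex (ev (s : K) (path d (inverse Ω) h κ b))).coef I g =
          (C ((ex (incAct d (inverse Ω) h κ b)).coef I g) +
            X * C ((ex b).coef I g - (ex (incAct d (inverse Ω) h κ b)).coef I g)).eval (s : K) :=
        fun s => by
          rw [parity_of_deg (ex_deg (ev_mem_supp _ S.path_fil) (ev_mem_supp _ S.path_deg)),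
            S.ev_ex_path, coef_add_eq, coef_smul_eq, coef_smul_eq]
          simp only [Pi.add_apply, Pi.smul_apply, smul_eq_mul, eval_add, eval_C, eval_mul, eval_X]
          ring
      simp only [h1]
      rw [← coef_tw_eq, ← S.ex_incAct_sub]
      have h2 : HasDerivWithinAt _ _ (Set.Icc (0 : ℝ) 1) t :=
        (hasDerivAt_eval (C ((ex (incAct d (inverse Ω) h κ b)).coef I g) +
          X * C ((ex b).coef I g - (ex (incAct d (inverse Ω) h κ b)).coef I g)) t).hasDerivWithinAt
      refine h2.congr_deriv ?_
      rw [coef_sub_eq]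
      simp
  start := by rw [RCLike.ofReal_zero, S.ev_path_zero]
  finish := by rw [RCLike.ofReal_one, S.ev_path_one]

lemma isQuantumLInfty_int : IsQuantumLInfty d Ω (Sf + hb d K 0 1 * b).coef :=
  isQuantumLInfty_coef S.free_deg S.free_supp S.int_deg S.int_fil S.int_genus
    ((qme_add_eq_zero_iff S.poisson S.free_par S.int_par S.int_fil S.qme_free).2 S.closed)

lemma isQuantumLInfty_incAct :
    IsQuantumLInfty d Ω (Sf + hb d K 0 1 * incAct d (inverse Ω) h κ b).coef :=
  isQuantumLInfty_coef S.free_deg S.free_supp S.incAct_deg S.incAct_fil S.incAct_genus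
    S.qme_add_incAct

lemma isQuantumMorphism_FlowAt : IsQuantumMorphism d d Ω
    (Sf + hb d K 0 1 * incAct d (inverse Ω) h κ b).coef Ω (Sf + hb d K 0 1 * b).coef
    fun i => (S.FlowAt 1 (phi d K 0 i)).coef :=
  isQuantumMorphism S.poisson S.poisson (S.isPullback_FlowAt 1)
    (map_sig_of_deg (S.isPullback_FlowAt 1).cont fun _ _ => S.FlowAt_mem_deg 1) S.FlowAt_tw
    S.isQuantumLInfty_incAct S.isQuantumLInfty_int (S.isNearIdentity_FlowAt 1).formalMap

variable {ΩH : {i // h i} → {i // h i} → K} (hΩ : inverse ΩH = fun i j => inverse Ω i.1 j.1)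
include hΩ

lemma isQuantumLInfty_effAct : IsQuantumLInfty (fun i : {i // h i} => d i.1) ΩH
    (hb _ K 0 1 * effAct d (inverse Ω) h κ b).coef := by
  have := isQuantumLInfty_coef (Ω := ΩH) (zero_mem _) (zero_mem _) S.effAct_deg S.effAct_fil
    S.effAct_genus (by rw [zero_add, hΩ]; exact S.qme_effAct)
  rwa [zero_add] at this

lemma tw_inc_effAct (F : SF (fun i : {i // h i} => d i.1) K 0) :
    inc d K 0 h (tw (inverse ΩH) (hb _ K 0 1 * effAct d (inverse Ω) h κ b) F) =
      tw (inverse Ω) (Sf + hb d K 0 1 * incAct d (inverse Ω) h κ b) (inc d K 0 h F) := by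
  rw [hΩ, ← S.tw_inc, map_mul, inc_hb]
  rfl

omit S hΩ in
lemma inc_deg {n : ℤ} {F : SF (fun i : {i // h i} => d i.1) K 0}
    (hF : F ∈ Deg (fun i : {i // h i} => d i.1) K 0 n) : inc d K 0 h F ∈ Deg d K 0 n :=
  inc_mem_supp (fun I g hI => by
    rw [mem_ofPred_eq] at hI ⊢; rwa [em_monDegree]) hF

omit S hΩ in
lemma isFormalMap_of_deg {ι' : Type*} [LinearOrder ι'] {d' : ι' → ℤ} {L : SF d' K 0 →+* SF d K 0}
    (hdeg : ∀ n, ∀ F ∈ Deg d' K 0 n, L F ∈ Deg d K 0 n) (h1 : ∀ i, L (phi d' K 0 i) ∈ Fil d K 0 1) :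
    IsFormalMap d d' fun i => (L (phi d' K 0 i)).coef :=
  ⟨fun i => isFunPos_coef (h1 i), fun i => hasDegree_coef (hdeg _ _ (phi_deg i))⟩

lemma isQuantumMorphism_inc : IsQuantumMorphism d (fun i : {i // h i} => d i.1) Ω
    (Sf + hb d K 0 1 * incAct d (inverse Ω) h κ b).coef ΩH
    (hb _ K 0 1 * effAct d (inverse Ω) h κ b).coef (projMap h) := by
  refine isQuantumMorphism S.poisson (hΩ ▸ S.poissonH) (isPullback_inc h)
    (map_sig_of_deg cont_inc fun _ _ => inc_deg) (S.tw_inc_effAct hΩ)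
    S.isQuantumLInfty_incAct (S.isQuantumLInfty_effAct hΩ) ?_
  have := isFormalMap_of_deg (d := d) (d' := fun i : {i // h i} => d i.1) (L := inc d K 0 h)
    (fun _ _ => inc_deg) fun i => by rw [inc_phi]; exact fil_anti (by norm_num) (phi_mem_fil i.1)
  simp only [(isPullback_inc h).coef] at this
  exact this

lemma isQuantumMorphism_FlowInv_inc : IsQuantumMorphism d (fun i : {i // h i} => d i.1) Ω
    (Sf + hb d K 0 1 * b).coef ΩH (hb _ K 0 1 * effAct d (inverse Ω) h κ b).coef
    (BV.comp d (projMap h) fun i => (S.FlowInv (phi d K 0 i)).coef) := by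
  have hP := S.isPullback_FlowInv.comp (isPullback_inc (d := d) (K := K) (c := 0) h)
  have hdeg : ∀ n, ∀ F ∈ Deg (fun i : {i // h i} => d i.1) K 0 n,
      (S.FlowInv.comp (inc d K 0 h)) F ∈ Deg d K 0 n := fun n F hF => by
    rw [RingHom.comp_apply]
    exact S.FlowInv_deg (inc_deg hF)
  refine isQuantumMorphism S.poisson (hΩ ▸ S.poissonH) hP (map_sig_of_deg hP.cont hdeg)
    (fun F => ?_) S.isQuantumLInfty_int (S.isQuantumLInfty_effAct hΩ) ?_
  · rw [RingHom.comp_apply, RingHom.comp_apply, S.tw_inc_effAct hΩ, S.FlowInv_tw]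
  · have := isFormalMap_of_deg hdeg fun i => by
      rw [RingHom.comp_apply, inc_phi]
      exact S.FlowInv_mem_fil (fil_anti (by norm_num) (phi_mem_fil i.1))
    simp only [hP.coef] at this
    exact this

end Action

end Results

end SF

end BVCalc

end

theorem mainTheorem5 {𝕜 : Type*} [RCLike 𝕜] {V : Type*} [AddCommGroup V] [Module 𝕜 V]
    (𝒱 : ℤ → Submodule 𝕜 V) (ω : V →ₗ[𝕜] V →ₗ[𝕜] 𝕜) (Q : V →ₗ[𝕜] V)
    (hV : IsDGSymplectic 𝒱 ω Q)
    (H B C : Submodule 𝕜 V) (hHodge : IsHodgeDecomposition ω Q H B C)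
    {ι : Type*} [LinearOrder ι] (e : Module.Basis ι 𝕜 V) (d : ι → ℤ)
    (he : IsAdaptedBasis 𝒱 H B C e d)
    (S : Coef ι 𝕜) (hS : IsQuantumLInfty d (fun i j => ω (e i) (e j)) S)
    -- the quadratic genus zero part of `S` is `S_free`, the rest has weight at least three
    (hfree : ∀ I g, weight I g ≤ 2 → S I g = freeAction d ω Q e I g) :
    let Ω : ι → ι → 𝕜 := fun i j => ω (e i) (e j)
    let h : ι → Prop := fun i => e i ∈ H
    let dH : {i // h i} → ℤ := fun i => d i
    let ΩH : {i // h i} → {i // h i} → 𝕜 := fun i j => Ω i j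
    let κ : ι → ι → 𝕜 := fun i j => e.repr (homotopy Q C e (e j)) i
    let Sfree : Coef ι 𝕜 := freeAction d ω Q e
    let Sint : Coef ι 𝕜 := S - Sfree
    let E : Coef ι 𝕜 := expo d (hbar (-1) Sint)
    let F : Coef ι 𝕜 := pertContraction d Ω h κ E
    let W : Coef {i // h i} 𝕜 := hbar 1 (logar dH (pertProj d Ω h κ E))
    let IW : Coef ι 𝕜 := incl h W
    let A : ℝ → Coef ι 𝕜 := fun t =>
      hbar 1 (logar d ((1 - (t : 𝕜)) • expo d (hbar (-1) IW) + (t : 𝕜) • E))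
    let Bt : ℝ → Coef ι 𝕜 := fun t => hbar 1 (mul d (expo d (-hbar (-1) (A t))) F)
    -- the effective action is well defined
    expo dH (hbar (-1) W) = pertProj d Ω h κ E ∧
    IsFunPos dH (hbar (-1) W) ∧
    -- the difference of the exponentials is exact, with the distinguished primitive `F`
    IsFunPos d F ∧ HasDegree d (-1) F ∧
    expo d (hbar (-1) IW) - E = twisted d Ω Sfree F ∧
    pertProj d Ω h κ F = 0 ∧ pertContraction d Ω h κ F = 0 ∧
    (∀ F' : Coef ι 𝕜, IsFunPos d F' → expo d (hbar (-1) IW) - E = twisted d Ω Sfree F' →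
      pertProj d Ω h κ F' = 0 → pertContraction d Ω h κ F' = 0 → F' = F) ∧
    -- the explicit homotopy between `I(W)` and `S_int`
    (∀ t : ℝ, expo d (hbar (-1) (A t)) =
      (1 - (t : 𝕜)) • expo d (hbar (-1) IW) + (t : 𝕜) • E) ∧
    IsHomotopy d Ω Sfree A Bt IW Sint ∧
    -- `I(W)` has no quadratic terms of genus zero
    (∀ I : ι →₀ ℕ, I.degree = 2 → IW I 0 = 0) ∧
    -- the flow, the decomposition, and the morphisms
    ∃ Φt : ℝ → ι → Coef ι 𝕜,
      IsFlow d (fun t G =>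
        -hbar 1 (bracket d Ω (mul d (expo d (-hbar (-1) (A t))) F) G)) Φt ∧
      ∃ Ψ : ι → Coef ι 𝕜,
        IsNearIdentity d Ψ ∧
        comp d Ψ (Φt 1) = coord ∧ comp d (Φt 1) Ψ = coord ∧
        IsPoisson d d Ω Ω (Φt 1) ∧
        expo d (hbar (-1) (Sfree + IW)) =
          semiPullback d (Φt 1) (expo d (hbar (-1) (Sfree + Sint))) ∧
        IsQuantumMorphism d d Ω (Sfree + IW) Ω (Sfree + Sint) (Φt 1) ∧
        IsQuantumMorphism d dH Ω (Sfree + IW) ΩH W (projMap h) ∧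
        IsQuantumMorphism d dH Ω (Sfree + Sint) ΩH W (comp d (projMap h) Ψ) := by
  intro Ω h dH ΩH κ Sfree Sint E F W IW A Bt
  obtain ⟨Sf, b, hSf, hb, T⟩ := BVCalc.SF.exists_action hV hHodge he hS hfree
  have hΩ : inverse ΩH = fun i j => inverse Ω i.1 j.1 :=
    funext fun i => funext fun j => BVCalc.inverse_restrict hV hHodge he i j
  have hk : ∀ i j, BVCalc.opMat e (homotopy Q C e) (BVCalc.finite_homotopy hV hHodge he) i j =
    -κ i j := fun _ _ => rfl
  generalize BVCalc.opMat e (homotopy Q C e) (BVCalc.finite_homotopy hV hHodge he) = k at T hk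
  have hSint : Sint = hbar 1 b.coef := by rw [hb, BVCalc.SF.hbar_hbar_neg]
  have hE : E = (BVCalc.SF.ex b).coef := by rw [BVCalc.SF.coef_ex_eq T.int_fil, hb]
  have hF : F = (BVCalc.SF.prim d (inverse Ω) h k b).coef := by
    rw [BVCalc.SF.prim, BVCalc.SF.coef_Kop_Yop_eq Ω h k hk, ← hE]
  have heff : pertProj d Ω h κ E = (BVCalc.SF.eff d (inverse Ω) h k b).coef := by
    rw [BVCalc.SF.eff, BVCalc.SF.coef_prj_Yop_eq Ω h k hk, ← hE]
  have hW : W = (BVCalc.SF.hb _ 𝕜 0 1 * BVCalc.SF.effAct d (inverse Ω) h k b).coef := by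
    rw [BVCalc.SF.coef_hb_eq, BVCalc.SF.effAct, BVCalc.SF.coef_lg_eq T.eff_sub_one, ← heff]
  have hIW : IW = hbar 1 (BVCalc.SF.incAct d (inverse Ω) h k b).coef := by
    rw [← BVCalc.SF.coef_hb_eq, BVCalc.SF.incAct, ← BVCalc.SF.inc_hb (h := h), ← map_mul,
      BVCalc.SF.coef_inc_eq, ← hW]
  have hIW' : hbar (-1) IW = (BVCalc.SF.incAct d (inverse Ω) h k b).coef := by
    rw [hIW, BVCalc.SF.hbar_neg_hbar]
  have heIW : expo d (hbar (-1) IW) = (BVCalc.SF.ex (BVCalc.SF.incAct d (inverse Ω) h k b)).coef := by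
    rw [hIW', BVCalc.SF.coef_ex_eq T.incAct_fil]
  have hmix : ∀ t : ℝ, (1 - (t : 𝕜)) • expo d (hbar (-1) IW) + (t : 𝕜) • E =
      (BVCalc.SF.ex (BVCalc.SF.ev (t : 𝕜) (BVCalc.SF.path d (inverse Ω) h k b))).coef := fun t => by
    rw [heIW, hE, T.ev_ex_path]
    rfl
  have hpath : ∀ t : 𝕜, BVCalc.SF.ev t (BVCalc.SF.path d (inverse Ω) h k b) ∈ _ := fun t =>
    BVCalc.SF.ev_mem_supp t T.path_fil
  have hA : A = fun t : ℝ => hbar 1 (BVCalc.SF.ev (t : 𝕜) (BVCalc.SF.path d (inverse Ω) h k b)).coef := by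
    funext t
    change hbar 1 (logar d _) = _
    rw [hmix, ← BVCalc.SF.coef_lg_eq (BVCalc.SF.ex_sub_one_mem le_rfl (hpath _)),
      BVCalc.SF.lg_ex (hpath _) (BVCalc.SF.ev_mem_supp _ T.path_par)]
  have hA' : ∀ t, hbar (-1) (A t) = (BVCalc.SF.ev (t : 𝕜) (BVCalc.SF.path d (inverse Ω) h k b)).coef :=
    fun t => by rw [hA, BVCalc.SF.hbar_neg_hbar]
  have hham : ∀ t, mul d (expo d (-hbar (-1) (A t))) F =
      (BVCalc.SF.ev (t : 𝕜) (BVCalc.SF.ham d (inverse Ω) h k b)).coef := fun t => by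
    rw [hA', hF, ← BVCalc.SF.coef_neg_eq, ← BVCalc.SF.coef_ex_eq (neg_mem (hpath _)),
      ← BVCalc.SF.coef_mul_eq, T.ev_ham]
  have hBt : Bt = fun t : ℝ => hbar 1 (BVCalc.SF.ev (t : 𝕜) (BVCalc.SF.ham d (inverse Ω) h k b)).coef :=
    funext fun t => congrArg (hbar 1) (hham t)
  have hfree_add : Sfree + IW =
      (Sf + BVCalc.SF.hb d 𝕜 0 1 * BVCalc.SF.incAct d (inverse Ω) h k b).coef := by
    rw [BVCalc.SF.coef_add_eq, BVCalc.SF.coef_hb_eq, hSf, ← hIW]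
  have hfree_int : Sfree + Sint = (Sf + BVCalc.SF.hb d 𝕜 0 1 * b).coef := by
    rw [BVCalc.SF.coef_add_eq, BVCalc.SF.coef_hb_eq, hSf, ← hSint]
  have hdiff : expo d (hbar (-1) IW) - E = (BVCalc.SF.ex (BVCalc.SF.incAct d (inverse Ω) h k b) -
      BVCalc.SF.ex b).coef := by rw [heIW, hE, BVCalc.SF.coef_sub_eq]
  refine ⟨?_, ?_, ?_, ?_, ?_, ?_, ?_, ?_, ?_, ?_, ?_, fun t i => (T.FlowAt (t : 𝕜) (BVCalc.SF.phi d 𝕜 0 i)).coef,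
    T.isFlow fun t G => by rw [hham], fun i => (T.FlowInv (BVCalc.SF.phi d 𝕜 0 i)).coef,
    T.isNearIdentity_FlowInv, ?_, ?_, ?_, ?_, ?_, ?_, ?_⟩
  · rw [hW, BVCalc.SF.coef_hb_eq, BVCalc.SF.hbar_neg_hbar, ← BVCalc.SF.coef_ex_eq T.effAct_fil,
      T.ex_effAct, heff]
  · rw [hW, BVCalc.SF.coef_hb_eq, BVCalc.SF.hbar_neg_hbar]
    exact BVCalc.SF.isFunPos_coef T.effAct_fil
  · rw [hF]
    exact BVCalc.SF.isFunPos_coef T.prim_fil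
  · rw [hF]
    exact BVCalc.SF.hasDegree_coef T.prim_deg
  · rw [hdiff, T.ex_incAct_sub, BVCalc.SF.coef_tw_eq, hSf, ← hF]
  · rw [hF, ← BVCalc.SF.coef_prj_Yop_eq Ω h k hk, T.prj_Yop_prim]
    rfl
  · rw [hF, ← BVCalc.SF.coef_Kop_Yop_eq Ω h k hk, T.Kop_Yop_prim]
    rfl
  · intro F' h1 h2 h3 h4
    obtain ⟨F', -, rfl⟩ := BVCalc.SF.exists_of_isFunWeight h1
    rw [hF]
    refine congrArg BVCalc.SF.coef (T.prim_unique (BVCalc.SF.coef_injective ?_)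
      (BVCalc.SF.coef_injective ?_) (BVCalc.SF.coef_injective ?_))
    · rw [← hdiff, h2, BVCalc.SF.coef_tw_eq, hSf]
    · rw [BVCalc.SF.coef_prj_Yop_eq Ω h k hk, h3]
      rfl
    · rw [BVCalc.SF.coef_Kop_Yop_eq Ω h k hk, h4]
      rfl
  · intro t
    rw [hA', ← BVCalc.SF.coef_ex_eq (hpath _), hmix]
  · have := T.isHomotopy
    rwa [← hA, ← hBt, ← hIW, ← hSint, hSf] at this
  · intro I hI
    rw [hIW, ← BVCalc.SF.coef_hb_eq]
    by_contra hne
    have h3 := BVCalc.SF.hb_mul_mem_fil 1 T.incAct_fil (I, 0) hne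
    rw [Set.mem_ofPred_eq, BVCalc.SF.lv_zero_eq, weight, hI] at h3
    norm_num at h3
  · simp only [RCLike.ofReal_one]
    exact T.comp_FlowInv_FlowAt
  · simp only [RCLike.ofReal_one]
    exact T.comp_FlowAt_FlowInv
  · simp only [RCLike.ofReal_one]
    exact T.isQuantumMorphism_FlowAt.poisson
  · simp only [RCLike.ofReal_one]
    rw [hIW, hSint, show Sfree = Sf.coef from hSf.symm]
    exact T.semidensity
  · simp only [RCLike.ofReal_one]
    rw [hfree_add, hfree_int]
    exact T.isQuantumMorphism_FlowAt
  · rw [hfree_add, hW]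
    exact T.isQuantumMorphism_inc hΩ
  · rw [hfree_int, hW]
    exact T.isQuantumMorphism_FlowInv_inc hΩ
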